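/- Let $k$ be a field, let $n>2$ and $0<r<d$ be integers, let $E_1,\dots,E_n$ be $d$-dimensional $k$-vector spaces, and let $f_i:E_i\to E_{i+1}$, $g_i:E_{i+1}\to E_i$ ($1\le i\le n-1$) be linear maps with $f_ig_i=0$, $g_if_i=0$, $\ker f_i=\operatorname{im} g_i$, $\ker g_i=\operatorname{im} f_i$ for $1\le i\le n-1$, and $\operatorname{im} f_i\cap\ker f_{i+1}=0$, $\operatorname{im} g_{i+1}\cap\ker g_i=0$ for $1\le i\le n-2$. Let $LG$ be the linked Grassmannian: its $T$-points, for a $k$-scheme $T$, are the families of rank-$r$ sub-bundles $V_i\subset E_i\otimes\mathcal O_T$ ($1\le i\le n$) with $f_i(V_i)\subset V_{i+1}$ and $g_i(V_{i+1})\subset V_i$ for all $i$. Let $\operatorname{pr}_{1n}$ be the map $(V_i)_i\mapsto(V_1,V_n)$ to the product of the Grassmannians $G(r,E_1)\times G(r,E_n)$. Write $f_{i,j}=f_j\circ\cdots\circ f_i$ and $g_{j,i}=g_i\circ\cdots\circ g_j$ for $1\le i\le j\le n-1$, let $g_{0,1}$ and $f_{n,n-1}$ be the identity maps of $E_1$ and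 $E_n$, and write $\operatorname{d}(\cdot)$ for dimension. Fix $r$-dimensional subspaces $V_1\subset E_1$, $V_n\subset E_n$ with $f_{1,n-1}(V_1)\subset V_n$ and $g_{n-1,1}(V_n)\subset V_1$. Put $V_{1,n}=g_{n-1,1}(V_n)$, $V_{n,1}=f_{1,n-1}(V_1)$, and, for $1\le i\le n$, $\bar V_{1,i}=V_1\cap\operatorname{im} g_{i-1,1}$ and $\bar V_{n,i}=V_n\cap\operatorname{im} f_{i,n-1}$. For $1<i<n$ let $\bar Z_i$ be the cokernel of $$(g_{i-1,1},f_{i,n-1}):\ g_{i-1,1}^{-1}(V_1)\cap f_{i,n-1}^{-1}(V_n)\to\bar V_{1,i}\oplus\bar V_{n,i},$$ and let $\bar Z_{1,i},\bar Z_{n,i}\subset\bar Z_i$ be the images of $\bar V_{1,i}\oplus 0$ and $0\oplus\bar V_{n,i}$. For a point $(V_i)_i$ of the fiber of $\operatorname{pr}_{1n}$ over $(V_1,V_n)$ and $1<i<n$ put $V_{1,i}=g_{i-1,1}(V_i)$, $V_{n,i}=f_{i,n-1}(V_i)$, and let $Z_i\subset\bar Z_i$ be the image of $V_{1,i}\oplus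 V_{n,i}$. For non-negative integers $\delta=(d_{V_{1,i}},d_{V_{n,i}},d_{Z_i})_{1<i<n}$ let the stratum $X_\delta$ be the subfunctor of the fiber given by the condition that for all $1<i<n$ the images $V_{1,i}$, $V_{n,i}$, $Z_i$ are sub-bundles of the trivial bundles with fibers $E_1$, $E_n$, $\bar Z_i$, of ranks $d_{V_{1,i}}$, $d_{V_{n,i}}$, $d_{Z_i}$ respectively. Write also $d_{V_{1,n}}:=\operatorname{d}(V_{1,n})$ and $d_{V_{n,1}}:=\operatorname{d}(V_{n,1})$. **Theorem.** (a) The fiber of $\operatorname{pr}_{1n}$ over $(V_1,V_n)$ is represented by a $k$-scheme $Y$, and each $X_\delta$ is a locally closed subscheme of $Y$. The $X_\delta$ are pairwise disjoint for distinct $\delta$, and their union is, set-theoretically, all of $Y$. (b) $X_\delta$ is non-empty if and only if, for all $2\le i\le n-1$, 1. $d_{Z_i}\le\operatorname{d}(\bar Z_{1,i}\cap\bar Z_{n,i})$, 2. $\operatorname{d}(\bar V_{1,i+1})\ge d_{V_{1,i}}-d_{Z_i}\ge d_{V_{1,i+1}}$, 3. $\operatorname{d}(\bar V_{n,i-1})\ge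 d_{V_{n,i}}-d_{Z_i}\ge d_{V_{n,i-1}}$, 4. $d_{V_{1,i}}+d_{V_{n,i}}-d_{Z_i}\ge r$, 5. $r\ge d_{V_{1,i+1}}+d_{V_{n,i}}$, 6. $r\ge d_{V_{1,i}}+d_{V_{n,i-1}}$. (c) If $X_\delta$ is non-empty, it is smooth over $k$ of (relative) dimension $$\sum_{i=2}^{n-1}\Big[d_{Z_i}\big(\operatorname{d}(\bar Z_{1,i}\cap\bar Z_{n,i})-d_{Z_i}\big)+(d_{V_{1,i}}-d_{V_{1,i+1}})\big(\operatorname{d}(\bar V_{1,i+1})-d_{V_{1,i}}+d_{Z_i}\big)+(d_{V_{n,i}}-d_{V_{n,i-1}})\big(\operatorname{d}(\bar V_{n,i-1})-d_{V_{n,i}}+d_{Z_i}\big)+(r-d_{V_{1,i+1}}-d_{V_{n,i-1}})(d_{V_{1,i}}+d_{V_{n,i}}-d_{Z_i}-r)\Big].$$ (d) For given $n$ and $r$, the dimension of the fiber of $\operatorname{pr}_{1n}$ over $(V_1,V_n)$ depends only on the numbers $\operatorname{d}(V_{1,n})$, $\operatorname{d}(V_{n,1})$, $\operatorname{d}(\bar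 V_{1,n})$, $\operatorname{d}(\bar V_{n,1})$ and $\operatorname{d}(\bar V_{1,i})$, $\operatorname{d}(\bar V_{n,i})$, $\operatorname{d}(\bar Z_i)$ for $1<i<n$: two such pairs with the same numbers, even for different linked Grassmannians (over possibly different fields), have fibers of the same dimension. -/

import Mathlib

open CategoryTheory AlgebraicGeometry
open scoped TensorProduct

universe u v w₁ w₂ w₃ w₄

noncomputable section

namespace LinkedGr

/-- Data of a linked Grassmannian over the field `k` with `s = 0`: vector spaces `E 1, …, E n` of
dimension `d` and maps `f i : E i → E (i+1)`, `g i : E (i+1) → E i` for `1 ≤ i < n`.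
Values at indices outside this range play no role. -/
structure LinkedSystem (k : Type u) [Field k] (n d : ℕ) where
  E : ℕ → Type v
  [addCommGroup : ∀ i, AddCommGroup (E i)]
  [module : ∀ i, Module k (E i)]
  f : ∀ i, E i →ₗ[k] E (i + 1)
  g : ∀ i, E (i + 1) →ₗ[k] E i
  finiteDimensional : ∀ i, 1 ≤ i → i ≤ n → FiniteDimensional k (E i)
  finrank_eq : ∀ i, 1 ≤ i → i ≤ n → Module.finrank k (E i) = d
  f_comp_g : ∀ i, 1 ≤ i → i < n → f i ∘ₗ g i = 0
  g_comp_f : ∀ i, 1 ≤ i → i < n → g i ∘ₗ f i = 0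
  ker_f : ∀ i, 1 ≤ i → i < n → LinearMap.ker (f i) = LinearMap.range (g i)
  ker_g : ∀ i, 1 ≤ i → i < n → LinearMap.ker (g i) = LinearMap.range (f i)
  f_disjoint : ∀ i, 1 ≤ i → i + 1 < n →
    LinearMap.range (f i) ⊓ LinearMap.ker (f (i + 1)) = ⊥
  g_disjoint : ∀ i, 1 ≤ i → i + 1 < n →
    LinearMap.range (g (i + 1)) ⊓ LinearMap.ker (g i) = ⊥

attribute [instance] LinkedSystem.addCommGroup LinkedSystem.module

/-- `W` is a sub-bundle of rank `ρ` of the (finite locally free) `A`-module `M`: the quotient is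
locally free and `W` has constant rank `ρ`. -/
def IsSubbundle (A : Type*) [CommRing A] {M : Type*} [AddCommGroup M] [Module A M]
    (W : Submodule A M) (ρ : ℕ) : Prop :=
  Module.Projective A (M ⧸ W) ∧ ∀ p : PrimeSpectrum A, Module.rankAtStalk (R := A) W p = ρ

/-- Pull-back along `φ : A → B` of a submodule of `A ⊗ M`: the `B`-submodule of `B ⊗ M` that its
image generates (for a sub-bundle `W` this is `B ⊗_A W`). -/
def pullback {k A B M : Type*} [CommRing k] [CommRing A] [CommRing B] [Algebra k A] [Algebra k B]
    [AddCommGroup M] [Module k M] (φ : A →ₐ[k] B) (W : Submodule A (A ⊗[k] M)) :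
    Submodule B (B ⊗[k] M) :=
  Submodule.span B (φ.toLinearMap.rTensor M '' (W : Set (A ⊗[k] M)))

namespace LinkedSystem

variable {k : Type u} [Field k] {n d : ℕ} (S : LinkedSystem.{u, v} k n d)

/-- The composite `f (j-1) ∘ ⋯ ∘ f i : E i → E j` for `i ≤ j` (the identity for `i = j`). -/
def fComp (i j : ℕ) : S.E i →ₗ[k] S.E j :=
  if h : i ≤ j then
    Nat.leRec (motive := fun j _ => S.E i →ₗ[k] S.E j) LinearMap.id (fun j _ φ => S.f j ∘ₗ φ) h
  else 0

/-- The composite `g i ∘ ⋯ ∘ g (j-1) : E j → E i` for `i ≤ j` (the identity for `i = j`). -/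
def gComp (j i : ℕ) : S.E j →ₗ[k] S.E i :=
  if h : i ≤ j then
    Nat.leRec (motive := fun j _ => S.E j →ₗ[k] S.E i) LinearMap.id (fun j _ φ => φ ∘ₗ S.g j) h
  else 0

theorem fComp_self (i : ℕ) : S.fComp i i = LinearMap.id := by
  simp [fComp]

theorem fComp_succ {i j : ℕ} (h : i ≤ j) : S.fComp i (j + 1) = S.f j ∘ₗ S.fComp i j := by
  simp [fComp, h, Nat.le_succ_of_le h, Nat.leRec_succ]

theorem gComp_self (i : ℕ) : S.gComp i i = LinearMap.id := by
  simp [gComp]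

theorem gComp_succ {i j : ℕ} (h : i ≤ j) : S.gComp (j + 1) i = S.gComp j i ∘ₗ S.g j := by
  simp [gComp, h, Nat.le_succ_of_le h, Nat.leRec_succ]

/-- The points of the linked Grassmannian with values in the `k`-algebra `A`: linked families of
rank `r` sub-bundles of the bundles `A ⊗ E i`, `1 ≤ i ≤ n`. -/
structure Point (r : ℕ) (A : Type u) [CommRing A] [Algebra k A] where
  V : ∀ i : Set.Icc 1 n, Submodule A (A ⊗[k] S.E i)
  isSubbundle : ∀ i, IsSubbundle A (V i) r
  map_f_le : ∀ (i : ℕ) (h₁ : 1 ≤ i) (h₂ : i < n),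
    (V ⟨i, h₁, h₂.le⟩).map ((S.f i).baseChange A) ≤ V ⟨i + 1, by omega, h₂⟩
  map_g_le : ∀ (i : ℕ) (h₁ : 1 ≤ i) (h₂ : i < n),
    (V ⟨i + 1, by omega, h₂⟩).map ((S.g i).baseChange A) ≤ V ⟨i, h₁, h₂.le⟩

/-- A pair `(V₁, Vₙ)` of `r`-dimensional subspaces of `E 1` and `E n` such that the iterated images
of each lie in the other. -/
structure EndPair (r : ℕ) where
  V₁ : Submodule k (S.E 1)
  Vₙ : Submodule k (S.E n)
  finrank_V₁ : Module.finrank k V₁ = r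
  finrank_Vₙ : Module.finrank k Vₙ = r
  map_f_le : V₁.map (S.fComp 1 n) ≤ Vₙ
  map_g_le : Vₙ.map (S.gComp n 1) ≤ V₁

end LinkedSystem

/-- Prescribed dimensions `d_{V_{1,i}}`, `d_{V_{n,i}}`, `d_{Z_i}`; only the values at `1 < i < n`
play a role. -/
structure Prescription where
  V₁ : ℕ → ℕ
  Vₙ : ℕ → ℕ
  Z : ℕ → ℕ

namespace LinkedSystem.EndPair

variable {k : Type u} [Field k] {n d r : ℕ} {S : LinkedSystem.{u, v} k n d} (C : S.EndPair r)

/-- `\bar V_{1,i} = V₁ ∩ im (E i → E 1)`. -/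
def barV₁ (i : ℕ) : Submodule k (S.E 1) := C.V₁ ⊓ LinearMap.range (S.gComp i 1)

/-- `\bar V_{n,i} = Vₙ ∩ im (E i → E n)`. -/
def barVₙ (i : ℕ) : Submodule k (S.E n) := C.Vₙ ⊓ LinearMap.range (S.fComp i n)

/-- `V_{1,n}`, the image of `Vₙ` in `E 1`. -/
def V₁ₙ : Submodule k (S.E 1) := C.Vₙ.map (S.gComp n 1)

/-- `V_{n,1}`, the image of `V₁` in `E n`. -/
def Vₙ₁ : Submodule k (S.E n) := C.V₁.map (S.fComp 1 n)

/-- The subspace of `E i` of vectors that map into `V₁` and into `Vₙ`. -/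
def preim (i : ℕ) : Submodule k (S.E i) := C.V₁.comap (S.gComp i 1) ⊓ C.Vₙ.comap (S.fComp i n)

/-- The map `preim i → \bar V_{1,i} ⊕ \bar V_{n,i}` given by the two composites. -/
def preimMap (i : ℕ) : C.preim i →ₗ[k] C.barV₁ i × C.barVₙ i :=
  LinearMap.prod
    ((S.gComp i 1).restrict fun x hx => ⟨hx.1, x, rfl⟩)
    ((S.fComp i n).restrict fun x hx => ⟨hx.2, x, rfl⟩)

/-- `\bar Z_i`, the cokernel of `preim i → \bar V_{1,i} ⊕ \bar V_{n,i}`. -/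
abbrev BarZ (i : ℕ) : Type v := (C.barV₁ i × C.barVₙ i) ⧸ LinearMap.range (C.preimMap i)

/-- The map `\bar V_{1,i} → \bar Z_i`. -/
def ζ₁ (i : ℕ) : C.barV₁ i →ₗ[k] C.BarZ i :=
  (LinearMap.range (C.preimMap i)).mkQ ∘ₗ LinearMap.inl k _ _

/-- The map `\bar V_{n,i} → \bar Z_i`. -/
def ζₙ (i : ℕ) : C.barVₙ i →ₗ[k] C.BarZ i :=
  (LinearMap.range (C.preimMap i)).mkQ ∘ₗ LinearMap.inr k _ _

/-- `\bar Z_{1,i}`. -/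
def barZ₁ (i : ℕ) : Submodule k (C.BarZ i) := LinearMap.range (C.ζ₁ i)

/-- `\bar Z_{n,i}`. -/
def barZₙ (i : ℕ) : Submodule k (C.BarZ i) := LinearMap.range (C.ζₙ i)

/-- `A`-valued points of the fibre over `(V₁, Vₙ)` of the projection of the linked Grassmannian
to the first and the last subspace: the linked families whose first and last members are
`A ⊗ V₁` and `A ⊗ Vₙ`. -/
structure FiberPoint (A : Type u) [CommRing A] [Algebra k A] extends S.Point r A where
  first : ∀ h : 1 ∈ Set.Icc 1 n, V ⟨1, h⟩ = C.V₁.baseChange A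
  last : ∀ h : n ∈ Set.Icc 1 n, V ⟨n, h⟩ = C.Vₙ.baseChange A

/-- `V_{1,i}`, the image of `V i` in `A ⊗ E 1`. -/
def FiberPoint.V₁ {C : S.EndPair r} {A : Type u} [CommRing A] [Algebra k A] (P : C.FiberPoint A)
    (i : Set.Icc 1 n) : Submodule A (A ⊗[k] S.E 1) :=
  (P.V i).map ((S.gComp i 1).baseChange A)

/-- `V_{n,i}`, the image of `V i` in `A ⊗ E n`. -/
def FiberPoint.Vₙ {C : S.EndPair r} {A : Type u} [CommRing A] [Algebra k A] (P : C.FiberPoint A)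
    (i : Set.Icc 1 n) : Submodule A (A ⊗[k] S.E n) :=
  (P.V i).map ((S.fComp i n).baseChange A)

/-- `Z_i`, the image of `V_{1,i} ⊕ V_{n,i} ⊆ A ⊗ (\bar V_{1,i} ⊕ \bar V_{n,i})` in `A ⊗ \bar Z_i`. -/
def FiberPoint.Z {C : S.EndPair r} {A : Type u} [CommRing A] [Algebra k A] (P : C.FiberPoint A)
    (i : Set.Icc 1 n) : Submodule A (A ⊗[k] C.BarZ i) :=
  ((P.V₁ i).comap ((C.barV₁ i).subtype.baseChange A)).map ((C.ζ₁ i).baseChange A) ⊔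
    ((P.Vₙ i).comap ((C.barVₙ i).subtype.baseChange A)).map ((C.ζₙ i).baseChange A)

/-- The point lies in the stratum of the prescription `δ`: for `1 < i < n` the maps from `V i` to
`A ⊗ E 1` and `A ⊗ E n`, and from their images to `A ⊗ \bar Z_i`, have constant rank as prescribed,
in the scheme-theoretic sense that the images are sub-bundles of that rank. -/
def FiberPoint.InStratum {C : S.EndPair r} {A : Type u} [CommRing A] [Algebra k A]
    (P : C.FiberPoint A) (δ : Prescription) : Prop :=
  ∀ i : Set.Icc 1 n, 1 < (i : ℕ) → (i : ℕ) < n →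
    IsSubbundle A (P.V₁ i) (δ.V₁ i) ∧ IsSubbundle A (P.Vₙ i) (δ.Vₙ i) ∧
      IsSubbundle A (P.Z i) (δ.Z i)

end LinkedSystem.EndPair

/-- `Spec A` as a scheme over `Spec k`. -/
abbrev specOver (k : Type u) [CommRing k] (A : Type u) [CommRing A] [Algebra k A] :
    Over (Spec (CommRingCat.of k)) :=
  Over.mk (Spec.map (CommRingCat.ofHom (algebraMap k A)))

/-- The morphism of schemes over `Spec k` given by a homomorphism of `k`-algebras. -/
def specMap {k : Type u} [CommRing k] {A B : Type u} [CommRing A] [CommRing B] [Algebra k A]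
    [Algebra k B] (φ : A →ₐ[k] B) : specOver k B ⟶ specOver k A :=
  Over.homMk (Spec.map (CommRingCat.ofHom φ.toRingHom)) (by
    simp only [Over.mk_hom, ← Spec.map_comp, ← CommRingCat.ofHom_comp]
    congr 2
    exact φ.comp_algebraMap)

namespace LinkedSystem.EndPair

variable {k : Type u} [Field k] {n d r : ℕ} {S : LinkedSystem.{u, v} k n d} (C : S.EndPair r)

/-- The `k`-scheme `Y` is the fibre over `(V₁, Vₙ)`: its functor of points is that of the fibre,
naturally in the `k`-algebra `A` (this determines `Y` up to unique isomorphism). -/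
structure FiberRepresentation (Y : Over (Spec (CommRingCat.of k))) where
  points : ∀ (A : Type u) [CommRing A] [Algebra k A], (specOver k A ⟶ Y) ≃ C.FiberPoint A
  points_comp : ∀ (A B : Type u) [CommRing A] [CommRing B] [Algebra k A] [Algebra k B]
    (φ : A →ₐ[k] B) (x : specOver k A ⟶ Y) (i : Set.Icc 1 n),
    (points B (specMap φ ≫ x)).V i = pullback φ ((points A x).V i)

/-- `d_{V_{1,i}}`, with the convention `d_{V_{1,n}} = dim V_{1,n}`. -/
def dV₁ (δ : Prescription) : ℕ → ℕ := Function.update δ.V₁ n (Module.finrank k C.V₁ₙ)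

/-- `d_{V_{n,i}}`, with the convention `d_{V_{n,1}} = dim V_{n,1}`. -/
def dVₙ (δ : Prescription) : ℕ → ℕ := Function.update δ.Vₙ 1 (Module.finrank k C.Vₙ₁)

/-- The inequalities (1)-(6), for all `2 ≤ i ≤ n - 1`. -/
def Admissible (δ : Prescription) : Prop :=
  ∀ i, 2 ≤ i → i + 1 ≤ n →
    δ.Z i ≤ Module.finrank k (C.barZ₁ i ⊓ C.barZₙ i : Submodule k (C.BarZ i)) ∧
    ((C.dV₁ δ i : ℤ) - δ.Z i ≤ Module.finrank k (C.barV₁ (i + 1)) ∧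
      (C.dV₁ δ (i + 1) : ℤ) ≤ C.dV₁ δ i - δ.Z i) ∧
    ((C.dVₙ δ i : ℤ) - δ.Z i ≤ Module.finrank k (C.barVₙ (i - 1)) ∧
      (C.dVₙ δ (i - 1) : ℤ) ≤ C.dVₙ δ i - δ.Z i) ∧
    (r : ℤ) ≤ C.dV₁ δ i + C.dVₙ δ i - δ.Z i ∧
    C.dV₁ δ (i + 1) + C.dVₙ δ i ≤ r ∧
    C.dV₁ δ i + C.dVₙ δ (i - 1) ≤ r

/-- The expected dimension of the stratum of `δ`. -/
def stratumDim (δ : Prescription) : ℤ :=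
  ∑ i ∈ Finset.Icc 2 (n - 1),
    ((δ.Z i : ℤ) *
        (Module.finrank k (C.barZ₁ i ⊓ C.barZₙ i : Submodule k (C.BarZ i)) - δ.Z i) +
      ((C.dV₁ δ i : ℤ) - C.dV₁ δ (i + 1)) *
        (Module.finrank k (C.barV₁ (i + 1)) - C.dV₁ δ i + δ.Z i) +
      ((C.dVₙ δ i : ℤ) - C.dVₙ δ (i - 1)) *
        (Module.finrank k (C.barVₙ (i - 1)) - C.dVₙ δ i + δ.Z i) +
      ((r : ℤ) - C.dV₁ δ (i + 1) - C.dVₙ δ (i - 1)) *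
        (C.dV₁ δ i + C.dVₙ δ i - δ.Z i - r))

/-- `(V₁, Vₙ)` and `(V₁', Vₙ')` (possibly for different linked Grassmannians) have the same
numerical invariants. -/
def SameInvariants {k' : Type*} [Field k'] {d' : ℕ} {S' : LinkedSystem k' n d'}
    (C' : S'.EndPair r) : Prop :=
  Module.finrank k C.V₁ₙ = Module.finrank k' C'.V₁ₙ ∧
  Module.finrank k C.Vₙ₁ = Module.finrank k' C'.Vₙ₁ ∧
  Module.finrank k (C.barV₁ n) = Module.finrank k' (C'.barV₁ n) ∧
  Module.finrank k (C.barVₙ 1) = Module.finrank k' (C'.barVₙ 1) ∧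
  ∀ i, 1 < i → i < n →
    Module.finrank k (C.barV₁ i) = Module.finrank k' (C'.barV₁ i) ∧
    Module.finrank k (C.barVₙ i) = Module.finrank k' (C'.barVₙ i) ∧
    Module.finrank k (C.BarZ i) = Module.finrank k' (C'.BarZ i)

end LinkedSystem.EndPair

/-- Two prescriptions differ at some index `1 < i < n`. -/
def Prescription.DifferBelow (n : ℕ) (δ δ' : Prescription) : Prop :=
  ∃ i, 1 < i ∧ i < n ∧ (δ.V₁ i ≠ δ'.V₁ i ∨ δ.Vₙ i ≠ δ'.Vₙ i ∨ δ.Z i ≠ δ'.Z i)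

end LinkedGr

end

/-!
# Fibres of linked Grassmannians over the product of the end Grassmannians

*Reduction to chains.* The `i`-th member of a point of the fibre over `(V₁, Vₙ)` is contained in the
subspace `C.preim i` of the vectors whose images in `E 1` and `E n` lie in `V₁` and `Vₙ`. These
subspaces form a `Chain`, and the points of the fibre are the linked families in the chain that are
everything at both ends (`EndPair.fiberPointEquiv`). The data of a stratum become the ranks of the
images under `g`, under `f`, and modulo `ker f ⊔ ker g` (`FiberPoint.inStratum_iff`), and the
dimensions in the theorem are dimensions of kernels in the chain (`finrank_kerF`, `finrank_kerG`,
`rankB_chain`).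

*Representability.* A Zariski sheaf on `k`-algebras with an `AffineAtlas` is represented by the scheme
that is glued from the charts (`AffineAtlas.pointsEquiv`). For linked families the charts consist of
graphs of linear maps, on which the linking conditions are closed (`Chain.atlas`). The condition to be
a sub-bundle of given rank is locally closed (`exists_ideal_isSubbundle`), so that the strata are
locally closed subschemes (`AffineAtlas.isImmersion_inclusion`).

*Structure of the strata.* In an inner space of the chain the kernels `P` of `f` and `Q` of `g` are
disjoint. A member `W` of a family contains the images `G ≤ P` and `F ≤ Q` of its neighbours.
Choose splittings such that `P'` and `P''` complete `G` to `P`, `Q'` and `Q''` complete `F` to `Q`,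
and `B'`, `B''` complement `P ⊔ Q`, with `P' ⊔ Q' ⊔ B' = H₀ ⊔ H₁`. Then `W` is the sum of `G`, `F` and
a submodule that is described by arbitrary linear maps `P' → P''`, `Q' → Q''`,
`B' → P'' ⊔ Q'' ⊔ B''` and `H₀ → H₁`, uniquely determined by `W` (`Spot.Good.exists_eq_sup`,
`Spot.Good.param_unique`). Conversely such submodules, given at every inner space, generate a linked
family, which is the only solution of the resulting equations, because `f` and `g` annihilate each
other (`Chain.eq_of_step_eq`). It lies in the stratum if certain submodules span, which is an open
condition: the numbers of generators bound the ranks from above (`Frame.Spans.good`). Hence the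
stratum is covered by open subsets of affine spaces. It is smooth, and its dimension is the number of
parameters (`Frame.Fits.card_idx`, `Chain.stratum_smooth`).

*Non-emptiness.* The ranks of a family over a field are sums of dimensions of the summands of such a
splitting, which gives the inequalities (`Point.InStratum.admissible`). Conversely, if they hold, one
chooses subspaces with suitable images under `g` by descending induction and with suitable images
under `f` by ascending induction, and combines the two choices (`Chain.Admissible.exists_point`).

*Dimension of the fibre.* A chain of irreducible closed subsets of length `l` leads to a point whose
residue field has transcendence degree at least `l` over `k` (`exists_le_trdeg`). Since the point lies
in a chart of its stratum, this degree is at most the dimension of the stratum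
(`length_le_stratumDim`). The dimension of the fibre is therefore the maximum of the dimensions of the
non-empty strata, which is given by the numbers in the theorem (`SameDims.topologicalKrullDim_eq`).
-/

universe w w' w''

noncomputable section

namespace LinkedGr

/-! ### Morphisms from affine schemes over a base -/

section

variable {k : Type u} [CommRing k]

@[simp] theorem specMap_left {A B : Type u} [CommRing A] [CommRing B] [Algebra k A] [Algebra k B]
    (φ : A →ₐ[k] B) : (specMap φ).left = Spec.map (CommRingCat.ofHom φ.toRingHom) := rfl

theorem specMap_comp {A B C : Type u} [CommRing A] [CommRing B] [CommRing C] [Algebra k A]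
    [Algebra k B] [Algebra k C] (φ : A →ₐ[k] B) (ψ : B →ₐ[k] C) :
    specMap ψ ≫ specMap φ = specMap (ψ.comp φ) := by
  ext1
  simp only [Over.comp_left, specMap_left, ← Spec.map_comp, ← CommRingCat.ofHom_comp]
  rfl

theorem specMap_id {A : Type u} [CommRing A] [Algebra k A] :
    specMap (AlgHom.id k A) = 𝟙 (specOver k A) := by
  ext1
  simp only [specMap_left, Over.id_left]
  exact Spec.map_id _

theorem specMap_surjective {A B : Type u} [CommRing A] [CommRing B] [Algebra k A] [Algebra k B]
    (h : specOver k B ⟶ specOver k A) : ∃ φ : A →ₐ[k] B, specMap φ = h := by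
  obtain ⟨ψ, hψ⟩ := Spec.map_surjective h.left
  have hw := Over.w h
  simp only [Over.mk_hom, ← hψ, ← Spec.map_comp] at hw
  have := Spec.map_injective hw
  refine ⟨{ ψ.hom with commutes' := fun r => ?_ }, ?_⟩
  · exact congrArg (fun q => q.hom r) this
  · ext1
    rw [← hψ]; rfl

theorem specMap_injective {A B : Type u} [CommRing A] [CommRing B] [Algebra k A] [Algebra k B]
    {φ ψ : A →ₐ[k] B} (h : specMap φ = specMap ψ) : φ = ψ := by
  have := Spec.map_injective (congrArg (fun q => q.left) h)
  ext x
  exact congrArg (fun q => q.hom x) this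

/-- A morphism from an affine scheme to a scheme over `k` is a morphism over `k` for a suitable
algebra structure. -/
theorem exists_algebra_of_hom {T : Over (Spec (CommRingCat.of k))} {R : CommRingCat.{u}}
    (t : Spec R ⟶ T.left) :
    ∃ (_ : Algebra k R) (x : specOver k R ⟶ T), x.left = t := by
  obtain ⟨ψ, hψ⟩ := Spec.map_surjective (t ≫ T.hom)
  let _ := ψ.hom.toAlgebra
  exact ⟨ψ.hom.toAlgebra, Over.homMk t (by rw [← hψ]; rfl), rfl⟩

/-- The localization map as a homomorphism of `k`-algebras. -/
abbrev awayHom (k : Type u) [CommRing k] {A : Type u} [CommRing A] [Algebra k A] (f : A) :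
    A →ₐ[k] Localization.Away f :=
  IsScalarTower.toAlgHom k A (Localization.Away f)

instance (A : Type u) [CommRing A] [Algebra k A] (f : A) :
    IsOpenImmersion (specMap (awayHom k f)).left := by
  rw [specMap_left]
  exact inferInstanceAs (IsOpenImmersion (Spec.map (CommRingCat.ofHom (algebraMap A (Localization.Away f)))))

theorem mem_range_specMap_awayHom {A : Type u} [CommRing A] [Algebra k A] {f : A}
    {p : Spec (CommRingCat.of A)} :
    p ∈ Set.range (specMap (awayHom k f)).left ↔ f ∉ p.asIdeal := by
  have := PrimeSpectrum.localization_away_comap_range (Localization.Away f) f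
  exact (Set.ext_iff.1 this p)

/-- An affine open neighbourhood of a point of an affine `k`-scheme on which a morphism lands in a
given open subscheme. -/
theorem exists_lift_of_mem_range {T U : Over (Spec (CommRingCat.of k))} (u : U ⟶ T)
    [IsOpenImmersion u.left] {B : Type u} [CommRing B] [Algebra k B] (x : specOver k B ⟶ T)
    (p : Spec (CommRingCat.of B)) (hp : x.left p ∈ Set.range u.left) :
    ∃ b ∉ p.asIdeal, ∃ y : specOver k (Localization.Away b) ⟶ U,
      y ≫ u = specMap (awayHom k b) ≫ x := by
  have ho : IsOpen (x.left ⁻¹' Set.range u.left) :=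
    u.left.isOpenEmbedding.isOpen_range.preimage x.left.continuous
  obtain ⟨_, ⟨b, rfl⟩, hb, hle⟩ :=
    PrimeSpectrum.isTopologicalBasis_basic_opens.exists_subset_of_mem_open hp ho
  have hr : Set.range (specMap (awayHom k b) ≫ x).left ⊆ Set.range u.left := by
    rintro _ ⟨q, rfl⟩
    have : (specMap (awayHom k b)).left q ∈ (x.left ⁻¹' Set.range u.left) :=
      hle (mem_range_specMap_awayHom.1 ⟨q, rfl⟩)
    simpa using this
  refine ⟨b, hb, Over.homMk (IsOpenImmersion.lift u.left (specMap (awayHom k b) ≫ x).left hr) ?_, ?_⟩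
  · refine (congrArg (fun q => IsOpenImmersion.lift u.left (specMap (awayHom k b) ≫ x).left hr ≫ q)
      (Over.w u)).symm.trans ?_
    exact (IsOpenImmersion.lift_fac_assoc _ _ _ _).trans (Over.w (specMap (awayHom k b) ≫ x))
  · ext1
    exact IsOpenImmersion.lift_fac _ _ _

variable {T T' : Over (Spec (CommRingCat.of k))}

theorem span_range_eq_top_of_forall_notMem {B : Type*} [CommRing B] (b : PrimeSpectrum B → B)
    (hb : ∀ p, b p ∉ p.asIdeal) : Ideal.span (Set.range b) = ⊤ := by
  by_contra h
  obtain ⟨m, hm, hle⟩ := Ideal.exists_le_maximal _ h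
  exact hb ⟨m, hm.isPrime⟩ (hle (Ideal.subset_span ⟨_, rfl⟩))

/-- Two points of a `k`-scheme with values in `B` that agree on basic open sets around all primes
agree. -/
theorem hom_ext_of_local {B : Type u} [CommRing B] [Algebra k B] {x x' : specOver k B ⟶ T}
    (h : ∀ p : PrimeSpectrum B, ∃ b ∉ p.asIdeal,
      specMap (awayHom k b) ≫ x = specMap (awayHom k b) ≫ x') : x = x' := by
  choose b hb hx using h
  ext1
  refine (Scheme.affineOpenCoverOfSpanRangeEqTop (R := CommRingCat.of B) b
    (span_range_eq_top_of_forall_notMem b hb)).openCover.hom_ext _ _ fun p => ?_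
  exact congrArg (fun q => q.left) (hx p)

/-- Morphisms from a `k`-scheme are determined by their composites with the points of the scheme
that have values in `k`-algebras. -/
theorem hom_ext_of_points {Z : Scheme.{u}} {h h' : T.left ⟶ Z}
    (H : ∀ (B : Type u) [CommRing B] [Algebra k B] (x : specOver k B ⟶ T),
      x.left ≫ h = x.left ≫ h') : h = h' := by
  refine T.left.affineCover.hom_ext _ _ fun j => ?_
  obtain ⟨_, x, hx⟩ := exists_algebra_of_hom (T := T) (T.left.affineCover.f j)
  rw [← hx]
  exact H _ x

/-- Gluing of morphisms over `k` along an open cover; compatibility is tested on points with values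
in `k`-algebras. -/
theorem exists_glue_of_cover {J : Type*} (X : J → Over (Spec (CommRingCat.of k))) (x : ∀ j, X j ⟶ T)
    [∀ j, IsOpenImmersion (x j).left] (hx : ∀ t : T.left, ∃ j, t ∈ Set.range (x j).left)
    (y : ∀ j, X j ⟶ T')
    (H : ∀ (i j) (B : Type u) [CommRing B] [Algebra k B] (a : specOver k B ⟶ X i)
      (b : specOver k B ⟶ X j), a ≫ x i = b ≫ x j → a ≫ y i = b ≫ y j) :
    ∃ h : T ⟶ T', ∀ j, x j ≫ h = y j := by
  let 𝒰 : T.left.OpenCover := Scheme.Cover.mkOfCovers J (fun j => (X j).left) (fun j => (x j).left)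
    (fun t => (hx t).imp fun j ⟨a, ha⟩ => ⟨a, ha⟩) (fun _ => inferInstance)
  have key : ∀ i j : 𝒰.I₀, Limits.pullback.fst (𝒰.f i) (𝒰.f j) ≫ (y i).left =
      Limits.pullback.snd (𝒰.f i) (𝒰.f j) ≫ (y j).left := by
    intro i j
    let W : Over (Spec (CommRingCat.of k)) :=
      Over.mk (Limits.pullback.fst (𝒰.f i) (𝒰.f j) ≫ (X i).hom)
    let w₁ : W ⟶ X i := Over.homMk (Limits.pullback.fst (𝒰.f i) (𝒰.f j)) rfl
    have h1 : 𝒰.f i ≫ T.hom = (X i).hom := Over.w (x i)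
    have h2 : 𝒰.f j ≫ T.hom = (X j).hom := Over.w (x j)
    let w₂ : W ⟶ X j := Over.homMk (Limits.pullback.snd (𝒰.f i) (𝒰.f j)) (by
      change _ ≫ (X j).hom = _ ≫ (X i).hom
      rw [← h1, ← h2]
      exact (Limits.pullback.condition_assoc _).symm)
    refine hom_ext_of_points (T := W) fun C _ _ c => ?_
    have h3 : w₁ ≫ x i = w₂ ≫ x j := by
      ext1
      exact Limits.pullback.condition
    have := H i j C (c ≫ w₁) (c ≫ w₂) (by rw [Category.assoc, Category.assoc, h3])
    rw [Category.assoc, Category.assoc] at this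
    exact congrArg (fun q => q.left) this
  have hι : ∀ j, (x j).left ≫ 𝒰.glueMorphisms (fun j => (y j).left) key = (y j).left :=
    fun j => 𝒰.ι_glueMorphisms _ key j
  refine ⟨Over.homMk (𝒰.glueMorphisms (fun j => (y j).left) key) ?_, fun j => by ext1; exact hι j⟩
  refine 𝒰.hom_ext _ _ fun j => ?_
  exact (Category.assoc _ _ _).symm.trans ((congrArg (· ≫ T'.hom) (hι j)).trans
    ((Over.w (y j)).trans (Over.w (x j)).symm))

/-- Points of a `k`-scheme over basic open sets that cover `Spec B` glue if they agree on overlaps.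
-/
theorem exists_glue_of_local {B : Type u} [CommRing B] [Algebra k B] (b : PrimeSpectrum B → B)
    (hb : ∀ p, b p ∉ p.asIdeal) (y : ∀ p, specOver k (Localization.Away (b p)) ⟶ T)
    (H : ∀ (p q) (C : Type u) [CommRing C] [Algebra k C] (φ : Localization.Away (b p) →ₐ[k] C)
      (ψ : Localization.Away (b q) →ₐ[k] C), φ.comp (awayHom k (b p)) = ψ.comp (awayHom k (b q)) →
      specMap φ ≫ y p = specMap ψ ≫ y q) :
    ∃ x : specOver k B ⟶ T, ∀ p, specMap (awayHom k (b p)) ≫ x = y p := by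
  refine exists_glue_of_cover (fun p => specOver k (Localization.Away (b p)))
    (fun p => specMap (awayHom k (b p))) (fun p => ⟨p, mem_range_specMap_awayHom.2 (hb p)⟩) y ?_
  intro p q C _ _ φ ψ h
  obtain ⟨φ, rfl⟩ := specMap_surjective φ
  obtain ⟨ψ, rfl⟩ := specMap_surjective ψ
  rw [specMap_comp, specMap_comp] at h
  exact H p q C φ ψ (specMap_injective h)

/-- An affine open cover of a `k`-scheme by spectra of `k`-algebras. -/
theorem exists_affine_nhd (t : T.left) : ∃ (B : Type u) (_ : CommRing B) (_ : Algebra k B)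
    (x : specOver k B ⟶ T), IsOpenImmersion x.left ∧ t ∈ Set.range x.left := by
  obtain ⟨j, a, ha⟩ := T.left.affineCover.exists_eq t
  obtain ⟨alg, x, hx⟩ := exists_algebra_of_hom (T := T) (T.left.affineCover.f j)
  exact ⟨_, _, alg, x, by rw [hx]; exact T.left.affineCover.map_prop j,
    by rw [hx]; exact ⟨a, ha⟩⟩

/-- A natural transformation between the functors of points on `k`-algebras comes from a
morphism. -/
theorem exists_hom_of_natural
    (η : ∀ (B : Type u) [CommRing B] [Algebra k B], (specOver k B ⟶ T) → (specOver k B ⟶ T'))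
    (hη : ∀ (B C : Type u) [CommRing B] [CommRing C] [Algebra k B] [Algebra k C] (φ : B →ₐ[k] C)
      (x : specOver k B ⟶ T), η C (specMap φ ≫ x) = specMap φ ≫ η B x) :
    ∃ h : T ⟶ T', ∀ (B : Type u) [CommRing B] [Algebra k B] (x : specOver k B ⟶ T),
      x ≫ h = η B x := by
  choose R cr alg x hx hmem using fun t => exists_affine_nhd (T := T) t
  obtain ⟨h, hh⟩ := exists_glue_of_cover (fun t => specOver k (R t)) x (fun t => ⟨t, hmem t⟩)
    (fun t => η (R t) (x t)) (fun i j B _ _ y z hyz => by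
      obtain ⟨φ, rfl⟩ := specMap_surjective y
      obtain ⟨ψ, rfl⟩ := specMap_surjective z
      rw [← hη, ← hη, hyz])
  refine ⟨h, fun B _ _ y => hom_ext_of_local fun p => ?_⟩
  obtain ⟨b, hb, w, hw⟩ := exists_lift_of_mem_range (x (y.left p)) y p (hmem _)
  refine ⟨b, hb, ?_⟩
  obtain ⟨φ, rfl⟩ := specMap_surjective w
  rw [← Category.assoc, ← hw, Category.assoc, hh, ← hη, ← hη, hw]

theorem over_hom_ext {h h' : T ⟶ T'}
    (H : ∀ (B : Type u) [CommRing B] [Algebra k B] (x : specOver k B ⟶ T), x ≫ h = x ≫ h') :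
    h = h' := by
  ext1
  exact hom_ext_of_points fun B _ _ x => congrArg (fun q => q.left) (H B x)

end

/-! ### Representability of Zariski sheaves with an affine atlas -/

section

/-- A Zariski sheaf on affine schemes over `k`, given by its values on `k`-algebras. The
sheaf axioms are stated for covers by one basic open set around each prime. -/
structure ZariskiSheaf (k : Type u) [CommRing k] where
  obj : ∀ (A : Type u) [CommRing A] [Algebra k A], Type w
  map : ∀ {A B : Type u} [CommRing A] [CommRing B] [Algebra k A] [Algebra k B],
    (A →ₐ[k] B) → obj A → obj B
  map_id : ∀ {A : Type u} [CommRing A] [Algebra k A] (a : obj A), map (AlgHom.id k A) a = a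
  map_comp : ∀ {A B C : Type u} [CommRing A] [CommRing B] [CommRing C] [Algebra k A] [Algebra k B]
    [Algebra k C] (φ : A →ₐ[k] B) (ψ : B →ₐ[k] C) (a : obj A),
    map (ψ.comp φ) a = map ψ (map φ a)
  sep : ∀ {A : Type u} [CommRing A] [Algebra k A] (a b : obj A),
    (∀ p : PrimeSpectrum A, ∃ f ∉ p.asIdeal, map (awayHom k f) a = map (awayHom k f) b) → a = b
  glue : ∀ {A : Type u} [CommRing A] [Algebra k A] (f : PrimeSpectrum A → A)
    (_ : ∀ p, f p ∉ p.asIdeal) (a : ∀ p, obj (Localization.Away (f p)))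
    (_ : ∀ (p q) (C : Type u) [CommRing C] [Algebra k C] (φ : Localization.Away (f p) →ₐ[k] C)
      (ψ : Localization.Away (f q) →ₐ[k] C), φ.comp (awayHom k (f p)) = ψ.comp (awayHom k (f q)) →
      map φ (a p) = map ψ (a q)),
    ∃ b : obj A, ∀ p, map (awayHom k (f p)) b = a p

/-- A covering of a Zariski sheaf by open subsheaves that are represented by `k`-algebras. -/
structure AffineAtlas {k : Type u} [CommRing k] (F : ZariskiSheaf.{u, w} k) where
  J : Type w'
  [small : Small.{u} J]
  R : J → Type u
  [commRing : ∀ j, CommRing (R j)]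
  [algebra : ∀ j, Algebra k (R j)]
  pt : ∀ j, F.obj (R j)
  inj : ∀ (j) {B : Type u} [CommRing B] [Algebra k B] (φ ψ : R j →ₐ[k] B),
    F.map φ (pt j) = F.map ψ (pt j) → φ = ψ
  isOpen : ∀ (j) {A K : Type u} [CommRing A] [Algebra k A] [Field K] [Algebra k K] (a : F.obj A)
    (φ : A →ₐ[k] K), (∃ ψ : R j →ₐ[k] K, F.map ψ (pt j) = F.map φ a) →
    ∃ (B : Type u) (_ : CommRing B) (_ : Algebra k B) (φ₀ : A →ₐ[k] B) (χ : B →ₐ[k] K)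
      (ψ : R j →ₐ[k] B), IsOpenImmersion (specMap φ₀).left ∧ χ.comp φ₀ = φ ∧
        F.map ψ (pt j) = F.map φ₀ a
  cover : ∀ {K : Type u} [Field K] [Algebra k K] (a : F.obj K), ∃ (j : J) (ψ : R j →ₐ[k] K),
    F.map ψ (pt j) = a

attribute [instance] AffineAtlas.small AffineAtlas.commRing AffineAtlas.algebra

variable {k : Type u} [CommRing k]

/-- The homomorphism of algebras underlying a morphism of affine `k`-schemes. -/
def algHomOf {A B : Type u} [CommRing A] [CommRing B] [Algebra k A] [Algebra k B]
    (h : specOver k B ⟶ specOver k A) : A →ₐ[k] B :=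
  (specMap_surjective h).choose

@[simp] theorem specMap_algHomOf {A B : Type u} [CommRing A] [CommRing B] [Algebra k A]
    [Algebra k B] (h : specOver k B ⟶ specOver k A) : specMap (algHomOf h) = h :=
  (specMap_surjective h).choose_spec

@[simp] theorem algHomOf_specMap {A B : Type u} [CommRing A] [CommRing B] [Algebra k A]
    [Algebra k B] (φ : A →ₐ[k] B) : algHomOf (specMap φ) = φ :=
  specMap_injective (specMap_algHomOf _)

theorem algHomOf_comp {A B C : Type u} [CommRing A] [CommRing B] [CommRing C] [Algebra k A]
    [Algebra k B] [Algebra k C] (h : specOver k C ⟶ specOver k B) (h' : specOver k B ⟶ specOver k A) :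
    algHomOf (h ≫ h') = (algHomOf h).comp (algHomOf h') :=
  specMap_injective (by rw [← specMap_comp]; simp)

/-- The homomorphism from a `k`-algebra to the residue field at a prime. -/
abbrev residueHom (k : Type u) [CommRing k] {A : Type u} [CommRing A] [Algebra k A]
    (p : PrimeSpectrum A) : A →ₐ[k] p.asIdeal.ResidueField :=
  IsScalarTower.toAlgHom k A p.asIdeal.ResidueField

theorem ker_algHom_of_specMap {A K : Type u} [CommRing A] [Algebra k A] [Field K] [Algebra k K]
    (φ : A →ₐ[k] K) (x : Spec (CommRingCat.of K)) :
    ((specMap φ).left x).asIdeal = RingHom.ker φ := by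
  have hx : x.asIdeal = ⊥ := by
    have := x.2
    exact (Ideal.eq_bot_or_top x.asIdeal).resolve_right this.ne_top
  change Ideal.comap φ.toRingHom x.asIdeal = _
  rw [hx]; rfl

theorem specMap_residueHom_apply {A : Type u} [CommRing A] [Algebra k A] (p : PrimeSpectrum A)
    (x : Spec (CommRingCat.of p.asIdeal.ResidueField)) : (specMap (residueHom k p)).left x = p := by
  apply PrimeSpectrum.ext
  rw [ker_algHom_of_specMap]
  exact Ideal.ker_algebraMap_residueField p.asIdeal

namespace AffineAtlas

variable {F : ZariskiSheaf.{u, w} k} (𝔄 : AffineAtlas.{u, w, w'} F)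

/-- The point `a` lies in the `j`-th chart. -/
def InChart {A : Type u} [CommRing A] [Algebra k A] (j : 𝔄.J) (a : F.obj A) : Prop :=
  ∃ ψ : 𝔄.R j →ₐ[k] A, F.map ψ (𝔄.pt j) = a

theorem InChart.map {𝔄 : AffineAtlas.{u, w, w'} F} {A B : Type u} [CommRing A] [Algebra k A]
    [CommRing B] [Algebra k B] {j : 𝔄.J} {a : F.obj A} (h : 𝔄.InChart j a) (φ : A →ₐ[k] B) :
    𝔄.InChart j (F.map φ a) := by
  obtain ⟨ψ, rfl⟩ := h
  exact ⟨φ.comp ψ, F.map_comp _ _ _⟩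

/-- The charts are subsheaves: since the points of a chart are determined by the points of `F` that
they give, local lifts to the chart glue. -/
theorem inChart_of_local {A : Type u} [CommRing A] [Algebra k A] {j : 𝔄.J} {a : F.obj A}
    (h : ∀ p : PrimeSpectrum A, ∃ f ∉ p.asIdeal, 𝔄.InChart j (F.map (awayHom k f) a)) :
    𝔄.InChart j a := by
  choose f hf ψ hψ using h
  obtain ⟨x, hx⟩ := exists_glue_of_local f hf (fun p => specMap (ψ p)) (by
    intro p q C _ _ φ χ hφ
    rw [specMap_comp, specMap_comp]
    congr 1
    apply 𝔄.inj
    rw [F.map_comp, F.map_comp, hψ, hψ, ← F.map_comp, ← F.map_comp, hφ])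
  refine ⟨algHomOf x, F.sep _ _ fun p => ⟨f p, hf p, ?_⟩⟩
  rw [← F.map_comp, ← hψ]
  congr 1
  apply specMap_injective
  rw [← specMap_comp, specMap_algHomOf, hx]

/-- The locus in `Spec A` where the point `a` lies in the `j`-th chart. -/
def locus {A : Type u} [CommRing A] [Algebra k A] (j : 𝔄.J) (a : F.obj A) :
    (Spec (CommRingCat.of A)).Opens where
  carrier := ⋃ (B : Type u) (_ : CommRing B) (_ : Algebra k B) (φ : A →ₐ[k] B)
    (_ : IsOpenImmersion (specMap φ).left) (_ : 𝔄.InChart j (F.map φ a)),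
    Set.range (specMap φ).left
  is_open' := by
    refine isOpen_iUnion fun B => isOpen_iUnion fun _ => isOpen_iUnion fun _ => isOpen_iUnion
      fun φ => isOpen_iUnion fun h => isOpen_iUnion fun _ => ?_
    exact (specMap φ).left.isOpenEmbedding.isOpen_range

theorem mem_locus {A : Type u} [CommRing A] [Algebra k A] {j : 𝔄.J} {a : F.obj A}
    {p : Spec (CommRingCat.of A)} : p ∈ 𝔄.locus j a ↔
      ∃ (B : Type u) (_ : CommRing B) (_ : Algebra k B) (φ : A →ₐ[k] B),
      IsOpenImmersion (specMap φ).left ∧ 𝔄.InChart j (F.map φ a) ∧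
        p ∈ Set.range (specMap φ).left := by
  change p ∈ ⋃ (B : Type u) (_ : CommRing B) (_ : Algebra k B) (φ : A →ₐ[k] B)
    (_ : IsOpenImmersion (specMap φ).left) (_ : 𝔄.InChart j (F.map φ a)),
    Set.range (specMap φ).left ↔ _
  simp only [Set.mem_iUnion, exists_prop]

/-- The universal property of the locus: a pull-back of `a` lies in the chart if and only if it
comes from a point of the locus. -/
theorem inChart_map_iff {A B : Type u} [CommRing A] [Algebra k A] [CommRing B] [Algebra k B]
    {j : 𝔄.J} {a : F.obj A} (φ : A →ₐ[k] B) :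
    𝔄.InChart j (F.map φ a) ↔
      Set.range (specMap φ).left ⊆ (𝔄.locus j a : Set (Spec (CommRingCat.of A))) := by
  constructor
  · rintro h _ ⟨(q : PrimeSpectrum B), rfl⟩
    have h1 := h.map (residueHom k q)
    rw [← F.map_comp] at h1
    obtain ⟨A', _, _, φ₀, χ, ψ, ho, hχ, hψ⟩ := 𝔄.isOpen j a _ h1
    refine 𝔄.mem_locus.2 ⟨A', _, _, φ₀, ho, ⟨ψ, hψ⟩, ?_⟩
    obtain ⟨x⟩ : Nonempty (Spec (CommRingCat.of q.asIdeal.ResidueField)) :=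
      inferInstance
    refine ⟨(specMap χ).left x, ?_⟩
    rw [← Scheme.Hom.comp_apply, ← Over.comp_left, specMap_comp, hχ, ← specMap_comp,
      Over.comp_left, Scheme.Hom.comp_apply, specMap_residueHom_apply]
  · refine fun h => 𝔄.inChart_of_local fun q => ?_
    obtain ⟨A', _, _, φ₀, ho, hc, hq⟩ := 𝔄.mem_locus.1 (h ⟨q, rfl⟩)
    obtain ⟨b, hb, y, hy⟩ := exists_lift_of_mem_range (specMap φ₀) (specMap φ) q hq
    obtain ⟨χ, rfl⟩ := specMap_surjective y
    refine ⟨b, hb, ?_⟩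
    rw [specMap_comp, specMap_comp] at hy
    rw [← F.map_comp, ← specMap_injective hy, F.map_comp]
    exact hc.map χ

/-- An open subscheme of a chart. -/
structure OpenPiece where
  idx : 𝔄.J
  U : (Spec (CommRingCat.of (𝔄.R idx))).Opens

instance : Small.{u} 𝔄.OpenPiece :=
  small_of_injective (β := Σ j : 𝔄.J, (Spec (CommRingCat.of (𝔄.R j))).Opens)
    (f := fun l => ⟨l.idx, l.U⟩) (by
      rintro ⟨i, U⟩ ⟨j, V⟩ h
      simp only [Sigma.mk.injEq] at h
      obtain ⟨rfl, h⟩ := h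
      cases h; rfl)

variable {𝔄}

namespace OpenPiece

/-- An open piece of a chart as a `k`-scheme. -/
def toOver (l : 𝔄.OpenPiece) : Over (Spec (CommRingCat.of k)) :=
  Over.mk (l.U.ι ≫ (specOver k (𝔄.R l.idx)).hom)

/-- The inclusion of an open piece in its chart. -/
def incl (l : 𝔄.OpenPiece) : l.toOver ⟶ specOver k (𝔄.R l.idx) := Over.homMk l.U.ι rfl

instance instIsOpenImmersionLeftIncl (l : 𝔄.OpenPiece) : IsOpenImmersion l.incl.left :=
  inferInstanceAs (IsOpenImmersion l.U.ι)

theorem range_incl (l : 𝔄.OpenPiece) :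
    Set.range l.incl.left = (l.U : Set (Spec (CommRingCat.of (𝔄.R l.idx)))) := l.U.range_ι

instance (l : 𝔄.OpenPiece) : Mono l.incl :=
  haveI : Mono l.incl.left := inferInstance
  Over.mono_of_mono_left _

/-- The point of the sheaf given by a point of an open piece of a chart. -/
def pt (l : 𝔄.OpenPiece) {B : Type u} [CommRing B] [Algebra k B] (x : specOver k B ⟶ l.toOver) :
    F.obj B :=
  F.map (algHomOf (x ≫ l.incl)) (𝔄.pt l.idx)

theorem pt_comp (l : 𝔄.OpenPiece) {B C : Type u} [CommRing B] [Algebra k B] [CommRing C]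
    [Algebra k C] (φ : B →ₐ[k] C) (x : specOver k B ⟶ l.toOver) :
    l.pt (specMap φ ≫ x) = F.map φ (l.pt x) := by
  rw [pt, pt, ← F.map_comp, Category.assoc, algHomOf_comp, algHomOf_specMap]

theorem pt_injective (l : 𝔄.OpenPiece) {B : Type u} [CommRing B] [Algebra k B]
    {x y : specOver k B ⟶ l.toOver} (h : l.pt x = l.pt y) : x = y := by
  have := congrArg specMap (𝔄.inj _ _ _ h)
  rw [specMap_algHomOf, specMap_algHomOf] at this
  exact (cancel_mono l.incl).1 this

/-- Morphisms of open pieces: open immersions compatible with the maps to the sheaf. -/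
@[ext] structure Hom (l l' : 𝔄.OpenPiece) where
  hom : l.toOver ⟶ l'.toOver
  isOpenImmersion : IsOpenImmersion hom.left
  pt_eq : ∀ (B : Type u) [CommRing B] [Algebra k B] (x : specOver k B ⟶ l.toOver),
    l'.pt (x ≫ hom) = l.pt x

instance : Category 𝔄.OpenPiece where
  Hom := Hom
  id l := ⟨𝟙 _, inferInstanceAs (IsOpenImmersion (𝟙 l.toOver.left)), fun _ _ _ x => by rw [Category.comp_id]⟩
  comp f g := ⟨f.hom ≫ g.hom, by
    have := f.isOpenImmersion; have := g.isOpenImmersion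
    rw [Over.comp_left]; infer_instance, fun B _ _ x => by
      rw [← Category.assoc, g.pt_eq, f.pt_eq]⟩
  id_comp f := Hom.ext (Category.id_comp _)
  comp_id f := Hom.ext (Category.comp_id _)
  assoc f g h := Hom.ext (Category.assoc _ _ _)

instance : Quiver.IsThin 𝔄.OpenPiece := fun l l' => ⟨fun f g => Hom.ext (over_hom_ext
  fun B _ _ x => l'.pt_injective (by rw [f.pt_eq, g.pt_eq]))⟩

variable (𝔄) in
/-- The diagram of all open pieces of the charts. -/
def diagram : 𝔄.OpenPiece ⥤ Scheme.{u} where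
  obj l := l.toOver.left
  map f := f.hom.left
  map_id _ := rfl
  map_comp _ _ := rfl

instance {l l' : 𝔄.OpenPiece} (f : l ⟶ l') : IsOpenImmersion ((diagram 𝔄).map f) :=
  f.isOpenImmersion

/-- An open piece of an open piece, with its inclusion. -/
abbrev restrict (l : 𝔄.OpenPiece) (V : l.toOver.left.Opens) : 𝔄.OpenPiece :=
  ⟨l.idx, l.U.ι ''ᵁ V⟩

/-- A morphism that lands in an open subscheme, over `k`. -/
def liftOver {T U W : Over (Spec (CommRingCat.of k))} (u : U ⟶ T) [IsOpenImmersion u.left]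
    (x : W ⟶ T) (h : Set.range x.left ⊆ Set.range u.left) :
    W ⟶ U :=
  Over.homMk (IsOpenImmersion.lift u.left x.left h) (by
    rw [← Over.w u, IsOpenImmersion.lift_fac_assoc, Over.w])

@[simp] theorem liftOver_fac {T U W : Over (Spec (CommRingCat.of k))} (u : U ⟶ T)
    [IsOpenImmersion u.left] (x : W ⟶ T) (h : Set.range x.left ⊆ Set.range u.left) :
    liftOver u x h ≫ u = x := by
  ext1
  exact IsOpenImmersion.lift_fac _ _ _

theorem isOpenImmersion_liftOver {T U W : Over (Spec (CommRingCat.of k))} (u : U ⟶ T)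
    [IsOpenImmersion u.left] (x : W ⟶ T) [IsOpenImmersion x.left]
    (h : Set.range x.left ⊆ Set.range u.left) : IsOpenImmersion (liftOver u x h).left := by
  have : IsOpenImmersion ((liftOver u x h).left ≫ u.left) := by
    rw [← Over.comp_left, liftOver_fac]; infer_instance
  exact IsOpenImmersion.of_comp _ u.left

theorem range_restrict_incl (l : 𝔄.OpenPiece) (V : l.toOver.left.Opens) :
    Set.range (l.restrict V).incl.left = l.incl.left '' V := by
  rw [range_incl]
  rfl

/-- The inclusion of an open piece of an open piece. -/
def restrictHom (l : 𝔄.OpenPiece) (V : l.toOver.left.Opens) : l.restrict V ⟶ l :=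
  have h : Set.range (l.restrict V).incl.left ⊆ Set.range l.incl.left :=
    (range_restrict_incl l V).trans_subset (Set.image_subset_range _ _)
  have : IsOpenImmersion (l.restrict V).incl.left := instIsOpenImmersionLeftIncl _
  ⟨liftOver l.incl (l.restrict V).incl h, isOpenImmersion_liftOver _ _ _, fun B _ _ x => by
    have : (x ≫ liftOver l.incl (l.restrict V).incl h) ≫ l.incl = x ≫ (l.restrict V).incl := by
      rw [Category.assoc]
      exact congrArg (x ≫ ·) (liftOver_fac l.incl (l.restrict V).incl h)
    rw [pt, this]
    rfl⟩

theorem range_restrictHom (l : 𝔄.OpenPiece) (V : l.toOver.left.Opens) :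
    Set.range (l.restrictHom V).hom.left = V := by
  have h1 : l.incl.left '' Set.range (l.restrictHom V).hom.left = l.incl.left '' V := by
    rw [← range_restrict_incl, ← Set.range_comp]
    have : (l.restrictHom V).hom ≫ l.incl = (l.restrict V).incl := liftOver_fac _ _ _
    rw [← this]
    exact Set.ext fun _ => Iff.rfl
  exact l.incl.left.isOpenEmbedding.injective.image_injective h1

/-- Two open pieces inside a third one have a common open piece around each common point. -/
theorem exists_common {i j m : 𝔄.OpenPiece} (fi : i ⟶ m) (fj : j ⟶ m) (xi : i.toOver.left)
    (xj : j.toOver.left) (h : fi.hom.left xi = fj.hom.left xj) :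
    ∃ (l : 𝔄.OpenPiece) (fli : l ⟶ i) (flj : l ⟶ j) (x : l.toOver.left),
      fli.hom.left x = xi ∧ flj.hom.left x = xj := by
  have := fi.isOpenImmersion
  have := fj.isOpenImmersion
  let V : i.toOver.left.Opens := fi.hom.left ⁻¹ᵁ fj.hom.left.opensRange
  have hr : Set.range (i.restrictHom V ≫ fi).hom.left ⊆ Set.range fj.hom.left := by
    change Set.range ((i.restrictHom V).hom ≫ fi.hom).left ⊆ _
    rintro _ ⟨x, rfl⟩
    have : (i.restrictHom V).hom.left x ∈ (V : Set i.toOver.left) := by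
      rw [← range_restrictHom]; exact ⟨x, rfl⟩
    exact this
  have := (i.restrictHom V ≫ fi).isOpenImmersion
  let g : i.restrict V ⟶ j := ⟨liftOver fj.hom (i.restrictHom V ≫ fi).hom hr,
    isOpenImmersion_liftOver _ _ _, fun B _ _ x => by
      rw [← fj.pt_eq, Category.assoc, liftOver_fac, (i.restrictHom V ≫ fi).pt_eq]⟩
  have hxi : xi ∈ (V : Set i.toOver.left) := ⟨xj, h.symm⟩
  rw [← range_restrictHom] at hxi
  obtain ⟨x, rfl⟩ := hxi
  refine ⟨i.restrict V, i.restrictHom V, g, x, rfl, fj.hom.left.isOpenEmbedding.injective ?_⟩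
  rw [← h]
  have : g.hom ≫ fj.hom = (i.restrictHom V).hom ≫ fi.hom := liftOver_fac _ _ _
  have := congrArg (fun q => q.left x) this
  simpa using this

instance : ((diagram 𝔄) ⋙ Scheme.forget).IsLocallyDirected where
  cond fi fj xi xj h := exists_common fi fj xi xj h


/-- The points of an open piece are the points of the sheaf that lie in it. -/
theorem exists_pt_eq (l : 𝔄.OpenPiece) {B : Type u} [CommRing B] [Algebra k B]
    (ψ : 𝔄.R l.idx →ₐ[k] B)
    (h : Set.range (specMap ψ).left ⊆ (l.U : Set (Spec (CommRingCat.of (𝔄.R l.idx))))) :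
    ∃ x : specOver k B ⟶ l.toOver, l.pt x = F.map ψ (𝔄.pt l.idx) := by
  refine ⟨liftOver l.incl (specMap ψ) (h.trans_eq (range_incl l).symm), ?_⟩
  rw [pt, liftOver_fac, algHomOf_specMap]

/-- The part of the `i`-th chart that lies in the `j`-th chart. -/
abbrev overlap (i j : 𝔄.J) : 𝔄.OpenPiece := ⟨i, 𝔄.locus j (𝔄.pt i)⟩

/-- The part of the `i`-th chart in the `j`-th one maps to the part of the `j`-th chart in the
`i`-th one, compatibly with the points of `F`. -/
theorem exists_transition (i j : 𝔄.J) : ∃ t : (overlap i j).toOver ⟶ (overlap j i).toOver,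
    ∀ (B : Type u) [CommRing B] [Algebra k B] (x : specOver k B ⟶ (overlap i j).toOver),
      (overlap j i).pt (x ≫ t) = (overlap i j).pt x := by
  have H : ∀ (B : Type u) [CommRing B] [Algebra k B] (x : specOver k B ⟶ (overlap i j).toOver),
      ∃ y : specOver k B ⟶ (overlap j i).toOver, (overlap j i).pt y = (overlap i j).pt x := by
    intro B _ _ x
    have h1 : 𝔄.InChart j ((overlap i j).pt x) := by
      refine (𝔄.inChart_map_iff _).2 ?_
      rw [specMap_algHomOf]
      refine Set.Subset.trans ?_ (range_incl (overlap i j)).subset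
      rintro _ ⟨q, rfl⟩
      exact ⟨x.left q, rfl⟩
    obtain ⟨ψ, hψ⟩ := h1
    obtain ⟨y, hy⟩ := exists_pt_eq (overlap j i) ψ ((𝔄.inChart_map_iff ψ).1 ⟨_, hψ.symm⟩)
    exact ⟨y, hy.trans hψ⟩
  choose η hη using H
  obtain ⟨t, ht⟩ := exists_hom_of_natural η (fun B C _ _ _ _ φ x => pt_injective _ (by
    rw [hη, pt_comp, pt_comp, hη]))
  exact ⟨t, fun B _ _ x => by rw [ht, hη]⟩

/-- The transition map between two charts. -/
theorem exists_overlap_hom (i j : 𝔄.J) : Nonempty (overlap i j ⟶ overlap j i) := by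
  obtain ⟨t, ht⟩ := exists_transition i j
  obtain ⟨s, hs⟩ := exists_transition j i
  have h1 : t ≫ s = 𝟙 _ := over_hom_ext fun B _ _ x => pt_injective _ (by
    rw [← Category.assoc, hs, ht, Category.comp_id])
  have h2 : s ≫ t = 𝟙 _ := over_hom_ext fun B _ _ x => pt_injective _ (by
    rw [← Category.assoc, ht, hs, Category.comp_id])
  have h3 : IsIso t.left := ⟨s.left, congrArg (fun q => q.left) h1, congrArg (fun q => q.left) h2⟩
  exact ⟨⟨t, inferInstance, ht⟩⟩

end OpenPiece

open OpenPiece Limits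

variable (𝔄)

/-- The scheme glued from the charts. -/
def glued : Over (Spec (CommRingCat.of k)) :=
  Over.mk (colimit.desc (diagram 𝔄)
    { pt := Spec (CommRingCat.of k)
      ι := { app := fun l => l.toOver.hom
             naturality := fun l l' f => by
              exact (Over.w f.hom).trans (Category.comp_id _).symm } })

/-- The inclusion of an open piece in the glued scheme. -/
def ι (l : 𝔄.OpenPiece) : l.toOver ⟶ 𝔄.glued :=
  Over.homMk (colimit.ι (diagram 𝔄) l) (colimit.ι_desc _ _)

instance (l : 𝔄.OpenPiece) : IsOpenImmersion (𝔄.ι l).left :=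
  inferInstanceAs (IsOpenImmersion (colimit.ι (diagram 𝔄) l))

instance (l : 𝔄.OpenPiece) : Mono (𝔄.ι l) :=
  haveI : Mono (𝔄.ι l).left := inferInstance
  Over.mono_of_mono_left _

theorem hom_ι {l l' : 𝔄.OpenPiece} (f : l ⟶ l') : f.hom ≫ 𝔄.ι l' = 𝔄.ι l := by
  ext1
  exact colimit.w (diagram 𝔄) f

/-- The `j`-th chart as an open piece. -/
abbrev full (j : 𝔄.J) : 𝔄.OpenPiece := ⟨j, ⊤⟩

theorem exists_hom_full (l : 𝔄.OpenPiece) : Nonempty (l ⟶ 𝔄.full l.idx) := by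
  have h : Set.range l.incl.left ⊆ Set.range (𝔄.full l.idx).incl.left := by
    rw [(𝔄.full l.idx).range_incl]; exact fun _ _ => trivial
  exact ⟨⟨liftOver (𝔄.full l.idx).incl l.incl h, isOpenImmersion_liftOver _ _ _, fun B _ _ x => by
    have e : (x ≫ liftOver (𝔄.full l.idx).incl l.incl h) ≫ (𝔄.full l.idx).incl = x ≫ l.incl :=
      (Category.assoc _ _ _).trans (congrArg (x ≫ ·) (liftOver_fac _ _ _))
    exact congrArg (fun z => F.map (algHomOf z) (𝔄.pt l.idx)) e⟩⟩

/-- Points of two open pieces agree as points of the sheaf if and only if they agree as points of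
the glued scheme. -/
theorem pt_eq_iff {l l' : 𝔄.OpenPiece} {B : Type u} [CommRing B] [Algebra k B]
    (x : specOver k B ⟶ l.toOver) (x' : specOver k B ⟶ l'.toOver) :
    l.pt x = l'.pt x' ↔ x ≫ 𝔄.ι l = x' ≫ 𝔄.ι l' := by
  constructor
  · intro h
    obtain ⟨f⟩ := 𝔄.exists_hom_full l
    obtain ⟨f'⟩ := 𝔄.exists_hom_full l'
    obtain ⟨t⟩ := exists_overlap_hom l.idx l'.idx
    obtain ⟨g⟩ := 𝔄.exists_hom_full (overlap l.idx l'.idx)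
    obtain ⟨g'⟩ := 𝔄.exists_hom_full (overlap l'.idx l.idx)
    obtain ⟨y, hy⟩ := exists_pt_eq (overlap l.idx l'.idx) (algHomOf (x ≫ l.incl))
      ((𝔄.inChart_map_iff _).1 ⟨algHomOf (x' ≫ l'.incl), h.symm⟩)
    have h1 : y ≫ g.hom = x ≫ f.hom := pt_injective _ (by
      rw [g.pt_eq, f.pt_eq, hy]; rfl)
    have h2 : (y ≫ t.hom) ≫ g'.hom = x' ≫ f'.hom := pt_injective _ (by
      rw [g'.pt_eq, f'.pt_eq, t.pt_eq, hy, ← h]; rfl)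
    rw [← 𝔄.hom_ι f, ← 𝔄.hom_ι f', ← Category.assoc, ← Category.assoc, ← h1, ← h2,
      Category.assoc, Category.assoc, Category.assoc]
    have e1 : g.hom ≫ 𝔄.ι (𝔄.full l.idx) = 𝔄.ι (overlap l.idx l'.idx) := 𝔄.hom_ι g
    have e2 : g'.hom ≫ 𝔄.ι (𝔄.full l'.idx) = 𝔄.ι (overlap l'.idx l.idx) := 𝔄.hom_ι g'
    exact congrArg (y ≫ ·) (e1.trans ((𝔄.hom_ι t).symm.trans (congrArg (t.hom ≫ ·) e2.symm)))
  · refine fun h => F.sep _ _ fun q => ?_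
    have hq : (𝔄.ι l).left (x.left q) = (𝔄.ι l').left (x'.left q) :=
      congrArg (fun r => r.left q) h
    obtain ⟨m, f, f', z, hz, hz'⟩ := (Scheme.IsLocallyDirected.ι_eq_ι_iff (diagram 𝔄)).1 hq
    have := f.isOpenImmersion
    obtain ⟨b, hb, y, hy⟩ := exists_lift_of_mem_range f.hom x q ⟨z, hz⟩
    refine ⟨b, hb, ?_⟩
    have h1 : y ≫ f'.hom = specMap (awayHom k b) ≫ x' := by
      rw [← cancel_mono (𝔄.ι l'), Category.assoc, Category.assoc, 𝔄.hom_ι, ← 𝔄.hom_ι f, ← h,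
        ← Category.assoc, hy, Category.assoc]
    rw [← pt_comp, ← pt_comp, ← hy, ← h1, f.pt_eq, f'.pt_eq]

theorem exists_mem_range_ι (y : 𝔄.glued.left) : ∃ l : 𝔄.OpenPiece, y ∈ Set.range (𝔄.ι l).left := by
  obtain ⟨l, x, hx⟩ := Scheme.IsLocallyDirected.ι_jointly_surjective (diagram 𝔄) y
  exact ⟨l, x, hx⟩

/-- A point of the glued scheme gives a point of the sheaf: locally it lies in a chart, and the
points of the sheaf obtained there glue. -/
theorem exists_point {A : Type u} [CommRing A] [Algebra k A] (x : specOver k A ⟶ 𝔄.glued) :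
    ∃ a : F.obj A, ∀ (l : 𝔄.OpenPiece) (B : Type u) [CommRing B] [Algebra k B] (φ : A →ₐ[k] B)
      (y : specOver k B ⟶ l.toOver), specMap φ ≫ x = y ≫ 𝔄.ι l → F.map φ a = l.pt y := by
  have H : ∀ p : PrimeSpectrum A, ∃ f ∉ p.asIdeal, ∃ (l : 𝔄.OpenPiece)
      (y : specOver k (Localization.Away f) ⟶ l.toOver),
      y ≫ 𝔄.ι l = specMap (awayHom k f) ≫ x := fun p => by
    obtain ⟨l, hl⟩ := 𝔄.exists_mem_range_ι (x.left p)
    obtain ⟨f, hf, y, hy⟩ := exists_lift_of_mem_range (𝔄.ι l) x p hl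
    exact ⟨f, hf, l, y, hy⟩
  choose f hf l y hy using H
  obtain ⟨a, ha⟩ := F.glue f hf (fun p => (l p).pt (y p)) (by
    intro p q C _ _ φ ψ h
    rw [← pt_comp, ← pt_comp, 𝔄.pt_eq_iff, Category.assoc, Category.assoc, hy, hy,
      ← Category.assoc, ← Category.assoc, specMap_comp, specMap_comp, h])
  refine ⟨a, fun m B _ _ φ z hz => F.sep _ _ fun q => ?_⟩
  let p : PrimeSpectrum A := (specMap φ).left q
  obtain ⟨b, hb, w, hw⟩ := exists_lift_of_mem_range
    (specMap (awayHom k (f p))) (specMap φ) q (mem_range_specMap_awayHom.2 (hf p))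
  refine ⟨b, hb, ?_⟩
  obtain ⟨χ, rfl⟩ := specMap_surjective w
  rw [specMap_comp, specMap_comp] at hw
  rw [← F.map_comp, ← specMap_injective hw, F.map_comp, ha, ← pt_comp, ← pt_comp, 𝔄.pt_eq_iff,
    Category.assoc, Category.assoc, hy, ← hz, ← Category.assoc, ← Category.assoc, specMap_comp,
    specMap_comp, specMap_injective hw]

/-- Locally every point of the sheaf lies in a chart. -/
theorem exists_local_piece {A : Type u} [CommRing A] [Algebra k A] (a : F.obj A)
    (p : PrimeSpectrum A) : ∃ f ∉ p.asIdeal, ∃ (l : 𝔄.OpenPiece)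
      (y : specOver k (Localization.Away f) ⟶ l.toOver), l.pt y = F.map (awayHom k f) a := by
  obtain ⟨j, ψ, hψ⟩ := 𝔄.cover (F.map (residueHom k p) a)
  obtain ⟨B, _, _, φ₀, χ, ψ, ho, hχ, hψ⟩ := 𝔄.isOpen j a _ ⟨ψ, hψ⟩
  obtain ⟨x⟩ : Nonempty (Spec (CommRingCat.of p.asIdeal.ResidueField)) := inferInstance
  obtain ⟨f, hf, w, hw⟩ := exists_lift_of_mem_range (specMap φ₀) (𝟙 (specOver k A)) p
    ⟨(specMap χ).left x, by
      rw [← Scheme.Hom.comp_apply, ← Over.comp_left, specMap_comp, hχ, specMap_residueHom_apply]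
      rfl⟩
  obtain ⟨θ, rfl⟩ := specMap_surjective w
  rw [Category.comp_id, specMap_comp] at hw
  obtain ⟨y, hy⟩ := exists_pt_eq (𝔄.full j) (θ.comp ψ) (fun _ _ => trivial)
  refine ⟨f, hf, 𝔄.full j, y, ?_⟩
  rw [hy, F.map_comp, ← specMap_injective hw, F.map_comp, ← hψ]

/-- A point of the sheaf gives a point of the glued scheme: locally it lies in a chart, and the
points of the glued scheme obtained there glue. -/
theorem exists_hom {A : Type u} [CommRing A] [Algebra k A] (a : F.obj A) :
    ∃ x : specOver k A ⟶ 𝔄.glued, ∀ (l : 𝔄.OpenPiece) (B : Type u) [CommRing B] [Algebra k B]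
      (φ : A →ₐ[k] B) (y : specOver k B ⟶ l.toOver), F.map φ a = l.pt y →
        specMap φ ≫ x = y ≫ 𝔄.ι l := by
  have H := 𝔄.exists_local_piece a
  choose f hf l y hy using H
  obtain ⟨x, hx⟩ := exists_glue_of_local f hf (fun p => y p ≫ 𝔄.ι (l p)) (by
    intro p q C _ _ φ ψ h
    rw [← Category.assoc, ← Category.assoc, ← 𝔄.pt_eq_iff, pt_comp, pt_comp, hy, hy,
      ← F.map_comp, ← F.map_comp, h])
  refine ⟨x, fun m B _ _ φ z hz => hom_ext_of_local fun q => ?_⟩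
  let p : PrimeSpectrum A := (specMap φ).left q
  obtain ⟨b, hb, w, hw⟩ := exists_lift_of_mem_range
    (specMap (awayHom k (f p))) (specMap φ) q (mem_range_specMap_awayHom.2 (hf p))
  refine ⟨b, hb, ?_⟩
  obtain ⟨χ, rfl⟩ := specMap_surjective w
  rw [← Category.assoc, ← hw, Category.assoc, hx, ← Category.assoc, ← Category.assoc,
    ← 𝔄.pt_eq_iff, pt_comp, pt_comp, hy, ← hz, ← F.map_comp, ← F.map_comp]
  congr 1
  rw [specMap_comp, specMap_comp] at hw
  exact specMap_injective hw

/-- The functor of points of the glued scheme. -/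
def pointsEquiv (A : Type u) [CommRing A] [Algebra k A] : (specOver k A ⟶ 𝔄.glued) ≃ F.obj A where
  toFun x := (𝔄.exists_point x).choose
  invFun a := (𝔄.exists_hom a).choose
  left_inv x := by
    refine hom_ext_of_local fun p => ?_
    obtain ⟨l, hl⟩ := 𝔄.exists_mem_range_ι (x.left p)
    obtain ⟨f, hf, y, hy⟩ := exists_lift_of_mem_range (𝔄.ι l) x p hl
    refine ⟨f, hf, ?_⟩
    rw [(𝔄.exists_hom _).choose_spec l _ (awayHom k f) y
      ((𝔄.exists_point x).choose_spec l _ (awayHom k f) y hy.symm), hy]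
  right_inv a := by
    refine F.sep _ _ fun p => ?_
    obtain ⟨f, hf, l, y, hy⟩ := 𝔄.exists_local_piece a p
    refine ⟨f, hf, ?_⟩
    rw [(𝔄.exists_point _).choose_spec l _ (awayHom k f) y
      ((𝔄.exists_hom a).choose_spec l _ (awayHom k f) y hy.symm), hy]

theorem pointsEquiv_comp {A B : Type u} [CommRing A] [Algebra k A] [CommRing B] [Algebra k B]
    (φ : A →ₐ[k] B) (x : specOver k A ⟶ 𝔄.glued) :
    𝔄.pointsEquiv B (specMap φ ≫ x) = F.map φ (𝔄.pointsEquiv A x) := by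
  refine F.sep _ _ fun p => ?_
  obtain ⟨l, hl⟩ := 𝔄.exists_mem_range_ι ((specMap φ ≫ x).left p)
  obtain ⟨f, hf, y, hy⟩ := exists_lift_of_mem_range (𝔄.ι l) (specMap φ ≫ x) p hl
  refine ⟨f, hf, ?_⟩
  rw [← F.map_comp]
  refine ((𝔄.exists_point (specMap φ ≫ x)).choose_spec l _ (awayHom k f) y hy.symm).trans
    ((𝔄.exists_point x).choose_spec l _ ((awayHom k f).comp φ) y ?_).symm
  rw [hy, ← Category.assoc, specMap_comp]

/-- The inclusion of a chart in the glued scheme. -/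
def chart (j : 𝔄.J) : specOver k (𝔄.R j) ⟶ 𝔄.glued := (𝔄.pointsEquiv (𝔄.R j)).symm (𝔄.pt j)

theorem pointsEquiv_comp_chart {A : Type u} [CommRing A] [Algebra k A] (j : 𝔄.J)
    (ψ : 𝔄.R j →ₐ[k] A) : 𝔄.pointsEquiv A (specMap ψ ≫ 𝔄.chart j) = F.map ψ (𝔄.pt j) := by
  rw [pointsEquiv_comp, chart, Equiv.apply_symm_apply]

theorem pointsEquiv_comp_ι {B : Type u} [CommRing B] [Algebra k B] {l : 𝔄.OpenPiece}
    (y : specOver k B ⟶ l.toOver) : 𝔄.pointsEquiv B (y ≫ 𝔄.ι l) = l.pt y := by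
  have := (𝔄.exists_point (y ≫ 𝔄.ι l)).choose_spec l B (AlgHom.id k B) y (by
    rw [specMap_id, Category.id_comp])
  rwa [F.map_id] at this

theorem incl_comp_chart (l : 𝔄.OpenPiece) : l.incl ≫ 𝔄.chart l.idx = 𝔄.ι l := by
  refine over_hom_ext fun B _ _ x => (𝔄.pointsEquiv B).injective ?_
  refine .trans ?_ (𝔄.pointsEquiv_comp_ι x).symm
  refine .trans ?_ (𝔄.pointsEquiv_comp_chart l.idx (algHomOf (x ≫ l.incl)))
  rw [specMap_algHomOf, Category.assoc]

instance (j : 𝔄.J) : IsOpenImmersion (𝔄.chart j).left := by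
  have : Surjective (𝔄.full j).incl.left :=
    ⟨Set.range_eq_univ.1 ((range_incl (𝔄.full j)).trans rfl)⟩
  have : IsIso (𝔄.full j).incl.left :=
    (isIso_iff_isOpenImmersion_and_surjective _).2 ⟨inferInstance, inferInstance⟩
  have : IsOpenImmersion ((𝔄.full j).incl.left ≫ (𝔄.chart j).left) := by
    rw [← Over.comp_left, 𝔄.incl_comp_chart (𝔄.full j)]; infer_instance
  exact (MorphismProperty.cancel_left_of_respectsIso @IsOpenImmersion _ _).1 this

theorem exists_mem_range_chart (y : 𝔄.glued.left) : ∃ j, y ∈ Set.range (𝔄.chart j).left := by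
  obtain ⟨l, x, rfl⟩ := 𝔄.exists_mem_range_ι y
  refine ⟨l.idx, l.incl.left x, ?_⟩
  rw [← 𝔄.incl_comp_chart l]
  rfl

end AffineAtlas

end

/-! ### Base change and pull-back of submodules -/

section

section BaseChange

variable {k : Type*} [Field k] {A : Type*} [CommRing A] [Algebra k A]
  {M N : Type*} [AddCommGroup M] [Module k M] [AddCommGroup N] [Module k N]

theorem range_baseChange (p : M →ₗ[k] N) :
    LinearMap.range (p.baseChange A) = (LinearMap.range p).baseChange A := by
  rw [LinearMap.range_eq_map, ← Submodule.baseChange_top, Submodule.baseChange_eq_span,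
    Submodule.map_span, LinearMap.range_eq_map, Submodule.baseChange_eq_span]
  congr 1
  ext x
  simp

theorem map_baseChange (p : M →ₗ[k] N) (K : Submodule k M) :
    (K.baseChange A).map (p.baseChange A) = (K.map p).baseChange A := by
  rw [Submodule.baseChange_eq_span, Submodule.map_span, Submodule.baseChange_eq_span]
  congr 1
  ext x
  simp

theorem ker_baseChange (p : M →ₗ[k] N) :
    LinearMap.ker (p.baseChange A) = (LinearMap.ker p).baseChange A := by
  have h := Module.Flat.lTensor_exact A (f := (LinearMap.ker p).subtype) (g := p)
    (LinearMap.exact_subtype_ker_map p)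
  ext x
  have h1 := h x
  have e : (p.lTensor A) x = p.baseChange A x := rfl
  have e2 : (x ∈ Set.range ((LinearMap.ker p).subtype.lTensor A)) ↔
      x ∈ LinearMap.range ((LinearMap.ker p).subtype.baseChange A) := Iff.rfl
  rw [e, e2, range_baseChange, Submodule.range_subtype] at h1
  exact h1

theorem baseChange_injective {p : M →ₗ[k] N} (hp : Function.Injective p) :
    Function.Injective (p.baseChange A) := by
  rw [← LinearMap.ker_eq_bot, ker_baseChange, LinearMap.ker_eq_bot.2 hp, Submodule.baseChange_bot]

theorem comap_baseChange (p : M →ₗ[k] N) (K : Submodule k N) :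
    (K.baseChange A).comap (p.baseChange A) = (K.comap p).baseChange A := by
  have h : LinearMap.ker (K.mkQ.baseChange A) = K.baseChange A := by
    rw [ker_baseChange, Submodule.ker_mkQ]
  rw [← h, ← LinearMap.ker_comp, ← LinearMap.baseChange_comp, ker_baseChange, LinearMap.ker_comp,
    Submodule.ker_mkQ]

theorem baseChange_sup (K L : Submodule k M) :
    (K ⊔ L).baseChange A = K.baseChange A ⊔ L.baseChange A := by
  simp only [Submodule.baseChange_eq_span, Submodule.map_sup, ← Submodule.span_union]
  refine le_antisymm (Submodule.span_le.2 ?_) (Submodule.span_mono ?_)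
  · intro x hx
    obtain ⟨y, hy, z, hz, rfl⟩ := Submodule.mem_sup.1 hx
    exact add_mem (Submodule.subset_span (.inl hy)) (Submodule.subset_span (.inr hz))
  · exact Set.union_subset (fun x hx => Submodule.mem_sup_left hx)
      (fun x hx => Submodule.mem_sup_right hx)

theorem baseChange_inf (K L : Submodule k M) :
    (K ⊓ L).baseChange A = K.baseChange A ⊓ L.baseChange A := by
  have h : K ⊓ L = (L.comap K.subtype).map K.subtype := by
    rw [Submodule.map_comap_subtype]
  rw [h, ← map_baseChange, ← comap_baseChange, Submodule.map_comap_eq, range_baseChange,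
    Submodule.range_subtype]

theorem isCompl_baseChange {K L : Submodule k M} (h : IsCompl K L) :
    IsCompl (K.baseChange A) (L.baseChange A) := by
  constructor
  · rw [disjoint_iff, ← baseChange_inf, h.inf_eq_bot, Submodule.baseChange_bot]
  · rw [codisjoint_iff, ← baseChange_sup, h.sup_eq_top, Submodule.baseChange_top]

end BaseChange

section Pullback

variable {k : Type*} [Field k] {A B C : Type*} [CommRing A] [Algebra k A] [CommRing B]
  [Algebra k B] [CommRing C] [Algebra k C]
  {M N : Type*} [AddCommGroup M] [Module k M] [AddCommGroup N] [Module k N]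

theorem rTensor_smul (φ : A →ₐ[k] B) (a : A) (x : A ⊗[k] M) :
    φ.toLinearMap.rTensor M (a • x) = φ a • φ.toLinearMap.rTensor M x := by
  induction x with
  | zero => simp
  | tmul b m => simp [TensorProduct.smul_tmul']
  | add x y hx hy => simp only [smul_add, map_add, hx, hy]

theorem rTensor_baseChange (φ : A →ₐ[k] B) (p : M →ₗ[k] N) (x : A ⊗[k] M) :
    φ.toLinearMap.rTensor N (p.baseChange A x) = p.baseChange B (φ.toLinearMap.rTensor M x) := by
  induction x with
  | zero => simp
  | tmul b m => simp
  | add x y hx hy => simp only [map_add, hx, hy]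

theorem rTensor_comp_apply (φ : A →ₐ[k] B) (ψ : B →ₐ[k] C) (x : A ⊗[k] M) :
    (ψ.comp φ).toLinearMap.rTensor M x = ψ.toLinearMap.rTensor M (φ.toLinearMap.rTensor M x) := by
  rw [AlgHom.comp_toLinearMap, LinearMap.rTensor_comp_apply]

theorem rTensor_mem_pullback (φ : A →ₐ[k] B) {W : Submodule A (A ⊗[k] M)} {x : A ⊗[k] M}
    (hx : x ∈ W) : φ.toLinearMap.rTensor M x ∈ pullback φ W :=
  Submodule.subset_span ⟨x, hx, rfl⟩

theorem pullback_le {φ : A →ₐ[k] B} {W : Submodule A (A ⊗[k] M)} {U : Submodule B (B ⊗[k] M)} :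
    pullback φ W ≤ U ↔ ∀ x ∈ W, φ.toLinearMap.rTensor M x ∈ U := by
  rw [pullback, Submodule.span_le]
  exact ⟨fun h x hx => h ⟨x, hx, rfl⟩, fun h _ ⟨x, hx, e⟩ => e ▸ h x hx⟩

theorem pullback_span (φ : A →ₐ[k] B) (s : Set (A ⊗[k] M)) :
    pullback φ (Submodule.span A s) = Submodule.span B (φ.toLinearMap.rTensor M '' s) := by
  refine le_antisymm (pullback_le.2 fun x hx => ?_)
    (Submodule.span_mono (Set.image_mono Submodule.subset_span))
  induction hx using Submodule.span_induction with
  | mem x hx => exact Submodule.subset_span ⟨x, hx, rfl⟩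
  | zero => simp
  | add x y _ _ hx hy => rw [map_add]; exact add_mem hx hy
  | smul a x _ hx => rw [rTensor_smul]; exact Submodule.smul_mem _ _ hx

theorem pullback_mono (φ : A →ₐ[k] B) {W U : Submodule A (A ⊗[k] M)} (h : W ≤ U) :
    pullback φ W ≤ pullback φ U :=
  pullback_le.2 fun _ hx => rTensor_mem_pullback φ (h hx)

theorem pullback_id (W : Submodule A (A ⊗[k] M)) : pullback (AlgHom.id k A) W = W := by
  refine le_antisymm (pullback_le.2 fun x hx => ?_) fun x hx => ?_
  · simpa using hx
  · simpa using rTensor_mem_pullback (AlgHom.id k A) hx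

theorem pullback_comp (φ : A →ₐ[k] B) (ψ : B →ₐ[k] C) (W : Submodule A (A ⊗[k] M)) :
    pullback (ψ.comp φ) W = pullback ψ (pullback φ W) := by
  rw [pullback, pullback.eq_1 φ, pullback_span, ← Set.image_comp]
  congr 2
  ext x
  rw [rTensor_comp_apply]; rfl

theorem pullback_baseChange (φ : A →ₐ[k] B) (K : Submodule k M) :
    pullback φ (K.baseChange A) = K.baseChange B := by
  rw [Submodule.baseChange_eq_span, pullback_span, Submodule.baseChange_eq_span]
  congr 1
  ext x
  simp

theorem pullback_top (φ : A →ₐ[k] B) : pullback φ (⊤ : Submodule A (A ⊗[k] M)) = ⊤ := by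
  rw [← Submodule.baseChange_top, pullback_baseChange, Submodule.baseChange_top]

theorem pullback_bot (φ : A →ₐ[k] B) : pullback φ (⊥ : Submodule A (A ⊗[k] M)) = ⊥ := by
  rw [← Submodule.baseChange_bot, pullback_baseChange, Submodule.baseChange_bot]

theorem pullback_sup (φ : A →ₐ[k] B) (W U : Submodule A (A ⊗[k] M)) :
    pullback φ (W ⊔ U) = pullback φ W ⊔ pullback φ U := by
  refine le_antisymm (pullback_le.2 fun x hx => ?_)
    (sup_le (pullback_mono φ le_sup_left) (pullback_mono φ le_sup_right))
  obtain ⟨y, hy, z, hz, rfl⟩ := Submodule.mem_sup.1 hx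
  rw [map_add]
  exact add_mem (Submodule.mem_sup_left (rTensor_mem_pullback φ hy))
    (Submodule.mem_sup_right (rTensor_mem_pullback φ hz))

theorem pullback_map (φ : A →ₐ[k] B) (p : M →ₗ[k] N) (W : Submodule A (A ⊗[k] M)) :
    pullback φ (W.map (p.baseChange A)) = (pullback φ W).map (p.baseChange B) := by
  refine le_antisymm (pullback_le.2 ?_) ?_
  · rintro _ ⟨x, hx, rfl⟩
    rw [rTensor_baseChange]
    exact ⟨_, rTensor_mem_pullback φ hx, rfl⟩
  · rw [Submodule.map_le_iff_le_comap, pullback_le]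
    intro x hx
    rw [Submodule.mem_comap, ← rTensor_baseChange]
    exact rTensor_mem_pullback φ ⟨x, hx, rfl⟩

/-- The base change along `φ : A → B` of an `A`-linear map between extensions of scalars of
`k`-modules. -/
def mapHom (φ : A →ₐ[k] B) (t : A ⊗[k] M →ₗ[A] A ⊗[k] N) : B ⊗[k] M →ₗ[B] B ⊗[k] N :=
  LinearMap.liftBaseChange B
    (φ.toLinearMap.rTensor N ∘ₗ t.restrictScalars k ∘ₗ TensorProduct.mk k A M 1)

theorem mapHom_rTensor (φ : A →ₐ[k] B) (t : A ⊗[k] M →ₗ[A] A ⊗[k] N) (x : A ⊗[k] M) :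
    mapHom φ t (φ.toLinearMap.rTensor M x) = φ.toLinearMap.rTensor N (t x) := by
  induction x with
  | zero => simp
  | tmul a m =>
    have : a ⊗ₜ[k] m = a • ((1 : A) ⊗ₜ[k] m) := by simp [TensorProduct.smul_tmul']
    rw [this, rTensor_smul, (mapHom φ t).map_smul, t.map_smul, rTensor_smul]
    simp [mapHom]
  | add x y hx hy => simp only [map_add, hx, hy]

theorem mem_baseChange_iff_forall {U : Submodule B (B ⊗[k] M)} {K : Submodule k M} :
    K.baseChange B ≤ U ↔ ∀ m ∈ K, (1 : B) ⊗ₜ[k] m ∈ U := by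
  rw [Submodule.baseChange_eq_span, Submodule.span_le]
  exact ⟨fun h m hm => h ⟨m, hm, rfl⟩, fun h _ ⟨m, hm, e⟩ => e ▸ h m hm⟩

theorem isCompl_pullback_pullback (φ : A →ₐ[k] B) {W U : Submodule A (A ⊗[k] M)}
    (h : IsCompl W U) : IsCompl (pullback φ W) (pullback φ U) := by
  refine ⟨?_, codisjoint_iff.2 (by rw [← pullback_sup, h.sup_eq_top, pullback_top])⟩
  -- the projection to `U` along `W` extends to one along the pull-back of `W`
  let e := Submodule.projection _ _ h.symm
  have h1 : pullback φ W ≤ LinearMap.ker (mapHom φ e) := pullback_le.2 fun x hx => by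
    rw [LinearMap.mem_ker, mapHom_rTensor, (Submodule.projection_apply_eq_zero_iff h.symm).2 hx,
      map_zero]
  have h2 : pullback φ U ≤ LinearMap.ker (mapHom φ e - LinearMap.id) := pullback_le.2 fun x hx => by
    rw [LinearMap.mem_ker, LinearMap.sub_apply, mapHom_rTensor,
      Submodule.projection_apply_of_mem_left h.symm hx, LinearMap.id_apply, sub_self]
  rw [Submodule.disjoint_def]
  intro x hx hx'
  have e1 := h1 hx
  have e2 := h2 hx'
  rw [LinearMap.mem_ker] at e1 e2
  rw [LinearMap.sub_apply, e1, zero_sub, neg_eq_zero] at e2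
  exact e2

/-- Pulling back preserves complements of submodules that come from the base field. -/
theorem isCompl_pullback (φ : A →ₐ[k] B) {W : Submodule A (A ⊗[k] M)} {K : Submodule k M}
    (h : IsCompl W (K.baseChange A)) : IsCompl (pullback φ W) (K.baseChange B) := by
  rw [← pullback_baseChange φ]
  exact isCompl_pullback_pullback φ h

end Pullback

section Ranks

variable {k : Type*} [Field k] {A : Type*} [CommRing A] [Algebra k A]
  {M : Type*} [AddCommGroup M] [Module k M]

/-- The quotient of `A ⊗ M` by the submodule that comes from a subspace `K` of `M`. -/
def quotBaseChange (A : Type*) [CommRing A] [Algebra k A] (K : Submodule k M) :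
    ((A ⊗[k] M) ⧸ K.baseChange A) ≃ₗ[A] A ⊗[k] (M ⧸ K) :=
  (Submodule.quotEquivOfEq _ _ (by rw [ker_baseChange, Submodule.ker_mkQ])).trans
    ((K.mkQ.baseChange A).quotKerEquivOfSurjective (by
      rw [← LinearMap.range_eq_top, range_baseChange, Submodule.range_mkQ, Submodule.baseChange_top]))

/-- A submodule with projective quotient is a direct summand, since the quotient map splits. -/
theorem exists_isCompl_of_projective (W : Submodule A (A ⊗[k] M))
    [Module.Projective A ((A ⊗[k] M) ⧸ W)] : ∃ U, IsCompl W U := by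
  obtain ⟨s, hs⟩ := Module.projective_lifting_property W.mkQ LinearMap.id W.mkQ_surjective
  refine ⟨_, LinearMap.isCompl_of_proj (p := W)
    (f := (LinearMap.id - s ∘ₗ W.mkQ).codRestrict W fun x => ?_) fun x => ?_⟩
  · ext
    simp [(Submodule.Quotient.mk_eq_zero W).2 x.2]
  · refine (Submodule.Quotient.mk_eq_zero W).1 ?_
    have := LinearMap.congr_fun hs (W.mkQ x)
    simp only [LinearMap.comp_apply, LinearMap.id_apply] at this
    change W.mkQ _ = 0
    simp [-Submodule.mkQ_apply, this]

theorem IsSubbundle.exists_isCompl {W : Submodule A (A ⊗[k] M)} {ρ : ℕ} (h : IsSubbundle A W ρ) :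
    ∃ U, IsCompl W U :=
  have := h.1
  exists_isCompl_of_projective W

theorem finite_projective_of_isCompl [FiniteDimensional k M] {W U : Submodule A (A ⊗[k] M)} (h : IsCompl W U) :
    Module.Finite A W ∧ Module.Projective A W :=
  ⟨.of_surjective _ (Submodule.projectionOnto_surjective h),
    .of_split W.subtype (W.projectionOnto _ h) (by ext; simp)⟩

variable [FiniteDimensional k M]

/-- A constant subspace of complementary dimension that spans everything together with a sub-bundle
is a complement: the sub-bundle surjects onto the quotient by that subspace, and both have the same
rank. -/
theorem IsSubbundle.isCompl {W : Submodule A (A ⊗[k] M)} {ρ : ℕ} (h : IsSubbundle A W ρ)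
    {K : Submodule k M} (hK : Module.finrank k K + ρ = Module.finrank k M)
    (hs : W ⊔ K.baseChange A = ⊤) : IsCompl W (K.baseChange A) := by
  obtain ⟨U, hU⟩ := h.exists_isCompl
  obtain ⟨_, _⟩ := finite_projective_of_isCompl hU
  rcases subsingleton_or_nontrivial A with _ | _
  · have := Module.subsingleton A (A ⊗[k] M)
    exact ⟨by rw [disjoint_iff]; exact Subsingleton.elim _ _, codisjoint_iff.2 hs⟩
  let π : W →ₗ[A] (A ⊗[k] M) ⧸ K.baseChange A := (K.baseChange A).mkQ ∘ₗ W.subtype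
  have hπ : Function.Surjective π := by
    rw [← LinearMap.range_eq_top, LinearMap.range_comp, Submodule.range_subtype,
      Submodule.map_mkQ_eq_top, sup_comm]
    exact hs
  have : Module.Free A ((A ⊗[k] M) ⧸ K.baseChange A) := .of_equiv (quotBaseChange A K).symm
  have : Module.Finite A ((A ⊗[k] M) ⧸ K.baseChange A) := inferInstance
  have hb : Function.Bijective π := by
    refine Module.bijective_of_surjective_of_rankAtStalk_eq (M := W)
      (N := (A ⊗[k] M) ⧸ K.baseChange A) (φ := π) hπ fun m _ => ?_
    rw [h.2 ⟨m, inferInstance⟩, Module.rankAtStalk_eq_finrank_of_free, (quotBaseChange A K).finrank_eq]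
    have := Submodule.finrank_quotient_add_finrank K
    simp only [Module.finrank_baseChange, Pi.natCast_apply, Nat.cast_id]
    omega
  refine ⟨?_, codisjoint_iff.2 hs⟩
  rw [Submodule.disjoint_def]
  intro x hx hx'
  have : (⟨x, hx⟩ : W) = 0 := hb.1 (by
    rw [map_zero]; exact (Submodule.Quotient.mk_eq_zero _).2 hx')
  exact congrArg Subtype.val this

theorem isSubbundle_of_isCompl {W : Submodule A (A ⊗[k] M)} {ρ : ℕ}
    {K : Submodule k M} (hK : Module.finrank k K + ρ = Module.finrank k M)
    (h : IsCompl W (K.baseChange A)) : IsSubbundle A W ρ := by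
  rcases subsingleton_or_nontrivial A with _ | _
  · have := Module.subsingleton A (A ⊗[k] M)
    exact ⟨inferInstance, fun p => (IsEmpty.false p).elim⟩
  let e₁ := W.quotientEquivOfIsCompl _ h
  let e₂ := ((K.baseChange A).quotientEquivOfIsCompl _ h.symm).symm.trans (quotBaseChange A K)
  have eK : A ⊗[k] K ≃ₗ[A] K.baseChange A :=
    (LinearEquiv.ofInjective (K.subtype.baseChange A)
      (baseChange_injective K.injective_subtype)).trans
      (LinearEquiv.ofEq _ _ (by rw [range_baseChange, Submodule.range_subtype]))
  refine ⟨.of_equiv (eK.trans e₁.symm), fun p => ?_⟩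
  have : Module.Free A W := .of_equiv e₂.symm
  rw [Module.rankAtStalk_eq_finrank_of_free, e₂.finrank_eq]
  have := Submodule.finrank_quotient_add_finrank K
  simp only [Module.finrank_baseChange, Pi.natCast_apply, Nat.cast_id]
  omega
end Ranks

end

/-! ### Ranks of sub-bundles -/

section

section Fields

variable {k : Type u} [Field k] {A : Type u} [CommRing A] [Algebra k A] {K : Type u} [Field K]
  [Algebra k K] {M : Type*} [AddCommGroup M] [Module k M]

/-- A submodule of `K ⊗ M` that is disjoint from the subspace `S` of `M` and together with the
larger subspace `T` spans everything has a complement defined over `k` between `S` and `T`. -/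
theorem exists_isCompl_between [FiniteDimensional k M] (V : Submodule K (K ⊗[k] M))
    {S T : Submodule k M} (hST : S ≤ T) (hS : V ⊓ S.baseChange K = ⊥)
    (hT : V ⊔ T.baseChange K = ⊤) :
    ∃ U : Submodule k M, S ≤ U ∧ U ≤ T ∧ IsCompl V (U.baseChange K) := by
  obtain ⟨U, hU⟩ := exists_maximal_of_wellFoundedGT
    (fun U : Submodule k M => S ≤ U ∧ U ≤ T ∧ V ⊓ U.baseChange K = ⊥) ⟨S, le_rfl, hST, hS⟩
  obtain ⟨⟨hSU, hUT, hV⟩, hmax⟩ := hU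
  refine ⟨U, hSU, hUT, disjoint_iff.2 hV, codisjoint_iff.2 ?_⟩
  by_contra hne
  have hex : ∃ t ∈ T, (1 : K) ⊗ₜ[k] t ∉ V ⊔ U.baseChange K := by
    by_contra! h
    refine hne (top_le_iff.1 (hT ▸ sup_le le_sup_left ?_))
    exact mem_baseChange_iff_forall.2 h
  obtain ⟨t, ht, htU⟩ := hex
  have htU' : t ∉ U := fun h => htU (Submodule.mem_sup_right
    (Submodule.tmul_mem_baseChange_of_mem 1 h))
  have hle : U ⊔ Submodule.span k {t} ≤ U := by
    refine hmax ⟨hSU.trans le_sup_left, sup_le hUT ?_, ?_⟩ le_sup_left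
    · rwa [Submodule.span_singleton_le_iff_mem]
    · rw [Submodule.eq_bot_iff]
      rintro x ⟨hxV, hxU⟩
      rw [baseChange_sup, Submodule.baseChange_span, Set.image_singleton] at hxU
      obtain ⟨y, hy, z, hz, rfl⟩ := Submodule.mem_sup.1 hxU
      obtain ⟨c, rfl⟩ := Submodule.mem_span_singleton.1 hz
      by_cases hc : c = 0
      · subst hc
        rw [zero_smul, add_zero] at hxV ⊢
        exact (Submodule.mem_bot K).1 (hV ▸ ⟨hxV, hy⟩)
      · refine (htU ?_).elim
        have : c⁻¹ • ((y + c • (TensorProduct.mk k K M 1) t) - y) ∈ V ⊔ U.baseChange K :=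
          Submodule.smul_mem _ _ (sub_mem (Submodule.mem_sup_left hxV) (Submodule.mem_sup_right hy))
        rwa [add_sub_cancel_left, smul_smul, inv_mul_cancel₀ hc, one_smul] at this
  exact htU' (hle (Submodule.mem_sup_right (Submodule.mem_span_singleton_self t)))

theorem repr_rTensor {B : Type u} [CommRing B] [Algebra k B] {ι : Type*}
    (b : Module.Basis ι k M) (ψ : A →ₐ[k] B) (x : A ⊗[k] M) (i : ι) :
    (b.baseChange B).repr (ψ.toLinearMap.rTensor M x) i = ψ ((b.baseChange A).repr x i) := by
  induction x with
  | zero => simp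
  | tmul a m => simp [Module.Basis.baseChange_repr_tmul]
  | add x y hx hy => simp only [map_add, Finsupp.add_apply, hx, hy]

theorem det_rTensor {B : Type u} [CommRing B] [Algebra k B] {ι : Type*} [Fintype ι]
    [DecidableEq ι] (b : Module.Basis ι k M) (ψ : A →ₐ[k] B) (u : ι → A ⊗[k] M) :
    (b.baseChange B).det (fun i => ψ.toLinearMap.rTensor M (u i)) =
      ψ ((b.baseChange A).det u) := by
  rw [Module.Basis.det_apply, Module.Basis.det_apply, AlgHom.map_det]
  congr 1
  ext i j
  simp only [Module.Basis.toMatrix_apply, AlgHom.mapMatrix_apply, Matrix.map_apply, repr_rTensor]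

/-- The locus where a submodule of `A ⊗ M` pulls back to everything is open. -/
theorem exists_isUnit_pullback_eq_top [FiniteDimensional k M] {U : Submodule A (A ⊗[k] M)}
    {φ : A →ₐ[k] K} (h : pullback φ U = ⊤) :
    ∃ f : A, φ f ≠ 0 ∧ ∀ (B : Type u) [CommRing B] [Algebra k B] (ψ : A →ₐ[k] B),
      IsUnit (ψ f) → pullback ψ U = ⊤ := by
  classical
  have hs : ⊤ ≤ Submodule.span K (φ.toLinearMap.rTensor M '' (U : Set (A ⊗[k] M))) := h.ge
  let b := Module.finBasis k M
  let c := Module.Basis.ofSpan hs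
  have := Module.Finite.finite_basis c
  let e := c.indexEquiv (b.baseChange K)
  have hc : ∀ i, ∃ u ∈ U, φ.toLinearMap.rTensor M u = c (e.symm i) := fun i =>
    Module.Basis.ofSpan_subset hs ⟨_, rfl⟩
  choose u hu huc using hc
  refine ⟨(b.baseChange A).det u, ?_, fun B _ _ ψ hψ => ?_⟩
  · rw [← det_rTensor]
    simp only [huc]
    have := (b.baseChange K).isUnit_det (c.reindex e)
    simpa [Function.comp_def] using this.ne_zero
  · rw [← det_rTensor, ← Module.Basis.is_basis_iff_det] at hψ
    rw [← top_le_iff, ← hψ.2, Submodule.span_le]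
    rintro _ ⟨i, rfl⟩
    exact rTensor_mem_pullback ψ (hu i)

/-- The dimension of the fibre is at most the rank at the prime: the fibre, a subspace of `K ⊗ M`,
is a quotient of the base change of `W`. -/
theorem finrank_pullback_le [FiniteDimensional k M] {W : Submodule A (A ⊗[k] M)}
    [Module.Finite A W] [Module.Projective A W] (φ : A →ₐ[k] K) :
    Module.finrank K (pullback φ W) ≤
      Module.rankAtStalk (R := A) W (PrimeSpectrum.comap φ.toRingHom ⊥) := by
  let := φ.toRingHom.toAlgebra
  have : IsScalarTower k A K := .of_algebraMap_eq fun x => (φ.commutes x).symm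
  let t : W →ₗ[A] K ⊗[k] M :=
    { toFun := fun x => φ.toLinearMap.rTensor M x
      map_add' := fun x y => by simp
      map_smul' := fun a x => by
        rw [Submodule.coe_smul, rTensor_smul]
        exact algebraMap_smul K a _ }
  have hr : LinearMap.range (t.liftBaseChange K) = pullback φ W := by
    rw [LinearMap.range_liftBaseChange, pullback]
    congr 1
    ext x
    simp [t]
  have h1 := LinearMap.finrank_range_le (t.liftBaseChange K)
  rw [hr] at h1
  have h2 := Module.rankAtStalk_baseChange (R := A) (M := W) (S := K) ⊥
  rw [Module.rankAtStalk_eq_finrank_of_free] at h2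
  exact h1.trans h2.le

/-- The rank of a direct summand at a prime is the dimension of its fibre. -/
theorem finrank_pullback_of_isCompl [FiniteDimensional k M] {W U : Submodule A (A ⊗[k] M)}
    (hU : IsCompl W U) (φ : A →ₐ[k] K) : Module.finrank K (pullback φ W) =
      Module.rankAtStalk (R := A) W (PrimeSpectrum.comap φ.toRingHom ⊥) := by
  have : Nontrivial A := φ.toRingHom.domain_nontrivial
  obtain ⟨_, _⟩ := finite_projective_of_isCompl hU
  obtain ⟨_, _⟩ := finite_projective_of_isCompl hU.symm
  have hsum := congrFun (Module.rankAtStalk_eq_of_equiv (R := A)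
    (Submodule.prodEquivOfIsCompl _ _ hU)) (PrimeSpectrum.comap φ.toRingHom ⊥)
  rw [Module.rankAtStalk_prod, Pi.add_apply,
    Module.rankAtStalk_eq_finrank_of_free (M := A ⊗[k] M)] at hsum
  replace hsum := hsum.trans Module.finrank_baseChange
  have h1 := finrank_pullback_le (W := W) φ
  have h2 := finrank_pullback_le (W := U) φ
  have h4 := Submodule.finrank_add_le_finrank_add_finrank (pullback φ W) (pullback φ U)
  rw [← pullback_sup, hU.sup_eq_top, pullback_top, finrank_top, Module.finrank_baseChange] at h4
  omega

theorem IsSubbundle.finrank_pullback [FiniteDimensional k M] {W : Submodule A (A ⊗[k] M)} {ρ : ℕ}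
    (h : IsSubbundle A W ρ) (φ : A →ₐ[k] K) : Module.finrank K (pullback φ W) = ρ := by
  obtain ⟨U, hU⟩ := h.exists_isCompl
  rw [finrank_pullback_of_isCompl hU, h.2]

/-- The pull-back of a sub-bundle is a sub-bundle of the same rank. -/
theorem IsSubbundle.pullback [FiniteDimensional k M] {B : Type u} [CommRing B] [Algebra k B]
    {W : Submodule A (A ⊗[k] M)} {ρ : ℕ} (h : IsSubbundle A W ρ) (φ : A →ₐ[k] B) :
    IsSubbundle B (pullback φ W) ρ := by
  obtain ⟨U, hU⟩ := h.exists_isCompl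
  have hc := isCompl_pullback_pullback φ hU
  have := (finite_projective_of_isCompl hc.symm).2
  refine ⟨.of_equiv (Submodule.quotientEquivOfIsCompl _ _ hc).symm, fun q => ?_⟩
  have h1 := finrank_pullback_of_isCompl hc (IsScalarTower.toAlgHom k B q.asIdeal.ResidueField)
  rw [← pullback_comp, h.finrank_pullback] at h1
  rw [h1]
  congr 1
  apply PrimeSpectrum.ext
  exact (Ideal.ker_algebraMap_residueField q.asIdeal).symm

theorem IsSubbundle.of_finrank [FiniteDimensional k M] {W : Submodule K (K ⊗[k] M)} {ρ : ℕ}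
    (h : Module.finrank K W = ρ) : IsSubbundle K W ρ :=
  have : Module.Free K W := Module.Free.of_divisionRing K W
  ⟨inferInstance, fun p => by
    rw [Module.rankAtStalk_eq_finrank_of_free (R := K) (M := W), ← h]; rfl⟩

theorem IsSubbundle.finrank_eq [FiniteDimensional k M] {W : Submodule K (K ⊗[k] M)} {ρ : ℕ}
    (h : IsSubbundle K W ρ) : Module.finrank K W = ρ := by
  have := h.finrank_pullback (AlgHom.id k K)
  rwa [pullback_id] at this

theorem finrank_submodule_baseChange (S : Submodule k M) :
    Module.finrank K (S.baseChange K) = Module.finrank k S := by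
  have e : K ⊗[k] S ≃ₗ[K] S.baseChange K :=
    (LinearEquiv.ofInjective (S.subtype.baseChange K)
      (baseChange_injective S.injective_subtype)).trans
      (LinearEquiv.ofEq _ _ (by rw [range_baseChange, Submodule.range_subtype]))
  rw [← e.finrank_eq, Module.finrank_baseChange]

theorem finrank_add_of_isCompl [FiniteDimensional k M] {V : Submodule K (K ⊗[k] M)}
    {S : Submodule k M} (h : IsCompl V (S.baseChange K)) :
    Module.finrank k S + Module.finrank K V = Module.finrank k M := by
  have := Submodule.finrank_add_eq_of_isCompl h
  rwa [finrank_submodule_baseChange, Module.finrank_baseChange, add_comm] at this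

end Fields

end

/-! ### Local properties and glueing of submodules -/

section

section Local

variable {k : Type u} [Field k] {A : Type u} [CommRing A] [Algebra k A]
  {M : Type*} [AddCommGroup M] [Module k M]

variable (k M) in
/-- The localization map of `A ⊗ M` away from `f`, as an `A`-linear map. -/
abbrev awayMap (f : A) : A ⊗[k] M →ₗ[A] Localization.Away f ⊗[k] M :=
  TensorProduct.AlgebraTensorModule.rTensor k M (Algebra.linearMap A (Localization.Away f))

instance (f : A) : IsLocalizedModule (Submonoid.powers f) (awayMap k M f) := inferInstance

theorem awayMap_apply (f : A) (x : A ⊗[k] M) :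
    awayMap k M f x = (awayHom k f).toLinearMap.rTensor M x := by
  induction x with
  | zero => simp
  | tmul a m => rfl
  | add x y hx hy => simp only [map_add, hx, hy]

theorem pullback_awayHom (f : A) (W : Submodule A (A ⊗[k] M)) :
    pullback (awayHom k f) W =
      W.localized' (Localization.Away f) (Submonoid.powers f) (awayMap k M f) := by
  rw [Submodule.localized'_eq_span, pullback]
  congr 2

theorem exists_smul_eq_awayMap (f : A) (y : Localization.Away f ⊗[k] M) :
    ∃ (N : ℕ) (x : A ⊗[k] M), f ^ N • y = (awayHom k f).toLinearMap.rTensor M x := by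
  obtain ⟨⟨x, s, N, rfl⟩, h⟩ := IsLocalizedModule.surj (Submonoid.powers f) (awayMap k M f) y
  exact ⟨N, x, (awayMap_apply f x) ▸ h⟩

theorem mem_pullback_awayHom_iff {f : A} {W : Submodule A (A ⊗[k] M)} {x : A ⊗[k] M} :
    (awayHom k f).toLinearMap.rTensor M x ∈ pullback (awayHom k f) W ↔ ∃ N : ℕ, f ^ N • x ∈ W := by
  rw [← awayMap_apply, pullback_awayHom, Submodule.mem_localized']
  constructor
  · rintro ⟨m, hm, ⟨_, N, rfl⟩, h⟩
    rw [IsLocalizedModule.mk'_eq_iff, Submonoid.smul_def, ← map_smul] at h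
    obtain ⟨⟨_, N', rfl⟩, h⟩ := (IsLocalizedModule.eq_iff_exists (Submonoid.powers f) _).1 h
    refine ⟨N' + N, ?_⟩
    rw [pow_add, mul_smul]
    simp only [Submonoid.smul_def] at h
    exact h ▸ W.smul_mem _ hm
  · rintro ⟨N, h⟩
    refine ⟨_, h, ⟨_, N, rfl⟩, ?_⟩
    rw [IsLocalizedModule.mk'_eq_iff, Submonoid.smul_def, map_smul]

theorem eq_top_of_local {I : Ideal A} (h : ∀ p : PrimeSpectrum A, ∃ f ∉ p.asIdeal, ∃ N : ℕ, f ^ N ∈ I) :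
    I = ⊤ := by
  by_contra hI
  obtain ⟨m, hm, hle⟩ := I.exists_le_maximal hI
  obtain ⟨f, hf, N, hN⟩ := h ⟨m, hm.isPrime⟩
  exact hf (hm.isPrime.mem_of_pow_mem N (hle hN))

/-- Membership in a submodule of `A ⊗ M` is a local condition. -/
theorem mem_of_local {W : Submodule A (A ⊗[k] M)} {x : A ⊗[k] M}
    (h : ∀ p : PrimeSpectrum A, ∃ f ∉ p.asIdeal,
      (awayHom k f).toLinearMap.rTensor M x ∈ pullback (awayHom k f) W) : x ∈ W := by
  have : W.comap (LinearMap.toSpanSingleton A _ x) = ⊤ := eq_top_of_local fun p => by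
    obtain ⟨f, hf, hx⟩ := h p
    obtain ⟨N, hN⟩ := mem_pullback_awayHom_iff.1 hx
    exact ⟨f, hf, N, hN⟩
  have h1 : (1 : A) ∈ W.comap (LinearMap.toSpanSingleton A _ x) := by rw [this]; trivial
  simpa using h1

theorem le_of_local {W U : Submodule A (A ⊗[k] M)}
    (h : ∀ p : PrimeSpectrum A, ∃ f ∉ p.asIdeal,
      pullback (awayHom k f) W ≤ pullback (awayHom k f) U) : W ≤ U := fun _ hx =>
  mem_of_local fun p => by
    obtain ⟨f, hf, hle⟩ := h p
    exact ⟨f, hf, hle (rTensor_mem_pullback _ hx)⟩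

theorem eq_of_local {W U : Submodule A (A ⊗[k] M)}
    (h : ∀ p : PrimeSpectrum A, ∃ f ∉ p.asIdeal,
      pullback (awayHom k f) W = pullback (awayHom k f) U) : W = U :=
  le_antisymm (le_of_local fun p => (h p).imp fun _ h => ⟨h.1, h.2.le⟩)
    (le_of_local fun p => (h p).imp fun _ h => ⟨h.1, h.2.ge⟩)

theorem exists_comp_awayHom {B : Type u} [CommRing B] [Algebra k B] {f : A} (φ : A →ₐ[k] B)
    (h : IsUnit (φ f)) : ∃ χ : Localization.Away f →ₐ[k] B, χ.comp (awayHom k f) = φ :=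
  ⟨{ IsLocalization.Away.lift (S := Localization.Away f) (g := φ.toRingHom) f h with
      commutes' := fun r => by
        have := IsLocalization.Away.lift_eq (S := Localization.Away f) (g := φ.toRingHom) f h
          (algebraMap k A r)
        rw [← IsScalarTower.algebraMap_apply] at this
        exact this.trans (φ.commutes r) },
    AlgHom.ext fun a => IsLocalization.Away.lift_eq (g := φ.toRingHom) f h a⟩

/-- Being a sub-bundle of given rank is a local condition. -/
theorem isSubbundle_of_local [FiniteDimensional k M] {W : Submodule A (A ⊗[k] M)} {ρ : ℕ}
    (h : ∀ p : PrimeSpectrum A, ∃ f ∉ p.asIdeal,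
      IsSubbundle (Localization.Away f) (pullback (awayHom k f) W) ρ) : IsSubbundle A W ρ := by
  choose f hf h using h
  have hspan := span_range_eq_top_of_forall_notMem f hf
  have h' : ∀ g : Set.range f, IsSubbundle (Localization.Away g.1)
      (W.localized' (Localization.Away g.1) (Submonoid.powers g.1) (awayMap k M g.1)) ρ := by
    rintro ⟨_, p, rfl⟩
    rw [← pullback_awayHom]
    exact h p
  let Q : Set.range f → Type _ := fun g => (Localization.Away g.1 ⊗[k] M) ⧸
      W.localized' (Localization.Away g.1) (Submonoid.powers g.1) (awayMap k M g.1)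
  let t : ∀ g : Set.range f, (A ⊗[k] M) ⧸ W →ₗ[A] Q g := fun g => W.toLocalizedQuotient' (Localization.Away g.1) (Submonoid.powers g.1) (awayMap k M g.1)
  -- finite presentation and flatness of the quotient can be checked locally
  have hfp : Module.FinitePresentation A ((A ⊗[k] M) ⧸ W) :=
    Module.FinitePresentation.of_localizationSpan' (Set.range f) hspan
      (Mₚ := Q)
      (Rₚ := fun g => Localization.Away g.1) t fun g => by
        have := (h' g).1
        exact Module.finitePresentation_of_projective _ _
  have hfl : Module.Flat A ((A ⊗[k] M) ⧸ W) :=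
    Module.flat_of_isLocalized_span A _ (Set.range f) hspan Q t fun g => by
      have := (h' g).1
      exact Module.Flat.trans A (Localization.Away g.1) _
  have hp : Module.Projective A ((A ⊗[k] M) ⧸ W) := Module.Flat.projective_of_finitePresentation
  refine ⟨hp, fun p => ?_⟩
  obtain ⟨U, hU⟩ := exists_isCompl_of_projective W
  have h1 := finrank_pullback_of_isCompl hU (IsScalarTower.toAlgHom k A p.asIdeal.ResidueField)
  obtain ⟨χ, hχ⟩ := exists_comp_awayHom (f := f p)
    (IsScalarTower.toAlgHom k A p.asIdeal.ResidueField) (by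
      rw [isUnit_iff_ne_zero]
      exact fun h0 => hf p ((Ideal.algebraMap_residueField_eq_zero).1 h0))
  rw [← hχ, pullback_comp, (h p).finrank_pullback, hχ] at h1
  rw [h1]
  congr 1
  apply PrimeSpectrum.ext
  exact (Ideal.ker_algebraMap_residueField p.asIdeal).symm

/-- Submodules given locally on `Spec A` glue. -/
theorem exists_glue_submodule (f : PrimeSpectrum A → A) (hf : ∀ p, f p ∉ p.asIdeal)
    (W : ∀ p, Submodule (Localization.Away (f p)) (Localization.Away (f p) ⊗[k] M))
    (h : ∀ (p q) (C : Type u) [CommRing C] [Algebra k C] (φ : Localization.Away (f p) →ₐ[k] C)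
      (ψ : Localization.Away (f q) →ₐ[k] C), φ.comp (awayHom k (f p)) = ψ.comp (awayHom k (f q)) →
      pullback φ (W p) = pullback ψ (W q)) :
    ∃ U : Submodule A (A ⊗[k] M), ∀ p, pullback (awayHom k (f p)) U = W p := by
  let U : Submodule A (A ⊗[k] M) := ⨅ p, ((W p).restrictScalars A).comap (awayMap k M (f p))
  have hU : ∀ x, x ∈ U ↔ ∀ p, (awayHom k (f p)).toLinearMap.rTensor M x ∈ W p := fun x => by
    simp only [U, Submodule.mem_iInf, Submodule.mem_comap, Submodule.restrictScalars_mem,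
      awayMap_apply]
  -- if the image of `x` lies in `W p`, then so it does in `W q` after inverting `f p`
  have key : ∀ p q x, (awayHom k (f p)).toLinearMap.rTensor M x ∈ W p →
      (awayHom k (algebraMap A (Localization.Away (f q)) (f p))).toLinearMap.rTensor M
        ((awayHom k (f q)).toLinearMap.rTensor M x) ∈ 
        pullback (awayHom k (algebraMap A (Localization.Away (f q)) (f p))) (W q) := by
    intro p q x hx
    obtain ⟨φ, hφ⟩ := exists_comp_awayHom (f := f p)
      ((awayHom k (algebraMap A (Localization.Away (f q)) (f p))).comp (awayHom k (f q)))
      (IsLocalization.Away.algebraMap_isUnit (S := Localization.Away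
        (algebraMap A (Localization.Away (f q)) (f p)))
        (algebraMap A (Localization.Away (f q)) (f p)))
    rw [← h p q _ φ _ hφ, ← rTensor_comp_apply, ← hφ, rTensor_comp_apply]
    exact rTensor_mem_pullback φ hx
  refine ⟨U, fun p => le_antisymm (pullback_le.2 fun x hx => (hU x).1 hx p) fun y hy => ?_⟩
  obtain ⟨N, x, hx⟩ := exists_smul_eq_awayMap (f p) y
  have hxp : (awayHom k (f p)).toLinearMap.rTensor M x ∈ W p := hx ▸ by
    rw [← algebraMap_smul (Localization.Away (f p)) (f p ^ N) y]
    exact (W p).smul_mem _ hy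
  obtain ⟨t, ht, ht'⟩ := (Ideal.span_eq_top_iff_finite _).1
    (span_range_eq_top_of_forall_notMem f hf)
  choose s hs using fun g : t => ht g.2
  have hN : ∀ q, ∃ N : ℕ, (awayHom k (f q)).toLinearMap.rTensor M (f p ^ N • x) ∈ W q := fun q => by
    obtain ⟨N, hN⟩ := mem_pullback_awayHom_iff.1 (key p q x hxp)
    refine ⟨N, ?_⟩
    rw [rTensor_smul, map_pow]
    exact hN
  choose m hm using hN
  let m₀ := ∑ g : t, m (s g)
  have hx₀ : f p ^ m₀ • x ∈ U := by
    rw [hU]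
    refine fun q => mem_of_local fun P => ?_
    obtain ⟨g, hg⟩ : ∃ g : t, algebraMap A (Localization.Away (f q)) (f (s g)) ∉ P.asIdeal := by
      by_contra! hall
      have : Ideal.span (t : Set A) ≤ P.asIdeal.comap (algebraMap A _) := Ideal.span_le.2
        fun g hg => by have := hall ⟨g, hg⟩; rw [hs] at this; exact this
      rw [ht', top_le_iff] at this
      exact (P.2.comap (algebraMap A (Localization.Away (f q)))).ne_top this
    refine ⟨_, hg, key _ _ _ ?_⟩
    have hle : m (s g) ≤ m₀ := Finset.single_le_sum (f := fun g : t => m (s g))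
      (fun _ _ => Nat.zero_le _) (Finset.mem_univ g)
    rw [← Nat.sub_add_cancel hle, pow_add, mul_smul, rTensor_smul]
    exact Submodule.smul_mem _ _ (hm _)
  have h1 := rTensor_mem_pullback (awayHom k (f p)) hx₀
  rw [rTensor_smul, ← hx, ← algebraMap_smul (Localization.Away (f p)) (f p ^ N) y, smul_smul] at h1
  have hu : IsUnit ((awayHom k (f p)) (f p ^ m₀) * algebraMap A (Localization.Away (f p)) (f p ^ N)) := by
    have : IsUnit (algebraMap A (Localization.Away (f p)) (f p)) :=
      IsLocalization.Away.algebraMap_isUnit _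
    rw [map_pow, map_pow]
    exact (this.pow _).mul (this.pow _)
  obtain ⟨c, hc⟩ := hu
  rw [← hc] at h1
  exact (Submodule.smul_mem_iff_of_isUnit _ c.isUnit).1 h1

end Local

end

/-! ### Criteria for sub-bundles and numbers of generators -/

section

theorem finrank_map_add_finrank_ker {F X Y : Type*} [Field F] [AddCommGroup X] [Module F X]
    [AddCommGroup Y] [Module F Y] [FiniteDimensional F X] (p : X →ₗ[F] Y) (V : Submodule F X) :
    Module.finrank F (V.map p) + Module.finrank F (LinearMap.ker p) =
      Module.finrank F (V ⊔ LinearMap.ker p : Submodule F X) := by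
  have h0 : (LinearMap.ker p).map p = ⊥ := (Submodule.map_le_iff_le_comap.2 le_rfl).antisymm bot_le
  have h1 := LinearMap.finrank_range_add_finrank_ker (p ∘ₗ (V ⊔ LinearMap.ker p).subtype)
  rw [LinearMap.range_comp, Submodule.range_subtype, Submodule.map_sup,
    h0, sup_bot_eq, LinearMap.ker_comp,
    LinearEquiv.finrank_eq (Submodule.comapSubtypeEquivOfLe (le_sup_right))] at h1
  exact h1

section Subbundles

variable {k : Type u} [Field k] {A : Type u} [CommRing A] [Algebra k A] {K : Type u} [Field K]
  [Algebra k K] {M N : Type*} [AddCommGroup M] [Module k M] [FiniteDimensional k M]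
  [AddCommGroup N] [Module k N] [FiniteDimensional k N]

/-- Over a field extension every subspace has a complement that is defined over `k`. Hence the
charts, whose shape is given by subspaces over `k`, reach all field-valued points. -/
theorem exists_isCompl_pullback (V : Submodule K (K ⊗[k] M)) :
    ∃ S : Submodule k M, IsCompl V (S.baseChange K) := by
  obtain ⟨S, -, -, h⟩ := exists_isCompl_between V (bot_le (a := (⊤ : Submodule k M)))
    (by rw [Submodule.baseChange_bot, inf_bot_eq]) (by rw [Submodule.baseChange_top, sup_top_eq])
  exact ⟨S, h⟩

/-- To span everything together with a constant subspace is an open condition. -/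
theorem exists_isUnit_sup_eq_top {W : Submodule A (A ⊗[k] M)} {S : Submodule k M} {φ : A →ₐ[k] K}
    (h : pullback φ W ⊔ S.baseChange K = ⊤) :
    ∃ f : A, φ f ≠ 0 ∧ ∀ (B : Type u) [CommRing B] [Algebra k B] (ψ : A →ₐ[k] B),
      IsUnit (ψ f) → pullback ψ W ⊔ S.baseChange B = ⊤ := by
  rw [← pullback_baseChange φ, ← pullback_sup] at h
  obtain ⟨f, hf, H⟩ := exists_isUnit_pullback_eq_top h
  refine ⟨f, hf, fun B _ _ ψ hψ => ?_⟩
  rw [← pullback_baseChange ψ, ← pullback_sup, H B ψ hψ]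

/-- A submodule of `A ⊗ M` is a sub-bundle of rank `ρ` if and only if its quotient is projective
and its fibres have dimension `ρ`. -/
theorem isSubbundle_iff_finrank {W : Submodule A (A ⊗[k] M)} {ρ : ℕ} :
    IsSubbundle A W ρ ↔ Module.Projective A ((A ⊗[k] M) ⧸ W) ∧ ∀ p : PrimeSpectrum A,
      Module.finrank p.asIdeal.ResidueField (pullback (residueHom k p) W) = ρ := by
  refine ⟨fun h => ⟨h.1, fun p => h.finrank_pullback _⟩, fun ⟨h, h'⟩ => ⟨h, fun p => ?_⟩⟩
  obtain ⟨U, hU⟩ := exists_isCompl_of_projective W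
  rw [← h' p, finrank_pullback_of_isCompl hU]
  congr 1
  apply PrimeSpectrum.ext
  exact (Ideal.ker_algebraMap_residueField p.asIdeal).symm

/-- The image of a submodule of `A ⊗ M` under a `k`-linear map is a sub-bundle if and only if its
sum with the kernel is one. -/
theorem isSubbundle_map_iff (p : M →ₗ[k] N) (W : Submodule A (A ⊗[k] M)) (ρ : ℕ) :
    IsSubbundle A (W.map (p.baseChange A)) ρ ↔
      IsSubbundle A (W ⊔ (LinearMap.ker p).baseChange A) (ρ + Module.finrank k (LinearMap.ker p)) := by
  rw [isSubbundle_iff_finrank, isSubbundle_iff_finrank]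
  refine and_congr ?_ (forall_congr' fun P => ?_)
  · -- `q` is a generalized inverse of `p`; projectivity is compared via the maps induced by `p` and `q`
    obtain ⟨s, hs⟩ := p.rangeRestrict.exists_rightInverse_of_surjective p.range_rangeRestrict
    obtain ⟨π, hπ⟩ := (LinearMap.range p).subtype.exists_leftInverse_of_injective
      (Submodule.ker_subtype _)
    have hq : p ∘ₗ (s ∘ₗ π) ∘ₗ p = p := by
      ext x
      have h1 : π (p x) = p.rangeRestrict x := LinearMap.congr_fun hπ (p.rangeRestrict x)
      have h2 := LinearMap.congr_fun hs (p.rangeRestrict x)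
      simp only [LinearMap.comp_apply, LinearMap.id_apply] at h2 ⊢
      rw [h1]
      exact congrArg Subtype.val h2
    generalize s ∘ₗ π = q at hq
    have hqA : ∀ x, p.baseChange A (q.baseChange A (p.baseChange A x)) = p.baseChange A x := by
      intro x
      rw [← LinearMap.comp_apply, ← LinearMap.comp_apply, ← LinearMap.baseChange_comp,
        ← LinearMap.baseChange_comp, LinearMap.comp_assoc, hq]
    have hker : ∀ x, q.baseChange A (p.baseChange A x) - x ∈ (LinearMap.ker p).baseChange A := by
      intro x
      rw [← ker_baseChange, LinearMap.mem_ker, map_sub, hqA, sub_self]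
    let W' := W.map (p.baseChange A)
    let W'' := W ⊔ (LinearMap.ker p).baseChange A
    let p' : (A ⊗[k] M) ⧸ W'' →ₗ[A] (A ⊗[k] N) ⧸ W' := Submodule.mapQ _ _ (p.baseChange A) (by
      refine sup_le (Submodule.le_comap_map _ _) ?_
      rw [← ker_baseChange]
      exact fun x hx => by
        rw [Submodule.mem_comap, LinearMap.mem_ker.1 hx]; exact zero_mem _)
    let q' : (A ⊗[k] N) ⧸ W' →ₗ[A] (A ⊗[k] M) ⧸ W'' := Submodule.mapQ _ _ (q.baseChange A) (by
      rw [Submodule.map_le_iff_le_comap]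
      intro x hx
      have := add_mem (Submodule.mem_sup_right (S := W) (hker x)) (Submodule.mem_sup_left hx)
      rwa [sub_add_cancel] at this)
    constructor
    · intro h
      refine .of_split (M := (A ⊗[k] N) ⧸ W') p' q' ?_
      refine Submodule.linearMap_qext _ (LinearMap.ext fun x => ?_)
      exact (Submodule.Quotient.eq _).2 (Submodule.mem_sup_right (hker x))
    · intro h
      let e : (A ⊗[k] N) ⧸ W' →ₗ[A] A ⊗[k] N :=
        W'.liftQ (LinearMap.id - p.baseChange A ∘ₗ q.baseChange A) (by
          rw [Submodule.map_le_iff_le_comap]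
          intro x hx
          simp [hqA])
      refine .of_split (M := ((A ⊗[k] M) ⧸ W'') × (A ⊗[k] N)) (q'.prod e)
        (p'.coprod W'.mkQ) ?_
      refine Submodule.linearMap_qext _ (LinearMap.ext fun x => ?_)
      change W'.mkQ (p.baseChange A (q.baseChange A x)) +
        W'.mkQ (x - p.baseChange A (q.baseChange A x)) = W'.mkQ x
      rw [← map_add, add_sub_cancel]
  · rw [pullback_map, pullback_sup, pullback_baseChange]
    set V := pullback (residueHom k P) W
    have h1 := finrank_map_add_finrank_ker (p.baseChange P.asIdeal.ResidueField) V
    rw [ker_baseChange, finrank_submodule_baseChange] at h1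
    omega

end Subbundles

section Loci
variable {k : Type u} [Field k] {A : Type u} [CommRing A] [Algebra k A] 
  {M N : Type*} [AddCommGroup M] [Module k M] [FiniteDimensional k M]

/-- The locus where a submodule of `A ⊗ M` pulls back to zero is closed. -/
theorem exists_ideal_pullback_eq_bot (T : Submodule A (A ⊗[k] M)) :
    ∃ I : Ideal A, ∀ (B : Type u) [CommRing B] [Algebra k B] (φ : A →ₐ[k] B),
      pullback φ T = ⊥ ↔ I ≤ RingHom.ker φ := by
  let b := Module.finBasis k M
  refine ⟨Ideal.span {a | ∃ x ∈ T, ∃ i, (b.baseChange A).repr x i = a}, fun B _ _ φ => ?_⟩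
  rw [Ideal.span_le, eq_bot_iff, pullback_le]
  constructor
  · rintro h _ ⟨x, hx, i, rfl⟩
    have h1 := (Submodule.mem_bot B).1 (h x hx)
    change φ _ = 0
    rw [← repr_rTensor, h1, map_zero, Finsupp.zero_apply]
  · intro h x hx
    refine (Submodule.mem_bot B).2 ((b.baseChange B).repr.injective (Finsupp.ext fun i => ?_))
    rw [repr_rTensor, map_zero, Finsupp.zero_apply]
    exact h ⟨x, hx, i, rfl⟩

/-- A submodule that spans everything together with a constant subspace contains a complement of
that subspace, since the quotient by the latter is free. -/
theorem exists_isCompl_le {U : Submodule A (A ⊗[k] M)} {S : Submodule k M}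
    (h : U ⊔ S.baseChange A = ⊤) : ∃ U₀ ≤ U, IsCompl U₀ (S.baseChange A) := by
  have : Module.Projective A ((A ⊗[k] M) ⧸ S.baseChange A) :=
    .of_equiv (quotBaseChange A S).symm
  let π : U →ₗ[A] (A ⊗[k] M) ⧸ S.baseChange A := (S.baseChange A).mkQ ∘ₗ U.subtype
  obtain ⟨s, hs⟩ := Module.projective_lifting_property π LinearMap.id (by
    rw [← LinearMap.range_eq_top, LinearMap.range_comp, Submodule.range_subtype,
      Submodule.map_mkQ_eq_top, sup_comm]
    exact h)
  have hs' : ∀ y, (S.baseChange A).mkQ (s y : A ⊗[k] M) = y := fun y => LinearMap.congr_fun hs y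
  refine ⟨LinearMap.range (U.subtype ∘ₗ s), ?_, ?_⟩
  · rintro _ ⟨y, rfl⟩
    exact (s y).2
  · constructor
    · rw [Submodule.disjoint_def]
      rintro _ ⟨y, rfl⟩ hy
      have : y = 0 := by
        rw [← hs' y]; exact (Submodule.Quotient.mk_eq_zero _).2 hy
      simp [this]
    · rw [codisjoint_iff, eq_top_iff]
      intro x _
      refine Submodule.mem_sup.2 ⟨s ((S.baseChange A).mkQ x), ⟨_, rfl⟩,
        x - s ((S.baseChange A).mkQ x), ?_, by simp⟩
      refine (Submodule.Quotient.mk_eq_zero _).1 ?_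
      change (S.baseChange A).mkQ _ = 0
      rw [map_sub, hs', sub_self]

/-- If a submodule and `A ⊗ S` span everything, the locus where the submodule pulls back to a
sub-bundle of rank `dim M - dim S` is closed. -/
theorem exists_ideal_isSubbundle {U : Submodule A (A ⊗[k] M)} {S : Submodule k M} {ρ : ℕ}
    (h : U ⊔ S.baseChange A = ⊤) (hρ : Module.finrank k S + ρ = Module.finrank k M) :
    ∃ I : Ideal A, ∀ (B : Type u) [CommRing B] [Algebra k B] (φ : A →ₐ[k] B),
      IsSubbundle B (pullback φ U) ρ ↔ I ≤ RingHom.ker φ := by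
  obtain ⟨U₀, hle, hU₀⟩ := exists_isCompl_le h
  obtain ⟨I, hI⟩ := exists_ideal_pullback_eq_bot (U ⊓ S.baseChange A)
  have hU : U = U₀ ⊔ U ⊓ S.baseChange A := by
    rw [inf_comm, ← sup_inf_assoc_of_le _ hle, hU₀.sup_eq_top, top_inf_eq]
  refine ⟨I, fun B _ _ φ => ?_⟩
  rw [← hI]
  constructor
  · intro hs
    have hc := hs.isCompl hρ (by rw [← pullback_baseChange φ, ← pullback_sup, h, pullback_top])
    rw [eq_bot_iff, ← hc.inf_eq_bot]
    refine le_inf (pullback_mono φ inf_le_left) ?_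
    rw [← pullback_baseChange φ]
    exact pullback_mono φ inf_le_right
  · intro hb
    refine isSubbundle_of_isCompl hρ ?_
    rw [hU, pullback_sup, hb, sup_bot_eq]
    exact isCompl_pullback φ hU₀

/-- The locus where a submodule is contained in a complemented one is closed. -/
theorem exists_ideal_pullback_le {U : Submodule A (A ⊗[k] M)} {S : Submodule k M}
    (h : IsCompl U (S.baseChange A)) (W : Submodule A (A ⊗[k] M)) :
    ∃ I : Ideal A, ∀ (B : Type u) [CommRing B] [Algebra k B] (φ : A →ₐ[k] B),
      pullback φ W ≤ pullback φ U ↔ I ≤ RingHom.ker φ := by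
  obtain ⟨I, hI⟩ := exists_ideal_pullback_eq_bot ((U ⊔ W) ⊓ S.baseChange A)
  have hU : U ⊔ W = U ⊔ (U ⊔ W) ⊓ S.baseChange A := by
    rw [inf_comm, ← sup_inf_assoc_of_le _ le_sup_left, h.sup_eq_top, top_inf_eq]
  refine ⟨I, fun B _ _ φ => ?_⟩
  have hc := isCompl_pullback φ h
  rw [← hI, ← sup_eq_left, ← pullback_sup, hU, pullback_sup, sup_eq_left, ← hU]
  constructor
  · intro hle
    rw [eq_bot_iff, ← hc.inf_eq_bot]
    refine le_inf hle ?_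
    rw [← pullback_baseChange φ]
    exact pullback_mono φ inf_le_right
  · intro hb
    rw [hb]
    exact bot_le

end Loci

section Generators

variable {A : Type*} [CommRing A] {N N' : Type*} [AddCommGroup N] [Module A N]
  [AddCommGroup N'] [Module A N']

/-- The submodule `W` is contained in one generated by `m` elements. In contrast to being generated
by `m` elements, this passes to submodules. -/
def SubGen (W : Submodule A N) (m : ℕ) : Prop :=
  ∃ v : Fin m → N, W ≤ Submodule.span A (Set.range v)

theorem SubGen.mono {W U : Submodule A N} {m : ℕ} (h : SubGen U m) (hle : W ≤ U) : SubGen W m :=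
  h.imp fun _ h => hle.trans h

theorem SubGen.map {W : Submodule A N} {m : ℕ} (h : SubGen W m) (p : N →ₗ[A] N') :
    SubGen (W.map p) m := by
  obtain ⟨v, hv⟩ := h
  refine ⟨p ∘ v, ?_⟩
  rw [Set.range_comp, Submodule.span_image]
  exact Submodule.map_mono hv

theorem SubGen.sup {W U : Submodule A N} {m l : ℕ} (h : SubGen W m) (h' : SubGen U l) :
    SubGen (W ⊔ U) (m + l) := by
  obtain ⟨v, hv⟩ := h
  obtain ⟨v', hv'⟩ := h'
  refine ⟨Fin.append v v', sup_le (hv.trans (Submodule.span_mono ?_))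
    (hv'.trans (Submodule.span_mono ?_))⟩
  · rintro _ ⟨i, rfl⟩; exact ⟨Fin.castAdd l i, by simp⟩
  · rintro _ ⟨i, rfl⟩; exact ⟨Fin.natAdd m i, by simp⟩

variable {k : Type*} [Field k] [Algebra k A] {M : Type*} [AddCommGroup M] [Module k M]
  [FiniteDimensional k M]

theorem subGen_baseChange (S : Submodule k M) : SubGen (S.baseChange A) (Module.finrank k S) := by
  let b := Module.finBasis k S
  refine ⟨fun i => 1 ⊗ₜ (b i : M), ?_⟩
  have : S = Submodule.span k (Set.range fun i => (b i : M)) := by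
    have := congrArg (Submodule.map S.subtype) b.span_eq
    rw [Submodule.map_span, ← Set.range_comp, Submodule.map_top, Submodule.range_subtype] at this
    exact this.symm
  conv_lhs => rw [this, Submodule.baseChange_span, ← Set.range_comp]
  exact le_rfl

/-- A submodule generated by `dim M - dim S` elements which together with `A ⊗ S` spans `A ⊗ M` is
a complement of `A ⊗ S`. -/
theorem SubGen.isCompl {W : Submodule A (A ⊗[k] M)} {m : ℕ} (h : SubGen W m) {S : Submodule k M}
    (hm : Module.finrank k S + m = Module.finrank k M) (hs : W ⊔ S.baseChange A = ⊤) :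
    IsCompl W (S.baseChange A) := by
  obtain ⟨v, hv⟩ := h
  refine ⟨?_, codisjoint_iff.2 hs⟩
  let l := Fintype.linearCombination A v
  have hrl : LinearMap.range l = Submodule.span A (Set.range v) := Fintype.range_linearCombination A v
  have hd : m = Module.finrank k (M ⧸ S) := by
    have := Submodule.finrank_quotient_add_finrank S
    omega
  subst hd
  let b := (Module.finBasis k (M ⧸ S)).baseChange A
  let e : ((A ⊗[k] M) ⧸ S.baseChange A) ≃ₗ[A] (Fin (Module.finrank k (M ⧸ S)) → A) :=
    (quotBaseChange A S).trans b.equivFun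
  have hsurj : Function.Surjective (e.toLinearMap ∘ₗ (S.baseChange A).mkQ ∘ₗ l) := by
    rw [LinearMap.coe_comp]
    refine e.surjective.comp ?_
    rw [← LinearMap.range_eq_top, LinearMap.range_comp, Submodule.map_mkQ_eq_top, sup_comm, hrl,
      eq_top_iff, ← hs]
    exact sup_le_sup_right hv _
  have hinj := OrzechProperty.injective_of_surjective_endomorphism _ hsurj
  rw [Submodule.disjoint_def]
  intro x hx hxS
  have hx' := hv hx
  rw [← hrl] at hx'
  obtain ⟨y, rfl⟩ := hx'
  have : y = 0 := hinj (by
    rw [map_zero]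
    have h0 : (S.baseChange A).mkQ (l y) = 0 := (Submodule.Quotient.mk_eq_zero _).2 hxS
    change e ((S.baseChange A).mkQ (l y)) = 0
    rw [h0, map_zero])
  rw [this, map_zero]

end Generators

end

/-! ### Linear maps with coefficients in an algebra -/

section

section Act

variable {k : Type*} [Field k] {A B : Type*} [CommRing A] [Algebra k A] [CommRing B] [Algebra k B]
  {L X Y : Type*} [AddCommGroup L] [Module k L] [AddCommGroup X] [Module k X]
  [AddCommGroup Y] [Module k Y]

/-- The action of `A ⊗ L` by `A`-linear maps `A ⊗ X → A ⊗ Y` that extends a linear family of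
`k`-linear maps `X → Y` parametrized by `L`. -/
def act (A : Type*) [CommRing A] [Algebra k A] (ev : L →ₗ[k] X →ₗ[k] Y) :
    A ⊗[k] L →ₗ[A] (A ⊗[k] X →ₗ[A] A ⊗[k] Y) :=
  (LinearMap.baseChangeHom k A X Y ∘ₗ ev).liftBaseChange A

theorem act_tmul (ev : L →ₗ[k] X →ₗ[k] Y) (a : A) (l : L) :
    act A ev (a ⊗ₜ l) = a • (ev l).baseChange A := by
  simp [act, LinearMap.baseChangeHom]

theorem rTensor_act (ev : L →ₗ[k] X →ₗ[k] Y) (φ : A →ₐ[k] B) (a : A ⊗[k] L) (x : A ⊗[k] X) :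
    φ.toLinearMap.rTensor Y (act A ev a x) =
      act B ev (φ.toLinearMap.rTensor L a) (φ.toLinearMap.rTensor X x) := by
  induction a with
  | zero => simp
  | tmul c l =>
    rw [act_tmul, LinearMap.smul_apply, rTensor_smul, rTensor_baseChange]
    simp [act_tmul]
  | add a b ha hb => simp only [map_add, LinearMap.add_apply, ha, hb]

theorem act_add (ev ev' : L →ₗ[k] X →ₗ[k] Y) (a : A ⊗[k] L) :
    act A (ev + ev') a = act A ev a + act A ev' a := by
  induction a with
  | zero => simp
  | tmul c l => simp [act_tmul, LinearMap.baseChange_add]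
  | add a b ha hb => rw [map_add, ha, hb, map_add, map_add]; abel

theorem act_comp {L' : Type*} [AddCommGroup L'] [Module k L'] (ev : L →ₗ[k] X →ₗ[k] Y)
    (p : L' →ₗ[k] L) (a : A ⊗[k] L') : act A (ev ∘ₗ p) a = act A ev (p.baseChange A a) := by
  induction a with
  | zero => simp
  | tmul c l => simp [act_tmul]
  | add a b ha hb => rw [map_add, ha, hb, map_add, map_add]

end Act

section HomExt

variable {k : Type*} [Field k] {M : Type*} [AddCommGroup M] [Module k M]

theorem exists_coproj {S T : Submodule k M} (h : Disjoint S T) :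
    ∃ π : M →ₗ[k] S, (∀ x : S, π x = x) ∧ ∀ x ∈ T, π x = 0 := by
  obtain ⟨U, hU, hc⟩ := h.symm.exists_isCompl
  exact ⟨S.projectionOnto U hc.symm, fun x => Submodule.projectionOnto_apply_left _ x,
    fun x hx => (Submodule.projectionOnto_apply_eq_zero_iff _).2 (hU hx)⟩

open Classical in
/-- A projection to the subspace `S` that kills `T`, if the two subspaces are disjoint. -/
def coproj (S T : Submodule k M) : M →ₗ[k] S :=
  if h : Disjoint S T then (exists_coproj h).choose else 0

theorem coproj_apply {S T : Submodule k M} (h : Disjoint S T) (x : S) : coproj S T x = x := by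
  rw [coproj, dif_pos h]
  exact (exists_coproj h).choose_spec.1 x

theorem coproj_apply_eq_zero {S T : Submodule k M} {x : M} (hx : x ∈ T) :
    coproj S T x = 0 := by
  by_cases h : Disjoint S T
  · rw [coproj, dif_pos h]
    exact (exists_coproj h).choose_spec.2 x hx
  · rw [coproj, dif_neg h, LinearMap.zero_apply]

/-- The extension of a linear map from `S` to `S'` to all of `M`, by zero on `T`. -/
def homExt (S S' T : Submodule k M) : (S →ₗ[k] S') →ₗ[k] M →ₗ[k] M where
  toFun u := S'.subtype ∘ₗ u ∘ₗ coproj S T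
  map_add' u v := by ext; simp
  map_smul' c u := by ext; simp

variable {A : Type*} [CommRing A] [Algebra k A]

theorem act_homExt_mem (S S' T : Submodule k M) (a : A ⊗[k] (S →ₗ[k] S')) (x : A ⊗[k] M) :
    act A (homExt S S' T) a x ∈ S'.baseChange A := by
  induction a with
  | zero => simp
  | tmul c l =>
    rw [act_tmul, LinearMap.smul_apply, homExt]
    refine Submodule.smul_mem _ _ ?_
    have := LinearMap.mem_range_self (S'.subtype.baseChange A) ((l ∘ₗ coproj S T).baseChange A x)
    rw [range_baseChange, Submodule.range_subtype] at this
    rw [← LinearMap.comp_apply, ← LinearMap.baseChange_comp] at this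
    exact this
  | add a b ha hb => rw [map_add, LinearMap.add_apply]; exact add_mem ha hb

theorem act_homExt_eq_zero (S S' T : Submodule k M) (a : A ⊗[k] (S →ₗ[k] S')) {x : A ⊗[k] M}
    (hx : x ∈ T.baseChange A) : act A (homExt S S' T) a x = 0 := by
  have : T.baseChange A ≤ LinearMap.ker (act A (homExt S S' T) a) := by
    rw [mem_baseChange_iff_forall]
    intro m hm
    rw [LinearMap.mem_ker]
    induction a with
    | zero => simp
    | tmul c l => simp [act_tmul, homExt, coproj_apply_eq_zero hm]
    | add a b ha hb => rw [map_add, LinearMap.add_apply, ha, hb, add_zero]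
  exact this hx

theorem mem_baseChange_iff {S : Submodule k M} {x : A ⊗[k] M} :
    x ∈ S.baseChange A ↔ ∃ y : A ⊗[k] S, S.subtype.baseChange A y = x := by
  rw [← LinearMap.mem_range, range_baseChange, Submodule.range_subtype]

variable [FiniteDimensional k M]

instance (S : Submodule k M) : Module.FinitePresentation k S :=
  Module.finitePresentation_of_finite k S

/-- `A ⊗ Hom (S, S')` is the module of `A`-linear maps from `A ⊗ S` to `A ⊗ S'`. -/
def homEquiv (A : Type*) [CommRing A] [Algebra k A] (S S' : Submodule k M) :
    A ⊗[k] (S →ₗ[k] S') ≃ₗ[A] (A ⊗[k] S →ₗ[A] A ⊗[k] S') :=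
  (Module.FinitePresentation.isBaseChange_map k S S' A).equiv

theorem act_homExt_apply {S S' T : Submodule k M} (h : Disjoint S T) (a : A ⊗[k] (S →ₗ[k] S'))
    (y : A ⊗[k] S) : act A (homExt S S' T) a (S.subtype.baseChange A y) =
      S'.subtype.baseChange A (homEquiv A S S' a y) := by
  induction a with
  | zero => simp
  | tmul c l =>
    have e : homEquiv A S S' (c ⊗ₜ l) = c • l.baseChange A := 
      IsBaseChange.equiv_tmul (Module.FinitePresentation.isBaseChange_map k S S' A) c l
    rw [e, act_tmul]
    simp only [LinearMap.smul_apply, map_smul]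
    congr 1
    rw [← LinearMap.comp_apply, ← LinearMap.comp_apply, ← LinearMap.baseChange_comp,
      ← LinearMap.baseChange_comp]
    congr 2
    ext x
    simp [homExt, coproj_apply h]
  | add a b ha hb => simp only [map_add, LinearMap.add_apply, ha, hb]

theorem act_homExt_injective {S S' T : Submodule k M} (h : Disjoint S T)
    {a b : A ⊗[k] (S →ₗ[k] S')}
    (hab : ∀ x ∈ S.baseChange A, act A (homExt S S' T) a x = act A (homExt S S' T) b x) :
    a = b := by
  apply (homEquiv A S S').injective
  refine LinearMap.ext fun y => ?_
  apply baseChange_injective S'.injective_subtype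
  rw [← act_homExt_apply h, ← act_homExt_apply h]
  exact hab _ (mem_baseChange_iff.2 ⟨y, rfl⟩)

/-- Every linear map between the base changes of `S` and `S'` is the action of a homomorphism with
coefficients, because `S` is finite-dimensional. -/
theorem exists_act_homExt_eq {S S' T : Submodule k M} (h : Disjoint S T)
    (t : A ⊗[k] M →ₗ[A] A ⊗[k] M) (ht : ∀ x ∈ S.baseChange A, t x ∈ S'.baseChange A) :
    ∃ a : A ⊗[k] (S →ₗ[k] S'), ∀ x ∈ S.baseChange A, act A (homExt S S' T) a x = t x := by
  let e : A ⊗[k] S' ≃ₗ[A] S'.baseChange A :=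
    (LinearEquiv.ofInjective (S'.subtype.baseChange A)
      (baseChange_injective S'.injective_subtype)).trans
      (LinearEquiv.ofEq _ _ (by rw [range_baseChange, Submodule.range_subtype]))
  have he : ∀ y, S'.subtype.baseChange A (e.symm y) = y := fun y => by
    obtain ⟨z, rfl⟩ := e.surjective y
    rw [e.symm_apply_apply]; rfl
  let t' : A ⊗[k] S →ₗ[A] A ⊗[k] S' := e.symm.toLinearMap ∘ₗ
    (t ∘ₗ S.subtype.baseChange A).codRestrict _
      (fun y => ht _ (mem_baseChange_iff.2 ⟨y, rfl⟩))
  refine ⟨(homEquiv A S S').symm t', fun x hx => ?_⟩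
  obtain ⟨y, rfl⟩ := mem_baseChange_iff.1 hx
  rw [act_homExt_apply h, LinearEquiv.apply_symm_apply]
  exact he _

end HomExt

end

/-! ### Splittings and their parameters -/

section

theorem eq_zero_of_add_add_eq_zero {R X : Type*} [Ring R] [AddCommGroup X] [Module R X]
    {P Q B : Submodule R X} (h₁ : Disjoint P Q) (h₂ : Disjoint (P ⊔ Q) B) {p q b : X} (hp : p ∈ P)
    (hq : q ∈ Q) (hb : b ∈ B) (h : p + q + b = 0) : p = 0 ∧ q = 0 ∧ b = 0 := by
  have hb0 : b = 0 := Submodule.disjoint_def.1 h₂ b (by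
    rw [eq_neg_of_add_eq_zero_right h]
    exact neg_mem (Submodule.add_mem_sup hp hq)) hb
  rw [hb0, add_zero] at h
  have hq0 : q = 0 := Submodule.disjoint_def.1 h₁ q (by
    rw [eq_neg_of_add_eq_zero_right h]; exact neg_mem hp) hq
  rw [hq0, add_zero] at h
  exact ⟨h, hq0, hb0⟩

section Prod

variable {k A X Y : Type*} [Field k] [CommRing A] [Algebra k A] [AddCommGroup X] [Module k X]
  [AddCommGroup Y] [Module k Y]

theorem exists_tensor_prod (x : A ⊗[k] X) (y : A ⊗[k] Y) : ∃ z : A ⊗[k] (X × Y),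
    (LinearMap.fst k X Y).baseChange A z = x ∧ (LinearMap.snd k X Y).baseChange A z = y := by
  refine ⟨(LinearMap.inl k X Y).baseChange A x + (LinearMap.inr k X Y).baseChange A y, ?_, ?_⟩ <;>
  simp only [map_add, ← LinearMap.comp_apply, ← LinearMap.baseChange_comp, LinearMap.fst_comp_inl,
    LinearMap.fst_comp_inr, LinearMap.snd_comp_inl, LinearMap.snd_comp_inr, LinearMap.baseChange_id,
    LinearMap.baseChange_zero, LinearMap.id_apply, LinearMap.zero_apply, add_zero, zero_add]

theorem tensor_prod_ext {z z' : A ⊗[k] (X × Y)}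
    (h₁ : (LinearMap.fst k X Y).baseChange A z = (LinearMap.fst k X Y).baseChange A z')
    (h₂ : (LinearMap.snd k X Y).baseChange A z = (LinearMap.snd k X Y).baseChange A z') :
    z = z' := by
  have key : ∀ z : A ⊗[k] (X × Y),
      (LinearMap.inl k X Y).baseChange A ((LinearMap.fst k X Y).baseChange A z) +
      (LinearMap.inr k X Y).baseChange A ((LinearMap.snd k X Y).baseChange A z) = z := by
    intro z
    rw [← LinearMap.comp_apply, ← LinearMap.comp_apply, ← LinearMap.baseChange_comp,
      ← LinearMap.baseChange_comp, ← LinearMap.add_apply, ← LinearMap.baseChange_add]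
    have : LinearMap.inl k X Y ∘ₗ LinearMap.fst k X Y + LinearMap.inr k X Y ∘ₗ LinearMap.snd k X Y =
      LinearMap.id := by ext <;> simp
    rw [this, LinearMap.baseChange_id, LinearMap.id_apply]
  rw [← key z, ← key z', h₁, h₂]

end Prod

/-- Splittings of two disjoint subspaces `P`, `Q` of `M` and of a complement of their sum, with
respect to which a subspace of `M` of a given type is written in coordinates. The complement of
`P' ⊔ P''` in `P` and that of `Q' ⊔ Q''` in `Q` are left free. -/
structure Spot {k : Type*} [Field k] {M : Type*} [AddCommGroup M] [Module k M]
    (P Q : Submodule k M) where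
  P' : Submodule k M
  P'' : Submodule k M
  Q' : Submodule k M
  Q'' : Submodule k M
  B' : Submodule k M
  B'' : Submodule k M
  H₀ : Submodule k M
  H₁ : Submodule k M
  le_P : P' ⊔ P'' ≤ P
  le_Q : Q' ⊔ Q'' ≤ Q
  disjoint_P : Disjoint P' P''
  disjoint_Q : Disjoint Q' Q''
  disjoint_B : Disjoint B' B''
  disjoint_PQ : Disjoint P Q
  isCompl_B : IsCompl (P ⊔ Q) (B' ⊔ B'')
  disjoint_H : Disjoint H₀ H₁
  sup_H : H₀ ⊔ H₁ = P' ⊔ Q' ⊔ B'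

namespace Spot

variable {k : Type u} [Field k] {M : Type*} [AddCommGroup M] [Module k M]
  {P Q : Submodule k M} (c : Spot P Q)

/-- The parameter space of a chart. -/
abbrev L : Type _ := (c.P' →ₗ[k] c.P'') × (c.Q' →ₗ[k] c.Q'') ×
  (c.B' →ₗ[k] (c.P'' ⊔ c.Q'' ⊔ c.B'' : Submodule k M)) × (c.H₀ →ₗ[k] c.H₁)

theorem disjoint_P_sup : Disjoint c.P' (c.P'' ⊔ Q ⊔ (c.B' ⊔ c.B'')) := by
  rw [Submodule.disjoint_def]
  intro x hx hx'
  obtain ⟨y, hy, b, hb, rfl⟩ := Submodule.mem_sup.1 hx'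
  obtain ⟨p, hp, q, hq, rfl⟩ := Submodule.mem_sup.1 hy
  have hxP := c.le_P (Submodule.mem_sup_left hx)
  have hpP := c.le_P (Submodule.mem_sup_right hp)
  obtain ⟨h1, h2, h3⟩ := eq_zero_of_add_add_eq_zero c.disjoint_PQ c.isCompl_B.disjoint
    (sub_mem hpP hxP) hq hb (by abel)
  exact Submodule.disjoint_def.1 c.disjoint_P _ hx (by rw [← sub_eq_zero.1 h1]; exact hp)

theorem disjoint_Q_sup : Disjoint c.Q' (c.Q'' ⊔ P ⊔ (c.B' ⊔ c.B'')) := by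
  rw [Submodule.disjoint_def]
  intro x hx hx'
  obtain ⟨y, hy, b, hb, rfl⟩ := Submodule.mem_sup.1 hx'
  obtain ⟨q, hq, p, hp, rfl⟩ := Submodule.mem_sup.1 hy
  have hxQ := c.le_Q (Submodule.mem_sup_left hx)
  have hqQ := c.le_Q (Submodule.mem_sup_right hq)
  obtain ⟨h1, h2, h3⟩ := eq_zero_of_add_add_eq_zero c.disjoint_PQ c.isCompl_B.disjoint
    hp (sub_mem hqQ hxQ) hb (by abel)
  exact Submodule.disjoint_def.1 c.disjoint_Q _ hx (by rw [← sub_eq_zero.1 h2]; exact hq)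

theorem disjoint_B_sup : Disjoint c.B' (P ⊔ Q ⊔ c.B'') := by
  rw [Submodule.disjoint_def]
  intro x hx hx'
  obtain ⟨y, hy, b, hb, rfl⟩ := Submodule.mem_sup.1 hx'
  obtain ⟨p, hp, q, hq, rfl⟩ := Submodule.mem_sup.1 hy
  obtain ⟨h1, h2, h3⟩ := eq_zero_of_add_add_eq_zero c.disjoint_PQ c.isCompl_B.disjoint hp hq
    (sub_mem (Submodule.mem_sup_right hb) (Submodule.mem_sup_left hx)) (by abel)
  exact Submodule.disjoint_def.1 c.disjoint_B _ hx (by rw [← sub_eq_zero.1 h3]; exact hb)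

/-- The part of the parameters that moves `P' ⊔ Q' ⊔ B'`. -/
def evτ : c.L →ₗ[k] M →ₗ[k] M :=
  homExt c.P' c.P'' (c.P'' ⊔ Q ⊔ (c.B' ⊔ c.B'')) ∘ₗ LinearMap.fst k _ _ +
    (homExt c.Q' c.Q'' (c.Q'' ⊔ P ⊔ (c.B' ⊔ c.B'')) ∘ₗ LinearMap.fst k _ _ +
    (homExt c.B' (c.P'' ⊔ c.Q'' ⊔ c.B'') (P ⊔ Q ⊔ c.B'') ∘ₗ LinearMap.fst k _ _) ∘ₗ
      LinearMap.snd k _ _) ∘ₗ LinearMap.snd k _ _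

/-- The part of the parameters that moves `H₀` inside `P' ⊔ Q' ⊔ B'`. -/
def evσ : c.L →ₗ[k] M →ₗ[k] M :=
  ((homExt c.H₀ c.H₁ c.H₁ ∘ₗ LinearMap.snd k _ _) ∘ₗ LinearMap.snd k _ _) ∘ₗ LinearMap.snd k _ _

section

variable (A : Type*) [CommRing A] [Algebra k A]

/-- The `A`-linear map with which the first part of a parameter acts. -/
abbrev τ (a : A ⊗[k] c.L) : A ⊗[k] M →ₗ[A] A ⊗[k] M := act A c.evτ a

/-- The `A`-linear map with which the second part of a parameter acts. -/
abbrev σ (a : A ⊗[k] c.L) : A ⊗[k] M →ₗ[A] A ⊗[k] M := act A c.evσ a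

variable {A}

theorem τ_eq (a : A ⊗[k] c.L) : c.τ A a =
    act A (homExt c.P' c.P'' (c.P'' ⊔ Q ⊔ (c.B' ⊔ c.B''))) ((LinearMap.fst k _ _).baseChange A a) +
    (act A (homExt c.Q' c.Q'' (c.Q'' ⊔ P ⊔ (c.B' ⊔ c.B'')))
      ((LinearMap.fst k _ _).baseChange A ((LinearMap.snd k _ _).baseChange A a)) +
    act A (homExt c.B' (c.P'' ⊔ c.Q'' ⊔ c.B'') (P ⊔ Q ⊔ c.B''))
      ((LinearMap.fst k _ _).baseChange A ((LinearMap.snd k _ _).baseChange A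
        ((LinearMap.snd k _ _).baseChange A a)))) := by
  simp only [τ, evτ, act_add, act_comp]

theorem σ_eq (a : A ⊗[k] c.L) : c.σ A a = act A (homExt c.H₀ c.H₁ c.H₁)
    ((LinearMap.snd k _ _).baseChange A ((LinearMap.snd k _ _).baseChange A
        ((LinearMap.snd k _ _).baseChange A a))) := by
  simp only [σ, evσ, act_comp]

theorem τ_P' (a : A ⊗[k] c.L) {x : A ⊗[k] M} (hx : x ∈ c.P'.baseChange A) : c.τ A a x =
    act A (homExt c.P' c.P'' (c.P'' ⊔ Q ⊔ (c.B' ⊔ c.B'')))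
      ((LinearMap.fst k _ _).baseChange A a) x := by
  have hP : c.P' ≤ P := le_sup_left.trans c.le_P
  rw [τ_eq, LinearMap.add_apply, LinearMap.add_apply,
    act_homExt_eq_zero _ _ (c.Q'' ⊔ P ⊔ (c.B' ⊔ c.B'')) _
      (Submodule.baseChange_mono A (hP.trans (le_sup_right.trans le_sup_left)) hx),
    act_homExt_eq_zero _ _ (P ⊔ Q ⊔ c.B'') _
      (Submodule.baseChange_mono A (hP.trans (le_sup_left.trans le_sup_left)) hx),
    add_zero, add_zero]

theorem τ_Q' (a : A ⊗[k] c.L) {x : A ⊗[k] M} (hx : x ∈ c.Q'.baseChange A) : c.τ A a x =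
    act A (homExt c.Q' c.Q'' (c.Q'' ⊔ P ⊔ (c.B' ⊔ c.B'')))
      ((LinearMap.fst k _ _).baseChange A ((LinearMap.snd k _ _).baseChange A a)) x := by
  have hQ : c.Q' ≤ Q := le_sup_left.trans c.le_Q
  rw [τ_eq, LinearMap.add_apply, LinearMap.add_apply,
    act_homExt_eq_zero _ _ (c.P'' ⊔ Q ⊔ (c.B' ⊔ c.B'')) _
      (Submodule.baseChange_mono A (hQ.trans (le_sup_right.trans le_sup_left)) hx),
    act_homExt_eq_zero _ _ (P ⊔ Q ⊔ c.B'') _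
      (Submodule.baseChange_mono A (hQ.trans (le_sup_right.trans le_sup_left)) hx),
    add_zero, zero_add]

theorem τ_B' (a : A ⊗[k] c.L) {x : A ⊗[k] M} (hx : x ∈ c.B'.baseChange A) : c.τ A a x =
    act A (homExt c.B' (c.P'' ⊔ c.Q'' ⊔ c.B'') (P ⊔ Q ⊔ c.B''))
      ((LinearMap.fst k _ _).baseChange A ((LinearMap.snd k _ _).baseChange A
        ((LinearMap.snd k _ _).baseChange A a))) x := by
  rw [τ_eq, LinearMap.add_apply, LinearMap.add_apply,
    act_homExt_eq_zero _ _ (c.P'' ⊔ Q ⊔ (c.B' ⊔ c.B'')) _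
      (Submodule.baseChange_mono A (le_sup_left.trans le_sup_right) hx),
    act_homExt_eq_zero _ _ (c.Q'' ⊔ P ⊔ (c.B' ⊔ c.B'')) _
      (Submodule.baseChange_mono A (le_sup_left.trans le_sup_right) hx),
    zero_add, zero_add]

theorem τ_P'_mem (a : A ⊗[k] c.L) {x : A ⊗[k] M} (hx : x ∈ c.P'.baseChange A) :
    c.τ A a x ∈ c.P''.baseChange A := by
  rw [τ_P' _ _ hx]; exact act_homExt_mem _ _ _ _ _

theorem τ_Q'_mem (a : A ⊗[k] c.L) {x : A ⊗[k] M} (hx : x ∈ c.Q'.baseChange A) :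
    c.τ A a x ∈ c.Q''.baseChange A := by
  rw [τ_Q' _ _ hx]; exact act_homExt_mem _ _ _ _ _

theorem τ_mem (a : A ⊗[k] c.L) (x : A ⊗[k] M) :
    c.τ A a x ∈ (c.P'' ⊔ c.Q'' ⊔ c.B'').baseChange A := by
  rw [τ_eq]
  refine add_mem ?_ (add_mem ?_ (act_homExt_mem _ _ _ _ _))
  · exact Submodule.baseChange_mono A (le_sup_left.trans le_sup_left) (act_homExt_mem _ _ _ _ _)
  · exact Submodule.baseChange_mono A (le_sup_right.trans le_sup_left) (act_homExt_mem _ _ _ _ _)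

theorem σ_mem (a : A ⊗[k] c.L) (x : A ⊗[k] M) : c.σ A a x ∈ c.H₁.baseChange A := by
  rw [σ_eq]; exact act_homExt_mem _ _ _ _ _

/-- Two parameters with the same action agree. -/
theorem param_ext [FiniteDimensional k M] {a b : A ⊗[k] c.L}
    (hτ : ∀ x ∈ (c.P' ⊔ c.Q' ⊔ c.B').baseChange A, c.τ A a x = c.τ A b x)
    (hσ : ∀ x ∈ c.H₀.baseChange A, c.σ A a x = c.σ A b x) : a = b := by
  refine tensor_prod_ext ?_ (tensor_prod_ext ?_ (tensor_prod_ext ?_ ?_))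
  · refine act_homExt_injective c.disjoint_P_sup fun x hx => ?_
    rw [← τ_P' _ _ hx, ← τ_P' _ _ hx]
    exact hτ x (Submodule.baseChange_mono A (le_sup_left.trans le_sup_left) hx)
  · refine act_homExt_injective c.disjoint_Q_sup fun x hx => ?_
    rw [← τ_Q' _ _ hx, ← τ_Q' _ _ hx]
    exact hτ x (Submodule.baseChange_mono A (le_sup_right.trans le_sup_left) hx)
  · refine act_homExt_injective c.disjoint_B_sup fun x hx => ?_
    rw [← τ_B' _ _ hx, ← τ_B' _ _ hx]
    exact hτ x (Submodule.baseChange_mono A le_sup_right hx)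
  · refine act_homExt_injective c.disjoint_H fun x hx => ?_
    rw [← σ_eq, ← σ_eq]
    exact hσ x hx

/-- Linear maps of the shape prescribed by the splitting come from parameters. -/
theorem exists_param [FiniteDimensional k M] (t s : A ⊗[k] M →ₗ[A] A ⊗[k] M)
    (hP : ∀ x ∈ c.P'.baseChange A, t x ∈ c.P''.baseChange A)
    (hQ : ∀ x ∈ c.Q'.baseChange A, t x ∈ c.Q''.baseChange A)
    (hB : ∀ x ∈ c.B'.baseChange A, t x ∈ (c.P'' ⊔ c.Q'' ⊔ c.B'').baseChange A)
    (hs : ∀ x ∈ c.H₀.baseChange A, s x ∈ c.H₁.baseChange A) :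
    ∃ a : A ⊗[k] c.L, (∀ x ∈ (c.P' ⊔ c.Q' ⊔ c.B').baseChange A, c.τ A a x = t x) ∧
      ∀ x ∈ c.H₀.baseChange A, c.σ A a x = s x := by
  obtain ⟨a₁, h₁⟩ := exists_act_homExt_eq c.disjoint_P_sup t hP
  obtain ⟨a₂, h₂⟩ := exists_act_homExt_eq c.disjoint_Q_sup t hQ
  obtain ⟨a₃, h₃⟩ := exists_act_homExt_eq c.disjoint_B_sup t hB
  obtain ⟨a₄, h₄⟩ := exists_act_homExt_eq c.disjoint_H s hs
  obtain ⟨z₃, e₃, e₄⟩ := exists_tensor_prod a₃ a₄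
  obtain ⟨z₂, e₂, e₂'⟩ := exists_tensor_prod a₂ z₃
  obtain ⟨a, e₁, e₁'⟩ := exists_tensor_prod a₁ z₂
  refine ⟨a, fun x hx => ?_, fun x hx => ?_⟩
  · rw [baseChange_sup, baseChange_sup] at hx
    obtain ⟨y, hy, z, hz, rfl⟩ := Submodule.mem_sup.1 hx
    obtain ⟨p, hp, q, hq, rfl⟩ := Submodule.mem_sup.1 hy
    rw [map_add, map_add, map_add, map_add, τ_P' _ _ hp, τ_Q' _ _ hq, τ_B' _ _ hz, e₁, e₁', e₂,
      e₂', e₃, h₁ _ hp, h₂ _ hq, h₃ _ hz]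
  · rw [σ_eq, e₁', e₂', e₄, h₄ _ hx]

/-- The submodule with given parameters. -/
def X (a : A ⊗[k] c.L) : Submodule A (A ⊗[k] M) :=
  ((c.H₀.baseChange A).map (LinearMap.id + c.σ A a)).map (LinearMap.id + c.τ A a)

theorem mem_X {a : A ⊗[k] c.L} {x : A ⊗[k] M} : x ∈ c.X a ↔
    ∃ h ∈ c.H₀.baseChange A, h + c.σ A a h + c.τ A a (h + c.σ A a h) = x := by
  simp [X]

end
end Spot

end

/-! ### Submodules in good position to a splitting -/

section

theorem exists_disjoint_sup_eq {R X : Type*} [DivisionRing R] [AddCommGroup X] [Module R X]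
    {S T : Submodule R X} (h : S ≤ T) : ∃ S', Disjoint S' S ∧ S' ⊔ S = T := by
  obtain ⟨C, hC⟩ := exists_isCompl S
  refine ⟨C ⊓ T, hC.symm.disjoint.mono_left inf_le_left, ?_⟩
  rw [sup_comm, ← sup_inf_assoc_of_le _ h, hC.sup_eq_top, top_inf_eq]

theorem finrank_sup_of_disjoint {F X : Type*} [Field F] [AddCommGroup X] [Module F X]
    [FiniteDimensional F X] {S T : Submodule F X} (h : Disjoint S T) :
    Module.finrank F (S ⊔ T : Submodule F X) = Module.finrank F S + Module.finrank F T := by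
  rw [← Submodule.finrank_sup_add_finrank_inf_eq, h.eq_bot, finrank_bot, add_zero]

/-- A graph over `P' ⊔ B'` that together with `G` and `Q` contains `W ⊔ Q` is itself contained in
`W ⊔ Q`, since the dimensions do not leave room for more. -/
theorem graph_le_of_le_graph {R X : Type*} [Ring R] [AddCommGroup X] [Module R X]
    {G P' P'' Q B' B'' W : Submodule R X} {t : X →ₗ[R] X}
    (hc : ∀ g ∈ G, ∀ p' ∈ P', ∀ p'' ∈ P'', ∀ q ∈ Q, ∀ b' ∈ B', ∀ b'' ∈ B'',
      g + (p' + p'') + q + (b' + b'') = 0 → p' = 0 ∧ p'' = 0 ∧ b' = 0 ∧ b'' = 0)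
    (hP : ∀ x ∈ P', t x ∈ P'') (hB : ∀ x ∈ B', t x ∈ P'' ⊔ Q ⊔ B'')
    (hle : W ⊔ Q ≤ G ⊔ (P' ⊔ B').map (LinearMap.id + t) ⊔ Q)
    (htop : W ⊔ Q ⊔ (P'' ⊔ B'') = ⊤) : (P' ⊔ B').map (LinearMap.id + t) ≤ W ⊔ Q := by
  rintro _ ⟨y, hy, rfl⟩
  obtain ⟨w, hw, n, hn, hx⟩ := Submodule.mem_sup.1
    (htop.ge (Submodule.mem_top (x := (LinearMap.id + t : X →ₗ[R] X) y)))
  obtain ⟨w', hw', q, hq, rfl⟩ := Submodule.mem_sup.1 (hle hw)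
  obtain ⟨g, hg, _, ⟨z, hz, rfl⟩, rfl⟩ := Submodule.mem_sup.1 hw'
  obtain ⟨p₁, hp₁, b₁, hb₁, h₁⟩ := Submodule.mem_sup.1 (sub_mem hz hy)
  obtain ⟨p₂, hp₂, b₂, hb₂, rfl⟩ := Submodule.mem_sup.1 hn
  obtain ⟨y₃, hy₃, b₃, hb₃, h₃⟩ := Submodule.mem_sup.1 (hB _ hb₁)
  obtain ⟨p₃, hp₃, q₃, hq₃, rfl⟩ := Submodule.mem_sup.1 hy₃
  have e : g + (p₁ + (t p₁ + p₂ + p₃)) + (q + q₃) + (b₁ + (b₂ + b₃)) = 0 := by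
    have h4 : t z = t y + t p₁ + t b₁ := by
      rw [add_assoc, ← map_add, h₁, map_sub]; abel
    have h5 : z = y + (p₁ + b₁) := by rw [h₁]; abel
    simp only [LinearMap.add_apply, LinearMap.id_apply] at hx
    rw [h4, ← h₃] at hx
    nth_rewrite 1 [h5] at hx
    rw [← sub_eq_zero] at hx
    rw [← hx]
    abel
  obtain ⟨hp, -, hb, -⟩ := hc g hg p₁ hp₁ _ (add_mem (add_mem (hP _ hp₁) hp₂) hp₃) _
    (add_mem hq hq₃) b₁ hb₁ _ (add_mem hb₂ hb₃) e
  have hzy : z = y := by rw [hp, hb, add_zero] at h₁; exact (sub_eq_zero.1 h₁.symm)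
  obtain ⟨-, hp2, -, hb2⟩ := hc g hg 0 (zero_mem _) p₂ hp₂ q hq 0 (zero_mem _) b₂ hb₂ (by
    rw [hzy, ← sub_eq_zero] at hx
    simp only [zero_add]
    refine Eq.trans ?_ hx
    abel)
  rw [← hx, hp2, hb2, add_zero, add_zero]
  exact hw

namespace Spot

variable {k : Type u} [Field k] {M : Type*} [AddCommGroup M] [Module k M]
  {P Q : Submodule k M}

/-- The position of `W` and of its submodules `G` and `F` in `P` and `Q` that is required for `W`
to be described by the coordinates of the chart. -/
structure Good (c : Spot P Q) {A : Type*} [CommRing A] [Algebra k A]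
    (G F W : Submodule A (A ⊗[k] M)) : Prop where
  G_le_P : G ≤ P.baseChange A
  F_le_Q : F ≤ Q.baseChange A
  G_le : G ≤ W
  F_le : F ≤ W
  isCompl_G : IsCompl G ((c.P' ⊔ c.P'' ⊔ Q ⊔ (c.B' ⊔ c.B'')).baseChange A)
  isCompl_F : IsCompl F ((c.Q' ⊔ c.Q'' ⊔ P ⊔ (c.B' ⊔ c.B'')).baseChange A)
  isCompl_Q : IsCompl (W ⊔ Q.baseChange A) ((c.P'' ⊔ c.B'').baseChange A)
  isCompl_P : IsCompl (W ⊔ P.baseChange A) ((c.Q'' ⊔ c.B'').baseChange A)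
  isCompl_PQ : IsCompl (W ⊔ (P ⊔ Q).baseChange A) (c.B''.baseChange A)
  isCompl : IsCompl W ((c.H₁ ⊔ (c.P'' ⊔ c.Q'' ⊔ c.B'')).baseChange A)

variable (c : Spot P Q)

theorem disjoint_H_N : Disjoint (c.P' ⊔ c.Q' ⊔ c.B') (c.P'' ⊔ c.Q'' ⊔ c.B'') := by
  rw [Submodule.disjoint_def]
  intro x hx hx'
  obtain ⟨y, hy, b, hb, rfl⟩ := Submodule.mem_sup.1 hx
  obtain ⟨p, hp, q, hq, rfl⟩ := Submodule.mem_sup.1 hy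
  obtain ⟨y', hy', b', hb', e⟩ := Submodule.mem_sup.1 hx'
  obtain ⟨p', hp', q', hq', rfl⟩ := Submodule.mem_sup.1 hy'
  obtain ⟨h1, h2, h3⟩ := eq_zero_of_add_add_eq_zero c.disjoint_PQ c.isCompl_B.disjoint
    (sub_mem (c.le_P (Submodule.mem_sup_right hp')) (c.le_P (Submodule.mem_sup_left hp)))
    (sub_mem (c.le_Q (Submodule.mem_sup_right hq')) (c.le_Q (Submodule.mem_sup_left hq)))
    (sub_mem (Submodule.mem_sup_right hb') (Submodule.mem_sup_left hb))
    (by rw [← sub_eq_zero] at e; rw [← e]; abel)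
  rw [Submodule.disjoint_def.1 c.disjoint_P _ hp (sub_eq_zero.1 h1 ▸ hp'),
    Submodule.disjoint_def.1 c.disjoint_Q _ hq (sub_eq_zero.1 h2 ▸ hq'),
    Submodule.disjoint_def.1 c.disjoint_B _ hb (sub_eq_zero.1 h3 ▸ hb'), add_zero, add_zero]

section

variable {A : Type*} [CommRing A] [Algebra k A]

theorem disjoint_baseChange {S T : Submodule k M} (h : Disjoint S T) :
    Disjoint (S.baseChange A) (T.baseChange A) := by
  rw [disjoint_iff, ← baseChange_inf, h.eq_bot, Submodule.baseChange_bot]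

theorem eq_zero_of_sum {p q b : A ⊗[k] M} (hp : p ∈ P.baseChange A) (hq : q ∈ Q.baseChange A)
    (hb : b ∈ (c.B' ⊔ c.B'').baseChange A) (h : p + q + b = 0) : p = 0 ∧ q = 0 ∧ b = 0 :=
  eq_zero_of_add_add_eq_zero (disjoint_baseChange c.disjoint_PQ)
    (by rw [← baseChange_sup]; exact disjoint_baseChange c.isCompl_B.disjoint) hp hq hb h

theorem P'_le : c.P'.baseChange A ≤ P.baseChange A :=
  Submodule.baseChange_mono A (le_sup_left.trans c.le_P)

theorem P''_le : c.P''.baseChange A ≤ P.baseChange A :=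
  Submodule.baseChange_mono A (le_sup_right.trans c.le_P)

theorem Q'_le : c.Q'.baseChange A ≤ Q.baseChange A :=
  Submodule.baseChange_mono A (le_sup_left.trans c.le_Q)

theorem Q''_le : c.Q''.baseChange A ≤ Q.baseChange A :=
  Submodule.baseChange_mono A (le_sup_right.trans c.le_Q)

theorem B'_le : c.B'.baseChange A ≤ (c.B' ⊔ c.B'').baseChange A :=
  Submodule.baseChange_mono A le_sup_left

theorem B''_le : c.B''.baseChange A ≤ (c.B' ⊔ c.B'').baseChange A :=
  Submodule.baseChange_mono A le_sup_right

variable {c} {G F W : Submodule A (A ⊗[k] M)}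

theorem P_le_of_sup_eq_top (hG : G ≤ P.baseChange A)
    (h : G ⊔ (c.P' ⊔ c.P'' ⊔ Q ⊔ (c.B' ⊔ c.B'')).baseChange A = ⊤) :
    P.baseChange A ≤ G ⊔ (c.P' ⊔ c.P'').baseChange A := by
  intro x hx
  obtain ⟨g, hg, y, hy, rfl⟩ := Submodule.mem_sup.1 (h.ge (Submodule.mem_top (x := x)))
  rw [baseChange_sup, baseChange_sup] at hy
  obtain ⟨z, hz, b, hb, rfl⟩ := Submodule.mem_sup.1 hy
  obtain ⟨p, hp, q, hq, rfl⟩ := Submodule.mem_sup.1 hz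
  have hpP := Submodule.baseChange_mono A c.le_P hp
  obtain ⟨-, hq0, hb0⟩ := c.eq_zero_of_sum (sub_mem (add_mem (hG hg) hpP) hx) hq hb (by abel)
  rw [hq0, hb0, add_zero, add_zero]
  exact Submodule.add_mem_sup hg hp

theorem Q_le_of_sup_eq_top (hF : F ≤ Q.baseChange A)
    (h : F ⊔ (c.Q' ⊔ c.Q'' ⊔ P ⊔ (c.B' ⊔ c.B'')).baseChange A = ⊤) :
    Q.baseChange A ≤ F ⊔ (c.Q' ⊔ c.Q'').baseChange A := by
  intro x hx
  obtain ⟨g, hg, y, hy, rfl⟩ := Submodule.mem_sup.1 (h.ge (Submodule.mem_top (x := x)))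
  rw [baseChange_sup, baseChange_sup] at hy
  obtain ⟨z, hz, b, hb, rfl⟩ := Submodule.mem_sup.1 hy
  obtain ⟨q, hq, p, hp, rfl⟩ := Submodule.mem_sup.1 hz
  have hqQ := Submodule.baseChange_mono A c.le_Q hq
  obtain ⟨hp0, -, hb0⟩ := c.eq_zero_of_sum hp (sub_mem (add_mem (hF hg) hqQ) hx) hb (by abel)
  rw [hp0, hb0, add_zero, add_zero]
  exact Submodule.add_mem_sup hg hq

/-- For all parameters, the submodule they describe spans everything together with
`H₁ ⊔ (P'' ⊔ Q'' ⊔ B'')`, as soon as `G` and `F` span their parts of `P` and `Q`. -/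
theorem sup_X_eq_top (hG : G ≤ P.baseChange A) (hF : F ≤ Q.baseChange A)
    (h₁ : G ⊔ (c.P' ⊔ c.P'' ⊔ Q ⊔ (c.B' ⊔ c.B'')).baseChange A = ⊤)
    (h₂ : F ⊔ (c.Q' ⊔ c.Q'' ⊔ P ⊔ (c.B' ⊔ c.B'')).baseChange A = ⊤) (a : A ⊗[k] c.L) :
    G ⊔ F ⊔ c.X a ⊔ (c.H₁ ⊔ (c.P'' ⊔ c.Q'' ⊔ c.B'')).baseChange A = ⊤ := by
  have hN : (c.P'' ⊔ c.Q'' ⊔ c.B'').baseChange A ≤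
      G ⊔ F ⊔ c.X a ⊔ (c.H₁ ⊔ (c.P'' ⊔ c.Q'' ⊔ c.B'')).baseChange A :=
    (Submodule.baseChange_mono A le_sup_right).trans le_sup_right
  have hH₁ : c.H₁.baseChange A ≤
      G ⊔ F ⊔ c.X a ⊔ (c.H₁ ⊔ (c.P'' ⊔ c.Q'' ⊔ c.B'')).baseChange A :=
    (Submodule.baseChange_mono A le_sup_left).trans le_sup_right
  have hG' : G ≤ G ⊔ F ⊔ c.X a ⊔ (c.H₁ ⊔ (c.P'' ⊔ c.Q'' ⊔ c.B'')).baseChange A :=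
    le_sup_left.trans (le_sup_left.trans le_sup_left)
  have hF' : F ≤ G ⊔ F ⊔ c.X a ⊔ (c.H₁ ⊔ (c.P'' ⊔ c.Q'' ⊔ c.B'')).baseChange A :=
    le_sup_right.trans (le_sup_left.trans le_sup_left)
  have hX : c.X a ≤ G ⊔ F ⊔ c.X a ⊔ (c.H₁ ⊔ (c.P'' ⊔ c.Q'' ⊔ c.B'')).baseChange A :=
    le_sup_right.trans le_sup_left
  generalize G ⊔ F ⊔ c.X a ⊔ (c.H₁ ⊔ (c.P'' ⊔ c.Q'' ⊔ c.B'')).baseChange A = T at *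
  have hH₀ : c.H₀.baseChange A ≤ T := fun h hh => by
    have := sub_mem (sub_mem (hX ((mem_X c).2 ⟨h, hh, rfl⟩)) (hN (c.τ_mem a (h + c.σ A a h))))
      (hH₁ (c.σ_mem a h))
    simpa using this
  have hH : (c.P' ⊔ c.Q' ⊔ c.B').baseChange A ≤ T := by
    rw [← c.sup_H, baseChange_sup]
    exact sup_le hH₀ hH₁
  have hP : P.baseChange A ≤ T := by
    refine (P_le_of_sup_eq_top hG h₁).trans (sup_le hG' ?_)
    rw [baseChange_sup]
    exact sup_le ((Submodule.baseChange_mono A (le_sup_left.trans le_sup_left)).trans hH)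
      ((Submodule.baseChange_mono A (le_sup_left.trans le_sup_left)).trans hN)
  have hQ : Q.baseChange A ≤ T := by
    refine (Q_le_of_sup_eq_top hF h₂).trans (sup_le hF' ?_)
    rw [baseChange_sup]
    exact sup_le ((Submodule.baseChange_mono A (le_sup_right.trans le_sup_left)).trans hH)
      ((Submodule.baseChange_mono A (le_sup_right.trans le_sup_left)).trans hN)
  rw [eq_top_iff, ← Submodule.baseChange_top, ← c.isCompl_B.sup_eq_top, baseChange_sup,
    baseChange_sup, baseChange_sup]
  exact sup_le (sup_le hP hQ) (sup_le ((Submodule.baseChange_mono A le_sup_right).trans hH)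
    ((Submodule.baseChange_mono A le_sup_right).trans hN))

/-- The graph of the first part of a good parameter: `W ⊔ Q` and `W ⊔ P` meet in a complement of
`P'' ⊔ Q'' ⊔ B''`. -/
theorem Good.isCompl_inf (h : c.Good G F W) :
    IsCompl ((W ⊔ Q.baseChange A) ⊓ (W ⊔ P.baseChange A))
      ((c.P'' ⊔ c.Q'' ⊔ c.B'').baseChange A) := by
  refine ⟨Submodule.disjoint_def.2 fun x hx hx' => ?_, codisjoint_iff.2 (eq_top_iff.2 ?_)⟩
  · rw [baseChange_sup, baseChange_sup] at hx'
    obtain ⟨y, hy, b, hb, rfl⟩ := Submodule.mem_sup.1 hx'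
    obtain ⟨p, hp, q, hq, rfl⟩ := Submodule.mem_sup.1 hy
    have h1 : p + b = 0 := Submodule.disjoint_def.1 h.isCompl_Q.disjoint _ (by
      have := sub_mem hx.1 (Submodule.mem_sup_right (c.Q''_le hq) : q ∈ W ⊔ Q.baseChange A)
      convert this using 1; abel) (by
      rw [baseChange_sup]; exact Submodule.add_mem_sup hp hb)
    have h2 : q + b = 0 := Submodule.disjoint_def.1 h.isCompl_P.disjoint _ (by
      have := sub_mem hx.2 (Submodule.mem_sup_right (c.P''_le hp) : p ∈ W ⊔ P.baseChange A)
      convert this using 1; abel) (by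
      rw [baseChange_sup]; exact Submodule.add_mem_sup hq hb)
    obtain ⟨hp0, -, hb0⟩ := c.eq_zero_of_sum (c.P''_le hp) (zero_mem _) (c.B''_le hb)
      (by rw [add_zero]; exact h1)
    rw [hb0, add_zero] at h2 ⊢
    rw [hp0, h2, add_zero]
  · intro m _
    obtain ⟨y, hy, n, hn, rfl⟩ := Submodule.mem_sup.1
      (h.isCompl_Q.sup_eq_top.ge (Submodule.mem_top (x := m)))
    obtain ⟨z, hz, n', hn', rfl⟩ := Submodule.mem_sup.1
      (h.isCompl_P.sup_eq_top.ge (Submodule.mem_top (x := y)))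
    rw [baseChange_sup] at hn'
    obtain ⟨q, hq, b, hb, rfl⟩ := Submodule.mem_sup.1 hn'
    have hzb : z + b ∈ W ⊔ Q.baseChange A := by
      have := sub_mem hy (Submodule.mem_sup_right (c.Q''_le hq) : q ∈ W ⊔ Q.baseChange A)
      convert this using 1; abel
    have hb0 : b = 0 := Submodule.disjoint_def.1 h.isCompl_PQ.disjoint _ (by
      rw [baseChange_sup]
      have := sub_mem ((sup_le_sup_left le_sup_right W : W ⊔ Q.baseChange A ≤
        W ⊔ (P.baseChange A ⊔ Q.baseChange A)) hzb) ((sup_le_sup_left le_sup_left W :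
        W ⊔ P.baseChange A ≤ W ⊔ (P.baseChange A ⊔ Q.baseChange A)) hz)
      convert this using 1; abel) hb
    rw [hb0, add_zero] at hzb
    rw [hb0, add_zero, add_assoc]
    refine Submodule.add_mem_sup ⟨hzb, hz⟩ (add_mem ?_ ?_)
    · exact Submodule.baseChange_mono A (le_sup_right.trans le_sup_left) hq
    · exact Submodule.baseChange_mono A (sup_le_sup_right le_sup_left _) hn

theorem H₁_le : c.H₁ ≤ c.P' ⊔ c.Q' ⊔ c.B' := le_sup_right.trans c.sup_H.le

theorem H₀_le : c.H₀ ≤ c.P' ⊔ c.Q' ⊔ c.B' := le_sup_left.trans c.sup_H.le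

/-- Every submodule in good position is described by some parameters. They are read off from the
projection to `P'' ⊔ Q'' ⊔ B''` along `(W ⊔ Q) ⊓ (W ⊔ P)` and the projection along `W`. -/
theorem Good.exists_eq_sup [FiniteDimensional k M] (h : c.Good G F W) :
    ∃ a : A ⊗[k] c.L, W = G ⊔ F ⊔ c.X a := by
  set e := Submodule.projection _ _ h.isCompl_inf.symm with he
  set e' := Submodule.projection _ _ h.isCompl.symm with he'
  obtain ⟨π, hπ, hπ'⟩ := exists_coproj (c.disjoint_H_N.mono_left H₁_le)
  have hmem : ∀ x, e x ∈ (c.P'' ⊔ c.Q'' ⊔ c.B'').baseChange A := fun x =>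
    Submodule.coe_mem (Submodule.projectionOnto _ _ h.isCompl_inf.symm x)
  have hmem' : ∀ x, e' x ∈ (c.H₁ ⊔ (c.P'' ⊔ c.Q'' ⊔ c.B'')).baseChange A := fun x =>
    Submodule.coe_mem (Submodule.projectionOnto _ _ h.isCompl.symm x)
  have hsub : ∀ x, x - e x ∈ (W ⊔ Q.baseChange A) ⊓ (W ⊔ P.baseChange A) := fun x => by
    rw [← Submodule.projection_apply_eq_zero_iff h.isCompl_inf.symm, map_sub,
      Submodule.projection_apply_of_mem_left h.isCompl_inf.symm (hmem x), sub_self]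
  have hsub' : ∀ x, x - e' x ∈ W := fun x => by
    rw [← Submodule.projection_apply_eq_zero_iff h.isCompl.symm, map_sub,
      Submodule.projection_apply_of_mem_left h.isCompl.symm (hmem' x), sub_self]
  have hWH : W ≤ (W ⊔ Q.baseChange A) ⊓ (W ⊔ P.baseChange A) := le_inf le_sup_left le_sup_left
  -- on `P'` and on `Q'` the projection `e` takes values in `P''` and in `Q''`
  have hp : ∀ x ∈ c.P'.baseChange A, (-e) x ∈ c.P''.baseChange A := fun x hx => by
    rw [LinearMap.neg_apply, neg_mem_iff]
    have h1 := hmem x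
    rw [baseChange_sup, baseChange_sup] at h1
    obtain ⟨y, hy, b, hb, hyb⟩ := Submodule.mem_sup.1 h1
    obtain ⟨p, hp, q, hq, rfl⟩ := Submodule.mem_sup.1 hy
    have h2 : q + b = 0 := Submodule.disjoint_def.1 h.isCompl_P.disjoint _ (by
      have := sub_mem (Submodule.mem_sup_right (sub_mem (c.P'_le hx) (c.P''_le hp)) :
        x - p ∈ W ⊔ P.baseChange A) (hsub x).2
      rw [← hyb] at this
      convert this using 1; abel) (by rw [baseChange_sup]; exact Submodule.add_mem_sup hq hb)
    rw [← hyb, add_assoc, h2, add_zero]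
    exact hp
  have hq : ∀ x ∈ c.Q'.baseChange A, (-e) x ∈ c.Q''.baseChange A := fun x hx => by
    rw [LinearMap.neg_apply, neg_mem_iff]
    have h1 := hmem x
    rw [baseChange_sup, baseChange_sup] at h1
    obtain ⟨y, hy, b, hb, hyb⟩ := Submodule.mem_sup.1 h1
    obtain ⟨p, hp, q, hq, rfl⟩ := Submodule.mem_sup.1 hy
    have h2 : p + b = 0 := Submodule.disjoint_def.1 h.isCompl_Q.disjoint _ (by
      have := sub_mem (Submodule.mem_sup_right (sub_mem (c.Q'_le hx) (c.Q''_le hq)) :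
        x - q ∈ W ⊔ Q.baseChange A) (hsub x).1
      rw [← hyb] at this
      convert this using 1; abel) (by rw [baseChange_sup]; exact Submodule.add_mem_sup hp hb)
    rw [← hyb, show p + q + b = q + (p + b) by abel, h2, add_zero]
    exact hq
  have hs : ∀ x ∈ c.H₀.baseChange A,
      (-((c.H₁.subtype ∘ₗ π).baseChange A ∘ₗ e')) x ∈ c.H₁.baseChange A := fun x hx => by
    rw [LinearMap.neg_apply, neg_mem_iff, LinearMap.comp_apply, LinearMap.baseChange_comp,
      LinearMap.comp_apply]
    exact mem_baseChange_iff.2 ⟨_, rfl⟩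
  obtain ⟨a, hτ, hσ⟩ := c.exists_param (-e) (-((c.H₁.subtype ∘ₗ π).baseChange A ∘ₗ e')) hp hq
    (fun x hx => neg_mem (hmem x)) hs
  have hX : c.X a ≤ W := fun x hx => by
    obtain ⟨y, hy, rfl⟩ := (mem_X c).1 hx
    have hyH := Submodule.baseChange_mono A H₀_le hy
    have hσH := Submodule.baseChange_mono A H₁_le (c.σ_mem a y)
    rw [hτ _ (add_mem hyH hσH)]
    have h2 := hmem' y
    rw [baseChange_sup] at h2
    obtain ⟨z, hz, n, hn, hzn⟩ := Submodule.mem_sup.1 h2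
    have hσy : c.σ A a y = -z := by
      rw [hσ _ hy, LinearMap.neg_apply, LinearMap.comp_apply, ← hzn, map_add]
      have h3 : (c.H₁.subtype ∘ₗ π).baseChange A z = z := by
        obtain ⟨z, rfl⟩ := mem_baseChange_iff.1 hz
        rw [← LinearMap.comp_apply, ← LinearMap.baseChange_comp]
        congr 2
        ext x
        simp [hπ]
      have h4 : (c.H₁.subtype ∘ₗ π).baseChange A n = 0 := by
        obtain ⟨n, rfl⟩ := mem_baseChange_iff.1 hn
        rw [← LinearMap.comp_apply, ← LinearMap.baseChange_comp]
        have : (c.H₁.subtype ∘ₗ π) ∘ₗ (c.P'' ⊔ c.Q'' ⊔ c.B'').subtype = 0 := by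
          ext x
          simp [hπ' x x.2]
        rw [this, LinearMap.baseChange_zero, LinearMap.zero_apply]
      rw [h3, h4, add_zero]
    have hw : y - z - n ∈ W := by
      have := hsub' y
      rwa [← hzn, ← sub_sub] at this
    have hen : e (y - z) = n := by
      have : y - z = (y - z - n) + n := by abel
      rw [this, map_add, (Submodule.projection_apply_eq_zero_iff _).2 (hWH hw), zero_add]
      exact Submodule.projection_apply_of_mem_left _ hn
    rw [hσy, ← sub_eq_add_neg, LinearMap.neg_apply, hen, ← sub_eq_add_neg]
    exact hw
  refine ⟨a, le_antisymm ?_ (sup_le (sup_le h.G_le h.F_le) hX)⟩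
  -- equality: both sides have the same complement
  have htop := sup_X_eq_top h.G_le_P h.F_le_Q h.isCompl_G.sup_eq_top h.isCompl_F.sup_eq_top a
  have := sup_inf_assoc_of_le ((c.H₁ ⊔ (c.P'' ⊔ c.Q'' ⊔ c.B'')).baseChange A)
    (sup_le (sup_le h.G_le h.F_le) hX)
  rw [htop, top_inf_eq, inf_comm, h.isCompl.inf_eq_bot, sup_bot_eq] at this
  exact this.le

theorem X_le (a : A ⊗[k] c.L) :
    c.X a ≤ ((c.P' ⊔ c.Q' ⊔ c.B').baseChange A).map (LinearMap.id + c.τ A a) := by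
  refine Submodule.map_mono ?_
  rintro _ ⟨x, hx, rfl⟩
  exact add_mem (Submodule.baseChange_mono A H₀_le hx)
    (Submodule.baseChange_mono A H₁_le (c.σ_mem a x))

theorem map_id_add_τ_Q'_le (a : A ⊗[k] c.L) :
    (c.Q'.baseChange A).map (LinearMap.id + c.τ A a) ≤ Q.baseChange A := by
  rintro _ ⟨x, hx, rfl⟩
  exact add_mem (c.Q'_le hx) (c.Q''_le (c.τ_Q'_mem a hx))

theorem map_id_add_τ_P'_le (a : A ⊗[k] c.L) :
    (c.P'.baseChange A).map (LinearMap.id + c.τ A a) ≤ P.baseChange A := by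
  rintro _ ⟨x, hx, rfl⟩
  exact add_mem (c.P'_le hx) (c.P''_le (c.τ_P'_mem a hx))

theorem X_le_sup_Q (a : A ⊗[k] c.L) : c.X a ≤
    ((c.P' ⊔ c.B').baseChange A).map (LinearMap.id + c.τ A a) ⊔ Q.baseChange A := by
  refine (X_le a).trans ?_
  rw [show c.P' ⊔ c.Q' ⊔ c.B' = (c.P' ⊔ c.B') ⊔ c.Q' from sup_right_comm _ _ _, baseChange_sup,
    Submodule.map_sup]
  exact sup_le_sup_left (map_id_add_τ_Q'_le a) _

theorem X_le_sup_P (a : A ⊗[k] c.L) : c.X a ≤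
    ((c.Q' ⊔ c.B').baseChange A).map (LinearMap.id + c.τ A a) ⊔ P.baseChange A := by
  refine (X_le a).trans ?_
  rw [show c.P' ⊔ c.Q' ⊔ c.B' = (c.Q' ⊔ c.B') ⊔ c.P' by ac_rfl, baseChange_sup,
    Submodule.map_sup]
  exact sup_le_sup_left (map_id_add_τ_P'_le a) _

theorem Good.id_add_τ_mem (h : c.Good G F W) {a : A ⊗[k] c.L} (hW : W = G ⊔ F ⊔ c.X a)
    {x : A ⊗[k] M} (hx : x ∈ (c.P' ⊔ c.Q' ⊔ c.B').baseChange A) :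
    x + c.τ A a x ∈ (W ⊔ Q.baseChange A) ⊓ (W ⊔ P.baseChange A) := by
  have hQ : ((c.P' ⊔ c.B').baseChange A).map (LinearMap.id + c.τ A a) ≤ W ⊔ Q.baseChange A := by
    have hdis := h.isCompl_G.disjoint
    have htop := h.isCompl_Q.sup_eq_top
    rw [baseChange_sup] at htop ⊢
    refine graph_le_of_le_graph (G := G) ?_ (fun x hx => c.τ_P'_mem a hx) (fun x hx => ?_) ?_ htop
    · intro g hg p' hp' p'' hp'' q hq b' hb' b'' hb'' hs
      have hg0 : g = 0 := Submodule.disjoint_def.1 hdis _ hg (by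
        rw [show g = -(p' + p'' + q + (b' + b'')) by
          rw [eq_neg_iff_add_eq_zero, ← hs]; abel]
        simp only [baseChange_sup]
        exact neg_mem (Submodule.add_mem_sup (Submodule.add_mem_sup
          (Submodule.add_mem_sup hp' hp'') hq) (Submodule.add_mem_sup hb' hb'')))
      rw [hg0, zero_add] at hs
      obtain ⟨h1, -, h3⟩ := c.eq_zero_of_sum (add_mem (c.P'_le hp') (c.P''_le hp'')) hq
        (add_mem (c.B'_le hb') (c.B''_le hb'')) hs
      obtain ⟨hp, -, hp2⟩ := eq_zero_of_add_add_eq_zero (Q := ⊥) disjoint_bot_right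
        (by rw [sup_bot_eq]; exact disjoint_baseChange c.disjoint_P) hp' (zero_mem _) hp''
        (by rwa [add_zero])
      obtain ⟨hb, -, hb2⟩ := eq_zero_of_add_add_eq_zero (Q := ⊥) disjoint_bot_right
        (by rw [sup_bot_eq]; exact disjoint_baseChange c.disjoint_B) hb' (zero_mem _) hb''
        (by rwa [add_zero])
      exact ⟨hp, hp2, hb, hb2⟩
    · have := c.τ_mem a x
      rw [baseChange_sup, baseChange_sup] at this
      refine (sup_le (sup_le ?_ ?_) le_sup_right : _ ≤ c.P''.baseChange A ⊔ Q.baseChange A ⊔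
        c.B''.baseChange A) this
      · exact le_sup_left.trans le_sup_left
      · exact c.Q''_le.trans (le_sup_right.trans le_sup_left)
    · rw [← baseChange_sup]
      refine sup_le (hW.le.trans (sup_le (sup_le ?_ ?_) ?_)) le_sup_right
      · exact le_sup_left.trans le_sup_left
      · exact h.F_le_Q.trans le_sup_right
      · exact (X_le_sup_Q a).trans (sup_le_sup_right le_sup_right _)
  have hP : ((c.Q' ⊔ c.B').baseChange A).map (LinearMap.id + c.τ A a) ≤ W ⊔ P.baseChange A := by
    have hdis := h.isCompl_F.disjoint
    have htop := h.isCompl_P.sup_eq_top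
    rw [baseChange_sup] at htop ⊢
    refine graph_le_of_le_graph (G := F) ?_ (fun x hx => c.τ_Q'_mem a hx) (fun x hx => ?_) ?_ htop
    · intro g hg p' hp' p'' hp'' q hq b' hb' b'' hb'' hs
      have hg0 : g = 0 := Submodule.disjoint_def.1 hdis _ hg (by
        rw [show g = -(p' + p'' + q + (b' + b'')) by
          rw [eq_neg_iff_add_eq_zero, ← hs]; abel]
        simp only [baseChange_sup]
        exact neg_mem (Submodule.add_mem_sup (Submodule.add_mem_sup
          (Submodule.add_mem_sup hp' hp'') hq) (Submodule.add_mem_sup hb' hb'')))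
      rw [hg0, zero_add] at hs
      obtain ⟨-, h1, h3⟩ := c.eq_zero_of_sum hq (add_mem (c.Q'_le hp') (c.Q''_le hp''))
        (add_mem (c.B'_le hb') (c.B''_le hb'')) (by rw [← hs]; abel)
      obtain ⟨hp, -, hp2⟩ := eq_zero_of_add_add_eq_zero (Q := ⊥) disjoint_bot_right
        (by rw [sup_bot_eq]; exact disjoint_baseChange c.disjoint_Q) hp' (zero_mem _) hp''
        (by rwa [add_zero])
      obtain ⟨hb, -, hb2⟩ := eq_zero_of_add_add_eq_zero (Q := ⊥) disjoint_bot_right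
        (by rw [sup_bot_eq]; exact disjoint_baseChange c.disjoint_B) hb' (zero_mem _) hb''
        (by rwa [add_zero])
      exact ⟨hp, hp2, hb, hb2⟩
    · have := c.τ_mem a x
      rw [baseChange_sup, baseChange_sup] at this
      refine (sup_le (sup_le ?_ ?_) le_sup_right : _ ≤ c.Q''.baseChange A ⊔ P.baseChange A ⊔
        c.B''.baseChange A) this
      · exact c.P''_le.trans (le_sup_right.trans le_sup_left)
      · exact le_sup_left.trans le_sup_left
    · rw [← baseChange_sup]
      refine sup_le (hW.le.trans (sup_le (sup_le ?_ ?_) ?_)) le_sup_right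
      · exact h.G_le_P.trans le_sup_right
      · exact le_sup_left.trans le_sup_left
      · exact (X_le_sup_P a).trans (sup_le_sup_right le_sup_right _)
  rw [baseChange_sup, baseChange_sup] at hx
  obtain ⟨y, hy, b, hb, rfl⟩ := Submodule.mem_sup.1 hx
  obtain ⟨p, hp, q, hq, rfl⟩ := Submodule.mem_sup.1 hy
  have e : p + q + b + c.τ A a (p + q + b) =
      (p + b + c.τ A a (p + b)) + (q + c.τ A a q) := by simp only [map_add]; abel
  have e' : p + q + b + c.τ A a (p + q + b) =
      (q + b + c.τ A a (q + b)) + (p + c.τ A a p) := by simp only [map_add]; abel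
  constructor
  · rw [e]
    refine add_mem (hQ ⟨p + b, ?_, rfl⟩) (Submodule.mem_sup_right
      (add_mem (c.Q'_le hq) (c.Q''_le (c.τ_Q'_mem a hq))))
    rw [baseChange_sup]; exact Submodule.add_mem_sup hp hb
  · rw [e']
    refine add_mem (hP ⟨q + b, ?_, rfl⟩) (Submodule.mem_sup_right
      (add_mem (c.P'_le hp) (c.P''_le (c.τ_P'_mem a hp))))
    rw [baseChange_sup]; exact Submodule.add_mem_sup hq hb

/-- The parameters of a submodule in good position are unique. -/
theorem Good.param_unique [FiniteDimensional k M] (h : c.Good G F W) {a b : A ⊗[k] c.L}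
    (ha : W = G ⊔ F ⊔ c.X a) (hb : W = G ⊔ F ⊔ c.X b) : a = b := by
  have hτ : ∀ x ∈ (c.P' ⊔ c.Q' ⊔ c.B').baseChange A, c.τ A a x = c.τ A b x := fun x hx => by
    rw [← sub_eq_zero]
    refine Submodule.disjoint_def.1 h.isCompl_inf.disjoint _ ?_
      (sub_mem (c.τ_mem a x) (c.τ_mem b x))
    have := sub_mem (h.id_add_τ_mem ha hx) (h.id_add_τ_mem hb hx)
    convert this using 1; abel
  refine c.param_ext hτ fun x hx => ?_
  have hxa : x + c.σ A a x + c.τ A a (x + c.σ A a x) ∈ W :=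
    ha ▸ Submodule.mem_sup_right ((mem_X c).2 ⟨x, hx, rfl⟩)
  have hxb : x + c.σ A b x + c.τ A b (x + c.σ A b x) ∈ W :=
    hb ▸ Submodule.mem_sup_right ((mem_X c).2 ⟨x, hx, rfl⟩)
  have h0 : (c.σ A a x - c.σ A b x) + (c.τ A a (x + c.σ A a x) - c.τ A b (x + c.σ A b x)) = 0 := by
    refine Submodule.disjoint_def.1 h.isCompl.disjoint _ ?_ ?_
    · have := sub_mem hxa hxb
      convert this using 1; abel
    · rw [baseChange_sup]
      exact Submodule.add_mem_sup (sub_mem (c.σ_mem a x) (c.σ_mem b x))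
        (sub_mem (c.τ_mem a _) (c.τ_mem b _))
  have h1 : c.σ A a x - c.σ A b x = 0 := by
    refine Submodule.disjoint_def.1 (disjoint_baseChange (A := A) c.disjoint_H_N) _
      (Submodule.baseChange_mono A H₁_le (sub_mem (c.σ_mem a x) (c.σ_mem b x))) ?_
    rw [eq_neg_of_add_eq_zero_left h0]
    exact neg_mem (sub_mem (c.τ_mem a _) (c.τ_mem b _))
  exact sub_eq_zero.1 h1

end
end Spot

end

/-! ### Openness and dimensions of good position -/

section

namespace Spot

section

variable {k : Type u} [Field k] {M : Type*} [AddCommGroup M] [Module k M]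
  {P Q : Submodule k M} {c : Spot P Q}

/-- The conditions of `Spot.Good` that define an open subset. -/
structure Spans (c : Spot P Q) {A : Type*} [CommRing A] [Algebra k A]
    (G F W : Submodule A (A ⊗[k] M)) : Prop where
  sup_G : G ⊔ (c.P' ⊔ c.P'' ⊔ Q ⊔ (c.B' ⊔ c.B'')).baseChange A = ⊤
  sup_F : F ⊔ (c.Q' ⊔ c.Q'' ⊔ P ⊔ (c.B' ⊔ c.B'')).baseChange A = ⊤
  sup_Q : (W ⊔ Q.baseChange A) ⊔ (c.P'' ⊔ c.B'').baseChange A = ⊤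
  sup_P : (W ⊔ P.baseChange A) ⊔ (c.Q'' ⊔ c.B'').baseChange A = ⊤
  sup : W ⊔ (c.H₁ ⊔ (c.P'' ⊔ c.Q'' ⊔ c.B'')).baseChange A = ⊤

section

variable {A : Type*} [CommRing A] [Algebra k A] {G F W : Submodule A (A ⊗[k] M)}

theorem Good.spans (h : c.Good G F W) : c.Spans G F W :=
  ⟨h.isCompl_G.sup_eq_top, h.isCompl_F.sup_eq_top, h.isCompl_Q.sup_eq_top, h.isCompl_P.sup_eq_top,
    h.isCompl.sup_eq_top⟩

theorem le_map_sup_Q (hF : F ≤ Q.baseChange A) (a : A ⊗[k] c.L) : G ⊔ F ⊔ c.X a ≤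
    (G ⊔ ((c.P' ⊔ c.B').baseChange A).map (LinearMap.id + c.τ A a)) ⊔ Q.baseChange A :=
  sup_le (sup_le (le_sup_left.trans le_sup_left) (hF.trans le_sup_right))
    ((X_le_sup_Q a).trans (sup_le_sup_right le_sup_right _))

theorem le_map_sup_P (hG : G ≤ P.baseChange A) (a : A ⊗[k] c.L) : G ⊔ F ⊔ c.X a ≤
    (F ⊔ ((c.Q' ⊔ c.B').baseChange A).map (LinearMap.id + c.τ A a)) ⊔ P.baseChange A :=
  sup_le (sup_le (hG.trans le_sup_right) (le_sup_left.trans le_sup_left))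
    ((X_le_sup_P a).trans (sup_le_sup_right le_sup_right _))

theorem X_pullback {B : Type*} [CommRing B] [Algebra k B] (φ : A →ₐ[k] B) (a : A ⊗[k] c.L) :
    pullback φ (c.X a) = c.X (φ.toLinearMap.rTensor _ a) := by
  have key : ∀ h, φ.toLinearMap.rTensor M (h + c.σ A a h + c.τ A a (h + c.σ A a h)) =
      φ.toLinearMap.rTensor M h + c.σ B (φ.toLinearMap.rTensor _ a) (φ.toLinearMap.rTensor M h) +
      c.τ B (φ.toLinearMap.rTensor _ a) (φ.toLinearMap.rTensor M h +
        c.σ B (φ.toLinearMap.rTensor _ a) (φ.toLinearMap.rTensor M h)) := fun h => by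
    simp only [map_add, rTensor_act]
  refine le_antisymm (pullback_le.2 fun x hx => ?_) ?_
  · obtain ⟨h, hh, rfl⟩ := (mem_X c).1 hx
    rw [key]
    exact (mem_X c).2 ⟨_, pullback_baseChange φ c.H₀ ▸ rTensor_mem_pullback φ hh, rfl⟩
  · rw [X, ← pullback_baseChange φ, pullback, Submodule.map_span, Submodule.map_span,
      Submodule.span_le]
    rintro _ ⟨_, ⟨_, ⟨h, hh, rfl⟩, rfl⟩, rfl⟩
    have := rTensor_mem_pullback φ ((mem_X c).2 ⟨h, hh, rfl⟩ : _ ∈ c.X a)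
    rw [key] at this
    exact this

end

variable {A : Type u} [CommRing A] [Algebra k A] {G F W : Submodule A (A ⊗[k] M)}

theorem Good.pullback {B : Type u} [CommRing B] [Algebra k B] (φ : A →ₐ[k] B)
    (h : c.Good G F W) :
    c.Good (LinkedGr.pullback φ G) (LinkedGr.pullback φ F) (LinkedGr.pullback φ W) where
  G_le_P := (pullback_mono φ h.G_le_P).trans (pullback_baseChange φ P).le
  F_le_Q := (pullback_mono φ h.F_le_Q).trans (pullback_baseChange φ Q).le
  G_le := pullback_mono φ h.G_le
  F_le := pullback_mono φ h.F_le
  isCompl_G := isCompl_pullback φ h.isCompl_G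
  isCompl_F := isCompl_pullback φ h.isCompl_F
  isCompl_Q := by
    have := isCompl_pullback φ h.isCompl_Q
    rwa [pullback_sup, pullback_baseChange] at this
  isCompl_P := by
    have := isCompl_pullback φ h.isCompl_P
    rwa [pullback_sup, pullback_baseChange] at this
  isCompl_PQ := by
    have := isCompl_pullback φ h.isCompl_PQ
    rwa [pullback_sup, pullback_baseChange] at this
  isCompl := isCompl_pullback φ h.isCompl

/-- The conditions of `Spot.Good` are open. -/
theorem Spans.exists_open [FiniteDimensional k M] {K : Type u} [Field K] [Algebra k K] {φ : A →ₐ[k] K}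
    (h : c.Spans (LinkedGr.pullback φ G) (LinkedGr.pullback φ F) (LinkedGr.pullback φ W)) :
    ∃ f : A, φ f ≠ 0 ∧ ∀ (B : Type u) [CommRing B] [Algebra k B] (ψ : A →ₐ[k] B), IsUnit (ψ f) →
      c.Spans (LinkedGr.pullback ψ G) (LinkedGr.pullback ψ F) (LinkedGr.pullback ψ W) := by
  obtain ⟨f₁, h₁, H₁⟩ := exists_isUnit_sup_eq_top h.sup_G
  obtain ⟨f₂, h₂, H₂⟩ := exists_isUnit_sup_eq_top h.sup_F
  obtain ⟨f₃, h₃, H₃⟩ := exists_isUnit_sup_eq_top (W := W ⊔ Q.baseChange A) (S := c.P'' ⊔ c.B'') (φ := φ) (by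
    rw [pullback_sup, pullback_baseChange]; exact h.sup_Q)
  obtain ⟨f₄, h₄, H₄⟩ := exists_isUnit_sup_eq_top (W := W ⊔ P.baseChange A) (S := c.Q'' ⊔ c.B'') (φ := φ) (by
    rw [pullback_sup, pullback_baseChange]; exact h.sup_P)
  obtain ⟨f₅, h₅, H₅⟩ := exists_isUnit_sup_eq_top h.sup
  refine ⟨f₁ * f₂ * f₃ * f₄ * f₅, by simp [h₁, h₂, h₃, h₄, h₅], fun B _ _ ψ hψ => ?_⟩
  simp only [map_mul, IsUnit.mul_iff] at hψ
  obtain ⟨⟨⟨⟨u₁, u₂⟩, u₃⟩, u₄⟩, u₅⟩ := hψ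
  refine ⟨H₁ B ψ u₁, H₂ B ψ u₂, ?_, ?_, H₅ B ψ u₅⟩
  · have := H₃ B ψ u₃
    rwa [pullback_sup, pullback_baseChange] at this
  · have := H₄ B ψ u₄
    rwa [pullback_sup, pullback_baseChange] at this

/-- The dimensions of the summands fit the ranks `γ` of `G` and `φ` of `F`. -/
structure Fits (c : Spot P Q) (γ φ : ℕ) : Prop where
  P_eq : γ + Module.finrank k c.P' + Module.finrank k c.P'' = Module.finrank k P
  Q_eq : φ + Module.finrank k c.Q' + Module.finrank k c.Q'' = Module.finrank k Q

section

variable [FiniteDimensional k M]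

variable (c)

theorem finrank_M : Module.finrank k M = Module.finrank k P + Module.finrank k Q +
    Module.finrank k c.B' + Module.finrank k c.B'' := by
  rw [← Submodule.finrank_add_eq_of_isCompl c.isCompl_B, finrank_sup_of_disjoint c.disjoint_PQ,
    finrank_sup_of_disjoint c.disjoint_B, add_assoc (_ + _)]

theorem finrank_H : Module.finrank k c.H₀ + Module.finrank k c.H₁ =
    Module.finrank k c.P' + Module.finrank k c.Q' + Module.finrank k c.B' := by
  have h1 : Disjoint c.P' c.Q' := c.disjoint_PQ.mono (le_sup_left.trans c.le_P)
    (le_sup_left.trans c.le_Q)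
  have h2 : Disjoint (c.P' ⊔ c.Q') c.B' := c.isCompl_B.disjoint.mono
    (sup_le_sup (le_sup_left.trans c.le_P) (le_sup_left.trans c.le_Q)) le_sup_left
  rw [← finrank_sup_of_disjoint c.disjoint_H, c.sup_H, finrank_sup_of_disjoint h2,
    finrank_sup_of_disjoint h1]

theorem finrank_N : Module.finrank k (c.P'' ⊔ c.Q'' ⊔ c.B'' : Submodule k M) =
    Module.finrank k c.P'' + Module.finrank k c.Q'' + Module.finrank k c.B'' := by
  have h1 : Disjoint c.P'' c.Q'' := c.disjoint_PQ.mono (le_sup_right.trans c.le_P)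
    (le_sup_right.trans c.le_Q)
  have h2 : Disjoint (c.P'' ⊔ c.Q'') c.B'' := c.isCompl_B.disjoint.mono
    (sup_le_sup (le_sup_right.trans c.le_P) (le_sup_right.trans c.le_Q)) le_sup_right
  rw [finrank_sup_of_disjoint h2, finrank_sup_of_disjoint h1]

theorem finrank_HN : Module.finrank k (c.H₁ ⊔ (c.P'' ⊔ c.Q'' ⊔ c.B'') : Submodule k M) =
    Module.finrank k c.H₁ + (Module.finrank k c.P'' + Module.finrank k c.Q'' +
      Module.finrank k c.B'') := by
  rw [finrank_sup_of_disjoint (c.disjoint_H_N.mono_left H₁_le), finrank_N]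

theorem finrank_PB : Module.finrank k (c.P'' ⊔ c.B'' : Submodule k M) =
    Module.finrank k c.P'' + Module.finrank k c.B'' :=
  finrank_sup_of_disjoint (c.isCompl_B.disjoint.mono
    ((le_sup_right.trans c.le_P).trans le_sup_left) le_sup_right)

theorem finrank_QB : Module.finrank k (c.Q'' ⊔ c.B'' : Submodule k M) =
    Module.finrank k c.Q'' + Module.finrank k c.B'' :=
  finrank_sup_of_disjoint (c.isCompl_B.disjoint.mono
    ((le_sup_right.trans c.le_Q).trans le_sup_right) le_sup_right)

theorem finrank_PQB : Module.finrank k (c.P' ⊔ c.P'' ⊔ Q ⊔ (c.B' ⊔ c.B'') : Submodule k M) =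
    Module.finrank k c.P' + Module.finrank k c.P'' + Module.finrank k Q +
      (Module.finrank k c.B' + Module.finrank k c.B'') := by
  rw [finrank_sup_of_disjoint (c.isCompl_B.disjoint.mono_left (sup_le_sup_right c.le_P Q)),
    finrank_sup_of_disjoint (c.disjoint_PQ.mono_left c.le_P), finrank_sup_of_disjoint c.disjoint_P,
    finrank_sup_of_disjoint c.disjoint_B]

theorem finrank_QPB : Module.finrank k (c.Q' ⊔ c.Q'' ⊔ P ⊔ (c.B' ⊔ c.B'') : Submodule k M) =
    Module.finrank k c.Q' + Module.finrank k c.Q'' + Module.finrank k P +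
      (Module.finrank k c.B' + Module.finrank k c.B'') := by
  rw [finrank_sup_of_disjoint (c.isCompl_B.disjoint.mono_left
    ((sup_comm _ _).le.trans (sup_le_sup_left c.le_Q P))),
    finrank_sup_of_disjoint (c.disjoint_PQ.symm.mono_left c.le_Q),
    finrank_sup_of_disjoint c.disjoint_Q, finrank_sup_of_disjoint c.disjoint_B]

/-- The number of parameters of a splitting. -/
theorem finrank_L : Module.finrank k c.L =
    Module.finrank k c.P' * Module.finrank k c.P'' + (Module.finrank k c.Q' * Module.finrank k c.Q''
      + (Module.finrank k c.B' * (Module.finrank k c.P'' + Module.finrank k c.Q'' +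
        Module.finrank k c.B'') + Module.finrank k c.H₀ * Module.finrank k c.H₁)) := by
  rw [Module.finrank_prod, Module.finrank_prod, Module.finrank_prod, Module.finrank_linearMap,
    Module.finrank_linearMap, Module.finrank_linearMap, Module.finrank_linearMap, finrank_N]

variable {c}

theorem subGen_graph_P {γ : ℕ} (hG : SubGen G γ) (a : A ⊗[k] c.L) :
    SubGen (G ⊔ ((c.P' ⊔ c.B').baseChange A).map (LinearMap.id + c.τ A a))
      (γ + (Module.finrank k c.P' + Module.finrank k c.B')) := by
  refine hG.sup ?_
  rw [← finrank_sup_of_disjoint (c.isCompl_B.disjoint.mono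
    ((le_sup_left.trans c.le_P).trans le_sup_left) le_sup_left)]
  exact (subGen_baseChange _).map _

theorem subGen_graph_Q {φ : ℕ} (hF : SubGen F φ) (a : A ⊗[k] c.L) :
    SubGen (F ⊔ ((c.Q' ⊔ c.B').baseChange A).map (LinearMap.id + c.τ A a))
      (φ + (Module.finrank k c.Q' + Module.finrank k c.B')) := by
  refine hF.sup ?_
  rw [← finrank_sup_of_disjoint (c.isCompl_B.disjoint.mono
    ((le_sup_left.trans c.le_Q).trans le_sup_right) le_sup_left)]
  exact (subGen_baseChange _).map _

/-- Spanning conditions suffice for good position. If `G` and `F` are generated by as many elements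
as their prescribed ranks, each of the submodules in question is generated by as many elements as
the codimension of its prospective complement, and a spanning set of that size leaves no
intersection. -/
theorem Spans.good {γ φ : ℕ} (a : A ⊗[k] c.L) (h : c.Spans G F (G ⊔ F ⊔ c.X a)) (hc : c.Fits γ φ)
    (hGP : G ≤ P.baseChange A) (hFQ : F ≤ Q.baseChange A)
    (hG : SubGen G γ) (hF : SubGen F φ) : c.Good G F (G ⊔ F ⊔ c.X a) where
  G_le_P := hGP
  F_le_Q := hFQ
  G_le := le_sup_left.trans le_sup_left
  F_le := le_sup_right.trans le_sup_left
  isCompl_G := hG.isCompl (by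
    have := c.finrank_M; have := c.finrank_PQB; have := hc.P_eq; omega) h.sup_G
  isCompl_F := hF.isCompl (by
    have := c.finrank_M; have := c.finrank_QPB; have := hc.Q_eq; omega) h.sup_F
  isCompl_Q := (((subGen_graph_P hG a).sup (subGen_baseChange Q)).mono
    (sup_le (le_map_sup_Q hFQ a) le_sup_right)).isCompl (by
      have := c.finrank_M; have := c.finrank_PB; have := hc.P_eq; omega) h.sup_Q
  isCompl_P := (((subGen_graph_Q hF a).sup (subGen_baseChange P)).mono
    (sup_le (le_map_sup_P hGP a) le_sup_right)).isCompl (by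
      have := c.finrank_M; have := c.finrank_QB; have := hc.Q_eq; omega) h.sup_P
  isCompl_PQ := by
    have h1 : SubGen (((c.B').baseChange A).map (LinearMap.id + c.τ A a) ⊔ (P ⊔ Q).baseChange A)
        (Module.finrank k c.B' + (Module.finrank k P + Module.finrank k Q)) := by
      rw [← finrank_sup_of_disjoint c.disjoint_PQ]
      exact ((subGen_baseChange _).map _).sup (subGen_baseChange _)
    refine (h1.mono (sup_le ((le_map_sup_Q hFQ a).trans ?_) le_sup_right)).isCompl ?_ ?_
    · rw [baseChange_sup, Submodule.map_sup, baseChange_sup]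
      refine sup_le (sup_le ?_ (sup_le ?_ le_sup_left)) (le_sup_right.trans le_sup_right)
      · exact hGP.trans (le_sup_left.trans le_sup_right)
      · exact (map_id_add_τ_P'_le a).trans (le_sup_left.trans le_sup_right)
    · have := c.finrank_M; omega
    · rw [eq_top_iff, ← h.sup_Q]
      have hP'' : c.P''.baseChange A ≤ (P ⊔ Q).baseChange A :=
        c.P''_le.trans (Submodule.baseChange_mono A le_sup_left)
      rw [baseChange_sup c.P'']
      refine sup_le (sup_le (le_sup_left.trans le_sup_left) ?_) (sup_le ?_ le_sup_right)
      · exact (Submodule.baseChange_mono A le_sup_right).trans (le_sup_right.trans le_sup_left)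
      · exact hP''.trans (le_sup_right.trans le_sup_left)
  isCompl := by
    have h1 : SubGen (c.X a) (Module.finrank k c.H₀) := ((subGen_baseChange _).map _).map _
    refine ((hG.sup hF).sup h1).isCompl ?_ h.sup
    have := c.finrank_M
    have := c.finrank_HN
    have := c.finrank_H
    have := hc.P_eq
    have := hc.Q_eq
    omega

end

section Field

variable [FiniteDimensional k M] {K : Type u} [Field K] [Algebra k K]
  {G F W : Submodule K (K ⊗[k] M)}

/-- Over a field, the dimensions of the summands of a chart in good position are determined. -/
theorem Good.finrank_eq (h : c.Good G F W) :
    Module.finrank K G + Module.finrank k c.P' + Module.finrank k c.P'' = Module.finrank k P ∧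
    Module.finrank K F + Module.finrank k c.Q' + Module.finrank k c.Q'' = Module.finrank k Q ∧
    Module.finrank K (W ⊔ Q.baseChange K : Submodule K _) + Module.finrank k c.P'' +
      Module.finrank k c.B'' = Module.finrank k M ∧
    Module.finrank K (W ⊔ P.baseChange K : Submodule K _) + Module.finrank k c.Q'' +
      Module.finrank k c.B'' = Module.finrank k M ∧
    Module.finrank K (W ⊔ (P ⊔ Q).baseChange K : Submodule K _) + Module.finrank k c.B'' =
      Module.finrank k M ∧
    Module.finrank K W + Module.finrank k c.H₁ + (Module.finrank k c.P'' + Module.finrank k c.Q'' +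
      Module.finrank k c.B'') = Module.finrank k M := by
  have := finrank_add_of_isCompl h.isCompl_G
  have := finrank_add_of_isCompl h.isCompl_F
  have := finrank_add_of_isCompl h.isCompl_Q
  have := finrank_add_of_isCompl h.isCompl_P
  have := finrank_add_of_isCompl h.isCompl_PQ
  have := finrank_add_of_isCompl h.isCompl
  have := c.finrank_M
  have := c.finrank_HN
  have := c.finrank_PB
  have := c.finrank_QB
  have := c.finrank_PQB
  have := c.finrank_QPB
  omega

/-- Over a field, every configuration lies in good position to some chart. -/
theorem exists_good (hPQ : Disjoint P Q) (hGP : G ≤ P.baseChange K)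
    (hFQ : F ≤ Q.baseChange K) (hG : G ≤ W) (hF : F ≤ W) : ∃ c : Spot P Q, c.Good G F W := by
  obtain ⟨B, hB⟩ := exists_isCompl (P ⊔ Q)
  -- complements of `G` in `P` and of `F` in `Q`
  have key : ∀ {P Q : Submodule k M} {G : Submodule K (K ⊗[k] M)}, Disjoint P Q →
      IsCompl (P ⊔ Q) B → G ≤ P.baseChange K → ∃ N ≤ P, IsCompl G ((N ⊔ Q ⊔ B).baseChange K) ∧
        P.baseChange K ≤ G ⊔ N.baseChange K := by
    intro P Q G hPQ hB hGP
    have htop : (⊤ : Submodule K (K ⊗[k] M)) = P.baseChange K ⊔ (Q ⊔ B).baseChange K := by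
      rw [← baseChange_sup, ← sup_assoc, hB.sup_eq_top, Submodule.baseChange_top]
    have hdis : Disjoint (P.baseChange K) ((Q ⊔ B).baseChange K) :=
      disjoint_baseChange (hPQ.disjoint_sup_right_of_disjoint_sup_left hB.disjoint)
    obtain ⟨N, -, hNP, hN⟩ := exists_isCompl_between (G ⊔ (Q ⊔ B).baseChange K)
      (bot_le (a := P)) (by rw [Submodule.baseChange_bot, inf_bot_eq]) (by
        rw [eq_top_iff, htop]
        exact sup_le le_sup_right (le_sup_right.trans le_sup_left))
    have hNK := Submodule.baseChange_mono K hNP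
    refine ⟨N, hNP, ⟨Submodule.disjoint_def.2 fun g hg hg' => ?_, codisjoint_iff.2 ?_⟩,
      fun x hx => ?_⟩
    · rw [sup_assoc, baseChange_sup] at hg'
      obtain ⟨n, hn, y, hy, rfl⟩ := Submodule.mem_sup.1 hg'
      have hn0 : n = 0 := Submodule.disjoint_def.1 hN.disjoint _ (by
        rw [show n = (n + y) - y by abel]
        exact sub_mem (Submodule.mem_sup_left hg) (Submodule.mem_sup_right hy)) hn
      rw [hn0, zero_add] at hg ⊢
      exact Submodule.disjoint_def.1 hdis _ (hGP hg) hy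
    · rw [sup_assoc N, baseChange_sup, ← sup_assoc, sup_right_comm, hN.sup_eq_top]
    · obtain ⟨z, hz, n, hn, rfl⟩ := Submodule.mem_sup.1
        (hN.sup_eq_top.ge (Submodule.mem_top (x := x)))
      obtain ⟨g, hg, y, hy, rfl⟩ := Submodule.mem_sup.1 hz
      have hy0 : y = 0 := Submodule.disjoint_def.1 hdis _ (by
        rw [show y = (g + y + n) - g - n by abel]
        exact sub_mem (sub_mem hx (hGP hg)) (hNK hn)) hy
      rw [hy0, add_zero]
      exact Submodule.add_mem_sup hg hn
  obtain ⟨N, hNP, hGN, hPN⟩ := key hPQ hB hGP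
  obtain ⟨N', hNQ, hFN, hQN⟩ := key hPQ.symm (sup_comm P Q ▸ hB) hFQ
  have htop : (⊤ : Submodule K (K ⊗[k] M)) = P.baseChange K ⊔ Q.baseChange K ⊔ B.baseChange K := by
    rw [← baseChange_sup, ← baseChange_sup, hB.sup_eq_top, Submodule.baseChange_top]
  -- the part of the complement that is missing in `W ⊔ P ⊔ Q`
  obtain ⟨B'', -, hB''B, hB''⟩ := exists_isCompl_between (W ⊔ (P ⊔ Q).baseChange K)
    (bot_le (a := B)) (by rw [Submodule.baseChange_bot, inf_bot_eq]) (by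
      rw [eq_top_iff, htop, ← baseChange_sup]
      exact sup_le_sup_right le_sup_right _)
  obtain ⟨B', hBd, hBs⟩ := exists_disjoint_sup_eq hB''B
  -- the parts of `P` and `Q` that are missing in `W ⊔ Q` and `W ⊔ P`
  have key₂ : ∀ {P Q N : Submodule k M} {G : Submodule K (K ⊗[k] M)}, G ≤ W →
      IsCompl (W ⊔ (P ⊔ Q).baseChange K) (B''.baseChange K) →
      P.baseChange K ≤ G ⊔ N.baseChange K →
      ∃ P'' ≤ N, IsCompl (W ⊔ Q.baseChange K) ((P'' ⊔ B'').baseChange K) := by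
    intro P Q N G hG hB'' hPN
    obtain ⟨U, hU₁, hU₂, hU⟩ := exists_isCompl_between (W ⊔ Q.baseChange K) (S := B'')
      (T := N ⊔ B'') le_sup_right (eq_bot_iff.2 ((inf_le_inf_right _ (sup_le_sup_left
        (Submodule.baseChange_mono K le_sup_right) W)).trans hB''.inf_eq_bot.le)) (by
        rw [eq_top_iff, ← hB''.sup_eq_top, baseChange_sup, baseChange_sup]
        refine sup_le (sup_le (le_sup_left.trans le_sup_left) (sup_le (hPN.trans (sup_le ?_ ?_))
          (le_sup_right.trans le_sup_left))) (le_sup_right.trans le_sup_right)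
        · exact hG.trans (le_sup_left.trans le_sup_left)
        · exact le_sup_left.trans le_sup_right)
    refine ⟨U ⊓ N, inf_le_right, ?_⟩
    rwa [inf_sup_assoc_of_le _ hU₁, inf_eq_left.2 hU₂]
  obtain ⟨P'', hP''N, hP''⟩ := key₂ hG hB'' hPN
  obtain ⟨Q'', hQ''N, hQ''⟩ := key₂ hF (sup_comm P Q ▸ hB'') hQN
  obtain ⟨P', hPd, hPs⟩ := exists_disjoint_sup_eq hP''N
  obtain ⟨Q', hQd, hQs⟩ := exists_disjoint_sup_eq hQ''N
  -- the rest of a complement of `W`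
  obtain ⟨U, hU₁, hU₂, hU⟩ := exists_isCompl_between W (S := P'' ⊔ Q'' ⊔ B'')
    (T := (P' ⊔ Q' ⊔ B') ⊔ (P'' ⊔ Q'' ⊔ B'')) le_sup_right (by
      rw [eq_bot_iff]
      rintro x ⟨hx, hx'⟩
      rw [SetLike.mem_coe, baseChange_sup, baseChange_sup] at hx'
      obtain ⟨y, hy, b, hb, rfl⟩ := Submodule.mem_sup.1 hx'
      obtain ⟨p, hp, q, hq, rfl⟩ := Submodule.mem_sup.1 hy
      have hpP := Submodule.baseChange_mono K (hP''N.trans hNP) hp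
      have hqQ := Submodule.baseChange_mono K (hQ''N.trans hNQ) hq
      have h1 : p + b = 0 := Submodule.disjoint_def.1 hP''.disjoint _ (by
        rw [show p + b = (p + q + b) - q by abel]
        exact sub_mem (Submodule.mem_sup_left hx) (Submodule.mem_sup_right hqQ)) (by
        rw [baseChange_sup]; exact Submodule.add_mem_sup hp hb)
      have h2 : q + b = 0 := Submodule.disjoint_def.1 hQ''.disjoint _ (by
        rw [show q + b = (p + q + b) - p by abel]
        exact sub_mem (Submodule.mem_sup_left hx) (Submodule.mem_sup_right hpP)) (by
        rw [baseChange_sup]; exact Submodule.add_mem_sup hq hb)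
      obtain ⟨hp0, -, hb0⟩ := eq_zero_of_add_add_eq_zero (disjoint_baseChange (A := K) hPQ)
        (by rw [← baseChange_sup]; exact disjoint_baseChange hB.disjoint) hpP (zero_mem _)
        (Submodule.baseChange_mono K hB''B hb) (by rwa [add_zero])
      rw [hb0, add_zero] at h2
      rw [hp0, h2, hb0, add_zero, add_zero]
      exact zero_mem _) (by
      have e : (P' ⊔ Q' ⊔ B') ⊔ (P'' ⊔ Q'' ⊔ B'') = N ⊔ N' ⊔ B := by
        rw [← hPs, ← hQs, ← hBs]; ac_rfl
      rw [e, eq_top_iff, htop, baseChange_sup, baseChange_sup]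
      refine sup_le (sup_le (hPN.trans (sup_le (hG.trans le_sup_left) ?_))
        (hQN.trans (sup_le (hF.trans le_sup_left) ?_))) ?_
      · exact (le_sup_left.trans le_sup_left).trans le_sup_right
      · exact (le_sup_right.trans le_sup_left).trans le_sup_right
      · exact le_sup_right.trans le_sup_right)
  obtain ⟨H₀, hHd, hHs⟩ := exists_disjoint_sup_eq (inf_le_right : U ⊓ (P' ⊔ Q' ⊔ B') ≤ _)
  refine ⟨⟨P', P'', Q', Q'', B', B'', H₀, U ⊓ (P' ⊔ Q' ⊔ B'), hPs.trans_le hNP, hQs.trans_le hNQ,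
    hPd, hQd, hBd, hPQ, hBs.symm ▸ hB, hHd, hHs⟩, ⟨hGP, hFQ, hG, hF, ?_, ?_, hP'', hQ'', hB'', ?_⟩⟩
  · simpa only [hPs, hBs] using hGN
  · simpa only [hQs, hBs] using hFN
  · have : U ⊓ (P' ⊔ Q' ⊔ B') ⊔ (P'' ⊔ Q'' ⊔ B'') = U := by
      rw [inf_sup_assoc_of_le _ hU₁, inf_eq_left.2 hU₂]
    simpa only [this] using hU

end Field

end

end Spot

end

/-! ### Chains and linked families -/

section

/-- The subsheaf of a Zariski sheaf that is defined by a local property. -/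
def ZariskiSheaf.sub {k : Type u} [CommRing k] (F : ZariskiSheaf.{u, w} k)
    (Φ : ∀ {A : Type u} [CommRing A] [Algebra k A], F.obj A → Prop)
    (map : ∀ {A B : Type u} [CommRing A] [CommRing B] [Algebra k A] [Algebra k B] (φ : A →ₐ[k] B)
      (a : F.obj A), Φ a → Φ (F.map φ a))
    (loc : ∀ {A : Type u} [CommRing A] [Algebra k A] (a : F.obj A),
      (∀ p : PrimeSpectrum A, ∃ f ∉ p.asIdeal, Φ (F.map (awayHom k f) a)) → Φ a) :
    ZariskiSheaf.{u, w} k where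
  obj A _ _ := {a : F.obj A // Φ a}
  map φ a := ⟨F.map φ a.1, map φ a.1 a.2⟩
  map_id a := Subtype.ext (F.map_id a.1)
  map_comp φ ψ a := Subtype.ext (F.map_comp φ ψ a.1)
  sep a b h := Subtype.ext (F.sep _ _ fun p => by
    obtain ⟨f, hf, e⟩ := h p
    exact ⟨f, hf, congrArg Subtype.val e⟩)
  glue f hf a h := by
    obtain ⟨b, hb⟩ := F.glue f hf (fun p => (a p).1) fun p q C _ _ φ ψ e =>
      congrArg Subtype.val (h p q C φ ψ e)
    exact ⟨⟨b, loc b fun p => ⟨f p, hf p, by rw [hb]; exact (a p).2⟩⟩,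
      fun p => Subtype.ext (hb p)⟩

/-- A sequence of vector spaces `M 0, …, M (m + 1)` with maps `f` and `g` in both directions whose
composites vanish, such that the kernels of the two maps that start from an inner space are
disjoint. -/
structure Chain (k : Type u) [Field k] (m : ℕ) where
  M : ℕ → Type v
  [addCommGroup : ∀ i, AddCommGroup (M i)]
  [module : ∀ i, Module k (M i)]
  [finiteDimensional : ∀ i, FiniteDimensional k (M i)]
  f : ∀ i, M i →ₗ[k] M (i + 1)
  g : ∀ i, M (i + 1) →ₗ[k] M i
  f_comp_g : ∀ i, f i ∘ₗ g i = 0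
  g_comp_f : ∀ i, g i ∘ₗ f i = 0
  disjoint : ∀ i, i < m → Disjoint (LinearMap.ker (f (i + 1))) (LinearMap.ker (g i))
  subsingleton : ∀ i, m + 1 < i → Subsingleton (M i)

attribute [instance] Chain.addCommGroup Chain.module Chain.finiteDimensional

namespace Chain

variable {k : Type u} [Field k] {m : ℕ} (T : Chain.{u, v} k m)

/-- Linked families of rank `r` sub-bundles that are everything at both ends. -/
@[ext] structure Point (r : ℕ) (A : Type u) [CommRing A] [Algebra k A] where
  W : ∀ i, Submodule A (A ⊗[k] T.M i)
  isSubbundle : ∀ i < m, IsSubbundle A (W (i + 1)) r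
  first : W 0 = ⊤
  last : W (m + 1) = ⊤
  map_f_le : ∀ i, (W i).map ((T.f i).baseChange A) ≤ W (i + 1)
  map_g_le : ∀ i, (W (i + 1)).map ((T.g i).baseChange A) ≤ W i

variable {T} {r : ℕ} {A B : Type u} [CommRing A] [Algebra k A] [CommRing B] [Algebra k B]

/-- The pull-back of a linked family. -/
def Point.map (φ : A →ₐ[k] B) (P : T.Point r A) : T.Point r B where
  W i := pullback φ (P.W i)
  isSubbundle i hi := (P.isSubbundle i hi).pullback φ
  first := by rw [P.first, pullback_top]
  last := by rw [P.last, pullback_top]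
  map_f_le i := by rw [← pullback_map]; exact pullback_mono φ (P.map_f_le i)
  map_g_le i := by rw [← pullback_map]; exact pullback_mono φ (P.map_g_le i)

variable (T r)

/-- The Zariski sheaf of linked families. -/
def sheaf : ZariskiSheaf.{u, max u v} k where
  obj A _ _ := T.Point r A
  map φ P := P.map φ
  map_id P := Point.ext (funext fun i => pullback_id _)
  map_comp φ ψ P := Point.ext (funext fun i => pullback_comp φ ψ _)
  sep P P' h := Point.ext (funext fun i => eq_of_local fun p => by
    obtain ⟨f, hf, e⟩ := h p
    exact ⟨f, hf, congrFun (congrArg Point.W e) i⟩)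
  glue f hf P h := by
    choose U hU using fun i => exists_glue_submodule (M := T.M i) f hf (fun p => (P p).W i)
      fun p q C _ _ φ ψ e => congrFun (congrArg Point.W (h p q C φ ψ e)) i
    refine ⟨⟨U, fun i hi => isSubbundle_of_local fun p => ⟨f p, hf p, ?_⟩, ?_, ?_,
      fun i => le_of_local fun p => ⟨f p, hf p, ?_⟩,
      fun i => le_of_local fun p => ⟨f p, hf p, ?_⟩⟩, fun p => Point.ext (funext fun i => hU i p)⟩
    · rw [hU]; exact (P p).isSubbundle i hi
    · exact eq_of_local fun p => ⟨f p, hf p, by rw [hU, (P p).first, pullback_top]⟩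
    · exact eq_of_local fun p => ⟨f p, hf p, by rw [hU, (P p).last, pullback_top]⟩
    · rw [pullback_map, hU, hU]; exact (P p).map_f_le i
    · rw [pullback_map, hU, hU]; exact (P p).map_g_le i

end Chain

/-- Ranks prescribed for the images of a linked family in a chain under `g` and under `f`, and
modulo the kernels of both maps. -/
structure Ranks where
  g : ℕ → ℕ
  f : ℕ → ℕ
  z : ℕ → ℕ

namespace Chain

variable {k : Type u} [Field k] {m : ℕ} {T : Chain.{u, v} k m} {r : ℕ}
  {A B : Type u} [CommRing A] [Algebra k A] [CommRing B] [Algebra k B]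

/-- The ranks of the images of the inner members of the family are as prescribed. The conditions are
stated for the preimages in the members of the chain of these images. -/
def Point.InStratum (P : T.Point r A) (δ : Ranks) : Prop :=
  ∀ i < m,
    IsSubbundle A (P.W (i + 1) ⊔ (LinearMap.ker (T.g i)).baseChange A)
      (δ.g (i + 1) + Module.finrank k (LinearMap.ker (T.g i))) ∧
    IsSubbundle A (P.W (i + 1) ⊔ (LinearMap.ker (T.f (i + 1))).baseChange A)
      (δ.f (i + 1) + Module.finrank k (LinearMap.ker (T.f (i + 1)))) ∧
    IsSubbundle A (P.W (i + 1) ⊔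
        (LinearMap.ker (T.f (i + 1)) ⊔ LinearMap.ker (T.g i)).baseChange A)
      (δ.z (i + 1) + (Module.finrank k (LinearMap.ker (T.f (i + 1))) +
        Module.finrank k (LinearMap.ker (T.g i))))

theorem Point.InStratum.map {P : T.Point r A} {δ : Ranks} (h : P.InStratum δ) (φ : A →ₐ[k] B) :
    (P.map φ).InStratum δ := fun i hi => by
  obtain ⟨h₁, h₂, h₃⟩ := h i hi
  have h₁ := h₁.pullback φ
  have h₂ := h₂.pullback φ
  have h₃ := h₃.pullback φ
  rw [pullback_sup, pullback_baseChange] at h₁ h₂ h₃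
  exact ⟨h₁, h₂, h₃⟩

theorem Point.inStratum_of_local {P : T.Point r A} {δ : Ranks}
    (h : ∀ p : PrimeSpectrum A, ∃ f ∉ p.asIdeal, (P.map (awayHom k f)).InStratum δ) :
    P.InStratum δ := fun i hi => by
  refine ⟨isSubbundle_of_local fun p => ?_, isSubbundle_of_local fun p => ?_,
    isSubbundle_of_local fun p => ?_⟩ <;>
  obtain ⟨f, hf, h⟩ := h p <;>
  refine ⟨f, hf, ?_⟩ <;>
  rw [pullback_sup, pullback_baseChange]
  exacts [(h i hi).1, (h i hi).2.1, (h i hi).2.2]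

variable (T r) in
/-- The Zariski sheaf of linked families with prescribed ranks. -/
def stratumSheaf (δ : Ranks) : ZariskiSheaf.{u, max u v} k :=
  (T.sheaf r).sub (fun P => Point.InStratum P δ) (fun φ _ h => h.map φ)
    fun _ h => Point.inStratum_of_local h

/-! ### Linked families generated by given submodules -/

section Generate

variable {A : Type*} [CommRing A] [Algebra k A]

/-- The image under `f` of the preceding member of a family. -/
def fImage (W : ∀ i, Submodule A (A ⊗[k] T.M i)) : ∀ i, Submodule A (A ⊗[k] T.M i)
  | 0 => ⊥
  | i + 1 => (W i).map ((T.f i).baseChange A)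

/-- The operator whose fixed points are the families generated by `X`. -/
def step (X : ∀ i, Submodule A (A ⊗[k] T.M i)) :
    (∀ i, Submodule A (A ⊗[k] T.M i)) →o (∀ i, Submodule A (A ⊗[k] T.M i)) where
  toFun W i := X i ⊔ (W (i + 1)).map ((T.g i).baseChange A) ⊔ fImage W i
  monotone' W W' h i := by
    refine sup_le_sup (sup_le_sup_left (Submodule.map_mono (h _)) _) ?_
    cases i with
    | zero => exact le_rfl
    | succ i => exact Submodule.map_mono (h i)

/-- The smallest family that contains `X` and is closed under `f` and `g`. -/
def gen (X : ∀ i, Submodule A (A ⊗[k] T.M i)) : ∀ i, Submodule A (A ⊗[k] T.M i) :=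
  OrderHom.lfp (step X)

theorem step_gen (X : ∀ i, Submodule A (A ⊗[k] T.M i)) : step X (gen X) = gen X :=
  OrderHom.map_lfp _

theorem map_g_map_f (i : ℕ) (W : Submodule A (A ⊗[k] T.M i)) :
    (W.map ((T.f i).baseChange A)).map ((T.g i).baseChange A) = ⊥ := by
  rw [← Submodule.map_comp, ← LinearMap.baseChange_comp, T.g_comp_f, LinearMap.baseChange_zero,
    Submodule.map_zero]

theorem map_f_map_g (i : ℕ) (W : Submodule A (A ⊗[k] T.M (i + 1))) :
    (W.map ((T.g i).baseChange A)).map ((T.f i).baseChange A) = ⊥ := by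
  rw [← Submodule.map_comp, ← LinearMap.baseChange_comp, T.f_comp_g, LinearMap.baseChange_zero,
    Submodule.map_zero]

/-- The equation for the images under `g` alone: the part that comes from `f` is annihilated. -/
theorem map_g_eq {X W : ∀ i, Submodule A (A ⊗[k] T.M i)} (h : step X W = W) (i : ℕ) :
    (W (i + 1)).map ((T.g i).baseChange A) = (X (i + 1)).map ((T.g i).baseChange A) ⊔
      ((W (i + 1 + 1)).map ((T.g (i + 1)).baseChange A)).map ((T.g i).baseChange A) := by
  conv_lhs => rw [← congrFun h (i + 1)]
  change (X (i + 1) ⊔ _ ⊔ (W i).map _).map _ = _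
  rw [Submodule.map_sup, Submodule.map_sup, map_g_map_f, sup_bot_eq]

/-- The equation for the images under `f` alone: the part that comes from `g` is annihilated. -/
theorem map_f_eq {X W : ∀ i, Submodule A (A ⊗[k] T.M i)} (h : step X W = W) (i : ℕ) :
    (W i).map ((T.f i).baseChange A) = (X i).map ((T.f i).baseChange A) ⊔
      (fImage W i).map ((T.f i).baseChange A) := by
  conv_lhs => rw [← congrFun h i]
  change (X i ⊔ _ ⊔ _).map _ = _
  rw [Submodule.map_sup, Submodule.map_sup, map_f_map_g, sup_bot_eq]

theorem eq_of_subsingleton {i : ℕ} (hi : m + 1 < i) (W W' : Submodule A (A ⊗[k] T.M i)) :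
    W = W' := by
  have := T.subsingleton i hi
  have : Subsingleton (A ⊗[k] T.M i) := inferInstance
  exact Subsingleton.elim _ _

/-- The equations that define the family generated by `X` have only one solution: since `f` and `g`
annihilate each other, they determine the images under `g` by descending induction, and those under
`f` by ascending induction. -/
theorem eq_of_step_eq {X W W' : ∀ i, Submodule A (A ⊗[k] T.M i)} (h : step X W = W)
    (h' : step X W' = W') : W = W' := by
  have hg : ∀ j i, m + 1 ≤ i + j → (W (i + 1)).map ((T.g i).baseChange A) =
      (W' (i + 1)).map ((T.g i).baseChange A) := by
    intro j
    induction j with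
    | zero => exact fun i hi => by rw [eq_of_subsingleton (by omega) (W (i + 1)) (W' (i + 1))]
    | succ j ih =>
      intro i hi
      rw [map_g_eq h, map_g_eq h', ih (i + 1) (by omega)]
  have hf : ∀ i, fImage W i = fImage W' i := by
    intro i
    induction i with
    | zero => rfl
    | succ i ih =>
      change (W i).map _ = (W' i).map _
      rw [map_f_eq h, map_f_eq h', ih]
  funext i
  rw [← h, ← h']
  change X i ⊔ _ ⊔ _ = X i ⊔ _ ⊔ _
  rw [hf, hg (m + 1) i (by omega)]

/-- The pull-back of a generated family is generated by the pull-back of the generators, because it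
solves the same equations. -/
theorem pullback_gen {B : Type*} [CommRing B] [Algebra k B] (φ : A →ₐ[k] B)
    (X : ∀ i, Submodule A (A ⊗[k] T.M i)) :
    (fun i => pullback φ (gen X i)) = gen fun i => pullback φ (X i) := by
  refine eq_of_step_eq ?_ (step_gen _)
  funext i
  conv_rhs => rw [← step_gen]
  change pullback φ (X i) ⊔ Submodule.map _ _ ⊔ fImage _ i = pullback φ (X i ⊔ _ ⊔ fImage _ i)
  rw [pullback_sup, pullback_sup, pullback_map]
  congr 1
  cases i with
  | zero => exact (pullback_bot φ).symm
  | succ i => exact (pullback_map φ _ _).symm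

end Generate

end Chain

end

/-! ### Linked families with given parameters -/

section

namespace Chain

variable {k : Type u} [Field k] {m : ℕ} {T : Chain.{u, v} k m} {r : ℕ}

variable (T) in
/-- A chart of a stratum: a splitting at every inner member of the chain. -/
abbrev Frame := ∀ i : Fin m, Spot (LinearMap.ker (T.f (i + 1))) (LinearMap.ker (T.g i))

namespace Frame

variable (c : T.Frame)

/-- The parameters of a chart with values in `A`. -/
abbrev Param (A : Type*) [CommRing A] [Algebra k A] := ∀ i : Fin m, A ⊗[k] (c i).L

section

variable {A : Type*} [CommRing A] [Algebra k A]

/-- The generating submodules with given parameters. -/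
def fam (a : c.Param A) : ∀ i, Submodule A (A ⊗[k] T.M i)
  | 0 => ⊤
  | i + 1 => if h : i < m then (c ⟨i, h⟩).X (a ⟨i, h⟩) else ⊤

/-- The linked family with given parameters. -/
def W (a : c.Param A) : ∀ i, Submodule A (A ⊗[k] T.M i) := gen (c.fam a)

theorem W_zero (a : c.Param A) : c.W a 0 = ⊤ := by
  rw [W, ← step_gen]
  change ⊤ ⊔ _ ⊔ _ = ⊤
  rw [top_sup_eq, top_sup_eq]

theorem W_last (a : c.Param A) : c.W a (m + 1) = ⊤ := by
  rw [W, ← step_gen]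
  change (dite _ _ _) ⊔ _ ⊔ _ = ⊤
  rw [dif_neg (lt_irrefl m), top_sup_eq, top_sup_eq]

/-- The equations that characterize the linked family with given parameters. -/
theorem W_succ (a : c.Param A) (i : Fin m) : c.W a (i + 1) =
    (c.W a (i + 1 + 1)).map ((T.g (i + 1)).baseChange A) ⊔ (c.W a i).map ((T.f i).baseChange A) ⊔
      (c i).X (a i) := by
  conv_lhs => rw [W, ← step_gen]
  change (dite _ _ _) ⊔ _ ⊔ (gen (c.fam a) i).map _ = _
  rw [dif_pos i.2, sup_assoc, sup_comm]
  rfl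

/-- A family that is everything at both ends and solves the equations is the one with the given
parameters. -/
theorem eq_W {V : ∀ i, Submodule A (A ⊗[k] T.M i)} {a : c.Param A} (h₀ : V 0 = ⊤)
    (h₁ : V (m + 1) = ⊤) (h : ∀ i : Fin m, V (i + 1) =
      (V (i + 1 + 1)).map ((T.g (i + 1)).baseChange A) ⊔ (V i).map ((T.f i).baseChange A) ⊔
        (c i).X (a i)) : V = c.W a := by
  refine eq_of_step_eq (X := c.fam a) ?_ (step_gen _)
  funext i
  obtain _ | i := i
  · rw [h₀]
    change ⊤ ⊔ _ ⊔ _ = ⊤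
    rw [top_sup_eq, top_sup_eq]
  · change (dite _ _ _) ⊔ Submodule.map _ _ ⊔ Submodule.map _ _ = _
    rcases lt_trichotomy i m with hi | rfl | hi
    · rw [dif_pos hi, h ⟨i, hi⟩, sup_assoc, sup_comm]
    · rw [dif_neg (lt_irrefl _), top_sup_eq, top_sup_eq, h₁]
    · exact eq_of_subsingleton (by omega) _ _

theorem pullback_W {B : Type*} [CommRing B] [Algebra k B] (φ : A →ₐ[k] B) (a : c.Param A) (i : ℕ) :
    pullback φ (c.W a i) = c.W (fun i => φ.toLinearMap.rTensor _ (a i)) i := by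
  have := congrFun (pullback_gen φ (c.fam a)) i
  refine this.trans (congrFun (congrArg gen (funext fun i => ?_)) i)
  obtain _ | i := i
  · exact pullback_top φ
  · simp only [fam]
    split_ifs
    · exact Spot.X_pullback φ _
    · exact pullback_top φ

/-- The family is in good position to the chart. -/
def Good (V : ∀ i, Submodule A (A ⊗[k] T.M i)) : Prop :=
  ∀ i : Fin m, (c i).Good ((V (i + 1 + 1)).map ((T.g (i + 1)).baseChange A))
    ((V i).map ((T.f i).baseChange A)) (V (i + 1))

/-- The open conditions for good position. -/
def Spans (V : ∀ i, Submodule A (A ⊗[k] T.M i)) : Prop :=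
  ∀ i : Fin m, (c i).Spans ((V (i + 1 + 1)).map ((T.g (i + 1)).baseChange A))
    ((V i).map ((T.f i).baseChange A)) (V (i + 1))

variable {c}

theorem Good.spans {V : ∀ i, Submodule A (A ⊗[k] T.M i)} (h : c.Good V) : c.Spans V :=
  fun i => (h i).spans

theorem Good.exists_eq_W {V : ∀ i, Submodule A (A ⊗[k] T.M i)} (h : c.Good V) (h₀ : V 0 = ⊤)
    (h₁ : V (m + 1) = ⊤) : ∃ a, V = c.W a := by
  choose a ha using fun i => (h i).exists_eq_sup
  exact ⟨a, c.eq_W h₀ h₁ ha⟩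

theorem Good.param_unique {V : ∀ i, Submodule A (A ⊗[k] T.M i)} (h : c.Good V)
    {a b : c.Param A} (ha : V = c.W a) (hb : V = c.W b) : a = b := by
  funext i
  refine (h i).param_unique ?_ ?_
  · conv_lhs => rw [ha, W_succ]
    rw [ha]
  · conv_lhs => rw [hb, W_succ]
    rw [hb]

end

variable {A B : Type u} [CommRing A] [Algebra k A] [CommRing B] [Algebra k B]

variable {c}

theorem Good.pullback {V : ∀ i, Submodule A (A ⊗[k] T.M i)} (h : c.Good V) (φ : A →ₐ[k] B) :
    c.Good fun i => LinkedGr.pullback φ (V i) := fun i => by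
  have := (h i).pullback φ
  rwa [pullback_map, pullback_map] at this

theorem Spans.exists_open {V : ∀ i, Submodule A (A ⊗[k] T.M i)} {K : Type u} [Field K]
    [Algebra k K] {φ : A →ₐ[k] K} (h : c.Spans fun i => LinkedGr.pullback φ (V i)) :
    ∃ f : A, φ f ≠ 0 ∧ ∀ (B : Type u) [CommRing B] [Algebra k B] (ψ : A →ₐ[k] B), IsUnit (ψ f) →
      c.Spans fun i => LinkedGr.pullback ψ (V i) := by
  have key : ∀ i : Fin m, ∃ f : A, φ f ≠ 0 ∧ ∀ (B : Type u) [CommRing B] [Algebra k B]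
      (ψ : A →ₐ[k] B), IsUnit (ψ f) → (c i).Spans
        ((LinkedGr.pullback ψ (V (i + 1 + 1))).map ((T.g (i + 1)).baseChange B))
        ((LinkedGr.pullback ψ (V i)).map ((T.f i).baseChange B))
        (LinkedGr.pullback ψ (V (i + 1))) := fun i => by
    have := h i
    rw [← pullback_map, ← pullback_map] at this
    obtain ⟨f, hf, H⟩ := this.exists_open
    refine ⟨f, hf, fun B _ _ ψ hψ => ?_⟩
    rw [← pullback_map, ← pullback_map]
    exact H B ψ hψ
  choose f hf H using key
  refine ⟨∏ i, f i, by rw [map_prod]; exact Finset.prod_ne_zero_iff.2 fun i _ => hf i,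
    fun B _ _ ψ hψ i => H i B ψ ?_⟩
  rw [map_prod] at hψ
  exact isUnit_of_dvd_unit (Finset.dvd_prod_of_mem (fun i => ψ (f i)) (Finset.mem_univ i)) hψ

variable (c)

/-- The dimensions of the summands of the chart fit the prescribed ranks. -/
structure Fits (δ : Ranks) (r : ℕ) : Prop where
  fits : ∀ i : Fin m, (c i).Fits (δ.g (i + 1 + 1)) (δ.f i)
  g_eq : ∀ i : Fin m, δ.g (i + 1) =
    δ.g (i + 1 + 1) + (Module.finrank k (c i).P' + Module.finrank k (c i).B')
  f_eq : ∀ i : Fin m, δ.f (i + 1) =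
    δ.f i + (Module.finrank k (c i).Q' + Module.finrank k (c i).B')
  z_eq : ∀ i : Fin m, δ.z (i + 1) = Module.finrank k (c i).B'
  r_eq : ∀ i : Fin m, δ.g (i + 1 + 1) + δ.f i + Module.finrank k (c i).H₀ = r

end Frame

/-- The ranks prescribed at the two ends are those of `g` and `f`. -/
structure EndRanks (T : Chain.{u, v} k m) (δ : Ranks) : Prop where
  g_eq : δ.g (m + 1) = Module.finrank k (LinearMap.range (T.g m))
  f_eq : δ.f 0 = Module.finrank k (LinearMap.range (T.f 0))

namespace Frame

variable {c : T.Frame} {A B : Type u} [CommRing A] [Algebra k A] [CommRing B] [Algebra k B]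
  {δ : Ranks}

theorem map_f_le_ker (V : ∀ i, Submodule A (A ⊗[k] T.M i)) (i : ℕ) :
    (V (i + 1)).map ((T.g i).baseChange A) ≤ (LinearMap.ker (T.f i)).baseChange A := by
  rw [← ker_baseChange, LinearMap.le_ker_iff_map, map_f_map_g]

theorem map_g_le_ker (V : ∀ i, Submodule A (A ⊗[k] T.M i)) (i : ℕ) :
    (V i).map ((T.f i).baseChange A) ≤ (LinearMap.ker (T.g i)).baseChange A := by
  rw [← ker_baseChange, LinearMap.le_ker_iff_map, map_g_map_f]

/-- The images under `g` are generated by as many elements as their prescribed rank; descending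
induction. -/
theorem subGen_map_g_W (hc : c.Fits δ r) (hδ : T.EndRanks δ) (a : c.Param A) :
    ∀ j i, i + j = m →
      SubGen ((c.W a (i + 1)).map ((T.g i).baseChange A)) (δ.g (i + 1)) := by
  intro j
  induction j with
  | zero =>
    intro i hi
    obtain rfl : i = m := hi
    rw [W_last, hδ.g_eq, Submodule.map_top, range_baseChange]
    exact subGen_baseChange _
  | succ j ih =>
    intro i hi
    have hi' : i < m := by omega
    have h1 := Spot.subGen_graph_P (c := c ⟨i, hi'⟩) (ih (i + 1) (by omega)) (a ⟨i, hi'⟩)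
    have h2 := c.W_succ a ⟨i, hi'⟩
    dsimp only at h2
    rw [hc.g_eq ⟨i, hi'⟩]
    refine (h1.map ((T.g i).baseChange A)).mono ?_
    have h3 := Submodule.map_mono (f := (T.g i).baseChange A) (h2.le.trans
      (Spot.le_map_sup_Q (c := c ⟨i, hi'⟩) (map_g_le_ker (c.W a) i) (a ⟨i, hi'⟩)))
    refine h3.trans ?_
    rw [Submodule.map_sup _ (Submodule.baseChange _ _), ← ker_baseChange,
      (LinearMap.le_ker_iff_map).1 le_rfl, sup_bot_eq]

/-- The images under `f` are generated by as many elements as their prescribed rank; ascending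
induction. -/
theorem subGen_map_f_W (hc : c.Fits δ r) (hδ : T.EndRanks δ) (a : c.Param A) :
    ∀ i, i ≤ m → SubGen ((c.W a i).map ((T.f i).baseChange A)) (δ.f i) := by
  intro i
  induction i with
  | zero =>
    intro _
    rw [W_zero, hδ.f_eq, Submodule.map_top, range_baseChange]
    exact subGen_baseChange _
  | succ i ih =>
    intro hi'
    have h1 := Spot.subGen_graph_Q (c := c ⟨i, hi'⟩) (ih (by omega)) (a ⟨i, hi'⟩)
    have h2 := c.W_succ a ⟨i, hi'⟩
    dsimp only at h2
    rw [hc.f_eq ⟨i, hi'⟩]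
    refine (h1.map ((T.f (i + 1)).baseChange A)).mono ?_
    have h3 := Submodule.map_mono (f := (T.f (i + 1)).baseChange A) (h2.le.trans
      (Spot.le_map_sup_P (c := c ⟨i, hi'⟩) (map_f_le_ker (c.W a) (i + 1)) (a ⟨i, hi'⟩)))
    refine h3.trans ?_
    rw [Submodule.map_sup _ (Submodule.baseChange _ _), ← ker_baseChange,
      (LinearMap.le_ker_iff_map).1 le_rfl, sup_bot_eq]

/-- The family with given parameters is in good position as soon as the open conditions hold: the
number of its generators bounds the ranks from above. -/
theorem Spans.good (hc : c.Fits δ r) (hδ : T.EndRanks δ) {a : c.Param A} (h : c.Spans (c.W a)) :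
    c.Good (c.W a) := fun i => by
  have h1 := h i
  rw [W_succ] at h1 ⊢
  exact h1.good _ (hc.fits i) (map_f_le_ker _ _) (map_g_le_ker _ _)
    (subGen_map_g_W hc hδ a (m - (i + 1)) (i + 1) (by omega)) (subGen_map_f_W hc hδ a i (by omega))

theorem finrank_ker_add (T : Chain.{u, v} k m) (i : ℕ) (hi : i < m) :
    Module.finrank k (LinearMap.ker (T.f (i + 1)) ⊔ LinearMap.ker (T.g i) : Submodule k (T.M (i + 1)))
      = Module.finrank k (LinearMap.ker (T.f (i + 1))) + Module.finrank k (LinearMap.ker (T.g i)) :=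
  finrank_sup_of_disjoint (T.disjoint i hi)

/-- The linked family with given parameters, if the open conditions hold. -/
def point (hc : c.Fits δ r) (hδ : T.EndRanks δ) {a : c.Param A} (h : c.Spans (c.W a)) :
    T.Point r A where
  W := c.W a
  isSubbundle i hi := isSubbundle_of_isCompl (by
    have := (c ⟨i, hi⟩).finrank_M
    have := (c ⟨i, hi⟩).finrank_HN
    have := (c ⟨i, hi⟩).finrank_H
    have := (hc.fits ⟨i, hi⟩).P_eq
    have := (hc.fits ⟨i, hi⟩).Q_eq
    have := hc.r_eq ⟨i, hi⟩
    dsimp only at *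
    omega) (h.good hc hδ ⟨i, hi⟩).isCompl
  first := c.W_zero a
  last := c.W_last a
  map_f_le i := by
    conv_rhs => rw [W, ← step_gen]
    exact le_sup_right
  map_g_le i := by
    conv_rhs => rw [W, ← step_gen]
    exact le_sup_right.trans le_sup_left

theorem inStratum_point (hc : c.Fits δ r) (hδ : T.EndRanks δ) {a : c.Param A}
    (h : c.Spans (c.W a)) : (point hc hδ h).InStratum δ := fun i hi => by
  have hg := h.good hc hδ ⟨i, hi⟩
  have := (c ⟨i, hi⟩).finrank_M
  have := (c ⟨i, hi⟩).finrank_PB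
  have := (c ⟨i, hi⟩).finrank_QB
  have := (hc.fits ⟨i, hi⟩).P_eq
  have := (hc.fits ⟨i, hi⟩).Q_eq
  have := hc.g_eq ⟨i, hi⟩
  have := hc.f_eq ⟨i, hi⟩
  have := hc.z_eq ⟨i, hi⟩
  dsimp only at *
  exact ⟨isSubbundle_of_isCompl (by omega) hg.isCompl_Q,
    isSubbundle_of_isCompl (by omega) hg.isCompl_P,
    isSubbundle_of_isCompl (by omega) hg.isCompl_PQ⟩

end Frame

theorem Point.InStratum.isSubbundle_map_g {A : Type u} [CommRing A] [Algebra k A]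
    {P : T.Point r A} {δ : Ranks} (h : P.InStratum δ) (hδ : T.EndRanks δ) (i : ℕ) (hi : i ≤ m) :
    IsSubbundle A ((P.W (i + 1)).map ((T.g i).baseChange A)) (δ.g (i + 1)) := by
  rw [isSubbundle_map_iff]
  rcases hi.lt_or_eq with hi | rfl
  · exact (h i hi).1
  · rw [P.last, top_sup_eq, hδ.g_eq, (T.g i).finrank_range_add_finrank_ker]
    exact isSubbundle_of_isCompl (K := ⊥) (by rw [finrank_bot, zero_add])
      (by rw [Submodule.baseChange_bot]; exact isCompl_top_bot)

theorem Point.InStratum.isSubbundle_map_f {A : Type u} [CommRing A] [Algebra k A]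
    {P : T.Point r A} {δ : Ranks} (h : P.InStratum δ) (hδ : T.EndRanks δ) (i : ℕ) (hi : i ≤ m) :
    IsSubbundle A ((P.W i).map ((T.f i).baseChange A)) (δ.f i) := by
  rw [isSubbundle_map_iff]
  obtain _ | i := i
  · rw [P.first, top_sup_eq, hδ.f_eq, (T.f 0).finrank_range_add_finrank_ker]
    exact isSubbundle_of_isCompl (K := ⊥) (by rw [finrank_bot, zero_add])
      (by rw [Submodule.baseChange_bot]; exact isCompl_top_bot)
  · exact (h i hi).2.1

namespace Frame

variable {c : T.Frame} {A B : Type u} [CommRing A] [Algebra k A] [CommRing B] [Algebra k B]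
  {δ : Ranks}

theorem Spans.good_of_inStratum {P : T.Point r A} (h : c.Spans P.W) (hc : c.Fits δ r)
    (hδ : T.EndRanks δ) (hP : P.InStratum δ) : c.Good P.W := fun i => by
  have hi := i.2
  have := (c i).finrank_M
  have := (c i).finrank_PB
  have := (c i).finrank_QB
  have := (c i).finrank_PQB
  have := (c i).finrank_QPB
  have := (c i).finrank_HN
  have := (c i).finrank_H
  have := (hc.fits i).P_eq
  have := (hc.fits i).Q_eq
  have := hc.g_eq i
  have := hc.f_eq i
  have := hc.z_eq i
  have := hc.r_eq i
  obtain ⟨h₁, h₂, h₃⟩ := hP i i.2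
  exact {
    G_le_P := map_f_le_ker _ _
    F_le_Q := map_g_le_ker _ _
    G_le := P.map_g_le _
    F_le := P.map_f_le _
    isCompl_G := (hP.isSubbundle_map_g hδ (i + 1) i.2).isCompl (by omega) (h i).sup_G
    isCompl_F := (hP.isSubbundle_map_f hδ i i.2.le).isCompl (by omega) (h i).sup_F
    isCompl_Q := h₁.isCompl (by omega) (h i).sup_Q
    isCompl_P := h₂.isCompl (by omega) (h i).sup_P
    isCompl_PQ := h₃.isCompl (by omega) (by
      have hP'' : (c i).P''.baseChange A ≤
          (LinearMap.ker (T.f (i + 1)) ⊔ LinearMap.ker (T.g i)).baseChange A :=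
        (c i).P''_le.trans (Submodule.baseChange_mono A le_sup_left)
      rw [eq_top_iff, ← (h i).sup_Q, baseChange_sup (c i).P'']
      refine sup_le (sup_le (le_sup_left.trans le_sup_left) ?_) (sup_le ?_ le_sup_right)
      · exact (Submodule.baseChange_mono A le_sup_right).trans (le_sup_right.trans le_sup_left)
      · exact hP''.trans (le_sup_right.trans le_sup_left))
    isCompl := (P.isSubbundle i i.2).isCompl (by omega) (h i).sup }

end Frame

/-- Every point of a stratum over a field lies in a chart. -/
theorem Point.InStratum.exists_frame {K : Type u} [Field K] [Algebra k K] {P : T.Point r K}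
    {δ : Ranks} (h : P.InStratum δ) (hδ : T.EndRanks δ) :
    ∃ c : T.Frame, c.Fits δ r ∧ c.Good P.W := by
  choose c hc using fun i : Fin m => Spot.exists_good (T.disjoint i i.2)
    (Frame.map_f_le_ker P.W (i + 1)) (Frame.map_g_le_ker P.W i) (P.map_g_le _) (P.map_f_le _)
  have key : ∀ i : Fin m, (c i).Fits (δ.g (i + 1 + 1)) (δ.f i) ∧ δ.g (i + 1) =
      δ.g (i + 1 + 1) + (Module.finrank k (c i).P' + Module.finrank k (c i).B') ∧
      δ.f (i + 1) = δ.f i + (Module.finrank k (c i).Q' + Module.finrank k (c i).B') ∧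
      δ.z (i + 1) = Module.finrank k (c i).B' ∧
      δ.g (i + 1 + 1) + δ.f i + Module.finrank k (c i).H₀ = r := fun i => by
    obtain ⟨e₁, e₂, e₃, e₄, e₅, e₆⟩ := (hc i).finrank_eq
    obtain ⟨h₁, h₂, h₃⟩ := h i i.2
    rw [h₁.finrank_eq] at e₃
    rw [h₂.finrank_eq] at e₄
    rw [h₃.finrank_eq] at e₅
    rw [(h.isSubbundle_map_g hδ (i + 1) i.2).finrank_eq] at e₁
    rw [(h.isSubbundle_map_f hδ i i.2.le).finrank_eq] at e₂
    rw [(P.isSubbundle i i.2).finrank_eq] at e₆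
    have := (c i).finrank_M
    have := (c i).finrank_H
    exact ⟨⟨by omega, by omega⟩, by omega, by omega, by omega, by omega⟩
  exact ⟨c, ⟨fun i => (key i).1, fun i => (key i).2.1, fun i => (key i).2.2.1,
    fun i => (key i).2.2.2.1, fun i => (key i).2.2.2.2⟩, hc⟩

end Chain

end

/-! ### The atlas of a stratum -/

section

section Small

variable {k : Type u} [Field k] {M : Type v} [AddCommGroup M] [Module k M] [FiniteDimensional k M]

/-- The universe of the vector spaces may exceed that of the base field, but their subspaces form a
small type. This makes the index types of the atlases small. -/
theorem small_submodule : Small.{u} (Submodule k M) :=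
  have : Small.{u} M := small_of_injective (Module.finBasis k M).equivFun.injective
  have : Small.{u} (Set M) := inferInstance
  small_of_injective (SetLike.coe_injective (A := Submodule k M))

instance (P Q : Submodule k M) : Small.{u} (Spot P Q) := by
  have := small_submodule (k := k) (M := M)
  refine small_of_injective (β := Submodule k M × Submodule k M × Submodule k M × Submodule k M ×
    Submodule k M × Submodule k M × Submodule k M × Submodule k M)
    (f := fun c => (c.P', c.P'', c.Q', c.Q'', c.B', c.B'', c.H₀, c.H₁)) fun c c' h => ?_
  cases c
  cases c'
  simp only [Prod.mk.injEq] at h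
  obtain ⟨rfl, rfl, rfl, rfl, rfl, rfl, rfl, rfl⟩ := h
  rfl

end Small

section Universal

variable {k : Type u} [Field k] {m : ℕ} (L : Fin m → Type*) [∀ i, AddCommGroup (L i)]
  [∀ i, Module k (L i)] [∀ i, FiniteDimensional k (L i)]

variable (k) in
/-- The index set of coordinates for a family of vector spaces. -/
abbrev CoordIdx := Σ i : Fin m, Fin (Module.finrank k (L i))

/-- The universal family of elements of the spaces `L i`: its coefficients are indeterminates. -/
def univElem (i : Fin m) : MvPolynomial (CoordIdx k L) k ⊗[k] L i :=
  ∑ j, MvPolynomial.X ⟨i, j⟩ ⊗ₜ Module.finBasis k (L i) j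

variable {L} {A : Type*} [CommRing A] [Algebra k A]

theorem rTensor_univElem (φ : MvPolynomial (CoordIdx k L) k →ₐ[k] A) (i : Fin m) :
    φ.toLinearMap.rTensor _ (univElem L i) =
      ∑ j, φ (MvPolynomial.X ⟨i, j⟩) • ((Module.finBasis k (L i)).baseChange A) j := by
  rw [univElem, map_sum]
  refine Finset.sum_congr rfl fun j _ => ?_
  rw [LinearMap.rTensor_tmul, Module.Basis.baseChange_apply, TensorProduct.smul_tmul', smul_eq_mul,
    mul_one]
  rfl

/-- Every family of elements is a specialization of the universal one. -/
theorem exists_rTensor_univElem (a : ∀ i, A ⊗[k] L i) :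
    ∃ φ : MvPolynomial (CoordIdx k L) k →ₐ[k] A,
      ∀ i, φ.toLinearMap.rTensor _ (univElem L i) = a i := by
  refine ⟨MvPolynomial.aeval fun p => ((Module.finBasis k (L p.1)).baseChange A).repr (a p.1) p.2,
    fun i => ?_⟩
  rw [rTensor_univElem]
  simp only [MvPolynomial.aeval_X]
  exact ((Module.finBasis k (L i)).baseChange A).sum_repr (a i)

theorem rTensor_univElem_injective {φ ψ : MvPolynomial (CoordIdx k L) k →ₐ[k] A}
    (h : ∀ i, φ.toLinearMap.rTensor _ (univElem L i) = ψ.toLinearMap.rTensor _ (univElem L i)) :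
    φ = ψ := by
  refine MvPolynomial.algHom_ext fun p => ?_
  have h1 := h p.1
  rw [rTensor_univElem, rTensor_univElem] at h1
  have h2 := congrArg (fun x => ((Module.finBasis k (L p.1)).baseChange A).repr x p.2) h1
  simp only [Module.Basis.repr_sum_self] at h2
  exact h2

end Universal

namespace Chain

variable {k : Type u} [Field k] {m : ℕ} {T : Chain.{u, v} k m} {r : ℕ}

namespace Frame

variable (c : T.Frame)

/-- The index set of coordinates for the parameters of a chart. -/
abbrev Idx := CoordIdx k fun i => (c i).L

/-- The universal parameters of a chart. -/
def univ : c.Param (MvPolynomial c.Idx k) := univElem fun i => (c i).L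

variable {c} {A B : Type u} [CommRing A] [Algebra k A] [CommRing B] [Algebra k B]

/-- The pull-back of parameters. -/
def Param.map (φ : A →ₐ[k] B) (a : c.Param A) : c.Param B :=
  fun i => φ.toLinearMap.rTensor _ (a i)

theorem Param.map_comp {C : Type u} [CommRing C] [Algebra k C] (φ : A →ₐ[k] B) (ψ : B →ₐ[k] C)
    (a : c.Param A) : a.map (ψ.comp φ) = (a.map φ).map ψ :=
  funext fun _ => rTensor_comp_apply φ ψ _

theorem pullback_W_map (φ : A →ₐ[k] B) (a : c.Param A) (i : ℕ) :
    pullback φ (c.W a i) = c.W (a.map φ) i := c.pullback_W φ a i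

theorem exists_map_univ (a : c.Param A) :
    ∃ φ : MvPolynomial c.Idx k →ₐ[k] A, c.univ.map φ = a := by
  obtain ⟨φ, hφ⟩ := exists_rTensor_univElem a
  exact ⟨φ, funext hφ⟩

theorem map_univ_injective {φ ψ : MvPolynomial c.Idx k →ₐ[k] A} (h : c.univ.map φ = c.univ.map ψ) :
    φ = ψ := rTensor_univElem_injective fun i => congrFun h i

end Frame

variable (T r) in
/-- The charts of a stratum: a splitting whose dimensions fit the prescribed ranks, and a principal
open subset of the space of parameters on which the open conditions hold. -/
abbrev StratumChart (δ : Ranks) := {p : Σ c : {c : T.Frame // c.Fits δ r}, MvPolynomial c.1.Idx k //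
  p.1.1.Spans (p.1.1.W (p.1.1.univ.map (awayHom k p.2)))}

theorem Localization.algHom_ext_of_comp {A B : Type u} [CommRing A] [Algebra k A] [CommRing B] [Algebra k B] {f : A}
    {φ ψ : Localization.Away f →ₐ[k] B} (h : φ.comp (awayHom k f) = ψ.comp (awayHom k f)) :
    φ = ψ := by
  have : φ.toRingHom = ψ.toRingHom :=
    IsLocalization.ringHom_ext (Submonoid.powers f) (RingHom.ext fun x => DFunLike.congr_fun h x)
  exact AlgHom.ext fun x => DFunLike.congr_fun this x

namespace Frame

variable {c : T.Frame} {δ : Ranks}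

/-- A chart of a stratum is open in it. -/
theorem exists_open_lift {A K : Type u} [CommRing A] [Algebra k A] [Field K] [Algebra k K]
    (hc : c.Fits δ r) (hδ : T.EndRanks δ) {s : MvPolynomial c.Idx k}
    (hs : c.Spans (c.W (c.univ.map (awayHom k s)))) {P : T.Point r A} (hstr : P.InStratum δ)
    (φ : A →ₐ[k] K) (ψ : Localization.Away s →ₐ[k] K)
    (hP : ∀ i, pullback ψ (c.W (c.univ.map (awayHom k s)) i) = pullback φ (P.W i)) :
    ∃ (B : Type u) (_ : CommRing B) (_ : Algebra k B) (φ₀ : A →ₐ[k] B) (χ : B →ₐ[k] K)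
      (ψ' : Localization.Away s →ₐ[k] B), IsOpenImmersion (specMap φ₀).left ∧ χ.comp φ₀ = φ ∧
        ∀ i, pullback ψ' (c.W (c.univ.map (awayHom k s)) i) = pullback φ₀ (P.W i) := by
  have hPW : (fun i => pullback φ (P.W i)) = c.W ((c.univ.map (awayHom k s)).map ψ) :=
    funext fun i => (hP i).symm.trans (Frame.pullback_W_map ψ _ i)
  have hg : c.Good fun i => pullback φ (P.W i) := by
    have := (Frame.Spans.good hc hδ hs).pullback ψ
    rwa [funext hP] at this
  obtain ⟨f, hf, H⟩ := hg.spans.exists_open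
  obtain ⟨χ, hχ⟩ := exists_comp_awayHom φ (IsUnit.mk0 _ hf)
  have hgf : c.Good fun i => pullback (awayHom k f) (P.W i) :=
    Frame.Spans.good_of_inStratum (P := P.map (awayHom k f))
      (H _ (awayHom k f) (IsLocalization.Away.algebraMap_isUnit f)) hc hδ (hstr.map _)
  obtain ⟨b, hb⟩ := hgf.exists_eq_W (by rw [P.first, pullback_top])
    (by rw [P.last, pullback_top])
  obtain ⟨θ, rfl⟩ := Frame.exists_map_univ b
  -- over `K` the parameters are those of the given point of the chart
  have hθ : χ.comp θ = ψ.comp (awayHom k s) := by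
    apply Frame.map_univ_injective
    refine hg.param_unique ?_ (hPW.trans (by rw [Frame.Param.map_comp]))
    funext i
    rw [Frame.Param.map_comp, ← Frame.pullback_W_map, ← hb, ← pullback_comp, hχ]
  have hχs : IsUnit (χ (θ s)) := by
    have e : χ (θ s) = ψ (awayHom k s s) := DFunLike.congr_fun hθ s
    rw [e]
    exact (IsLocalization.Away.algebraMap_isUnit s).map ψ
  obtain ⟨χ', hχ'⟩ := exists_comp_awayHom χ hχs
  obtain ⟨ψ', hψ'⟩ := exists_comp_awayHom (f := s) ((awayHom k (θ s)).comp θ)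
    (IsLocalization.Away.algebraMap_isUnit (θ s))
  refine ⟨Localization.Away (θ s), inferInstance, inferInstance,
    (awayHom k (θ s)).comp (awayHom k f), χ', ψ', ?_, ?_, ?_⟩
  · rw [← specMap_comp, Over.comp_left]
    infer_instance
  · rw [← AlgHom.comp_assoc, hχ', hχ]
  · intro i
    rw [Frame.pullback_W_map, ← Frame.Param.map_comp, hψ', pullback_comp,
      congrFun hb i, Frame.pullback_W_map, Frame.Param.map_comp]

/-- Every field-valued point of a stratum lies in one of its charts. -/
theorem exists_chart {K : Type u} [Field K] [Algebra k K] (hδ : T.EndRanks δ) {P : T.Point r K}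
    (hstr : P.InStratum δ) : ∃ (j : T.StratumChart r δ) (χ : Localization.Away j.1.2 →ₐ[k] K),
      ∀ i, pullback χ (j.1.1.1.W (j.1.1.1.univ.map (awayHom k j.1.2)) i) = P.W i := by
  obtain ⟨c, hc, hg⟩ := hstr.exists_frame hδ
  obtain ⟨a, ha⟩ := hg.exists_eq_W P.first P.last
  obtain ⟨ψ, rfl⟩ := Frame.exists_map_univ a
  have hs := hg.spans
  rw [ha, ← funext (Frame.pullback_W_map ψ c.univ)] at hs
  obtain ⟨s, hs, H⟩ := hs.exists_open
  have h1 := H _ (awayHom k s) (IsLocalization.Away.algebraMap_isUnit s)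
  rw [funext (Frame.pullback_W_map (awayHom k s) c.univ)] at h1
  obtain ⟨χ, hχ⟩ := exists_comp_awayHom ψ (IsUnit.mk0 _ hs)
  refine ⟨⟨⟨⟨c, hc⟩, s⟩, h1⟩, χ, fun i => ?_⟩
  dsimp only
  rw [Frame.pullback_W_map, ← Frame.Param.map_comp, hχ, ha]

end Frame

variable (T r) in
/-- The atlas of a stratum. -/
def stratumAtlas {δ : Ranks} (hδ : T.EndRanks δ) : AffineAtlas (T.stratumSheaf r δ) where
  J := T.StratumChart r δ
  R j := Localization.Away j.1.2
  pt j := ⟨Frame.point j.1.1.2 hδ j.2, Frame.inStratum_point j.1.1.2 hδ j.2⟩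
  inj j B _ _ φ ψ h := by
    have h0 : (Frame.point j.1.1.2 hδ j.2).map φ = (Frame.point j.1.1.2 hδ j.2).map ψ :=
      congrArg Subtype.val h
    have hφ : ((Frame.point j.1.1.2 hδ j.2).map φ).W =
      j.1.1.1.W ((j.1.1.1.univ.map (awayHom k j.1.2)).map φ) := funext fun i =>
        Frame.pullback_W_map φ _ i
    have hψ : ((Frame.point j.1.1.2 hδ j.2).map φ).W =
      j.1.1.1.W ((j.1.1.1.univ.map (awayHom k j.1.2)).map ψ) := h0 ▸ funext fun i =>
        Frame.pullback_W_map ψ _ i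
    have hg := (Frame.Spans.good j.1.1.2 hδ j.2).pullback φ
    have := hg.param_unique hφ hψ
    rw [← Frame.Param.map_comp, ← Frame.Param.map_comp] at this
    exact Localization.algHom_ext_of_comp (Frame.map_univ_injective this)
  isOpen j A K _ _ _ _ P φ h := by
    obtain ⟨ψ, hψ⟩ := h
    obtain ⟨B, i₁, i₂, φ₀, χ, ψ', h₁, h₂, h₃⟩ := Frame.exists_open_lift j.1.1.2 hδ j.2 P.2 φ ψ
      fun i => congrFun (congrArg Point.W (congrArg Subtype.val hψ)) i
    exact ⟨B, i₁, i₂, φ₀, χ, ψ', h₁, h₂, Subtype.ext (Point.ext (funext h₃))⟩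
  cover P := by
    obtain ⟨j, χ, h⟩ := Frame.exists_chart hδ P.2
    exact ⟨j, χ, Subtype.ext (Point.ext (funext h))⟩

end Chain

end

/-! ### The atlas of the scheme of linked families -/

section

section Graph

variable {k : Type u} [Field k] {M : Type*} [AddCommGroup M] [Module k M]
  {A B : Type*} [CommRing A] [Algebra k A] [CommRing B] [Algebra k B]

/-- The graph of a linear map from the base change of `S` to that of `K`. -/
def graph (S K : Submodule k M) (a : A ⊗[k] (S →ₗ[k] K)) : Submodule A (A ⊗[k] M) :=
  (S.baseChange A).map (LinearMap.id + act A (homExt S K K) a)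

variable {S K : Submodule k M}

theorem pullback_graph (φ : A →ₐ[k] B) (a : A ⊗[k] (S →ₗ[k] K)) :
    pullback φ (graph S K a) = graph S K (φ.toLinearMap.rTensor _ a) := by
  refine le_antisymm (pullback_le.2 ?_) ?_
  · rintro _ ⟨x, hx, rfl⟩
    refine ⟨φ.toLinearMap.rTensor M x, pullback_baseChange φ S ▸ rTensor_mem_pullback φ hx, ?_⟩
    simp [rTensor_act]
  · rw [graph, ← pullback_baseChange φ, pullback, Submodule.map_span, Submodule.span_le]
    rintro _ ⟨_, ⟨x, hx, rfl⟩, rfl⟩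
    have := rTensor_mem_pullback φ (show _ ∈ graph S K a from ⟨x, hx, rfl⟩)
    simpa [rTensor_act] using this

theorem isCompl_graph (h : IsCompl S K) (a : A ⊗[k] (S →ₗ[k] K)) :
    IsCompl (graph S K a) (K.baseChange A) := by
  have hSK := isCompl_baseChange (A := A) h
  refine ⟨Submodule.disjoint_def.2 ?_, codisjoint_iff.2 (eq_top_iff.2 ?_)⟩
  · rintro _ ⟨x, hx, rfl⟩ hxK
    have hx0 : x = 0 := Submodule.disjoint_def.1 hSK.disjoint _ hx (by
      have := sub_mem hxK (act_homExt_mem S K K a x)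
      simpa using this)
    rw [hx0, map_zero]
  · rw [← hSK.sup_eq_top]
    refine sup_le (fun x hx => ?_) le_sup_right
    have h1 : x + act A (homExt S K K) a x ∈ graph S K a := ⟨x, hx, rfl⟩
    have := sub_mem (Submodule.mem_sup_left (T := K.baseChange A) h1)
      (Submodule.mem_sup_right (act_homExt_mem S K K a x))
    simpa using this

theorem graph_injective [FiniteDimensional k M] (h : IsCompl S K) {a b : A ⊗[k] (S →ₗ[k] K)}
    (hab : graph S K a = graph S K b) : a = b := by
  have hSK := isCompl_baseChange (A := A) h
  refine act_homExt_injective h.disjoint fun x hx => ?_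
  have h1 : x + act A (homExt S K K) a x ∈ graph S K a := ⟨x, hx, rfl⟩
  obtain ⟨y, hy, e⟩ := hab.le h1
  simp only [LinearMap.add_apply, LinearMap.id_apply] at e
  have hxy : y - x = 0 := Submodule.disjoint_def.1 hSK.disjoint _ (sub_mem hy hx) (by
    have : y - x = act A (homExt S K K) a x - act A (homExt S K K) b y := by
      rw [sub_eq_sub_iff_add_eq_add, e]; abel
    rw [this]
    exact sub_mem (act_homExt_mem _ _ _ _ _) (act_homExt_mem _ _ _ _ _))
  rw [sub_eq_zero.1 hxy] at e
  exact (add_left_cancel e).symm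

/-- The complements of `K` are the graphs over a fixed complement `S`. -/
theorem exists_eq_graph [FiniteDimensional k M] (h : IsCompl S K) {W : Submodule A (A ⊗[k] M)}
    (hW : IsCompl W (K.baseChange A)) : ∃ a, W = graph S K a := by
  obtain ⟨a, ha⟩ := exists_act_homExt_eq (T := K) h.disjoint
    (-Submodule.projection _ _ hW.symm) (fun x _ => (Submodule.neg_mem_iff _).2
      (Submodule.coe_mem (Submodule.projectionOnto _ _ hW.symm x)))
  refine ⟨a, ?_⟩
  have hle : graph S K a ≤ W := by
    rintro _ ⟨x, hx, rfl⟩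
    rw [← Submodule.projection_apply_eq_zero_iff hW.symm, LinearMap.add_apply, ha x hx, map_add,
      LinearMap.neg_apply, map_neg, LinearMap.id_apply]
    rw [Submodule.projection_apply_of_mem_left hW.symm (x := Submodule.projection _ _ hW.symm x)
      (Submodule.coe_mem (Submodule.projectionOnto _ _ hW.symm x)), add_neg_cancel]
  refine le_antisymm ?_ hle
  have := sup_inf_assoc_of_le (K.baseChange A) hle
  rw [(isCompl_graph h a).sup_eq_top, top_inf_eq, inf_comm, hW.inf_eq_bot, sup_bot_eq] at this
  exact this.le

end Graph

namespace Chain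

variable {k : Type u} [Field k] {m : ℕ} {T : Chain.{u, v} k m} {r : ℕ}

variable (T r) in
/-- A chart of the scheme of linked families: at every inner member of the chain a decomposition
into a subspace of dimension `r` and a complement. -/
abbrev Split := ∀ i : Fin m, {p : Submodule k (T.M (i + 1)) × Submodule k (T.M (i + 1)) //
  IsCompl p.1 p.2 ∧ Module.finrank k p.1 = r}

instance : Small.{u} (T.Split r) := by
  have (i : ℕ) := small_submodule (k := k) (M := T.M i)
  infer_instance

namespace Split

variable (c : T.Split r)

/-- The coefficients of a family of graphs. -/
abbrev Param (A : Type*) [CommRing A] [Algebra k A] :=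
  ∀ i : Fin m, A ⊗[k] ((c i).1.1 →ₗ[k] (c i).1.2)

variable {A B : Type u} [CommRing A] [Algebra k A] [CommRing B] [Algebra k B]

/-- The family of graphs with given coefficients. -/
def W (a : c.Param A) : ∀ i, Submodule A (A ⊗[k] T.M i)
  | 0 => ⊤
  | i + 1 => if h : i < m then graph (c ⟨i, h⟩).1.1 (c ⟨i, h⟩).1.2 (a ⟨i, h⟩) else ⊤

theorem W_succ (a : c.Param A) (i : Fin m) :
    c.W a (i + 1) = graph (c i).1.1 (c i).1.2 (a i) := dif_pos i.2

theorem W_last (a : c.Param A) : c.W a (m + 1) = ⊤ := dif_neg (lt_irrefl m)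

/-- The index set of coordinates for the coefficients. -/
abbrev Idx := CoordIdx k fun i => (c i).1.1 →ₗ[k] (c i).1.2

/-- The universal coefficients. -/
def univ : c.Param (MvPolynomial c.Idx k) := univElem fun i => (c i).1.1 →ₗ[k] (c i).1.2

variable {c}

/-- The pull-back of coefficients. -/
def Param.map (φ : A →ₐ[k] B) (a : c.Param A) : c.Param B :=
  fun i => φ.toLinearMap.rTensor _ (a i)

theorem pullback_W (φ : A →ₐ[k] B) (a : c.Param A) (i : ℕ) :
    pullback φ (c.W a i) = c.W (a.map φ) i := by
  obtain _ | i := i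
  · exact pullback_top φ
  · simp only [W]
    split_ifs
    · exact pullback_graph φ _
    · exact pullback_top φ

theorem exists_map_univ (a : c.Param A) :
    ∃ φ : MvPolynomial c.Idx k →ₐ[k] A, c.univ.map φ = a := by
  obtain ⟨φ, hφ⟩ := exists_rTensor_univElem a
  exact ⟨φ, funext hφ⟩

theorem map_univ_injective {φ ψ : MvPolynomial c.Idx k →ₐ[k] A} (h : c.univ.map φ = c.univ.map ψ) :
    φ = ψ := rTensor_univElem_injective fun i => congrFun h i

theorem eq_W {V : ∀ i, Submodule A (A ⊗[k] T.M i)} (h₀ : V 0 = ⊤) (h₁ : V (m + 1) = ⊤)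
    (h : ∀ i : Fin m, IsCompl (V (i + 1)) ((c i).1.2.baseChange A)) : ∃ a, V = c.W a := by
  choose a ha using fun i => exists_eq_graph (c i).2.1 (h i)
  refine ⟨a, funext fun i => ?_⟩
  obtain _ | i := i
  · exact h₀
  · rcases lt_trichotomy i m with hi | rfl | hi
    · exact (ha ⟨i, hi⟩).trans (c.W_succ a ⟨i, hi⟩).symm
    · exact h₁.trans (c.W_last a).symm
    · exact eq_of_subsingleton (by omega) _ _

theorem W_injective {a b : c.Param A} (h : c.W a = c.W b) : a = b :=
  funext fun i => graph_injective (c i).2.1 (by rw [← W_succ, ← W_succ, h])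

variable (c) in
/-- The linking conditions define a closed subscheme. -/
theorem exists_ideal (a : c.Param A) : ∃ I : Ideal A, ∀ (B : Type u) [CommRing B] [Algebra k B]
    (φ : A →ₐ[k] B), I ≤ RingHom.ker φ ↔ ∀ i,
      (pullback φ (c.W a i)).map ((T.f i).baseChange B) ≤ pullback φ (c.W a (i + 1)) ∧
      (pullback φ (c.W a (i + 1))).map ((T.g i).baseChange B) ≤ pullback φ (c.W a i) := by
  have hc : ∀ i : Fin m, IsCompl (c.W a (i + 1)) ((c i).1.2.baseChange A) := fun i => by
    rw [W_succ]; exact isCompl_graph (c i).2.1 _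
  choose I hI using fun i : Fin m =>
    exists_ideal_pullback_le (hc i) ((c.W a i).map ((T.f i).baseChange A))
  choose J hJ using fun i : Fin m =>
    exists_ideal_pullback_le (hc i) ((c.W a (i + 1 + 1)).map ((T.g (i + 1)).baseChange A))
  refine ⟨⨆ i, I i ⊔ J i, fun B _ _ φ => ?_⟩
  simp only [iSup_le_iff, sup_le_iff, ← hI, ← hJ, pullback_map]
  refine ⟨fun h i => ⟨?_, ?_⟩, fun h i => ⟨(h i).1, (h (i + 1)).2⟩⟩
  · rcases lt_trichotomy i m with hi | rfl | hi
    · exact (h ⟨i, hi⟩).1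
    · rw [W_last, pullback_top]; exact le_top
    · exact (eq_of_subsingleton (by omega) _ _).le
  · obtain _ | i := i
    · rw [W, pullback_top]; exact le_top
    · rcases lt_trichotomy i m with hi | rfl | hi
      · exact (h ⟨i, hi⟩).2
      · rw [W_last, pullback_top]; exact le_top
      · exact (eq_of_subsingleton (by omega) _ _).le

variable (c) in
/-- The equations of the linking conditions. -/
def eqs : Ideal (MvPolynomial c.Idx k) := (c.exists_ideal c.univ).choose

theorem eqs_le_ker_iff {φ : MvPolynomial c.Idx k →ₐ[k] B} : c.eqs ≤ RingHom.ker φ ↔ ∀ i,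
    (c.W (c.univ.map φ) i).map ((T.f i).baseChange B) ≤ c.W (c.univ.map φ) (i + 1) ∧
    (c.W (c.univ.map φ) (i + 1)).map ((T.g i).baseChange B) ≤ c.W (c.univ.map φ) i := by
  simp only [← pullback_W]
  exact (c.exists_ideal c.univ).choose_spec B φ

/-- The linked family of graphs with given coefficients. -/
def point {φ : MvPolynomial c.Idx k →ₐ[k] B} (h : c.eqs ≤ RingHom.ker φ) : T.Point r B where
  W := c.W (c.univ.map φ)
  isSubbundle i hi := by
    rw [c.W_succ _ ⟨i, hi⟩]
    refine isSubbundle_of_isCompl ?_ (isCompl_graph (c ⟨i, hi⟩).2.1 _)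
    have := Submodule.finrank_add_eq_of_isCompl (c ⟨i, hi⟩).2.1
    have := (c ⟨i, hi⟩).2.2
    dsimp only at *
    omega
  first := rfl
  last := c.W_last _
  map_f_le i := (eqs_le_ker_iff.1 h i).1
  map_g_le i := (eqs_le_ker_iff.1 h i).2

theorem Param.map_comp {C : Type u} [CommRing C] [Algebra k C] (φ : A →ₐ[k] B) (ψ : B →ₐ[k] C)
    (a : c.Param A) : a.map (ψ.comp φ) = (a.map φ).map ψ :=
  funext fun _ => rTensor_comp_apply φ ψ _

/-- A linked family in the position of the chart is the pull-back of the universal one. -/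
theorem exists_lift {P : T.Point r B}
    (h : ∀ i : Fin m, IsCompl (P.W (i + 1)) ((c i).1.2.baseChange B)) :
    ∃ ψ : (MvPolynomial c.Idx k ⧸ c.eqs) →ₐ[k] B,
      P.W = c.W (c.univ.map (ψ.comp (Ideal.Quotient.mkₐ k c.eqs))) := by
  obtain ⟨a, ha⟩ := eq_W P.first P.last h
  obtain ⟨φ, rfl⟩ := exists_map_univ a
  have hφ : c.eqs ≤ RingHom.ker φ := eqs_le_ker_iff.2 fun i => by
    rw [← ha]
    exact ⟨P.map_f_le i, P.map_g_le i⟩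
  refine ⟨Ideal.Quotient.liftₐ c.eqs φ hφ, ha.trans ?_⟩
  congr 2

end Split

variable (T r) in
/-- The atlas of the scheme of linked families. -/
def atlas : AffineAtlas (T.sheaf r) where
  J := T.Split r
  R c := MvPolynomial c.Idx k ⧸ c.eqs
  pt c := Split.point (φ := Ideal.Quotient.mkₐ k c.eqs) (Ideal.Quotient.mkₐ_ker k c.eqs).ge
  inj c B _ _ φ ψ h := by
    have h1 : ∀ φ : (MvPolynomial c.Idx k ⧸ c.eqs) →ₐ[k] B, ((Split.point (φ := Ideal.Quotient.mkₐ k c.eqs)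
        (Ideal.Quotient.mkₐ_ker k c.eqs).ge).map φ).W =
        c.W (c.univ.map (φ.comp (Ideal.Quotient.mkₐ k c.eqs))) := fun φ => funext fun i => by
      rw [Split.Param.map_comp, ← Split.pullback_W]; rfl
    have h2 := (h1 φ).symm.trans ((congrArg Point.W h).trans (h1 ψ))
    exact Ideal.Quotient.algHom_ext _ (Split.map_univ_injective (Split.W_injective h2))
  isOpen c A K _ _ _ _ P φ := by
    rintro ⟨ψ, hψ⟩
    have hψ' : ∀ i : Fin m, pullback φ (P.W (i + 1)) ⊔ (c i).1.2.baseChange K = ⊤ := fun i => by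
      have e : pullback ψ (c.W (c.univ.map (Ideal.Quotient.mkₐ k c.eqs)) (i + 1)) =
        pullback φ (P.W (i + 1)) := congrFun (congrArg Point.W hψ) (i + 1)
      rw [← e, Split.pullback_W, Split.W_succ]
      exact (isCompl_graph (c i).2.1 _).sup_eq_top
    choose f hf H using fun i => exists_isUnit_sup_eq_top (hψ' i)
    have hφ : φ (∏ i, f i) ≠ 0 := by
      rw [map_prod]; exact Finset.prod_ne_zero_iff.2 fun i _ => hf i
    obtain ⟨χ, hχ⟩ := exists_comp_awayHom φ (IsUnit.mk0 _ hφ)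
    obtain ⟨ψ', hψ'⟩ := Split.exists_lift (c := c) (P := P.map (awayHom k (∏ i, f i))) fun i => by
      refine ((P.isSubbundle i i.2).pullback _).isCompl ?_ (H i _ _ ?_)
      · have := Submodule.finrank_add_eq_of_isCompl (c i).2.1
        have := (c i).2.2
        omega
      · exact isUnit_of_dvd_unit (map_dvd _ (Finset.dvd_prod_of_mem f (Finset.mem_univ i)))
          (IsLocalization.Away.algebraMap_isUnit (∏ i, f i))
    refine ⟨_, inferInstance, inferInstance, awayHom k (∏ i, f i), χ, ψ', inferInstance, hχ, ?_⟩
    refine Point.ext (Eq.trans (funext fun i => ?_) hψ'.symm)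
    rw [Split.Param.map_comp, ← Split.pullback_W]; rfl
  cover {K} _ _ P := by
    have : ∀ i : Fin m, ∃ p : Submodule k (T.M (i + 1)) × Submodule k (T.M (i + 1)),
        (IsCompl p.1 p.2 ∧ Module.finrank k p.1 = r) ∧ IsCompl (P.W (i + 1)) (p.2.baseChange K) := by
      intro i
      obtain ⟨S, hS⟩ := exists_isCompl_pullback (P.W (i + 1))
      obtain ⟨U, hU⟩ := exists_isCompl S
      refine ⟨(U, S), ⟨hU.symm, ?_⟩, hS⟩
      have := Submodule.finrank_add_eq_of_isCompl hU
      have := finrank_add_of_isCompl hS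
      have := (P.isSubbundle i i.2).finrank_eq
      dsimp only
      omega
    choose c hc hP using this
    obtain ⟨ψ, hψ⟩ := Split.exists_lift (c := fun i => ⟨c i, hc i⟩) hP
    refine ⟨fun i => ⟨c i, hc i⟩, ψ, Point.ext (Eq.trans (funext fun i => ?_) hψ.symm)⟩
    rw [Split.Param.map_comp, ← Split.pullback_W]; rfl

end Chain

end

/-! ### Subsheaves and immersions -/

section

/-- A morphism is an immersion if, around each point of its image, the target has an open subscheme
on which it is a closed immersion. -/
theorem isImmersion_of_local {X Y : Scheme.{u}} (f : X ⟶ Y)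
    (h : ∀ x : X, ∃ (C Z : Scheme.{u}) (u : C ⟶ Y) (i : Z ⟶ C) (j : Z ⟶ X), IsOpenImmersion u ∧
      IsClosedImmersion i ∧ IsPullback j i f u ∧ f x ∈ Set.range u) : IsImmersion f := by
  choose C Z u i j hu hi hp hx using h
  let U : Y.Opens := ⨆ x, (u x).opensRange
  have hf : Set.range f ⊆ Set.range U.ι := by
    rintro _ ⟨x, rfl⟩
    rw [Scheme.Opens.range_ι]
    exact (le_iSup (fun x => (u x).opensRange) x : _ ≤ U) (hx x)
  have hv : ∀ x, Set.range (u x) ⊆ Set.range U.ι := fun x => by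
    rw [Scheme.Opens.range_ι]
    exact (le_iSup (fun x => (u x).opensRange) x : _ ≤ U)
  let f' : X ⟶ U := IsOpenImmersion.lift U.ι f hf
  let v : ∀ x, C x ⟶ U := fun x => IsOpenImmersion.lift U.ι (u x) (hv x)
  have hf' : f' ≫ U.ι = f := IsOpenImmersion.lift_fac _ _ _
  have hv' : ∀ x, v x ≫ U.ι = u x := fun x => IsOpenImmersion.lift_fac _ _ _
  have ho : ∀ x, IsOpenImmersion (v x) := fun x => by
    have : IsOpenImmersion (v x ≫ U.ι) := by rw [hv']; exact hu x
    exact IsOpenImmersion.of_comp _ U.ι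
  have hU : ∀ y : U, ∃ x, y ∈ Set.range (v x) := fun y => by
    have hy : (y : Y) ∈ (⨆ x, (u x).opensRange : Y.Opens) := y.2
    obtain ⟨x, c, hc⟩ := TopologicalSpace.Opens.mem_iSup.1 hy
    refine ⟨x, c, U.ι.isOpenEmbedding.injective ?_⟩
    rw [← Scheme.Hom.comp_apply, hv', hc]
    rfl
  let 𝒰 : Scheme.OpenCover.{u} (U : Scheme.{u}) := Scheme.Cover.mkOfCovers X C v (fun y => by
    obtain ⟨x, c, hc⟩ := hU y
    exact ⟨x, c, hc⟩) ho
  have key : ∀ x, IsClosedImmersion (Limits.pullback.snd f' (v x)) := fun x => by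
    have hp' : IsPullback (j x) (i x) f' (v x) :=
      ⟨⟨by rw [← cancel_mono U.ι, Category.assoc, hf', Category.assoc, hv', (hp x).w]⟩,
        ⟨Limits.PullbackCone.IsLimit.mk _ (fun s => (hp x).lift s.fst s.snd (by
            rw [← hf', ← hv', s.condition_assoc])) (fun s => (hp x).lift_fst _ _ _)
          (fun s => (hp x).lift_snd _ _ _) fun s m h₁ h₂ => (hp x).hom_ext (by simpa using h₁)
            (by simpa using h₂)⟩⟩
    rw [← hp'.isoPullback_inv_snd]
    have := hi x
    infer_instance
  have hcl : IsClosedImmersion f' :=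
    IsZariskiLocalAtTarget.of_openCover (P := @IsClosedImmersion) 𝒰 key
  rw [← hf']
  infer_instance

section Sub

variable {k : Type u} [CommRing k]

/-- Two points of schemes over `k` with the same image in a third one come from a common
field-valued point. -/
theorem exists_common_point {X X' Y : Over (Spec (CommRingCat.of k))} (f : X ⟶ Y) (f' : X' ⟶ Y)
    (a : X.left) (b : X'.left) (h : f.left a = f'.left b) :
    ∃ (K : Type u) (_ : Field K) (_ : Algebra k K) (y : specOver k K ⟶ X) (y' : specOver k K ⟶ X'),
      y ≫ f = y' ≫ f' ∧ (∀ t, y.left t = a) ∧ ∀ t, y'.left t = b := by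
  obtain ⟨t, rfl, rfl⟩ := Scheme.Pullback.exists_preimage_pullback a b h
  let P := Limits.pullback f.left f'.left
  obtain ⟨alg, y, hy⟩ := exists_algebra_of_hom (T := X) (R := P.residueField t)
    (P.fromSpecResidueField t ≫ Limits.pullback.fst f.left f'.left)
  let y' : specOver k (P.residueField t) ⟶ X' := Over.homMk
    (P.fromSpecResidueField t ≫ Limits.pullback.snd f.left f'.left) (by
      rw [← Over.w y, hy, ← Over.w f, ← Over.w f', Category.assoc, Category.assoc,
        Limits.pullback.condition_assoc])
  refine ⟨P.residueField t, inferInstance, alg, y, y', ?_, fun s => ?_, fun s => ?_⟩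
  · ext1
    rw [Over.comp_left, Over.comp_left, hy]
    change (_ ≫ _) ≫ _ = (_ ≫ _) ≫ _
    rw [Category.assoc, Category.assoc, Limits.pullback.condition]
  · rw [hy, Scheme.Hom.comp_apply, Scheme.fromSpecResidueField_apply]
  · change (P.fromSpecResidueField t ≫ _) s = _
    rw [Scheme.Hom.comp_apply, Scheme.fromSpecResidueField_apply]

/-- An inclusion of Zariski sheaves. -/
structure ZariskiSheaf.Inclusion (G : ZariskiSheaf.{u, v} k) (F : ZariskiSheaf.{u, w} k) where
  toFun : ∀ {A : Type u} [CommRing A] [Algebra k A], G.obj A → F.obj A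
  injective : ∀ {A : Type u} [CommRing A] [Algebra k A] (a b : G.obj A), toFun a = toFun b → a = b
  map : ∀ {A B : Type u} [CommRing A] [Algebra k A] [CommRing B] [Algebra k B] (φ : A →ₐ[k] B)
    (a : G.obj A), toFun (G.map φ a) = F.map φ (toFun a)

variable {G : ZariskiSheaf.{u, v} k} {F : ZariskiSheaf.{u, w} k} (i : G.Inclusion F)

/-- The point `a` of the bigger sheaf lies in the smaller one. -/
def ZariskiSheaf.Inclusion.Mem {A : Type u} [CommRing A] [Algebra k A] (a : F.obj A) : Prop :=
  ∃ b, i.toFun b = a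

namespace AffineAtlas

variable (𝔄 : AffineAtlas.{u, w, w'} F) (𝔅 : AffineAtlas.{u, v, w''} G)

theorem exists_inclusion : ∃ ι : 𝔅.glued ⟶ 𝔄.glued, ∀ (A : Type u) [CommRing A] [Algebra k A]
    (y : specOver k A ⟶ 𝔅.glued), 𝔄.pointsEquiv A (y ≫ ι) = i.toFun (𝔅.pointsEquiv A y) := by
  obtain ⟨ι, hι⟩ := exists_hom_of_natural
    (fun B _ _ y => (𝔄.pointsEquiv B).symm (i.toFun (𝔅.pointsEquiv B y)) : ∀ (B : Type u)
      [CommRing B] [Algebra k B], (specOver k B ⟶ 𝔅.glued) → (specOver k B ⟶ 𝔄.glued)) (by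
    intro B C _ _ _ _ φ y
    apply (𝔄.pointsEquiv C).injective
    rw [Equiv.apply_symm_apply, pointsEquiv_comp, pointsEquiv_comp, Equiv.apply_symm_apply, i.map])
  exact ⟨ι, fun A _ _ y => by rw [hι, Equiv.apply_symm_apply]⟩

/-- The inclusion of a subsheaf, as a morphism of the schemes that represent the sheaves. -/
def inclusion : 𝔅.glued ⟶ 𝔄.glued := (exists_inclusion i 𝔄 𝔅).choose

theorem pointsEquiv_comp_inclusion {A : Type u} [CommRing A] [Algebra k A]
    (y : specOver k A ⟶ 𝔅.glued) :
    𝔄.pointsEquiv A (y ≫ inclusion i 𝔄 𝔅) = i.toFun (𝔅.pointsEquiv A y) :=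
  (exists_inclusion i 𝔄 𝔅).choose_spec A y

theorem exists_comp_inclusion_iff {A : Type u} [CommRing A] [Algebra k A]
    (x : specOver k A ⟶ 𝔄.glued) :
    (∃ y, y ≫ inclusion i 𝔄 𝔅 = x) ↔ i.Mem (𝔄.pointsEquiv A x) := by
  constructor
  · rintro ⟨y, rfl⟩
    exact ⟨_, (pointsEquiv_comp_inclusion i 𝔄 𝔅 y).symm⟩
  · rintro ⟨b, hb⟩
    refine ⟨(𝔅.pointsEquiv A).symm b, (𝔄.pointsEquiv A).injective ?_⟩
    rw [pointsEquiv_comp_inclusion, Equiv.apply_symm_apply, hb]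

instance : Mono (inclusion i 𝔄 𝔅) := ⟨fun g h e => over_hom_ext fun B _ _ x => by
  apply (𝔅.pointsEquiv B).injective
  apply i.injective
  rw [← pointsEquiv_comp_inclusion i 𝔄, ← pointsEquiv_comp_inclusion i 𝔄, Category.assoc, e,
    Category.assoc]⟩

/-- Where membership in the subsheaf is described by an ideal `I`, the inclusion is the closed
immersion defined by `I`. -/
theorem isPullback_inclusion {C : Type u} [CommRing C] [Algebra k C] (u : specOver k C ⟶ 𝔄.glued)
    (I : Ideal C) (hI : ∀ (B : Type u) [CommRing B] [Algebra k B] (ψ : C →ₐ[k] B),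
      i.Mem (F.map ψ (𝔄.pointsEquiv C u)) ↔ I ≤ RingHom.ker ψ) :
    ∃ z : specOver k (C ⧸ I) ⟶ 𝔅.glued,
      IsPullback z (specMap (Ideal.Quotient.mkₐ k I)) (inclusion i 𝔄 𝔅) u := by
  obtain ⟨z, hz⟩ := (exists_comp_inclusion_iff i 𝔄 𝔅 (specMap (Ideal.Quotient.mkₐ k I) ≫ u)).2 (by
    rw [pointsEquiv_comp, hI]
    intro x hx
    exact Ideal.Quotient.eq_zero_iff_mem.2 hx)
  -- uniqueness and existence of lifts are tested on points with values in `k`-algebras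
  have hm : ∀ (B : Type u) [CommRing B] [Algebra k B] (y y' : specOver k B ⟶ specOver k (C ⧸ I)),
      y ≫ specMap (Ideal.Quotient.mkₐ k I) = y' ≫ specMap (Ideal.Quotient.mkₐ k I) → y = y' := by
    intro B _ _ y y' e
    obtain ⟨χ, rfl⟩ := specMap_surjective y
    obtain ⟨χ', rfl⟩ := specMap_surjective y'
    rw [specMap_comp, specMap_comp] at e
    exact congrArg _ (Ideal.Quotient.algHom_ext _ (specMap_injective e))
  have : Mono (specMap (Ideal.Quotient.mkₐ k I)) := ⟨fun g h e => over_hom_ext fun B _ _ x => by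
    apply hm
    rw [Category.assoc, e, Category.assoc]⟩
  have hl : ∀ s : Limits.PullbackCone (inclusion i 𝔄 𝔅) u,
      ∃ l : s.pt ⟶ specOver k (C ⧸ I), l ≫ specMap (Ideal.Quotient.mkₐ k I) = s.snd := by
    intro s
    have hk : ∀ (B : Type u) [CommRing B] [Algebra k B] (x : specOver k B ⟶ s.pt),
        ∃ y : specOver k B ⟶ specOver k (C ⧸ I),
          y ≫ specMap (Ideal.Quotient.mkₐ k I) = x ≫ s.snd := by
      intro B _ _ x
      obtain ⟨ψ, hψ⟩ := specMap_surjective (x ≫ s.snd)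
      have h1 : i.Mem (F.map ψ (𝔄.pointsEquiv C u)) := by
        rw [← pointsEquiv_comp, ← exists_comp_inclusion_iff i 𝔄 𝔅]
        exact ⟨x ≫ s.fst, by rw [hψ, Category.assoc, s.condition, Category.assoc]⟩
      rw [hI] at h1
      refine ⟨specMap (Ideal.Quotient.liftₐ I ψ fun a ha => h1 ha), ?_⟩
      rw [specMap_comp, ← hψ]
      rfl
    choose η hη using hk
    obtain ⟨l, hl⟩ := exists_hom_of_natural η (by
      intro B B' _ _ _ _ φ x
      apply hm
      rw [hη, Category.assoc, Category.assoc, hη])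
    exact ⟨l, over_hom_ext fun B _ _ x => by rw [← Category.assoc, hl, hη]⟩
  choose l hl using hl
  refine ⟨z, ⟨hz⟩, ⟨Limits.PullbackCone.IsLimit.mk _ l (fun s => ?_) hl fun s m _ h => ?_⟩⟩
  · rw [← cancel_mono (inclusion i 𝔄 𝔅), Category.assoc, hz, ← Category.assoc, hl, s.condition]
  · rw [← cancel_mono (specMap (Ideal.Quotient.mkₐ k I)), hl, h]

/-- A subsheaf that is locally closed in the charts is represented by a locally closed
subscheme. -/
theorem isImmersion_inclusion (H : ∀ {A K : Type u} [CommRing A] [Algebra k A] [Field K]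
      [Algebra k K] (a : F.obj A) (φ : A →ₐ[k] K), i.Mem (F.map φ a) →
      ∃ f : A, φ f ≠ 0 ∧ ∃ I : Ideal (Localization.Away f), ∀ (B : Type u) [CommRing B]
        [Algebra k B] (ψ : Localization.Away f →ₐ[k] B),
        i.Mem (F.map (ψ.comp (awayHom k f)) a) ↔ I ≤ RingHom.ker ψ) :
    IsImmersion (inclusion i 𝔄 𝔅).left := by
  refine isImmersion_of_local _ fun b => ?_
  obtain ⟨j, p, hp⟩ := 𝔄.exists_mem_range_chart ((inclusion i 𝔄 𝔅).left b)
  obtain ⟨K, _, _, y, y', h, hy, hy'⟩ := exists_common_point (𝔄.chart j) (inclusion i 𝔄 𝔅) p b hp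
  obtain ⟨φ, rfl⟩ := specMap_surjective y
  have h1 := (exists_comp_inclusion_iff i 𝔄 𝔅 _).1 ⟨y', h.symm⟩
  rw [pointsEquiv_comp_chart] at h1
  obtain ⟨f, hf, I, hI⟩ := H _ _ h1
  obtain ⟨z, hz⟩ := isPullback_inclusion i 𝔄 𝔅 (specMap (awayHom k f) ≫ 𝔄.chart j) I (by
    intro B _ _ ψ
    rw [pointsEquiv_comp_chart, ← F.map_comp, hI])
  refine ⟨_, _, _, _, _, ?_, ?_, hz.map (Over.forget _), ?_⟩
  · change IsOpenImmersion (specMap (awayHom k f) ≫ 𝔄.chart j).left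
    rw [Over.comp_left]
    infer_instance
  · exact IsClosedImmersion.spec_of_surjective _ Ideal.Quotient.mk_surjective
  · change _ ∈ Set.range (specMap (awayHom k f) ≫ 𝔄.chart j).left
    have : p ∈ Set.range (specMap (awayHom k f)).left := by
      refine mem_range_specMap_awayHom.2 ?_
      obtain ⟨t⟩ : Nonempty (Spec (CommRingCat.of K)) := inferInstance
      rw [← hy t, ker_algHom_of_specMap]
      exact hf
    obtain ⟨q, hq⟩ := this
    refine ⟨q, ?_⟩
    rw [Over.comp_left, Scheme.Hom.comp_apply, hq, hp]

end AffineAtlas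
end Sub

end

/-! ### The strata as subschemes -/

section

/-- The polynomial ring in finitely many indeterminates, presented without relations. -/
def mvPolynomialPresentation (R : Type u) [CommRing R] (σ : Type v) :
    Algebra.SubmersivePresentation R (MvPolynomial σ R) σ PEmpty.{1} where
  __ := Algebra.Generators.ofSurjective (R := R) (S := MvPolynomial σ R) MvPolynomial.X
    (fun x => ⟨x, MvPolynomial.aeval_X_left_apply x⟩)
  relation := PEmpty.elim
  span_range_relation_eq_ker := by
    rw [Set.range_eq_empty, Ideal.span_empty]
    symm
    change RingHom.ker (MvPolynomial.aeval (R := R) (S₁ := MvPolynomial σ R) MvPolynomial.X) = ⊥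
    rw [MvPolynomial.aeval_X_left]
    exact (RingHom.injective_iff_ker_eq_bot (RingHom.id _)).1 Function.injective_id
  map := PEmpty.elim
  map_inj := fun x => x.elim
  jacobian_isUnit := by
    rw [Algebra.PreSubmersivePresentation.jacobian_eq_jacobiMatrix_det, Matrix.det_isEmpty, map_one]
    exact isUnit_one

/-- A basic open subset of an affine space is smooth of the expected dimension. -/
theorem smoothOfRelativeDimension_away {k : Type u} [CommRing k] {σ : Type} [Finite σ]
    (s : MvPolynomial σ k) : SmoothOfRelativeDimension (Nat.card σ)
      (specOver k (Localization.Away s)).hom := by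
  have h1 : Algebra.IsStandardSmoothOfRelativeDimension (Nat.card σ) k (MvPolynomial σ k) :=
    (mvPolynomialPresentation k σ).isStandardSmoothOfRelativeDimension (by
      rw [Algebra.Presentation.dimension, Nat.card_of_isEmpty (α := PEmpty.{1}), Nat.sub_zero])
  have h2 : Algebra.IsStandardSmoothOfRelativeDimension 0 (MvPolynomial σ k)
    (Localization.Away s) := .localization_away s
  have h3 := Algebra.IsStandardSmoothOfRelativeDimension.trans (Nat.card σ) 0 k
    (MvPolynomial σ k) (Localization.Away s)
  change SmoothOfRelativeDimension _ (Spec.map _)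
  rw [HasRingHomProperty.Spec_iff (P := @SmoothOfRelativeDimension (Nat.card σ))]
  refine RingHom.locally_of ?_ _ ?_
  · exact RingHom.isStandardSmoothOfRelativeDimension_respectsIso
  · rw [zero_add] at h3
    exact (RingHom.isStandardSmoothOfRelativeDimension_algebraMap _).2 h3

/-- A scheme that is covered by charts which are open subschemes of an affine space. -/
theorem AffineAtlas.smoothOfRelativeDimension {k : Type u} [CommRing k] {F : ZariskiSheaf.{u, w} k}
    (𝔄 : AffineAtlas.{u, w, w'} F) {N : ℕ}
    (h : ∀ j, SmoothOfRelativeDimension N (specOver k (𝔄.R j)).hom) :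
    SmoothOfRelativeDimension N 𝔄.glued.hom := by
  let 𝒰 : Scheme.OpenCover.{w'} 𝔄.glued.left := Scheme.Cover.mkOfCovers 𝔄.J
    (fun j => (specOver k (𝔄.R j)).left) (fun j => (𝔄.chart j).left) (fun y => by
      obtain ⟨j, x, hx⟩ := 𝔄.exists_mem_range_chart y
      exact ⟨j, x, hx⟩) (fun j => inferInstanceAs (IsOpenImmersion (𝔄.chart j).left))
  have key : ∀ j, SmoothOfRelativeDimension N ((𝔄.chart j).left ≫ 𝔄.glued.hom) := fun j => by
    rw [Over.w]; exact h j
  have hP : HasRingHomProperty (@SmoothOfRelativeDimension.{u} N)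
    (RingHom.Locally (RingHom.IsStandardSmoothOfRelativeDimension N)) := inferInstance
  have : IsZariskiLocalAtSource (@SmoothOfRelativeDimension.{u} N) :=
    @HasRingHomProperty.instIsZariskiLocalAtSource _ _ hP
  exact IsZariskiLocalAtSource.of_openCover (P := @SmoothOfRelativeDimension N) 𝒰 key

namespace Chain

variable {k : Type u} [Field k] {m : ℕ} {T : Chain.{u, v} k m} {r : ℕ}

/-- To be a sub-bundle of given rank is a locally closed condition. -/
theorem _root_.LinkedGr.exists_ideal_isSubbundle_of_field {M : Type*} [AddCommGroup M] [Module k M]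
    [FiniteDimensional k M] {A K : Type u} [CommRing A] [Algebra k A] [Field K] [Algebra k K]
    (U : Submodule A (A ⊗[k] M)) (φ : A →ₐ[k] K) {ρ : ℕ} (h : IsSubbundle K (pullback φ U) ρ) :
    ∃ f : A, φ f ≠ 0 ∧ ∃ I : Ideal A, ∀ (B : Type u) [CommRing B] [Algebra k B] (ψ : A →ₐ[k] B),
      IsUnit (ψ f) → (IsSubbundle B (pullback ψ U) ρ ↔ I ≤ RingHom.ker ψ) := by
  obtain ⟨S, hS⟩ := exists_isCompl_pullback (pullback φ U)
  obtain ⟨f, hf, H⟩ := exists_isUnit_sup_eq_top hS.sup_eq_top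
  have hu : IsUnit (awayHom k f f) := IsLocalization.Away.algebraMap_isUnit f
  have hρ := finrank_add_of_isCompl hS
  rw [h.finrank_eq] at hρ
  obtain ⟨I, hI⟩ := exists_ideal_isSubbundle (ρ := ρ) (H _ (awayHom k f) hu) (by omega)
  refine ⟨f, hf, I.comap (awayHom k f), fun B _ _ ψ hψ => ?_⟩
  obtain ⟨χ, rfl⟩ := exists_comp_awayHom ψ hψ
  rw [pullback_comp, hI]
  constructor
  · intro h x hx
    exact h hx
  · intro h
    have : I = (I.comap (algebraMap A (Localization.Away f))).map _ :=
      (IsLocalization.map_under (Submonoid.powers f) _ I).symm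
    rw [this, Ideal.map_le_iff_le_comap]
    intro x hx
    exact h hx

/-- Finitely many locally closed conditions amount to one locally closed condition. -/
theorem _root_.LinkedGr.exists_ideal_and {k A K : Type u} [CommRing k] [CommRing A] [Algebra k A]
    [Field K] [Algebra k K] {φ : A →ₐ[k] K} {ι : Type*} (s : Finset ι)
    {Φ : ι → ∀ (B : Type u) [CommRing B] [Algebra k B], (A →ₐ[k] B) → Prop}
    (h : ∀ i ∈ s, ∃ f : A, φ f ≠ 0 ∧ ∃ I : Ideal A, ∀ (B : Type u) [CommRing B] [Algebra k B]
      (ψ : A →ₐ[k] B), IsUnit (ψ f) → (Φ i B ψ ↔ I ≤ RingHom.ker ψ)) :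
    ∃ f : A, φ f ≠ 0 ∧ ∃ I : Ideal A, ∀ (B : Type u) [CommRing B] [Algebra k B]
      (ψ : A →ₐ[k] B), IsUnit (ψ f) → ((∀ i ∈ s, Φ i B ψ) ↔ I ≤ RingHom.ker ψ) := by
  choose f hf I hI using h
  refine ⟨∏ i : s, f i.1 i.2, ?_, ⨆ i : s, I i.1 i.2, fun B _ _ ψ hψ => ?_⟩
  · rw [map_prod]
    exact Finset.prod_ne_zero_iff.2 fun i _ => hf _ _
  · rw [iSup_le_iff]
    have H : ∀ i : s, _ := fun i => hI i.1 i.2 B ψ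
      (isUnit_of_dvd_unit (map_dvd _ (Finset.dvd_prod_of_mem _ (Finset.mem_univ i))) hψ)
    exact ⟨fun h i => (H i).1 (h i.1 i.2), fun h i hi => (H ⟨i, hi⟩).2 (h ⟨i, hi⟩)⟩

variable (T r) in
/-- The inclusion of a stratum. -/
def stratumInclusion (δ : Ranks) : (T.stratumSheaf r δ).Inclusion (T.sheaf r) where
  toFun P := P.1
  injective _ _ h := Subtype.ext h
  map _ _ := rfl

theorem mem_stratumInclusion_iff {δ : Ranks} {A : Type u} [CommRing A] [Algebra k A]
    {P : T.Point r A} : (T.stratumInclusion r δ).Mem P ↔ P.InStratum δ := by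
  constructor
  · rintro ⟨b, rfl⟩
    exact b.2
  · intro h
    exact ⟨⟨P, h⟩, rfl⟩

/-- To lie in a stratum is a locally closed condition, being a conjunction of conditions that
certain submodules are sub-bundles. -/
theorem Point.InStratum.exists_ideal {δ : Ranks} {A K : Type u} [CommRing A] [Algebra k A]
    [Field K] [Algebra k K] {P : T.Point r A} {φ : A →ₐ[k] K} (h : (P.map φ).InStratum δ) :
    ∃ f : A, φ f ≠ 0 ∧ ∃ I : Ideal A, ∀ (B : Type u) [CommRing B] [Algebra k B] (ψ : A →ₐ[k] B),
      IsUnit (ψ f) → ((P.map ψ).InStratum δ ↔ I ≤ RingHom.ker ψ) := by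
  let U : ∀ t : Fin 3, ∀ i, Submodule k (T.M (i + 1)) := fun t i =>
    ![LinearMap.ker (T.g i), LinearMap.ker (T.f (i + 1)),
      LinearMap.ker (T.f (i + 1)) ⊔ LinearMap.ker (T.g i)] t
  let ρ : ∀ t : Fin 3, ∀ i, ℕ := fun t i =>
    ![δ.g (i + 1) + Module.finrank k (LinearMap.ker (T.g i)),
      δ.f (i + 1) + Module.finrank k (LinearMap.ker (T.f (i + 1))),
      δ.z (i + 1) + (Module.finrank k (LinearMap.ker (T.f (i + 1))) +
        Module.finrank k (LinearMap.ker (T.g i)))] t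
  have key : ∀ (B : Type u) [CommRing B] [Algebra k B] (ψ : A →ₐ[k] B), (P.map ψ).InStratum δ ↔
      ∀ p ∈ Finset.univ (α := Fin 3) ×ˢ Finset.range m,
        IsSubbundle B (pullback ψ (P.W (p.2 + 1) ⊔ (U p.1 p.2).baseChange A)) (ρ p.1 p.2) := by
    intro B _ _ ψ
    simp only [Finset.mem_product, Finset.mem_univ, true_and, Finset.mem_range, Prod.forall,
      Point.InStratum, pullback_sup, pullback_baseChange]
    constructor
    · intro h t i hi
      fin_cases t
      exacts [(h i hi).1, (h i hi).2.1, (h i hi).2.2]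
    · intro h i hi
      exact ⟨h 0 i hi, h 1 i hi, h 2 i hi⟩
  simp only [key] at h ⊢
  exact exists_ideal_and _ fun p hp => exists_ideal_isSubbundle_of_field _ φ (h p hp)

variable (T r) in
/-- The scheme of linked families. -/
def scheme : Over (Spec (CommRingCat.of k)) := (T.atlas r).glued

/-- The scheme of linked families with prescribed ranks. -/
def stratum (r : ℕ) {δ : Ranks} (hδ : T.EndRanks δ) : Over (Spec (CommRingCat.of k)) :=
  (stratumAtlas T r hδ).glued

/-- The inclusion of a stratum in the scheme of linked families. -/
def stratumι (r : ℕ) {δ : Ranks} (hδ : T.EndRanks δ) : stratum r hδ ⟶ T.scheme r :=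
  AffineAtlas.inclusion (T.stratumInclusion r δ) (T.atlas r) (stratumAtlas T r hδ)

instance {δ : Ranks} (hδ : T.EndRanks δ) : IsImmersion (stratumι r hδ).left := by
  refine AffineAtlas.isImmersion_inclusion _ _ _ fun {A K} _ _ _ _ P φ h => ?_
  obtain ⟨f, hf, I, hI⟩ := (mem_stratumInclusion_iff.1 h).exists_ideal (P := P)
  refine ⟨f, hf, I.map (awayHom k f), fun B _ _ ψ => ?_⟩
  refine mem_stratumInclusion_iff.trans ((hI B (ψ.comp (awayHom k f)) ?_).trans ?_)
  · exact (IsLocalization.Away.algebraMap_isUnit (S := Localization.Away f) f).map ψ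
  · rw [Ideal.map_le_iff_le_comap]
    rfl

theorem exists_comp_stratumι_iff {δ : Ranks} (hδ : T.EndRanks δ) {A : Type u} [CommRing A]
    [Algebra k A] (x : specOver k A ⟶ T.scheme r) : (∃ y, y ≫ stratumι r hδ = x) ↔
      Point.InStratum ((T.atlas r).pointsEquiv A x : T.Point r A) δ :=
  (AffineAtlas.exists_comp_inclusion_iff _ _ _ x).trans mem_stratumInclusion_iff

end Chain

end

/-! ### Smoothness, disjointness and covering of the strata -/

section

theorem exists_field_point {k : Type u} [CommRing k] {X : Over (Spec (CommRingCat.of k))}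
    (x : X.left) : ∃ (K : Type u) (_ : Field K) (_ : Algebra k K) (y : specOver k K ⟶ X),
      ∀ t, y.left t = x := by
  obtain ⟨K, i, j, y, -, -, h, -⟩ := exists_common_point (𝟙 X) (𝟙 X) x x rfl
  exact ⟨K, i, j, y, h⟩

namespace Chain

variable {k : Type u} [Field k] {m : ℕ} {T : Chain.{u, v} k m} {r : ℕ} {δ : Ranks}

/-- The kernel of the map to the right at the inner place `i + 1`. -/
abbrev kerF (T : Chain.{u, v} k m) (i : ℕ) : Submodule k (T.M (i + 1)) := LinearMap.ker (T.f (i + 1))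

/-- The kernel of the map to the left at the inner place `i + 1`. -/
abbrev kerG (T : Chain.{u, v} k m) (i : ℕ) : Submodule k (T.M (i + 1)) := LinearMap.ker (T.g i)

/-- The dimension at the inner place `i + 1` modulo both kernels. -/
def rankB (T : Chain.{u, v} k m) (i : ℕ) : ℤ :=
  Module.finrank k (T.M (i + 1)) - Module.finrank k (T.kerF i) - Module.finrank k (T.kerG i)

variable (T r δ) in
/-- The expected dimension of a stratum. -/
def stratumDim : ℤ :=
  ∑ i ∈ Finset.range m,
    ((δ.z (i + 1) : ℤ) * (T.rankB i - δ.z (i + 1)) +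
      ((δ.g (i + 1) : ℤ) - δ.g (i + 2)) *
        (Module.finrank k (T.kerF i) - δ.g (i + 1) + δ.z (i + 1)) +
      ((δ.f (i + 1) : ℤ) - δ.f i) *
        (Module.finrank k (T.kerG i) - δ.f (i + 1) + δ.z (i + 1)) +
      ((r : ℤ) - δ.g (i + 2) - δ.f i) * (δ.g (i + 1) + δ.f (i + 1) - δ.z (i + 1) - r))

/-- The number of parameters of a chart is the expected dimension of the stratum. -/
theorem Frame.Fits.card_idx {c : T.Frame} (hc : c.Fits δ r) :
    (Nat.card c.Idx : ℤ) = T.stratumDim r δ := by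
  rw [stratumDim, Finset.sum_range, Nat.card_eq_fintype_card, Fintype.card_sigma, Nat.cast_sum]
  refine Finset.sum_congr rfl fun i _ => ?_
  rw [Fintype.card_fin, Spot.finrank_L, rankB]
  have h1 := (c i).finrank_M
  have h2 := (c i).finrank_H
  have h3 := (hc.fits i).P_eq
  have h4 := (hc.fits i).Q_eq
  have h5 := hc.g_eq i
  have h6 := hc.f_eq i
  have h7 := hc.z_eq i
  have h8 := hc.r_eq i
  simp only [kerF, kerG]
  generalize Module.finrank k (LinearMap.ker (T.f (i + 1))) = p at *
  generalize Module.finrank k (LinearMap.ker (T.g i)) = q at *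
  generalize Module.finrank k (T.M (i + 1)) = d at *
  generalize Module.finrank k (c i).P' = P' at *
  generalize Module.finrank k (c i).P'' = P'' at *
  generalize Module.finrank k (c i).Q' = Q' at *
  generalize Module.finrank k (c i).Q'' = Q'' at *
  generalize Module.finrank k (c i).B' = B' at *
  generalize Module.finrank k (c i).B'' = B'' at *
  generalize Module.finrank k (c i).H₀ = H₀ at *
  generalize Module.finrank k (c i).H₁ = H₁ at *
  have e1 : (H₁ : ℤ) = P' + Q' + B' - H₀ := by omega
  rw [h7, h1, h5, h6, ← h3, ← h4, ← h8]
  push_cast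
  rw [e1]
  ring

/-- A stratum is covered by open subsets of affine spaces, hence smooth. -/
theorem stratum_smooth (hδ : T.EndRanks δ) (h : Nonempty (stratum r hδ).left) :
    ∃ N : ℕ, (N : ℤ) = T.stratumDim r δ ∧ SmoothOfRelativeDimension N (stratum r hδ).hom := by
  obtain ⟨x⟩ := h
  obtain ⟨j, -⟩ := (stratumAtlas T r hδ).exists_mem_range_chart x
  let j : T.StratumChart r δ := j
  refine ⟨Nat.card j.1.1.1.Idx, j.1.1.2.card_idx, AffineAtlas.smoothOfRelativeDimension _ ?_⟩
  intro (l : T.StratumChart r δ)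
  have : Nat.card j.1.1.1.Idx = Nat.card l.1.1.1.Idx := by
    have h1 := j.1.1.2.card_idx
    rw [← l.1.1.2.card_idx] at h1
    exact_mod_cast h1
  rw [this]
  exact smoothOfRelativeDimension_away l.1.2

theorem nonempty_stratum_iff (hδ : T.EndRanks δ) : Nonempty (stratum r hδ).left ↔
    ∃ (K : Type u) (_ : Field K) (_ : Algebra k K) (P : T.Point r K), P.InStratum δ := by
  constructor
  · rintro ⟨x⟩
    obtain ⟨K, _, _, y, -⟩ := exists_field_point x
    let P := (stratumAtlas T r hδ).pointsEquiv K y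
    exact ⟨K, _, _, P.1, P.2⟩
  · rintro ⟨K, _, _, P, hP⟩
    let y := ((stratumAtlas T r hδ).pointsEquiv K).symm ⟨P, hP⟩
    obtain ⟨t⟩ : Nonempty (Spec (CommRingCat.of K)) := inferInstance
    exact ⟨y.left t⟩

/-- Over a field, a linked family lies in at most one stratum. -/
theorem Point.InStratum.eq {K : Type u} [Field K] [Algebra k K] {P : T.Point r K} {δ' : Ranks}
    (h : P.InStratum δ) (h' : P.InStratum δ') (i : ℕ) (hi : i < m) :
    δ.g (i + 1) = δ'.g (i + 1) ∧ δ.f (i + 1) = δ'.f (i + 1) ∧ δ.z (i + 1) = δ'.z (i + 1) := by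
  have h1 := (h i hi).1.finrank_eq.symm.trans (h' i hi).1.finrank_eq
  have h2 := (h i hi).2.1.finrank_eq.symm.trans (h' i hi).2.1.finrank_eq
  have h3 := (h i hi).2.2.finrank_eq.symm.trans (h' i hi).2.2.finrank_eq
  omega

theorem disjoint_range_stratumι {δ' : Ranks} (hδ : T.EndRanks δ) (hδ' : T.EndRanks δ')
    (h : ∃ i < m, ¬(δ.g (i + 1) = δ'.g (i + 1) ∧ δ.f (i + 1) = δ'.f (i + 1) ∧
      δ.z (i + 1) = δ'.z (i + 1))) :
    Disjoint (Set.range (stratumι r hδ).left) (Set.range (stratumι r hδ').left) := by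
  rw [Set.disjoint_left]
  rintro _ ⟨x, rfl⟩ ⟨x', hx⟩
  obtain ⟨K, _, _, y, y', e, -, -⟩ := exists_common_point _ _ _ _ hx.symm
  obtain ⟨i, hi, h⟩ := h
  have h1 := (exists_comp_stratumι_iff hδ (y ≫ stratumι r hδ)).1 ⟨y, rfl⟩
  have h2 := (exists_comp_stratumι_iff hδ' (y ≫ stratumι r hδ)).1 ⟨y', e.symm⟩
  exact h (h1.eq h2 i hi)

/-- Over a field every submodule is a sub-bundle, so that every linked family lies in a stratum. -/
theorem Point.exists_inStratum {K : Type u} [Field K] [Algebra k K] (P : T.Point r K) :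
    ∃ δ, T.EndRanks δ ∧ P.InStratum δ := by
  have key : ∀ (i : ℕ) (S : Submodule k (T.M i)), ∃ a, Module.finrank K (P.W i ⊔ S.baseChange K :
      Submodule K (K ⊗[k] T.M i)) = a + Module.finrank k S := fun i S => by
    refine ⟨_, (Nat.sub_add_cancel ?_).symm⟩
    rw [← finrank_submodule_baseChange (K := K) S]
    exact Submodule.finrank_mono le_sup_right
  choose a ha using fun i => key (i + 1) (T.kerG i)
  choose b hb using fun i => key (i + 1) (T.kerF i)
  choose c hc using fun i => key (i + 1) (T.kerF i ⊔ T.kerG i)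
  refine ⟨⟨fun i => if i = m + 1 then Module.finrank k (LinearMap.range (T.g m)) else a (i - 1),
    fun i => if i = 0 then Module.finrank k (LinearMap.range (T.f 0)) else b (i - 1),
    fun i => c (i - 1)⟩, ⟨by simp, by simp⟩, fun i hi =>
      ⟨.of_finrank ?_, .of_finrank ?_, .of_finrank ?_⟩⟩
  · dsimp only
    rw [if_neg (by omega), Nat.add_sub_cancel]
    exact ha i
  · dsimp only
    rw [if_neg (by omega), Nat.add_sub_cancel]
    exact hb i
  · rw [← Frame.finrank_ker_add T i hi]
    exact hc i

/-- The inequalities that hold if and only if a stratum is non-empty. -/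
def Admissible (T : Chain.{u, v} k m) (r : ℕ) (δ : Ranks) : Prop :=
  ∀ i < m, (δ.z (i + 1) : ℤ) ≤ T.rankB i ∧
    ((δ.g (i + 1) : ℤ) - δ.z (i + 1) ≤ Module.finrank k (T.kerF i) ∧
      (δ.g (i + 2) : ℤ) ≤ δ.g (i + 1) - δ.z (i + 1)) ∧
    ((δ.f (i + 1) : ℤ) - δ.z (i + 1) ≤ Module.finrank k (T.kerG i) ∧
      (δ.f i : ℤ) ≤ δ.f (i + 1) - δ.z (i + 1)) ∧
    (r : ℤ) ≤ δ.g (i + 1) + δ.f (i + 1) - δ.z (i + 1) ∧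
    δ.g (i + 2) + δ.f (i + 1) ≤ r ∧ δ.g (i + 1) + δ.f i ≤ r

theorem finrank_map_add_le {K V V' : Type*} [Field K] [AddCommGroup V] [Module K V]
    [AddCommGroup V'] [Module K V'] [FiniteDimensional K V] (f : V →ₗ[K] V') {W G : Submodule K V}
    (h : G ≤ W) (h' : G ≤ LinearMap.ker f) :
    Module.finrank K (W.map f) + Module.finrank K G ≤ Module.finrank K W := by
  rw [← (f.domRestrict W).finrank_range_add_finrank_ker, LinearMap.range_domRestrict]
  refine Nat.add_le_add_left ?_ _
  have : G.comap W.subtype ≤ LinearMap.ker (f.domRestrict W) := fun x hx => h' hx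
  rw [← (Submodule.comapSubtypeEquivOfLe h).finrank_eq]
  exact Submodule.finrank_mono this

/-- The inequalities between the ranks of a linked family over a field: the ranks are expressed by
the dimensions of the summands of a chart that contains the family, and these are nonnegative. -/
theorem Point.InStratum.admissible {K : Type u} [Field K] [Algebra k K] {P : T.Point r K}
    (h : P.InStratum δ) (hδ : T.EndRanks δ) : T.Admissible r δ := fun i hi => by
  obtain ⟨c, hc, -⟩ := h.exists_frame hδ
  have h1 := (c ⟨i, hi⟩).finrank_M
  have h2 := (c ⟨i, hi⟩).finrank_H
  have h3 := (hc.fits ⟨i, hi⟩).P_eq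
  have h4 := (hc.fits ⟨i, hi⟩).Q_eq
  have h5 := hc.g_eq ⟨i, hi⟩
  have h6 := hc.f_eq ⟨i, hi⟩
  have h7 := hc.z_eq ⟨i, hi⟩
  have h8 := hc.r_eq ⟨i, hi⟩
  have hr := (P.isSubbundle i hi).finrank_eq
  have ef := finrank_map_add_le ((T.f (i + 1)).baseChange K) (P.map_g_le (i + 1)) (by
    rw [ker_baseChange]; exact Frame.map_f_le_ker _ _)
  have eg := finrank_map_add_le ((T.g i).baseChange K) (P.map_f_le i) (by
    rw [ker_baseChange]; exact Frame.map_g_le_ker _ _)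
  rw [hr, (h.isSubbundle_map_f hδ _ hi).finrank_eq, (h.isSubbundle_map_g hδ _ hi).finrank_eq] at ef
  rw [hr, (h.isSubbundle_map_f hδ _ hi.le).finrank_eq,
    (h.isSubbundle_map_g hδ _ hi.le).finrank_eq] at eg
  simp only [rankB, kerF, kerG, show i + 2 = i + 1 + 1 from rfl]
  simp only [Nat.succ_eq_add_one] at *
  omega

end Chain

end

/-! ### Existence of linked families with given ranks -/

section

section Subspaces

variable {k M N : Type*} [Field k] [AddCommGroup M] [Module k M] [AddCommGroup N] [Module k N]

theorem finrank_map_of_disjoint (φ : M →ₗ[k] N) {U : Submodule k M}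
    (h : Disjoint U (LinearMap.ker φ)) : Module.finrank k (U.map φ) = Module.finrank k U := by
  rw [← LinearMap.range_domRestrict]
  refine LinearMap.finrank_range_of_inj (LinearMap.ker_eq_bot.1 ?_)
  rw [LinearMap.ker_eq_bot']
  intro x hx
  exact Subtype.ext (Submodule.disjoint_def.1 h x x.2 hx)

theorem disjoint_sup_of_disjoint {P Q B : Submodule k M} (hPQ : Disjoint P Q) (hB : Disjoint (P ⊔ Q) B) :
    Disjoint (P ⊔ B) Q := by
  rw [Submodule.disjoint_def]
  intro x hx hxQ
  obtain ⟨p, hp, b, hb, rfl⟩ := Submodule.mem_sup.1 hx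
  obtain ⟨h1, h2, h3⟩ := eq_zero_of_add_add_eq_zero hPQ hB hp (neg_mem hxQ) hb (by abel)
  rw [h1, h3, add_zero]

theorem exists_le_finrank_eq (S : Submodule k M) {n : ℕ} (h : n ≤ Module.finrank k S) :
    ∃ S' ≤ S, Module.finrank k S' = n := by
  obtain ⟨b, hb⟩ := exists_linearIndependent_of_le_finrank h
  refine ⟨(Submodule.span k (Set.range b)).map S.subtype, Submodule.map_subtype_le _ _, ?_⟩
  rw [finrank_map_of_disjoint _ (by rw [Submodule.ker_subtype]; exact disjoint_bot_right),
    finrank_span_eq_card hb, Fintype.card_fin]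

variable [FiniteDimensional k M]

theorem exists_le_disjoint_finrank_eq {G P : Submodule k M} (h : G ≤ P) {n : ℕ}
    (hn : Module.finrank k G + n ≤ Module.finrank k P) :
    ∃ P' ≤ P, Disjoint G P' ∧ Module.finrank k P' = n := by
  obtain ⟨C, hC, hCP⟩ := exists_disjoint_sup_eq h
  have h1 := finrank_sup_of_disjoint hC
  rw [hCP] at h1
  obtain ⟨P', hP', e⟩ := exists_le_finrank_eq C (n := n) (by omega)
  exact ⟨P', hP'.trans (le_sup_left.trans hCP.le), (hC.mono_left hP').symm, e⟩

/-- A subspace of a direct sum that surjects to both summands exists in every dimension allowed by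
the dimensions of the summands. -/
theorem exists_sup_eq_sup_of_finrank {P Q : Submodule k M} {h : ℕ}
    (hP : Module.finrank k P ≤ h) (hQ : Module.finrank k Q ≤ h)
    (hPQ : Disjoint P Q) (hs : h ≤ Module.finrank k P + Module.finrank k Q) :
    ∃ X : Submodule k M, X ⊔ P = P ⊔ Q ∧ X ⊔ Q = P ⊔ Q ∧ Module.finrank k X = h := by
  -- `X` is the sum of a part of `P`, a part of `Q` and the graph of an isomorphism between
  -- complements of these parts.
  obtain ⟨P₁, hP₁, e₁⟩ := exists_le_finrank_eq P (n := h - Module.finrank k Q) (by omega)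
  obtain ⟨Q₁, hQ₁, e₂⟩ := exists_le_finrank_eq Q (n := h - Module.finrank k P) (by omega)
  obtain ⟨P₂, hd₁, hs₁⟩ := exists_disjoint_sup_eq hP₁
  obtain ⟨Q₂, hd₂, hs₂⟩ := exists_disjoint_sup_eq hQ₁
  have f₁ := finrank_sup_of_disjoint hd₁
  have f₂ := finrank_sup_of_disjoint hd₂
  rw [hs₁] at f₁
  rw [hs₂] at f₂
  let e : P₂ ≃ₗ[k] Q₂ := LinearEquiv.ofFinrankEq _ _ (by omega)
  let D := LinearMap.range (P₂.subtype + Q₂.subtype ∘ₗ e.toLinearMap)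
  have hD : Module.finrank k D ≤ Module.finrank k P₂ := LinearMap.finrank_range_le _
  have hDm : ∀ x : P₂, (x : M) + e x ∈ D := fun x => ⟨x, rfl⟩
  have hPD : P₂ ≤ D ⊔ Q₂ := fun x hx => by
    rw [show x = (x + e ⟨x, hx⟩) - e ⟨x, hx⟩ by abel]
    exact sub_mem (Submodule.mem_sup_left (hDm ⟨x, hx⟩)) (Submodule.mem_sup_right (e _).2)
  have hQD : Q₂ ≤ D ⊔ P₂ := fun x hx => by
    obtain ⟨y, hy⟩ := e.surjective ⟨x, hx⟩
    rw [show x = (y + e y) - y by rw [hy]; simp]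
    exact sub_mem (Submodule.mem_sup_left (hDm y)) (Submodule.mem_sup_right y.2)
  have hDle : D ≤ P ⊔ Q := by
    rintro _ ⟨x, rfl⟩
    exact add_mem (Submodule.mem_sup_left (hs₁.le (Submodule.mem_sup_left x.2)))
      (Submodule.mem_sup_right (hs₂.le (Submodule.mem_sup_left (e x).2)))
  have hX : P₁ ⊔ Q₁ ⊔ D ≤ P ⊔ Q := sup_le (sup_le_sup hP₁ hQ₁) hDle
  have hXQ : P₁ ⊔ Q₁ ⊔ D ⊔ Q₂ = P ⊔ Q := by
    refine le_antisymm (sup_le hX ((le_sup_left.trans hs₂.le).trans le_sup_right)) (sup_le ?_ ?_)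
    · rw [← hs₁]
      refine sup_le (hPD.trans ?_) (le_sup_left.trans (le_sup_left.trans le_sup_left))
      exact sup_le_sup_right le_sup_right _
    · rw [← hs₂]
      exact sup_le le_sup_right (le_sup_right.trans (le_sup_left.trans le_sup_left))
  have hXP : P₁ ⊔ Q₁ ⊔ D ⊔ P₂ = P ⊔ Q := by
    refine le_antisymm (sup_le hX ((le_sup_left.trans hs₁.le).trans le_sup_left)) (sup_le ?_ ?_)
    · rw [← hs₁]
      exact sup_le le_sup_right (le_sup_left.trans (le_sup_left.trans le_sup_left))
    · rw [← hs₂]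
      refine sup_le (hQD.trans ?_) (le_sup_right.trans (le_sup_left.trans le_sup_left))
      exact sup_le_sup_right le_sup_right _
  refine ⟨P₁ ⊔ Q₁ ⊔ D, le_antisymm (sup_le hX le_sup_left) ?_, le_antisymm (sup_le hX le_sup_right)
    ?_, ?_⟩
  · rw [← hXP]; exact sup_le_sup_left (le_sup_left.trans hs₁.le) _
  · rw [← hXQ]; exact sup_le_sup_left (le_sup_left.trans hs₂.le) _
  · have a1 := Submodule.finrank_add_le_finrank_add_finrank (P₁ ⊔ Q₁) D
    have a2 := Submodule.finrank_add_le_finrank_add_finrank P₁ Q₁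
    have a3 := Submodule.finrank_add_le_finrank_add_finrank (P₁ ⊔ Q₁ ⊔ D) Q₂
    rw [hXQ, finrank_sup_of_disjoint hPQ] at a3
    omega

variable {P Q B : Submodule k M}

/-- Adds a complementary part of `P` and the space `B` to a subspace of `P`. -/
theorem exists_extension (hPQ : Disjoint P Q) (hB : Disjoint (P ⊔ Q) B) {G : Submodule k M}
    (hG : G ≤ P) {n : ℕ} (hn : Module.finrank k G + n ≤ Module.finrank k P) (φ : M →ₗ[k] N)
    (hφ : LinearMap.ker φ = Q) : ∃ P' ≤ P, Disjoint G P' ∧ Module.finrank k P' = n ∧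
      Module.finrank k ((G ⊔ P' ⊔ B).map φ) = Module.finrank k G + n + Module.finrank k B := by
  obtain ⟨P', hP', hd, e⟩ := exists_le_disjoint_finrank_eq hG hn
  have hU : G ⊔ P' ≤ P := sup_le hG hP'
  refine ⟨P', hP', hd, e, ?_⟩
  rw [finrank_map_of_disjoint, finrank_sup_of_disjoint (hB.mono_left (hU.trans le_sup_left)),
    finrank_sup_of_disjoint hd, e]
  rw [hφ]
  exact (disjoint_sup_of_disjoint hPQ hB).mono_left (sup_le_sup_right hU _)

/-- A subspace that contains `G` and `F` and whose images modulo `P`, modulo `Q` and modulo both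
are prescribed. -/
theorem exists_member (hPQ : Disjoint P Q) (hB : Disjoint (P ⊔ Q) B) {G P' F Q' : Submodule k M}
    (hG : G ≤ P) (hP' : P' ≤ P) (hGP : Disjoint G P') (hF : F ≤ Q) (hQ' : Q' ≤ Q)
    (hFQ : Disjoint F Q') {h : ℕ} (h₁ : Module.finrank k P' ≤ h) (h₂ : Module.finrank k Q' ≤ h)
    (h₃ : h ≤ Module.finrank k P' + Module.finrank k Q') :
    ∃ W : Submodule k M, G ≤ W ∧ F ≤ W ∧ W ⊔ Q = G ⊔ P' ⊔ B ⊔ Q ∧ W ⊔ P = F ⊔ Q' ⊔ B ⊔ P ∧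
      W ⊔ (P ⊔ Q) = B ⊔ (P ⊔ Q) ∧
      Module.finrank k W = Module.finrank k G + Module.finrank k F + h + Module.finrank k B := by
  obtain ⟨X, hXP, hXQ, hX⟩ := exists_sup_eq_sup_of_finrank h₁ h₂ (hPQ.mono hP' hQ') h₃
  have hXle : X ≤ P' ⊔ Q' := le_sup_left.trans hXP.le
  have hd : Disjoint (G ⊔ F) (P' ⊔ Q') := by
    rw [Submodule.disjoint_def]
    intro x hx hx'
    obtain ⟨g, hg, f, hf, rfl⟩ := Submodule.mem_sup.1 hx
    obtain ⟨p, hp, q, hq, hpq⟩ := Submodule.mem_sup.1 hx'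
    have e : g - p = q - f := by rw [sub_eq_sub_iff_add_eq_add, ← hpq]; abel
    have h0 : g - p = 0 := Submodule.disjoint_def.1 hPQ _ (sub_mem (hG hg) (hP' hp))
      (by rw [e]; exact sub_mem (hQ' hq) (hF hf))
    have hg0 := Submodule.disjoint_def.1 hGP g hg (by rw [sub_eq_zero.1 h0]; exact hp)
    have hf0 := Submodule.disjoint_def.1 hFQ f hf
      (by rw [← sub_eq_zero.1 (e.symm.trans h0)]; exact hq)
    rw [hg0, hf0, add_zero]
  have hle : G ⊔ F ⊔ X ≤ P ⊔ Q := sup_le (sup_le_sup hG hF) (hXle.trans (sup_le_sup hP' hQ'))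
  refine ⟨G ⊔ F ⊔ X ⊔ B, le_sup_left.trans (le_sup_left.trans le_sup_left),
    le_sup_right.trans (le_sup_left.trans le_sup_left), ?_, ?_, ?_, ?_⟩
  · calc G ⊔ F ⊔ X ⊔ B ⊔ Q = G ⊔ B ⊔ (F ⊔ Q) ⊔ X := by ac_rfl
      _ = G ⊔ B ⊔ (Q' ⊔ Q) ⊔ X := by rw [sup_eq_right.2 hF, sup_eq_right.2 hQ']
      _ = G ⊔ B ⊔ Q ⊔ (X ⊔ Q') := by ac_rfl
      _ = G ⊔ P' ⊔ B ⊔ (Q' ⊔ Q) := by rw [hXQ]; ac_rfl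
      _ = _ := by rw [sup_eq_right.2 hQ']
  · calc G ⊔ F ⊔ X ⊔ B ⊔ P = F ⊔ B ⊔ (G ⊔ P) ⊔ X := by ac_rfl
      _ = F ⊔ B ⊔ (P' ⊔ P) ⊔ X := by rw [sup_eq_right.2 hG, sup_eq_right.2 hP']
      _ = F ⊔ B ⊔ P ⊔ (X ⊔ P') := by ac_rfl
      _ = F ⊔ Q' ⊔ B ⊔ (P' ⊔ P) := by rw [hXP]; ac_rfl
      _ = _ := by rw [sup_eq_right.2 hP']
  · rw [sup_assoc, sup_left_comm, sup_eq_right.2 hle]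
  · rw [finrank_sup_of_disjoint (hB.mono_left hle), finrank_sup_of_disjoint (hd.mono_right hXle),
      finrank_sup_of_disjoint (hPQ.mono hG hF), hX]

end Subspaces

namespace Chain

variable {k : Type u} [Field k] {m : ℕ} {T : Chain.{u, v} k m} {r : ℕ} {δ : Ranks}

/-- Subspaces `U i` that contain the images under `g` of the following ones and have images of the
prescribed ranks under `g`. They are built by descending induction from the image of the following
subspace, a part of `ker f`, and `B`. Only their images under `g` are used later. -/
theorem exists_fam_g (h : T.Admissible r δ) (hδ : T.EndRanks δ)
    {B : ∀ i, Submodule k (T.M (i + 1))} (hB : ∀ i < m, Disjoint (T.kerF i ⊔ T.kerG i) (B i))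
    (hz : ∀ i < m, Module.finrank k (B i) = δ.z (i + 1)) :
    ∃ U : ∀ i, Submodule k (T.M i), U (m + 1) = ⊤ ∧ ∀ i < m,
      Module.finrank k ((U (i + 1)).map (T.g i)) = δ.g (i + 1) ∧ ∃ P' ≤ T.kerF i,
        Disjoint ((U (i + 2)).map (T.g (i + 1))) P' ∧
        Module.finrank k P' + δ.g (i + 2) + δ.z (i + 1) = δ.g (i + 1) ∧
        U (i + 1) = (U (i + 2)).map (T.g (i + 1)) ⊔ P' ⊔ B i := by
  have key : ∀ j, ∃ U : ∀ i, Submodule k (T.M i), U (m + 1) = ⊤ ∧ ∀ i < m, m ≤ i + j →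
      Module.finrank k ((U (i + 1)).map (T.g i)) = δ.g (i + 1) ∧ ∃ P' ≤ T.kerF i,
        Disjoint ((U (i + 2)).map (T.g (i + 1))) P' ∧
        Module.finrank k P' + δ.g (i + 2) + δ.z (i + 1) = δ.g (i + 1) ∧
        U (i + 1) = (U (i + 2)).map (T.g (i + 1)) ⊔ P' ⊔ B i := by
    intro j
    induction j with
    | zero => exact ⟨fun _ => ⊤, rfl, fun i h h' => by omega⟩
    | succ j ih =>
      obtain ⟨U, hU, H⟩ := ih
      by_cases hj : j < m
      swap
      · exact ⟨U, hU, fun i hi _ => H i hi (by omega)⟩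
      obtain ⟨l, hl⟩ : ∃ l, m = l + j + 1 := ⟨m - j - 1, by omega⟩
      have hlm : l < m := by omega
      -- the dimension of the image of the following subspace, which is everything if it is the last
      have hG : Module.finrank k ((U (l + 2)).map (T.g (l + 1))) = δ.g (l + 2) := by
        by_cases hl' : l + 1 < m
        · exact (H (l + 1) hl' (by omega)).1
        · obtain rfl : m = l + 1 := by omega
          rw [hU, Submodule.map_top]
          exact hδ.g_eq.symm
      obtain ⟨h1, ⟨h2, h3⟩, -⟩ := h l hlm
      have hGle : (U (l + 2)).map (T.g (l + 1)) ≤ T.kerF l := by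
        rw [Submodule.map_le_iff_le_comap]
        exact fun x _ => LinearMap.congr_fun (T.f_comp_g (l + 1)) x
      obtain ⟨P', hP', hd, e, hfin⟩ := exists_extension (P := T.kerF l) (T.disjoint l hlm) (hB l hlm) hGle
        (n := δ.g (l + 1) - δ.g (l + 2) - δ.z (l + 1)) (by rw [hG]; omega) (T.g l) rfl
      have hne : ∀ i, l < i → Function.update U (l + 1)
          ((U (l + 2)).map (T.g (l + 1)) ⊔ P' ⊔ B l) (i + 1) = U (i + 1) := fun i hi =>
        Function.update_of_ne (by omega) _ _
      refine ⟨Function.update U (l + 1) ((U (l + 2)).map (T.g (l + 1)) ⊔ P' ⊔ B l), ?_, ?_⟩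
      · rw [hne m hlm, hU]
      · intro i hi hij
        rcases (show l ≤ i by omega).eq_or_lt with rfl | hli
        · rw [hne (l + 1) (by omega), Function.update_self]
          exact ⟨by rw [hfin, hG, hz l hlm]; omega, P', hP', hd, by omega, rfl⟩
        · rw [hne i hli, hne (i + 1) (by omega)]
          exact H i hi (by omega)
  obtain ⟨U, hU, H⟩ := key m
  exact ⟨U, hU, fun i hi => H i hi (by omega)⟩

/-- The counterpart of `exists_fam_g` for the maps `f`, by ascending induction. -/
theorem exists_fam_f (h : T.Admissible r δ) (hδ : T.EndRanks δ)
    {B : ∀ i, Submodule k (T.M (i + 1))} (hB : ∀ i < m, Disjoint (T.kerF i ⊔ T.kerG i) (B i))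
    (hz : ∀ i < m, Module.finrank k (B i) = δ.z (i + 1)) :
    ∃ U : ∀ i, Submodule k (T.M i), U 0 = ⊤ ∧ ∀ i < m,
      Module.finrank k ((U (i + 1)).map (T.f (i + 1))) = δ.f (i + 1) ∧ ∃ Q' ≤ T.kerG i,
        Disjoint ((U i).map (T.f i)) Q' ∧
        Module.finrank k Q' + δ.f i + δ.z (i + 1) = δ.f (i + 1) ∧
        U (i + 1) = (U i).map (T.f i) ⊔ Q' ⊔ B i := by
  have key : ∀ j, ∃ U : ∀ i, Submodule k (T.M i), U 0 = ⊤ ∧ ∀ i < m, i < j →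
      Module.finrank k ((U (i + 1)).map (T.f (i + 1))) = δ.f (i + 1) ∧ ∃ Q' ≤ T.kerG i,
        Disjoint ((U i).map (T.f i)) Q' ∧
        Module.finrank k Q' + δ.f i + δ.z (i + 1) = δ.f (i + 1) ∧
        U (i + 1) = (U i).map (T.f i) ⊔ Q' ⊔ B i := by
    intro j
    induction j with
    | zero => exact ⟨fun _ => ⊤, rfl, fun i h h' => by omega⟩
    | succ l ih =>
      obtain ⟨U, hU, H⟩ := ih
      by_cases hlm : l < m
      swap
      · exact ⟨U, hU, fun i hi _ => H i hi (by omega)⟩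
      have hF : Module.finrank k ((U l).map (T.f l)) = δ.f l := by
        obtain _ | l := l
        · rw [hU, Submodule.map_top]
          exact hδ.f_eq.symm
        · exact (H l (by omega) (by omega)).1
      obtain ⟨h1, -, ⟨h2, h3⟩, -⟩ := h l hlm
      have hFle : (U l).map (T.f l) ≤ T.kerG l := by
        rw [Submodule.map_le_iff_le_comap]
        exact fun x _ => LinearMap.congr_fun (T.g_comp_f l) x
      obtain ⟨Q', hQ', hd, e, hfin⟩ := exists_extension (P := T.kerG l) (T.disjoint l hlm).symm
        (by rw [sup_comm]; exact hB l hlm) hFle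
        (n := δ.f (l + 1) - δ.f l - δ.z (l + 1)) (by rw [hF]; omega) (T.f (l + 1)) rfl
      have hne : ∀ i, i ≠ l + 1 → Function.update U (l + 1)
          ((U l).map (T.f l) ⊔ Q' ⊔ B l) i = U i := fun i hi =>
        Function.update_of_ne hi _ _
      refine ⟨Function.update U (l + 1) ((U l).map (T.f l) ⊔ Q' ⊔ B l), ?_, ?_⟩
      · rw [hne 0 (by omega), hU]
      · intro i hi hij
        rcases (show i ≤ l by omega).eq_or_lt with rfl | hli
        · rw [hne i (by omega), Function.update_self]
          exact ⟨by rw [hfin, hF, hz i hlm]; omega, Q', hQ', hd, by omega, rfl⟩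
        · rw [hne (i + 1) (by omega), hne i (by omega)]
          exact H i hi (by omega)
  obtain ⟨U, hU, H⟩ := key m
  exact ⟨U, hU, fun i hi => H i hi hi⟩

/-- Admissible ranks are attained, even over the base field: `exists_member` combines the subspaces
of `exists_fam_g` and `exists_fam_f` into members of rank `r` that have the same images under `g` as
the former and the same images under `f` as the latter. -/
theorem Admissible.exists_point (h : T.Admissible r δ) (hδ : T.EndRanks δ) :
    ∃ P : T.Point r k, P.InStratum δ := by
  -- `B` becomes the part of the member that survives modulo both kernels
  have hB : ∀ i, ∃ B : Submodule k (T.M (i + 1)), i < m →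
      Disjoint (T.kerF i ⊔ T.kerG i) B ∧ Module.finrank k B = δ.z (i + 1) := fun i => by
    by_cases hi : i < m
    · obtain ⟨B, -, h1, h2⟩ := exists_le_disjoint_finrank_eq (G := T.kerF i ⊔ T.kerG i) le_top
        (n := δ.z (i + 1)) (by
          have := (h i hi).1
          rw [rankB] at this
          have h2 := Frame.finrank_ker_add T i hi
          simp only [kerF, kerG] at this ⊢
          rw [h2, finrank_top]
          omega)
      exact ⟨B, fun _ => ⟨h1, h2⟩⟩
    · exact ⟨⊥, fun h => absurd h hi⟩
  choose B hB using hB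
  obtain ⟨U, hU, HU⟩ := exists_fam_g h hδ (fun i hi => (hB i hi).1) fun i hi => (hB i hi).2
  obtain ⟨V, hV, HV⟩ := exists_fam_f h hδ (fun i hi => (hB i hi).1) fun i hi => (hB i hi).2
  have hG : ∀ i ≤ m, Module.finrank k ((U (i + 1)).map (T.g i)) = δ.g (i + 1) := fun i hi => by
    rcases hi.lt_or_eq with hi | rfl
    · exact (HU i hi).1
    · rw [hU, Submodule.map_top, hδ.g_eq]
  have hF : ∀ i ≤ m, Module.finrank k ((V i).map (T.f i)) = δ.f i := fun i hi => by
    obtain _ | i := i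
    · rw [hV, Submodule.map_top, hδ.f_eq]
    · exact (HV i hi).1
  have hW : ∀ i, ∃ W : Submodule k (T.M (i + 1)), i < m →
      (U (i + 2)).map (T.g (i + 1)) ≤ W ∧ (V i).map (T.f i) ≤ W ∧
      W ⊔ T.kerG i = U (i + 1) ⊔ T.kerG i ∧ W ⊔ T.kerF i = V (i + 1) ⊔ T.kerF i ∧
      W ⊔ (T.kerF i ⊔ T.kerG i) = B i ⊔ (T.kerF i ⊔ T.kerG i) ∧ Module.finrank k W = r := fun i => by
    by_cases hi : i < m
    swap
    · exact ⟨⊥, fun h => absurd h hi⟩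
    obtain ⟨-, P', hP', hd, e, hUi⟩ := HU i hi
    obtain ⟨-, Q', hQ', hd', e', hVi⟩ := HV i hi
    obtain ⟨h1, ⟨h2, h3⟩, ⟨h4, h5⟩, h6, h7, h8⟩ := h i hi
    have hGle : (U (i + 2)).map (T.g (i + 1)) ≤ T.kerF i := by
      rw [Submodule.map_le_iff_le_comap]
      exact fun x _ => LinearMap.congr_fun (T.f_comp_g (i + 1)) x
    have hFle : (V i).map (T.f i) ≤ T.kerG i := by
      rw [Submodule.map_le_iff_le_comap]
      exact fun x _ => LinearMap.congr_fun (T.g_comp_f i) x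
    -- the part inside the sum of the kernels that is not forced by the neighbours has the dimension
    -- that is left after the images of the neighbours and `B`
    have h0 := hG (i + 1) hi
    have h0' := hF i hi.le
    have hz := (hB i hi).2
    obtain ⟨W, w1, w2, w3, w4, w5, w6⟩ := exists_member (T.disjoint i hi) (hB i hi).1 hGle hP' hd
      hFle hQ' hd' (h := r - δ.g (i + 2) - δ.f i - δ.z (i + 1)) (by omega) (by omega) (by omega)
    refine ⟨W, fun _ => ⟨w1, w2, by rw [w3, hUi], by rw [w4, hVi], w5, ?_⟩⟩
    rw [w6, h0, h0', hz, show i + 1 + 1 = i + 2 from rfl]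
    omega
  choose W hW using hW
  -- the family that is everything at both ends; its images are those of `U` and `V`
  let W' : ∀ i, Submodule k (T.M i) := fun i => match i with
    | 0 => ⊤
    | i + 1 => if i < m then W i else ⊤
  have hW' : ∀ i < m, W' (i + 1) = W i := fun i hi => if_pos hi
  have hlast : W' (m + 1) = ⊤ := if_neg (lt_irrefl m)
  have eg : ∀ i ≤ m, (W' (i + 1)).map (T.g i) = (U (i + 1)).map (T.g i) := fun i hi => by
    rcases hi.lt_or_eq with hi | rfl
    · rw [hW' i hi]
      have := congrArg (Submodule.map (T.g i)) (hW i hi).2.2.1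
      rwa [Submodule.map_sup, Submodule.map_sup, (LinearMap.le_ker_iff_map).1 le_rfl, sup_bot_eq,
        sup_bot_eq] at this
    · rw [hlast, hU]
  have ef : ∀ i ≤ m, (W' i).map (T.f i) = (V i).map (T.f i) := fun i hi => by
    obtain _ | i := i
    · rw [hV]
    · rw [hW' i hi]
      have := congrArg (Submodule.map (T.f (i + 1))) (hW i hi).2.2.2.1
      rwa [Submodule.map_sup, Submodule.map_sup, (LinearMap.le_ker_iff_map).1 le_rfl, sup_bot_eq,
        sup_bot_eq] at this
  have hgle : ∀ i, (W' (i + 1)).map (T.g i) ≤ W' i := fun i => by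
    obtain _ | i := i
    · exact le_top
    · by_cases hi : i < m
      · rw [eg (i + 1) hi, hW' i hi]
        exact (hW i hi).1
      · exact le_top.trans (if_neg hi).ge
  have hfle : ∀ i, (W' i).map (T.f i) ≤ W' (i + 1) := fun i => by
    by_cases hi : i < m
    · rw [ef i hi.le, hW' i hi]
      exact (hW i hi).2.1
    · exact le_top.trans (if_neg hi).ge
  refine ⟨⟨fun i => (W' i).baseChange k, fun i hi => .of_finrank ?_, ?_, ?_, fun i => ?_,
    fun i => ?_⟩, fun i hi => ⟨(isSubbundle_map_iff _ _ _).1 (.of_finrank ?_),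
      (isSubbundle_map_iff _ _ _).1 (.of_finrank ?_), .of_finrank ?_⟩⟩
  · rw [finrank_submodule_baseChange, hW' i hi]
    exact (hW i hi).2.2.2.2.2
  · exact Submodule.baseChange_top ..
  · rw [hlast]; exact Submodule.baseChange_top ..
  · rw [map_baseChange]; exact Submodule.baseChange_mono k (hfle i)
  · rw [map_baseChange]; exact Submodule.baseChange_mono k (hgle i)
  · rw [map_baseChange, finrank_submodule_baseChange, eg i hi.le]
    exact hG i hi.le
  · rw [map_baseChange, finrank_submodule_baseChange, ef (i + 1) hi]
    exact hF (i + 1) hi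
  · dsimp only
    rw [← baseChange_sup, finrank_submodule_baseChange, hW' i hi, (hW i hi).2.2.2.2.1,
      finrank_sup_of_disjoint (hB i hi).1.symm, (hB i hi).2, Frame.finrank_ker_add T i hi]

end Chain

end

/-! ### Transcendence degree and dimension -/

section

/-- A proper quotient of a domain over a field has smaller transcendence degree. -/
theorem trdeg_add_one_le {k A B : Type u} [Field k] [CommRing A] [IsDomain A] [CommRing B]
    [IsDomain B] [Algebra k A] [Algebra k B] (f : A →ₐ[k] B) (hf : Function.Surjective f)
    (hf' : ¬Function.Injective f) : Algebra.trdeg k B + 1 ≤ Algebra.trdeg k A := by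
  obtain ⟨ι, y, hy⟩ := exists_isTranscendenceBasis' k B
  choose x hx using fun i => hf (y i)
  obtain rfl : f ∘ x = y := funext hx
  have hxi : AlgebraicIndependent k x := hy.1.of_comp f
  obtain ⟨a, ha, ha0⟩ : ∃ a, f a = 0 ∧ a ≠ 0 := by
    by_contra! h
    exact hf' ((injective_iff_map_eq_zero f).2 h)
  -- an element of the kernel is transcendental over the lift of a transcendence basis: the constant
  -- coefficient of an equation lies in the kernel
  have ht : Transcendental (Algebra.adjoin k (Set.range x)) a := by
    intro halg
    obtain ⟨q, hq, hq'⟩ := halg.exists_nonzero_coeff_and_aeval_eq_zero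
      (mem_nonZeroDivisors_of_ne_zero ha0)
    have hc : f (q.coeff 0 : A) = 0 := by
      have h1 : (Polynomial.aeval a q : A) = q.coeff 0 + a * Polynomial.aeval a q.divX := by
        conv_lhs => rw [← Polynomial.X_mul_divX_add q]
        rw [map_add, map_mul, Polynomial.aeval_X, Polynomial.aeval_C, add_comm]
        rfl
      have h2 := congrArg f (h1.symm.trans hq')
      rwa [map_add, map_mul, ha, zero_mul, add_zero, map_zero] at h2
    obtain ⟨p, hp⟩ : ∃ p : MvPolynomial ι k, MvPolynomial.aeval x p = (q.coeff 0 : A) := by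
      have := (Algebra.adjoin_range_eq_range_aeval k x).le (q.coeff 0).2
      exact this
    have hp0 : p = 0 := hy.1.eq_zero_of_aeval_eq_zero p (by
      rw [← hc, ← hp, ← AlgHom.comp_apply, MvPolynomial.comp_aeval]
      rfl)
    refine hq (Subtype.ext ?_)
    rw [← hp, hp0, map_zero]
    rfl
  have := ((hxi.option_iff_transcendental a).2 ht).cardinalMk_le_trdeg
  rwa [Cardinal.mk_option, hy.cardinalMk_eq_trdeg] at this

/-- A chain of `n` strict inclusions of primes raises the transcendence degree of the quotient by
the smallest one to at least `n`. -/
theorem le_trdeg_of_chain {k R : Type u} [Field k] [CommRing R] [Algebra k R]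
    (p : ℕ → PrimeSpectrum R) (n : ℕ) (h : ∀ i < n, p (i + 1) < p i) :
    (n : Cardinal) ≤ Algebra.trdeg k (R ⧸ (p n).asIdeal) := by
  induction n with
  | zero => simp
  | succ n ih =>
    have hlt := h n (Nat.lt_succ_self n)
    have hle : (p (n + 1)).asIdeal ≤ (p n).asIdeal := hlt.le
    refine le_trans ?_ (trdeg_add_one_le (Ideal.Quotient.factorₐ k hle)
      (Ideal.Quotient.factor_surjective hle) fun hinj => ?_)
    · rw [Nat.cast_add, Nat.cast_one]
      exact add_le_add (ih fun i hi => h i (by omega)) le_rfl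
    · refine hlt.not_ge fun x hx => ?_
      rw [← Ideal.Quotient.eq_zero_iff_mem] at hx ⊢
      apply hinj
      rw [map_zero]
      exact hx

/-- A chain of irreducible closed subsets gives a prime of an affine open subscheme whose residue
ring has at least the corresponding transcendence degree. -/
theorem exists_le_trdeg {k : Type u} [Field k] {Y : Over (Spec (CommRingCat.of k))}
    (l : LTSeries (TopologicalSpace.IrreducibleCloseds Y.left)) :
    ∃ (R : Type u) (_ : CommRing R) (_ : Algebra k R) (x : specOver k R ⟶ Y)
      (p : PrimeSpectrum R), IsOpenImmersion x.left ∧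
        (l.length : Cardinal) ≤ Algebra.trdeg k (R ⧸ p.asIdeal) := by
  let Z : ℕ → TopologicalSpace.IrreducibleCloseds Y.left := fun i =>
    l ⟨min i l.length, by omega⟩
  have hZ : ∀ i < l.length, Z i < Z (i + 1) := fun i hi => l.strictMono (by
    rw [Fin.lt_def]; dsimp only; omega)
  have hZm : Monotone Z := fun i j hij => l.strictMono.monotone (by
    rw [Fin.le_def]; dsimp only; omega)
  let η : ℕ → Y.left := fun i => (Z i).isIrreducible'.genericPoint
  have hη : ∀ i, closure {η i} = (Z i : Set Y.left) := fun i =>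
    (Z i).isIrreducible'.closure_genericPoint (Z i).isClosed'
  obtain ⟨R, _, _, x, hx, h0⟩ := exists_affine_nhd (η 0)
  have hmem : ∀ i, ∃ p : PrimeSpectrum R, x.left p = η i := fun i => by
    have hs : η i ⤳ η 0 := by
      rw [specializes_iff_closure_subset, hη, hη]
      exact hZm (Nat.zero_le i)
    exact hs.mem_open x.left.isOpenEmbedding.isOpen_range h0
  choose p hp using hmem
  have hlt : ∀ i < l.length, p (i + 1) < p i := fun i hi => by
    have key : ∀ i j, p i ≤ p j ↔ Z j ≤ Z i := fun i j => by
      rw [PrimeSpectrum.le_iff_specializes]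
      refine (x.left.isOpenEmbedding.isInducing.specializes_iff).symm.trans ?_
      rw [hp, hp, specializes_iff_closure_subset, hη, hη]
      rfl
    rw [lt_iff_le_not_ge, key, key, ← lt_iff_le_not_ge]
    exact hZ i hi
  exact ⟨R, _, _, x, p l.length, hx, le_trdeg_of_chain p _ hlt⟩

/-- If a field-valued point is obtained from a localization of a polynomial ring through a
morphism that locally lifts to the chart, then the residue field is generated by the images of the
indeterminates. -/
theorem trdeg_le_of_factor {k R K : Type u} [Field k] [CommRing R] [Algebra k R] [Field K]
    [Algebra k K] (φ : R →ₐ[k] K) {σ : Type} [Finite σ]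
    {s : MvPolynomial σ k} {b : Localization.Away s} (θ : R →ₐ[k] Localization.Away b)
    (χ : Localization.Away b →ₐ[k] K) (h : χ.comp θ = φ)
    (hK : ∀ z : K, ∃ a c : R, z = φ a / φ c) : Algebra.trdeg k K ≤ Nat.card σ := by
  let v : σ → K := fun i => χ (algebraMap (Localization.Away s) (Localization.Away b)
    (algebraMap (MvPolynomial σ k) (Localization.Away s) (MvPolynomial.X i)))
  have h1 : ∀ p : MvPolynomial σ k, IsAlgebraic (Algebra.adjoin k (Set.range v))
      (χ (algebraMap (Localization.Away s) (Localization.Away b)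
        (algebraMap (MvPolynomial σ k) (Localization.Away s) p))) := fun p => by
    have : χ (algebraMap (Localization.Away s) (Localization.Away b)
        (algebraMap (MvPolynomial σ k) (Localization.Away s) p)) = MvPolynomial.aeval v p := by
      refine congrArg (fun g : MvPolynomial σ k →ₐ[k] K => g p) (?_ :
        (χ.comp (awayHom k b)).comp (awayHom k s) = MvPolynomial.aeval v)
      ext i
      rw [MvPolynomial.aeval_X]
      rfl
    rw [this]
    have hm : MvPolynomial.aeval v p ∈ Algebra.adjoin k (Set.range v) := by
      rw [Algebra.adjoin_range_eq_range_aeval]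
      exact ⟨p, rfl⟩
    exact isAlgebraic_algebraMap (⟨_, hm⟩ : Algebra.adjoin k (Set.range v))
  have hloc : ∀ {A : Type u} [CommRing A] [Algebra k A] (c : A) (g : Localization.Away c →ₐ[k] K),
      (∀ a : A, IsAlgebraic (Algebra.adjoin k (Set.range v)) (g (algebraMap _ _ a))) →
      ∀ z, IsAlgebraic (Algebra.adjoin k (Set.range v)) (g z) := by
    intro A _ _ c g hg z
    obtain ⟨⟨a, t⟩, hz⟩ := IsLocalization.surj (Submonoid.powers c) z
    have ht : g (algebraMap _ _ (t : A)) ≠ 0 :=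
      ((IsLocalization.map_units (Localization.Away c) t).map g).ne_zero
    have : g z = g (algebraMap _ _ a) * (g (algebraMap _ _ (t : A)))⁻¹ := by
      rw [← hz, map_mul, mul_inv_cancel_right₀ ht]
    rw [this]
    exact (hg a).mul (hg t).inv
  have h2 := hloc s (χ.comp (awayHom k b)) h1
  have h3 := hloc b χ h2
  have : Algebra.IsAlgebraic (Algebra.adjoin k (Set.range v)) K := ⟨fun z => by
    obtain ⟨a, c, rfl⟩ := hK z
    rw [div_eq_mul_inv, ← h]
    exact (h3 _).mul (h3 _).inv⟩
  refine (Algebra.IsAlgebraic.trdeg_le_cardinalMk k (Set.range v)).trans ?_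
  have hfin : Finite (Set.range v) := Set.finite_range v
  have hc : (Nat.card (Set.range v) : Cardinal) = Cardinal.mk (Set.range v) :=
    Cardinal.cast_toNat_of_lt_aleph0 Cardinal.mk_lt_aleph0
  rw [← hc]
  exact Nat.cast_le.2 (Finite.card_range_le v)

/-- Every maximal ideal of a polynomial ring in `n` variables over a field has height at least `n`:
its contraction to the polynomials in one variable fewer is maximal, and its height is smaller by
one. -/
theorem mvPolynomial_le_height {k : Type u} [Field k] (n : ℕ) (P : Ideal (MvPolynomial (Fin n) k))
    (hP : P.IsMaximal) : (n : ℕ∞) ≤ P.height := by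
  induction n with
  | zero => simp
  | succ n ih =>
    let e := (MvPolynomial.finSuccEquiv k n).toRingEquiv
    let Q := P.comap e.symm
    have hQ : Q.IsMaximal := Ideal.comap_isMaximal_of_equiv e.symm
    have h1 := Polynomial.isMaximal_comap_C_of_isJacobsonRing Q
    have : Q.LiesOver (Q.comap Polynomial.C) := ⟨rfl⟩
    have h2 := Polynomial.height_eq_height_add_one (Q.comap Polynomial.C) Q
    rw [RingEquiv.height_comap] at h2
    rw [h2, Nat.cast_add, Nat.cast_one]
    exact add_le_add (ih _ h1) le_rfl

/-- Nonempty basic open subsets of affine spaces have at least the expected dimension, since some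
maximal ideal of the polynomial ring avoids the given polynomial. -/
theorem le_ringKrullDim_away {k : Type u} [Field k] {σ : Type} [Finite σ] (s : MvPolynomial σ k)
    (hs : s ≠ 0) : (Nat.card σ : WithBot ℕ∞) ≤ ringKrullDim (Localization.Away s) := by
  have : Nontrivial (Localization.Away s) :=
    (IsLocalization.injective (Localization.Away s) (powers_le_nonZeroDivisors_of_noZeroDivisors hs)
      ).nontrivial
  obtain ⟨P, hP⟩ := Ideal.exists_maximal (Localization.Away s)
  have h1 := ((IsLocalization.isMaximal_iff_isMaximal_disjoint (R := MvPolynomial σ k) _ s P).1 hP).1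
  let e := (MvPolynomial.renameEquiv k (Finite.equivFin σ)).toRingEquiv
  have h2 := mvPolynomial_le_height _ _ (Ideal.comap_isMaximal_of_equiv e.symm (p := P.under _))
  rw [RingEquiv.height_comap, IsLocalization.height_under (Submonoid.powers s)] at h2
  exact (WithBot.coe_le_coe.2 h2).trans (Ideal.height_le_ringKrullDim_of_ne_top hP.ne_top)

end

/-! ### The dimension of the scheme of linked families -/

section

theorem AffineAtlas.exists_comp_chart {k : Type u} [CommRing k] {F : ZariskiSheaf.{u, w} k} (𝔄 : AffineAtlas.{u, w, w'} F) {K : Type u}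
    [Field K] [Algebra k K] (z : specOver k K ⟶ 𝔄.glued) :
    ∃ (j : 𝔄.J) (ψ : 𝔄.R j →ₐ[k] K), specMap ψ ≫ 𝔄.chart j = z := by
  obtain ⟨j, ψ, h⟩ := 𝔄.cover (𝔄.pointsEquiv K z)
  exact ⟨j, ψ, (𝔄.pointsEquiv K).injective (by rw [AffineAtlas.pointsEquiv_comp_chart, h])⟩

namespace Chain

variable {k : Type u} [Field k] {m : ℕ} {T : Chain.{u, v} k m} {r : ℕ}

/-- The dimension of the scheme of linked families is at most that of its strata: a chain of
irreducible closed subsets is bounded by the transcendence degree of a residue field, and the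
residue field of a point is that of a point of an affine chart of a stratum. -/
theorem length_le_stratumDim
    (l : LTSeries (TopologicalSpace.IrreducibleCloseds (T.scheme r).left)) :
    ∃ δ, T.EndRanks δ ∧ T.Admissible r δ ∧ (l.length : ℤ) ≤ T.stratumDim r δ := by
  obtain ⟨R, _, _, x, p, hx, hl⟩ := exists_le_trdeg l
  let K := p.asIdeal.ResidueField
  obtain ⟨δ, hδ, h⟩ := Point.exists_inStratum
    ((T.atlas r).pointsEquiv K (specMap (residueHom k p) ≫ x) : T.Point r K)
  refine ⟨δ, hδ, h.admissible hδ, ?_⟩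
  -- the generic point of `R ⧸ p`, as a point of the scheme, factors through a chart of its stratum
  obtain ⟨z, hz⟩ := (exists_comp_stratumι_iff hδ (specMap (residueHom k p) ≫ x)).2 h
  obtain ⟨j, χ₀, rfl⟩ := AffineAtlas.exists_comp_chart (stratumAtlas T r hδ) z
  let u := (stratumAtlas T r hδ).chart j ≫ stratumι r hδ
  obtain ⟨t⟩ : Nonempty (Spec (CommRingCat.of K)) := inferInstance
  have hu : specMap χ₀ ≫ u = specMap (residueHom k p) ≫ x :=
    (Category.assoc _ _ _).symm.trans hz
  -- a basic open subset of that chart maps to `Spec R`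
  obtain ⟨b, hb, y, hy⟩ := exists_lift_of_mem_range x u ((specMap χ₀).left t) (by
    refine ⟨(specMap (residueHom k p)).left t, ?_⟩
    have := congrArg (fun q => q.left t) hu
    exact this.symm)
  rw [ker_algHom_of_specMap] at hb
  obtain ⟨χ, hχ⟩ := exists_comp_awayHom χ₀ (f := b) (IsUnit.mk0 _ hb)
  have hmono : Mono x := Over.mono_of_mono_left x
  have hθ : χ.comp (algHomOf y) = residueHom k p := by
    apply specMap_injective
    rw [← specMap_comp, specMap_algHomOf, ← cancel_mono x, Category.assoc, hy, ← Category.assoc,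
      specMap_comp, hχ, hu]
  let j : T.StratumChart r δ := j
  have h1 : Algebra.trdeg k (R ⧸ p.asIdeal) ≤ Algebra.trdeg k K :=
    trdeg_le_of_injective (IsScalarTower.toAlgHom k (R ⧸ p.asIdeal) K)
      (IsFractionRing.injective (R ⧸ p.asIdeal) K)
  have h2 : Algebra.trdeg k K ≤ Nat.card j.1.1.1.Idx :=
    trdeg_le_of_factor (s := j.1.2) (residueHom k p) (algHomOf y) χ hθ fun z => by
      obtain ⟨a, c, -, rfl⟩ := IsFractionRing.div_surjective (A := R ⧸ p.asIdeal) z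
      obtain ⟨a, rfl⟩ := Ideal.Quotient.mk_surjective a
      obtain ⟨c, rfl⟩ := Ideal.Quotient.mk_surjective c
      exact ⟨a, c, rfl⟩
  rw [← j.1.1.2.card_idx]
  exact_mod_cast hl.trans (h1.trans h2)

/-- A stratum contributes its dimension: one of its charts is a nonempty open subset of an affine
space, and it is immersed in the scheme of linked families. -/
theorem stratumDim_le_topologicalKrullDim {δ : Ranks} (hδ : T.EndRanks δ)
    (h : T.Admissible r δ) : ∃ N : ℕ, (N : ℤ) = T.stratumDim r δ ∧
      (N : WithBot ℕ∞) ≤ topologicalKrullDim (T.scheme r).left := by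
  obtain ⟨P, hP⟩ := h.exists_point hδ
  obtain ⟨j, χ, -⟩ := (stratumAtlas T r hδ).cover (K := k) ⟨P, hP⟩
  let j : T.StratumChart r δ := j
  refine ⟨Nat.card j.1.1.1.Idx, j.1.1.2.card_idx, ?_⟩
  have hs : ∀ (s : MvPolynomial j.1.1.1.Idx k) (_ : Localization.Away s →ₐ[k] k), s ≠ 0 := by
    rintro s χ rfl
    have h1 : IsUnit (awayHom k (0 : MvPolynomial j.1.1.1.Idx k) 0) :=
      IsLocalization.Away.algebraMap_isUnit _
    have h2 := h1.map χ
    rw [map_zero, map_zero] at h2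
    exact not_isUnit_zero h2
  refine (le_ringKrullDim_away j.1.2 (hs _ χ)).trans ?_
  rw [← PrimeSpectrum.topologicalKrullDim_eq_ringKrullDim]
  exact ((stratumι r hδ).left.isEmbedding.comp
    ((stratumAtlas T r hδ).chart j).left.isEmbedding).isInducing.topologicalKrullDim_le

/-- Two chains have the same numerical invariants. -/
structure SameDims {k' : Type w} [Field k'] (T : Chain.{u, v} k m) (T' : Chain.{w, w'} k' m) :
    Prop where
  range_g : Module.finrank k (LinearMap.range (T.g m)) = Module.finrank k' (LinearMap.range (T'.g m))
  range_f : Module.finrank k (LinearMap.range (T.f 0)) = Module.finrank k' (LinearMap.range (T'.f 0))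
  finrank_M : ∀ i < m, Module.finrank k (T.M (i + 1)) = Module.finrank k' (T'.M (i + 1))
  finrank_kerF : ∀ i < m, Module.finrank k (T.kerF i) = Module.finrank k' (T'.kerF i)
  finrank_kerG : ∀ i < m, Module.finrank k (T.kerG i) = Module.finrank k' (T'.kerG i)

theorem SameDims.symm {k' : Type w} [Field k'] {T : Chain.{u, v} k m} {T' : Chain.{w, w'} k' m}
    (h : T.SameDims T') : T'.SameDims T :=
  ⟨h.1.symm, h.2.symm, fun i hi => (h.3 i hi).symm, fun i hi => (h.4 i hi).symm,
    fun i hi => (h.5 i hi).symm⟩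

theorem SameDims.topologicalKrullDim_le {k' : Type w} [Field k'] {T : Chain.{u, v} k m}
    {T' : Chain.{w, w'} k' m} (h : T.SameDims T') (r : ℕ) :
    topologicalKrullDim (T.scheme r).left ≤ topologicalKrullDim (T'.scheme r).left := by
  refine iSup_le fun l => ?_
  obtain ⟨δ, hδ, ha, hl⟩ := length_le_stratumDim l
  have hB : ∀ i < m, T.rankB i = T'.rankB i := fun i hi => by
    rw [rankB, rankB, h.finrank_M i hi, h.finrank_kerF i hi, h.finrank_kerG i hi]
  have ha' : T'.Admissible r δ := fun i hi => by
    rw [← hB i hi, ← h.finrank_kerF i hi, ← h.finrank_kerG i hi]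
    exact ha i hi
  have hd : T.stratumDim r δ = T'.stratumDim r δ := Finset.sum_congr rfl fun i hi => by
    rw [Finset.mem_range] at hi
    rw [hB i hi, h.finrank_kerF i hi, h.finrank_kerG i hi]
  obtain ⟨N, hN, hle⟩ := stratumDim_le_topologicalKrullDim
    ⟨hδ.1.trans h.range_g, hδ.2.trans h.range_f⟩ ha'
  refine le_trans ?_ hle
  rw [hd, ← hN] at hl
  exact_mod_cast hl

/-- The dimension of the scheme of linked families depends only on the numerical invariants of the
chain. -/
theorem SameDims.topologicalKrullDim_eq {k' : Type w} [Field k'] {T : Chain.{u, v} k m}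
    {T' : Chain.{w, w'} k' m} (h : T.SameDims T') (r : ℕ) :
    topologicalKrullDim (T.scheme r).left = topologicalKrullDim (T'.scheme r).left :=
  le_antisymm (h.topologicalKrullDim_le r) (h.symm.topologicalKrullDim_le r)

end Chain

end

/-! ### Kernels and dimensions in a linked system -/

section

namespace LinkedSystem

variable {k : Type u} [Field k] {n d : ℕ} (S : LinkedSystem.{u, v} k n d)

theorem fComp_eq_comp {i j : ℕ} (h : i < j) : S.fComp i j = S.fComp (i + 1) j ∘ₗ S.f i := by
  induction j, h using Nat.le_induction with
  | base => rw [S.fComp_succ le_rfl, S.fComp_self, S.fComp_self, LinearMap.comp_id, LinearMap.id_comp]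
  | succ j hj ih => rw [S.fComp_succ (by omega), ih, S.fComp_succ hj, LinearMap.comp_assoc]

/-- The condition on consecutive maps `g` propagates to their composites. -/
theorem disjoint_range_ker_gComp {i : ℕ} (h₁ : 1 ≤ i) (h₂ : i < n) :
    Disjoint (LinearMap.range (S.g i)) (LinearMap.ker (S.gComp i 1)) := by
  induction i, h₁ using Nat.le_induction with
  | base => rw [S.gComp_self, LinearMap.ker_id]; exact disjoint_bot_right
  | succ i hi ih =>
    rw [Submodule.disjoint_def]
    intro x hx hx'
    rw [S.gComp_succ hi, LinearMap.mem_ker, LinearMap.comp_apply] at hx'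
    have h0 := (Submodule.disjoint_def.1 (ih (by omega))) _ ⟨x, rfl⟩ hx'
    have : x ∈ LinearMap.range (S.g (i + 1)) ⊓ LinearMap.ker (S.g i) := ⟨hx, h0⟩
    rwa [S.g_disjoint i hi (by omega), Submodule.mem_bot] at this

/-- All composites of the maps `g` down to `E 1` that begin with `g i` have the same kernel as `g
i`. -/
theorem ker_gComp {i : ℕ} (h₁ : 1 ≤ i) (h₂ : i < n) :
    LinearMap.ker (S.gComp (i + 1) 1) = LinearMap.ker (S.g i) := by
  rw [S.gComp_succ h₁]
  refine le_antisymm (fun x hx => ?_) (LinearMap.ker_le_ker_comp _ _)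
  exact (Submodule.disjoint_def.1 (S.disjoint_range_ker_gComp h₁ h₂)) _ ⟨x, rfl⟩ hx

/-- The condition on consecutive maps `f` propagates to their composites. -/
theorem disjoint_range_ker_fComp {i : ℕ} (h₁ : 1 ≤ i) (h₂ : i < n) :
    Disjoint (LinearMap.range (S.f i)) (LinearMap.ker (S.fComp (i + 1) n)) := by
  obtain ⟨t, ht⟩ : ∃ t, i + t + 1 = n := ⟨n - (i + 1), by omega⟩
  induction t generalizing i with
  | zero =>
    obtain rfl : i + 1 = n := ht
    rw [S.fComp_self, LinearMap.ker_id]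
    exact disjoint_bot_right
  | succ t ih =>
    rw [Submodule.disjoint_def]
    intro x hx hx'
    rw [S.fComp_eq_comp (by omega), LinearMap.mem_ker, LinearMap.comp_apply] at hx'
    have h0 := (Submodule.disjoint_def.1 (ih (i := i + 1) (by omega) (by omega) (by omega))) _
      ⟨x, rfl⟩ hx'
    have : x ∈ LinearMap.range (S.f i) ⊓ LinearMap.ker (S.f (i + 1)) := ⟨hx, h0⟩
    rwa [S.f_disjoint i h₁ (by omega), Submodule.mem_bot] at this

/-- All composites of the maps `f` up to `E n` that begin with `f i` have the same kernel as `f i`.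
-/
theorem ker_fComp {i : ℕ} (h₁ : 1 ≤ i) (h₂ : i < n) :
    LinearMap.ker (S.fComp i n) = LinearMap.ker (S.f i) := by
  rw [S.fComp_eq_comp h₂]
  refine le_antisymm (fun x hx => ?_) (LinearMap.ker_le_ker_comp _ _)
  exact (Submodule.disjoint_def.1 (S.disjoint_range_ker_fComp h₁ h₂)) _ ⟨x, rfl⟩ hx

theorem gComp_f {i : ℕ} (h₁ : 1 ≤ i) (h₂ : i < n) (x : S.E i) :
    S.gComp (i + 1) 1 (S.f i x) = 0 := by
  rw [S.gComp_succ h₁, LinearMap.comp_apply]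
  rw [show S.g i (S.f i x) = 0 from LinearMap.congr_fun (S.g_comp_f i h₁ h₂) x, map_zero]

theorem fComp_g {i : ℕ} (h₁ : 1 ≤ i) (h₂ : i < n) (x : S.E (i + 1)) :
    S.fComp i n (S.g i x) = 0 := by
  rw [S.fComp_eq_comp h₂, LinearMap.comp_apply]
  rw [show S.f i (S.g i x) = 0 from LinearMap.congr_fun (S.f_comp_g i h₁ h₂) x, map_zero]

theorem disjoint_ker_f_ker_g {i : ℕ} (h₁ : 1 ≤ i) (h₂ : i + 1 < n) :
    Disjoint (LinearMap.ker (S.f (i + 1))) (LinearMap.ker (S.g i)) := by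
  rw [S.ker_g i h₁ (by omega), disjoint_iff, inf_comm, S.f_disjoint i h₁ h₂]

namespace EndPair

variable {S} {r : ℕ} (C : S.EndPair r)

theorem f_mem_preim {i : ℕ} (h₁ : 1 ≤ i) (h₂ : i < n) {x : S.E i} (hx : x ∈ C.preim i) :
    S.f i x ∈ C.preim (i + 1) := by
  refine ⟨?_, ?_⟩
  · rw [SetLike.mem_coe, Submodule.mem_comap, S.gComp_f h₁ h₂]
    exact zero_mem _
  · have := hx.2
    rwa [SetLike.mem_coe, Submodule.mem_comap, S.fComp_eq_comp h₂] at this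

theorem g_mem_preim {i : ℕ} (h₁ : 1 ≤ i) (h₂ : i < n) {x : S.E (i + 1)}
    (hx : x ∈ C.preim (i + 1)) : S.g i x ∈ C.preim i := by
  refine ⟨?_, ?_⟩
  · have := hx.1
    rwa [SetLike.mem_coe, Submodule.mem_comap, S.gComp_succ h₁] at this
  · rw [SetLike.mem_coe, Submodule.mem_comap, S.fComp_g h₁ h₂]
    exact zero_mem _

theorem preim_one : C.preim 1 = C.V₁ := by
  rw [preim, S.gComp_self, Submodule.comap_id]
  exact inf_eq_left.2 (Submodule.map_le_iff_le_comap.1 C.map_f_le)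

theorem preim_last : C.preim n = C.Vₙ := by
  rw [preim, S.fComp_self, Submodule.comap_id]
  exact inf_eq_right.2 (Submodule.map_le_iff_le_comap.1 C.map_g_le)

/-- The part of the kernel of `f` in `preim i` is isomorphic to its image in `E 1`. -/
theorem map_ker_f {i : ℕ} (h₁ : 1 ≤ i) (h₂ : i < n) :
    (C.preim i ⊓ LinearMap.ker (S.f i)).map (S.gComp i 1) = C.barV₁ (i + 1) := by
  ext v
  constructor
  · rintro ⟨x, ⟨hx, hx'⟩, rfl⟩
    rw [SetLike.mem_coe, S.ker_f i h₁ h₂] at hx'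
    obtain ⟨y, rfl⟩ := hx'
    exact ⟨hx.1, y, by rw [S.gComp_succ h₁]; rfl⟩
  · rintro ⟨hv, y, rfl⟩
    rw [S.gComp_succ h₁] at hv ⊢
    refine ⟨S.g i y, ⟨⟨hv, ?_⟩, LinearMap.congr_fun (S.f_comp_g i h₁ h₂) y⟩, rfl⟩
    rw [SetLike.mem_coe, Submodule.mem_comap, S.fComp_g h₁ h₂]
    exact zero_mem _

/-- The part of the kernel of `g` in `preim (i + 1)` is isomorphic to its image in `E n`. -/
theorem map_ker_g {i : ℕ} (h₁ : 1 ≤ i) (h₂ : i < n) :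
    (C.preim (i + 1) ⊓ LinearMap.ker (S.g i)).map (S.fComp (i + 1) n) = C.barVₙ i := by
  ext v
  constructor
  · rintro ⟨x, ⟨hx, hx'⟩, rfl⟩
    rw [SetLike.mem_coe, S.ker_g i h₁ h₂] at hx'
    obtain ⟨y, rfl⟩ := hx'
    exact ⟨hx.2, y, by rw [S.fComp_eq_comp h₂]; rfl⟩
  · rintro ⟨hv, y, rfl⟩
    rw [S.fComp_eq_comp h₂] at hv ⊢
    refine ⟨S.f i y, ⟨⟨?_, hv⟩, LinearMap.congr_fun (S.g_comp_f i h₁ h₂) y⟩, rfl⟩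
    rw [SetLike.mem_coe, Submodule.mem_comap, S.gComp_f h₁ h₂]
    exact zero_mem _

theorem finrank_ker_f {i : ℕ} (h₁ : 1 ≤ i) (h₂ : i + 1 < n) :
    Module.finrank k (C.preim (i + 1) ⊓ LinearMap.ker (S.f (i + 1)) : Submodule k (S.E (i + 1))) =
      Module.finrank k (C.barV₁ (i + 2)) := by
  rw [← C.map_ker_f (by omega) h₂, finrank_map_of_disjoint]
  rw [S.ker_gComp h₁ (by omega)]
  exact (S.disjoint_ker_f_ker_g h₁ h₂).mono_left inf_le_right

theorem finrank_ker_g {i : ℕ} (h₁ : 1 ≤ i) (h₂ : i + 1 < n) :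
    Module.finrank k (C.preim (i + 1) ⊓ LinearMap.ker (S.g i) : Submodule k (S.E (i + 1))) =
      Module.finrank k (C.barVₙ i) := by
  rw [← C.map_ker_g h₁ (by omega), finrank_map_of_disjoint]
  rw [S.ker_fComp (by omega) h₂]
  exact (S.disjoint_ker_f_ker_g h₁ h₂).symm.mono_left inf_le_right

theorem ker_preimMap {i : ℕ} (h₁ : 1 ≤ i) (h₂ : i + 1 < n) :
    LinearMap.ker (C.preimMap (i + 1)) = ⊥ := by
  rw [LinearMap.ker_eq_bot']
  intro x hx
  have hg : (x : S.E (i + 1)) ∈ LinearMap.ker (S.gComp (i + 1) 1) :=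
    congrArg (fun y : C.barV₁ (i + 1) × C.barVₙ (i + 1) => (y.1 : S.E 1)) hx
  have hf : (x : S.E (i + 1)) ∈ LinearMap.ker (S.fComp (i + 1) n) :=
    congrArg (fun y : C.barV₁ (i + 1) × C.barVₙ (i + 1) => (y.2 : S.E n)) hx
  rw [S.ker_gComp h₁ (by omega)] at hg
  rw [S.ker_fComp (by omega) h₂] at hf
  exact Subtype.ext ((Submodule.disjoint_def.1 (S.disjoint_ker_f_ker_g h₁ h₂)) _ hf hg)

/-- The map whose cokernel is `BarZ` is injective. -/
theorem finrank_barZ {i : ℕ} (h₁ : 1 ≤ i) (h₂ : i + 1 < n) :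
    Module.finrank k (C.BarZ (i + 1)) + Module.finrank k (C.preim (i + 1)) =
      Module.finrank k (C.barV₁ (i + 1)) + Module.finrank k (C.barVₙ (i + 1)) := by
  have := S.finiteDimensional 1 le_rfl (by omega)
  have := S.finiteDimensional n (by omega) le_rfl
  rw [← LinearMap.finrank_range_of_inj (LinearMap.ker_eq_bot.1 (C.ker_preimMap h₁ h₂)),
    Submodule.finrank_quotient_add_finrank, Module.finrank_prod]

theorem mem_ker_ζ₁ {i : ℕ} {v : C.barV₁ i} : v ∈ LinearMap.ker (C.ζ₁ i) ↔
    ∃ x ∈ C.preim i, S.gComp i 1 x = v ∧ S.fComp i n x = 0 := by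
  rw [LinearMap.mem_ker, ζ₁, LinearMap.comp_apply, Submodule.mkQ_apply,
    Submodule.Quotient.mk_eq_zero]
  constructor
  · rintro ⟨x, hx⟩
    exact ⟨x, x.2, congrArg (fun y => (y.1 : S.E 1)) hx, congrArg (fun y => (y.2 : S.E n)) hx⟩
  · rintro ⟨x, hx, h1, h2⟩
    exact ⟨⟨x, hx⟩, Prod.ext (Subtype.ext h1) (Subtype.ext h2)⟩

theorem mem_ker_ζₙ {i : ℕ} {v : C.barVₙ i} : v ∈ LinearMap.ker (C.ζₙ i) ↔
    ∃ x ∈ C.preim i, S.fComp i n x = v ∧ S.gComp i 1 x = 0 := by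
  rw [LinearMap.mem_ker, ζₙ, LinearMap.comp_apply, Submodule.mkQ_apply,
    Submodule.Quotient.mk_eq_zero]
  constructor
  · rintro ⟨x, hx⟩
    exact ⟨x, x.2, congrArg (fun y => (y.2 : S.E n)) hx, congrArg (fun y => (y.1 : S.E 1)) hx⟩
  · rintro ⟨x, hx, h1, h2⟩
    exact ⟨⟨x, hx⟩, Prod.ext (Subtype.ext h2) (Subtype.ext h1)⟩

theorem map_ker_ζ₁ {i : ℕ} (h₁ : 1 ≤ i) (h₂ : i < n) :
    (LinearMap.ker (C.ζ₁ i)).map (C.barV₁ i).subtype = C.barV₁ (i + 1) := by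
  rw [← C.map_ker_f h₁ h₂]
  ext v
  constructor
  · rintro ⟨w, hw, rfl⟩
    obtain ⟨x, hx, h1, h2⟩ := C.mem_ker_ζ₁.1 hw
    exact ⟨x, ⟨hx, (S.ker_fComp h₁ h₂).le h2⟩, h1⟩
  · rintro ⟨x, ⟨hx, hx'⟩, rfl⟩
    exact ⟨⟨S.gComp i 1 x, hx.1, x, rfl⟩,
      C.mem_ker_ζ₁.2 ⟨x, hx, rfl, (S.ker_fComp h₁ h₂).ge hx'⟩, rfl⟩

theorem map_ker_ζₙ {i : ℕ} (h₁ : 1 ≤ i) (h₂ : i < n) :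
    (LinearMap.ker (C.ζₙ (i + 1))).map (C.barVₙ (i + 1)).subtype = C.barVₙ i := by
  rw [← C.map_ker_g h₁ h₂]
  ext v
  constructor
  · rintro ⟨w, hw, rfl⟩
    obtain ⟨x, hx, h1, h2⟩ := C.mem_ker_ζₙ.1 hw
    exact ⟨x, ⟨hx, (S.ker_gComp h₁ h₂).le h2⟩, h1⟩
  · rintro ⟨x, ⟨hx, hx'⟩, rfl⟩
    exact ⟨⟨S.fComp (i + 1) n x, hx.2, x, rfl⟩,
      C.mem_ker_ζₙ.2 ⟨x, hx, rfl, (S.ker_gComp h₁ h₂).ge hx'⟩, rfl⟩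

theorem barZ₁_sup_barZₙ (i : ℕ) : C.barZ₁ i ⊔ C.barZₙ i = ⊤ := by
  rw [barZ₁, barZₙ, ζ₁, ζₙ, LinearMap.range_comp, LinearMap.range_comp, ← Submodule.map_sup,
    LinearMap.sup_range_inl_inr, Submodule.map_top, Submodule.range_mkQ]

/-- The dimension of the intersection of the images of `\bar V_{1,i}` and `\bar V_{n,i}` in
`\bar Z_i` is that of `preim i` modulo the kernels of both maps. -/
theorem finrank_barZ₁_inf_barZₙ {i : ℕ} (h₁ : 1 ≤ i) (h₂ : i + 1 < n) :
    Module.finrank k (C.barZ₁ (i + 1) ⊓ C.barZₙ (i + 1) : Submodule k (C.BarZ (i + 1))) +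
      Module.finrank k (C.barV₁ (i + 2)) + Module.finrank k (C.barVₙ i) =
      Module.finrank k (C.preim (i + 1)) := by
  have := S.finiteDimensional 1 le_rfl (by omega)
  have := S.finiteDimensional n (by omega) le_rfl
  have e1 := LinearMap.finrank_range_add_finrank_ker (C.ζ₁ (i + 1))
  have e2 := LinearMap.finrank_range_add_finrank_ker (C.ζₙ (i + 1))
  have e3 := Submodule.finrank_sup_add_finrank_inf_eq (C.barZ₁ (i + 1)) (C.barZₙ (i + 1))
  have e4 := C.finrank_barZ h₁ h₂
  have e5 := congrArg (fun W : Submodule k (S.E 1) => Module.finrank k W)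
    (C.map_ker_ζ₁ (i := i + 1) (by omega) h₂)
  have e6 := congrArg (fun W : Submodule k (S.E n) => Module.finrank k W)
    (C.map_ker_ζₙ h₁ (by omega))
  rw [Submodule.finrank_map_subtype_eq] at e5 e6
  rw [show i + 1 + 1 = i + 2 from rfl] at e5
  rw [C.barZ₁_sup_barZₙ, finrank_top, barZ₁, barZₙ] at e3
  rw [barZ₁, barZₙ]
  omega

end EndPair
end LinkedSystem

end

/-! ### The fibre as the linked families in a chain -/

section

theorem isSubbundle_map_iff_of_injective {k A : Type u} [Field k] [CommRing A] [Algebra k A]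
    {M : Type v} {N : Type w} [AddCommGroup M] [Module k M] [FiniteDimensional k M]
    [AddCommGroup N] [Module k N] [FiniteDimensional k N] {p : M →ₗ[k] N}
    (hp : Function.Injective p) (W : Submodule A (A ⊗[k] M)) (ρ : ℕ) :
    IsSubbundle A (W.map (p.baseChange A)) ρ ↔ IsSubbundle A W ρ := by
  rw [isSubbundle_map_iff, LinearMap.ker_eq_bot.2 hp, Submodule.baseChange_bot, sup_bot_eq,
    finrank_bot, add_zero]

/-- A constant subspace is a sub-bundle. -/
theorem isSubbundle_baseChange {k A : Type u} [Field k] [CommRing A] [Algebra k A]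
    {M : Type v} [AddCommGroup M] [Module k M] [FiniteDimensional k M] (K : Submodule k M) :
    IsSubbundle A (K.baseChange A) (Module.finrank k K) := by
  rw [← pullback_baseChange (Algebra.ofId k A) K]
  exact (IsSubbundle.of_finrank (finrank_submodule_baseChange K)).pullback _

namespace LinkedSystem

theorem Point.map_gComp_le {k : Type u} [Field k] {n d r : ℕ} {S : LinkedSystem.{u, v} k n d}
    {A : Type u} [CommRing A] [Algebra k A] (P : S.Point r A) {i : ℕ} (h₁ : 1 ≤ i) (h₂ : i ≤ n) :
    (P.V ⟨i, h₁, h₂⟩).map ((S.gComp i 1).baseChange A) ≤ P.V ⟨1, le_rfl, h₁.trans h₂⟩ := by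
  induction i, h₁ using Nat.le_induction with
  | base => rw [S.gComp_self, LinearMap.baseChange_id, Submodule.map_id]
  | succ i hi ih =>
    rw [S.gComp_succ hi, LinearMap.baseChange_comp, Submodule.map_comp]
    exact (Submodule.map_mono (P.map_g_le i hi h₂)).trans (ih (by omega))

theorem Point.map_fComp_le {k : Type u} [Field k] {n d r : ℕ} {S : LinkedSystem.{u, v} k n d}
    {A : Type u} [CommRing A] [Algebra k A] (P : S.Point r A) {i : ℕ} (h₁ : 1 ≤ i) (h₂ : i ≤ n) :
    (P.V ⟨i, h₁, h₂⟩).map ((S.fComp i n).baseChange A) ≤ P.V ⟨n, h₁.trans h₂, le_rfl⟩ := by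
  obtain ⟨t, ht⟩ : ∃ t, i + t = n := ⟨n - i, by omega⟩
  induction t generalizing i with
  | zero =>
    obtain rfl : i = n := ht
    rw [S.fComp_self, LinearMap.baseChange_id, Submodule.map_id]
  | succ t ih =>
    rw [S.fComp_eq_comp (by omega), LinearMap.baseChange_comp, Submodule.map_comp]
    exact (Submodule.map_mono (P.map_f_le i h₁ (by omega))).trans
      (ih (by omega) (by omega) (by omega))

namespace EndPair

variable {k : Type u} [Field k] {m d r : ℕ} {S : LinkedSystem.{u, v} k (m + 2) d}
  (C : S.EndPair r)

/-- The spaces `preim 1, …, preim n`, numbered from `0`, and zero from there on. -/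
def sub (i : ℕ) : Submodule k (S.E (i + 1)) := if i ≤ m + 1 then C.preim (i + 1) else ⊥

theorem sub_of_le {i : ℕ} (h : i ≤ m + 1) : C.sub i = C.preim (i + 1) := if_pos h

theorem f_mem_sub {i : ℕ} (h : i ≤ m) (x : S.E (i + 1)) (hx : x ∈ C.sub i) :
    S.f (i + 1) x ∈ C.sub (i + 1) := by
  rw [C.sub_of_le (by omega)] at hx ⊢
  exact C.f_mem_preim (by omega) (by omega) hx

theorem g_mem_sub {i : ℕ} (h : i ≤ m) (x : S.E (i + 2)) (hx : x ∈ C.sub (i + 1)) :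
    S.g (i + 1) x ∈ C.sub i := by
  rw [C.sub_of_le (by omega)] at hx ⊢
  exact C.g_mem_preim (by omega) (by omega) hx

/-- The chain of the subspaces `preim i`. Every member of a linked family with the given ends is
contained in the corresponding one of these subspaces. -/
def chain : Chain.{u, v} k m where
  M i := C.sub i
  finiteDimensional i := by
    by_cases h : i ≤ m + 1
    · have := S.finiteDimensional (i + 1) (by omega) (by omega)
      infer_instance
    · rw [sub, if_neg h]
      infer_instance
  f i := if h : i ≤ m then (S.f (i + 1)).restrict (C.f_mem_sub h) else 0
  g i := if h : i ≤ m then (S.g (i + 1)).restrict (C.g_mem_sub h) else 0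
  f_comp_g i := by
    split_ifs with h
    · ext x
      exact LinearMap.congr_fun (S.f_comp_g (i + 1) (by omega) (by omega)) (x : S.E (i + 2))
    · rfl
  g_comp_f i := by
    split_ifs with h
    · ext x
      exact LinearMap.congr_fun (S.g_comp_f (i + 1) (by omega) (by omega)) (x : S.E (i + 1))
    · rfl
  disjoint i hi := by
    rw [dif_pos (by omega), dif_pos hi.le, Submodule.disjoint_def]
    intro x hf hg
    exact Subtype.ext (Submodule.disjoint_def.1 (S.disjoint_ker_f_ker_g (i := i + 1) (by omega)
      (by omega)) _ (congrArg Subtype.val hf) (congrArg Subtype.val hg))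
  subsingleton i hi := by
    rw [sub, if_neg (by omega)]
    infer_instance

/-- The inclusion of a member of the chain in the linked system. -/
def incl (i : ℕ) : C.chain.M i →ₗ[k] S.E (i + 1) := (C.sub i).subtype

theorem incl_injective (i : ℕ) : Function.Injective (C.incl i) := Subtype.val_injective

theorem range_incl {i : ℕ} (h : i ≤ m + 1) : LinearMap.range (C.incl i) = C.preim (i + 1) :=
  (Submodule.range_subtype (C.sub i)).trans (C.sub_of_le h)

theorem incl_comp_f {i : ℕ} (h : i ≤ m) :
    C.incl (i + 1) ∘ₗ C.chain.f i = S.f (i + 1) ∘ₗ C.incl i := by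
  ext x
  simp only [chain, dif_pos h]
  rfl

theorem incl_comp_g {i : ℕ} (h : i ≤ m) :
    C.incl i ∘ₗ C.chain.g i = S.g (i + 1) ∘ₗ C.incl (i + 1) := by
  ext x
  simp only [chain, dif_pos h]
  rfl

theorem chain_g_of_lt {i : ℕ} (h : m < i) : C.chain.g i = 0 := dif_neg (by omega)

variable {C} {A B : Type u} [CommRing A] [Algebra k A] [CommRing B] [Algebra k B]

/-- The members of a point of the fibre lie in the subspaces `preim i`, because their images in `E
1` and `E n` lie in the given ends. -/
theorem FiberPoint.V_le (P : C.FiberPoint A) {i : ℕ} (h : i ≤ m + 1) :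
    P.V ⟨i + 1, by omega, by omega⟩ ≤ LinearMap.range ((C.incl i).baseChange A) := by
  rw [range_baseChange, C.range_incl h, preim, baseChange_inf, ← comap_baseChange,
    ← comap_baseChange, ← P.first ⟨le_rfl, by omega⟩, ← P.last ⟨by omega, le_rfl⟩]
  exact le_inf (Submodule.map_le_iff_le_comap.1 (P.map_gComp_le (by omega) (by omega)))
    (Submodule.map_le_iff_le_comap.1 (P.map_fComp_le (by omega) (by omega)))

theorem FiberPoint.ext {P Q : C.FiberPoint A} (h : ∀ i, P.V i = Q.V i) : P = Q := by
  obtain ⟨⟨V, _, _, _⟩, _, _⟩ := P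
  obtain ⟨⟨V', _, _, _⟩, _, _⟩ := Q
  obtain rfl : V = V' := funext h
  rfl

/-- The linked family in the chain that corresponds to a point of the fibre. -/
def FiberPoint.toChain (P : C.FiberPoint A) : C.chain.Point r A where
  W i := if h : i ≤ m + 1 then
      (P.V ⟨i + 1, by omega, by omega⟩).comap ((C.incl i).baseChange A)
    else ⊤
  isSubbundle i hi := by
    have := S.finiteDimensional (i + 2) (by omega) (by omega)
    rw [dif_pos (by omega), ← isSubbundle_map_iff_of_injective (C.incl_injective (i + 1)),
      Submodule.map_comap_eq_self (P.V_le (by omega))]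
    exact P.isSubbundle _
  first := by
    rw [dif_pos (by omega)]
    refine (congrArg (Submodule.comap ((C.incl 0).baseChange A)) (P.first _)).trans ?_
    have e : C.V₁ = LinearMap.range (C.incl 0) :=
      C.preim_one.symm.trans (C.range_incl (by omega)).symm
    rw [e, ← range_baseChange]
    exact LinearMap.range_le_iff_comap.1 le_rfl
  last := by
    rw [dif_pos le_rfl]
    refine (congrArg (Submodule.comap ((C.incl (m + 1)).baseChange A)) (P.last _)).trans ?_
    have e : C.Vₙ = LinearMap.range (C.incl (m + 1)) :=
      C.preim_last.symm.trans (C.range_incl le_rfl).symm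
    rw [e, ← range_baseChange]
    exact LinearMap.range_le_iff_comap.1 le_rfl
  map_f_le i := by
    by_cases h : i ≤ m
    · rw [dif_pos (by omega), dif_pos (by omega), Submodule.map_le_iff_le_comap,
        ← Submodule.comap_comp, ← LinearMap.baseChange_comp, C.incl_comp_f h,
        LinearMap.baseChange_comp, Submodule.comap_comp]
      exact Submodule.comap_mono (Submodule.map_le_iff_le_comap.1 (P.map_f_le (i + 1) (by omega) (by omega)))
    · rw [dif_neg (by omega : ¬i + 1 ≤ m + 1)]
      exact le_top
  map_g_le i := by
    by_cases h : i ≤ m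
    · rw [dif_pos (by omega), dif_pos (by omega), Submodule.map_le_iff_le_comap,
        ← Submodule.comap_comp, ← LinearMap.baseChange_comp, C.incl_comp_g h,
        LinearMap.baseChange_comp, Submodule.comap_comp]
      exact Submodule.comap_mono (Submodule.map_le_iff_le_comap.1 (P.map_g_le (i + 1) (by omega) (by omega)))
    · rw [C.chain_g_of_lt (by omega), LinearMap.baseChange_zero, Submodule.map_zero]
      exact bot_le

theorem FiberPoint.map_toChain (P : C.FiberPoint A) {i : ℕ} (h : i ≤ m + 1) :
    (P.toChain.W i).map ((C.incl i).baseChange A) = P.V ⟨i + 1, by omega, by omega⟩ := by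
  rw [toChain]
  dsimp only
  rw [dif_pos h, Submodule.map_comap_eq_self (P.V_le h)]

/-- The members of the family in the linked system that corresponds to a linked family in the
chain. -/
def chainV (Q : C.chain.Point r A) : ∀ i : Set.Icc 1 (m + 2), Submodule A (A ⊗[k] S.E i)
  | ⟨0, h⟩ => absurd h.1 (by omega)
  | ⟨i + 1, _⟩ => (Q.W i).map ((C.incl i).baseChange A)

theorem chainV_zero (Q : C.chain.Point r A) (h : 1 ∈ Set.Icc 1 (m + 2)) :
    chainV Q ⟨1, h⟩ = C.V₁.baseChange A := by
  change (Q.W 0).map ((C.incl 0).baseChange A) = _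
  rw [Q.first, Submodule.map_top, range_baseChange, C.range_incl (by omega), C.preim_one]

theorem chainV_last (Q : C.chain.Point r A) (h : m + 2 ∈ Set.Icc 1 (m + 2)) :
    chainV Q ⟨m + 2, h⟩ = C.Vₙ.baseChange A := by
  change (Q.W (m + 1)).map ((C.incl (m + 1)).baseChange A) = _
  rw [Q.last, Submodule.map_top, range_baseChange, C.range_incl le_rfl, C.preim_last]

theorem isSubbundle_chainV (Q : C.chain.Point r A) : ∀ i, IsSubbundle A (chainV Q i) r
  | ⟨0, h⟩ => absurd h.1 (by omega)
  | ⟨1, h⟩ => by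
    have := S.finiteDimensional 1 h.1 h.2
    have h₁ := isSubbundle_baseChange (A := A) C.V₁
    rw [C.finrank_V₁] at h₁
    rwa [chainV_zero]
  | ⟨i + 2, h⟩ => by
    have := S.finiteDimensional (i + 2) h.1 h.2
    by_cases hi : i = m
    · subst hi
      have h₁ := isSubbundle_baseChange (A := A) C.Vₙ
      rw [C.finrank_Vₙ] at h₁
      rwa [chainV_last]
    · exact (isSubbundle_map_iff_of_injective (C.incl_injective (i + 1)) _ _).2
        (Q.isSubbundle i (by have := h.2; omega))

/-- The point of the fibre that corresponds to a linked family in the chain. -/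
def FiberPoint.ofChain (Q : C.chain.Point r A) : C.FiberPoint A where
  V := chainV Q
  isSubbundle := isSubbundle_chainV Q
  map_f_le
    | 0, h₁, _ => absurd h₁ (by omega)
    | i + 1, _, h₂ => by
      change ((Q.W i).map ((C.incl i).baseChange A)).map _ ≤
        (Q.W (i + 1)).map ((C.incl (i + 1)).baseChange A)
      rw [← Submodule.map_comp, ← LinearMap.baseChange_comp, ← C.incl_comp_f (by omega),
        LinearMap.baseChange_comp, Submodule.map_comp]
      exact Submodule.map_mono (Q.map_f_le i)
  map_g_le
    | 0, h₁, _ => absurd h₁ (by omega)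
    | i + 1, _, h₂ => by
      change ((Q.W (i + 1)).map ((C.incl (i + 1)).baseChange A)).map _ ≤
        (Q.W i).map ((C.incl i).baseChange A)
      rw [← Submodule.map_comp, ← LinearMap.baseChange_comp, ← C.incl_comp_g (by omega),
        LinearMap.baseChange_comp, Submodule.map_comp]
      exact Submodule.map_mono (Q.map_g_le i)
  first := chainV_zero Q
  last := chainV_last Q

/-- The points of the fibre are the linked families in the chain. -/
def fiberPointEquiv (C : S.EndPair r) (A : Type u) [CommRing A] [Algebra k A] :
    C.FiberPoint A ≃ C.chain.Point r A where
  toFun := FiberPoint.toChain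
  invFun := FiberPoint.ofChain
  left_inv P := FiberPoint.ext fun
    | ⟨0, h⟩ => absurd h.1 (by omega)
    | ⟨i + 1, h⟩ => P.map_toChain (by have := h.2; omega)
  right_inv Q := Chain.Point.ext (funext fun i => by
    by_cases h : i ≤ m + 1
    · refine Submodule.map_injective_of_injective (baseChange_injective (C.incl_injective i)) ?_
      exact FiberPoint.map_toChain (FiberPoint.ofChain Q) h
    · have := C.chain.subsingleton i (by omega)
      have : Subsingleton (A ⊗[k] C.chain.M i) := inferInstance
      exact Subsingleton.elim _ _)

theorem fiberPointEquiv_symm_map (φ : A →ₐ[k] B) (Q : C.chain.Point r A) :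
    ∀ i, ((C.fiberPointEquiv B).symm (Q.map φ)).V i =
      pullback φ (((C.fiberPointEquiv A).symm Q).V i)
  | ⟨0, h⟩ => absurd h.1 (by omega)
  | ⟨_ + 1, _⟩ => (pullback_map _ _ _).symm

end EndPair
end LinkedSystem

end

/-! ### Ranks and dimensions in the fibre and in the chain -/

section

namespace LinkedSystem.EndPair

variable {k : Type u} [Field k] {m d r : ℕ} {S : LinkedSystem.{u, v} k (m + 2) d}
  (C : S.EndPair r)

theorem ker_chain_f {i : ℕ} (h : i ≤ m) :
    LinearMap.ker (C.chain.f i) = (LinearMap.ker (S.f (i + 1))).comap (C.incl i) := by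
  rw [← LinearMap.ker_comp, ← C.incl_comp_f h,
    LinearMap.ker_comp_of_ker_eq_bot _ (LinearMap.ker_eq_bot.2 (C.incl_injective _))]

theorem ker_chain_g {i : ℕ} (h : i ≤ m) :
    LinearMap.ker (C.chain.g i) = (LinearMap.ker (S.g (i + 1))).comap (C.incl (i + 1)) := by
  rw [← LinearMap.ker_comp, ← C.incl_comp_g h,
    LinearMap.ker_comp_of_ker_eq_bot _ (LinearMap.ker_eq_bot.2 (C.incl_injective _))]

theorem finrank_comap_incl {i : ℕ} (h : i ≤ m + 1) (K : Submodule k (S.E (i + 1))) :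
    Module.finrank k (K.comap (C.incl i)) =
      Module.finrank k (C.preim (i + 1) ⊓ K : Submodule k (S.E (i + 1))) := by
  rw [← finrank_map_of_disjoint (C.incl i), Submodule.map_comap_eq, C.range_incl h]
  rw [LinearMap.ker_eq_bot.2 (C.incl_injective i)]
  exact disjoint_bot_right

theorem finrank_kerF {i : ℕ} (h : i < m) :
    Module.finrank k (C.chain.kerF i) = Module.finrank k (C.barV₁ (i + 3)) := by
  rw [Chain.kerF, C.ker_chain_f (by omega), C.finrank_comap_incl (by omega)]
  exact C.finrank_ker_f (i := i + 1) (by omega) (by omega)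

theorem finrank_kerG {i : ℕ} (h : i < m) :
    Module.finrank k (C.chain.kerG i) = Module.finrank k (C.barVₙ (i + 1)) := by
  rw [Chain.kerG, C.ker_chain_g (by omega), C.finrank_comap_incl (by omega)]
  exact C.finrank_ker_g (i := i + 1) (by omega) (by omega)

theorem finrank_chain_M {i : ℕ} (h : i ≤ m + 1) :
    Module.finrank k (C.chain.M i) = Module.finrank k (C.preim (i + 1)) := by
  rw [← C.range_incl h, LinearMap.finrank_range_of_inj (C.incl_injective i)]

theorem rankB_chain {i : ℕ} (h : i < m) : C.chain.rankB i =
    Module.finrank k (C.barZ₁ (i + 2) ⊓ C.barZₙ (i + 2) : Submodule k (C.BarZ (i + 2))) := by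
  have e := C.finrank_barZ₁_inf_barZₙ (i := i + 1) (by omega) (by omega)
  rw [show i + 1 + 2 = i + 3 from rfl, show i + 1 + 1 = i + 2 from rfl] at e
  rw [Chain.rankB, C.finrank_kerF h, C.finrank_kerG h, C.finrank_chain_M (by omega),
    show i + 1 + 1 = i + 2 from rfl]
  omega

/-- The first of the two ranks that are determined by the ends; the composite of the remaining maps
`g` is injective on the image. -/
theorem finrank_range_chain_g :
    Module.finrank k (LinearMap.range (C.chain.g m)) = Module.finrank k C.V₁ₙ := by
  have e : C.V₁ₙ = (LinearMap.range (C.chain.g m)).map (S.gComp (m + 1) 1 ∘ₗ C.incl m) := by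
    rw [← LinearMap.range_comp, LinearMap.comp_assoc, C.incl_comp_g le_rfl, ← LinearMap.comp_assoc,
      ← S.gComp_succ (by omega), LinearMap.range_comp, C.range_incl le_rfl, C.preim_last]
    rfl
  rw [e]
  refine (finrank_map_of_disjoint _ (Submodule.disjoint_def.2 ?_)).symm
  rintro _ ⟨x, rfl⟩ hx
  have h1 : C.incl m (C.chain.g m x) = S.g (m + 1) (C.incl (m + 1) x) :=
    LinearMap.congr_fun (C.incl_comp_g le_rfl) x
  refine C.incl_injective m ((Submodule.disjoint_def.1
    (S.disjoint_range_ker_gComp (i := m + 1) (by omega) (by omega)) _ ⟨_, h1.symm⟩ hx).trans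
      (map_zero _).symm)

theorem finrank_range_chain_f :
    Module.finrank k (LinearMap.range (C.chain.f 0)) = Module.finrank k C.Vₙ₁ := by
  have e : C.Vₙ₁ = (LinearMap.range (C.chain.f 0)).map (S.fComp 2 (m + 2) ∘ₗ C.incl 1) := by
    have h2 : S.fComp 1 (m + 2) = S.fComp 2 (m + 2) ∘ₗ S.f 1 := S.fComp_eq_comp (by omega)
    have h3 : C.incl 1 ∘ₗ C.chain.f 0 = S.f 1 ∘ₗ C.incl 0 := C.incl_comp_f (Nat.zero_le m)
    have h4 : LinearMap.range (C.incl 0) = C.V₁ := (C.range_incl (by omega)).trans C.preim_one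
    rw [← LinearMap.range_comp, LinearMap.comp_assoc, h3, ← LinearMap.comp_assoc,
      LinearMap.range_comp, h4, Vₙ₁, h2]
  rw [e]
  refine (finrank_map_of_disjoint _ (Submodule.disjoint_def.2 ?_)).symm
  rintro _ ⟨x, rfl⟩ hx
  have h1 : C.incl 1 (C.chain.f 0 x) = S.f 1 (C.incl 0 x) :=
    LinearMap.congr_fun (C.incl_comp_f (Nat.zero_le m)) x
  refine C.incl_injective 1 ((Submodule.disjoint_def.1
    (S.disjoint_range_ker_fComp (i := 1) (by omega) (by omega)) _ ⟨_, h1.symm⟩ hx).trans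
      (map_zero _).symm)

/-- The ranks in the chain that correspond to prescribed dimensions, including the determined
ranks at the ends. -/
def ranks (δ : Prescription) : Ranks where
  g i := C.dV₁ δ (i + 1)
  f i := C.dVₙ δ (i + 1)
  z i := δ.Z (i + 1)

theorem endRanks (δ : Prescription) : C.chain.EndRanks (C.ranks δ) where
  g_eq := by
    rw [C.finrank_range_chain_g]
    simp only [ranks, dV₁, dVₙ, Function.update_self]
  f_eq := by
    rw [C.finrank_range_chain_f]
    simp only [ranks, dV₁, dVₙ, Function.update_self]

theorem ranks_g (δ : Prescription) {i : ℕ} (h : i < m) : (C.ranks δ).g (i + 1) = δ.V₁ (i + 2) := by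
  simp only [ranks, dV₁]
  exact Function.update_of_ne (by omega) _ _

theorem ranks_f (δ : Prescription) (i : ℕ) : (C.ranks δ).f (i + 1) = δ.Vₙ (i + 2) := by
  simp only [ranks, dVₙ]
  exact Function.update_of_ne (by omega) _ _

theorem admissible_iff (δ : Prescription) :
    C.chain.Admissible r (C.ranks δ) ↔ C.Admissible δ := by
  have key : ∀ i < m, (((C.ranks δ).z (i + 1) : ℤ) ≤ C.chain.rankB i ↔
      δ.Z (i + 2) ≤ Module.finrank k
        (C.barZ₁ (i + 2) ⊓ C.barZₙ (i + 2) : Submodule k (C.BarZ (i + 2)))) := fun i hi => by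
    rw [C.rankB_chain hi, Nat.cast_le]
    rfl
  constructor
  · intro h i h₁ h₂
    obtain ⟨i, rfl⟩ := Nat.exists_eq_add_of_le' h₁
    have hi : i < m := by omega
    have := h i hi
    rw [key i hi, C.finrank_kerF hi, C.finrank_kerG hi] at this
    exact this
  · intro h i hi
    rw [key i hi, C.finrank_kerF hi, C.finrank_kerG hi]
    exact h (i + 2) (by omega) (by omega)

theorem stratumDim_eq (δ : Prescription) :
    C.chain.stratumDim r (C.ranks δ) = C.stratumDim δ := by
  rw [stratumDim, Chain.stratumDim]
  refine Finset.sum_bij (fun i _ => i + 2) (fun i hi => ?_) (fun i _ j _ h => by omega)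
    (fun i hi => ?_) fun i hi => ?_
  · rw [Finset.mem_range] at hi
    rw [Finset.mem_Icc]
    omega
  · rw [Finset.mem_Icc] at hi
    exact ⟨i - 2, Finset.mem_range.2 (by omega), by omega⟩
  · rw [Finset.mem_range] at hi
    rw [C.rankB_chain hi, C.finrank_kerF hi, C.finrank_kerG hi]
    rfl

theorem SameInvariants.sameDims {k' : Type w} [Field k'] {d' : ℕ}
    {S' : LinkedSystem.{w, w'} k' (m + 2) d'} {C' : S'.EndPair r} (h : C.SameInvariants C') :
    C.chain.SameDims C'.chain := by
  obtain ⟨h1, h2, h3, h4, h5⟩ := h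
  refine ⟨?_, ?_, fun i hi => ?_, fun i hi => ?_, fun i hi => ?_⟩
  · rw [C.finrank_range_chain_g, C'.finrank_range_chain_g, h1]
  · rw [C.finrank_range_chain_f, C'.finrank_range_chain_f, h2]
  · have e1 := C.finrank_barZ (i := i + 1) (by omega) (by omega)
    have e2 := C'.finrank_barZ (i := i + 1) (by omega) (by omega)
    obtain ⟨e3, e4, e5⟩ := h5 (i + 1 + 1) (by omega) (by omega)
    rw [C.finrank_chain_M (by omega), C'.finrank_chain_M (by omega)]
    omega
  · rw [C.finrank_kerF hi, C'.finrank_kerF hi]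
    by_cases h : i + 3 = m + 2
    · rw [h]
      exact h3
    · exact (h5 (i + 3) (by omega) (by omega)).1
  · rw [C.finrank_kerG hi, C'.finrank_kerG hi]
    by_cases h : i = 0
    · rw [h]
      exact h4
    · exact (h5 (i + 1) (by omega) (by omega)).2.1

variable {A : Type u} [CommRing A] [Algebra k A] {C}

theorem FiberPoint.V₁_eq (P : C.FiberPoint A) {i : ℕ} (h : i ≤ m + 1) :
    P.V₁ ⟨i + 1, by omega, by omega⟩ =
      (P.toChain.W i).map ((S.gComp (i + 1) 1 ∘ₗ C.incl i).baseChange A) := by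
  rw [V₁, ← P.map_toChain h, ← Submodule.map_comp, ← LinearMap.baseChange_comp]

theorem FiberPoint.Vₙ_eq (P : C.FiberPoint A) {i : ℕ} (h : i ≤ m + 1) :
    P.Vₙ ⟨i + 1, by omega, by omega⟩ =
      (P.toChain.W i).map ((S.fComp (i + 1) (m + 2) ∘ₗ C.incl i).baseChange A) := by
  rw [Vₙ, ← P.map_toChain h, ← Submodule.map_comp, ← LinearMap.baseChange_comp]

theorem incl_mem {i : ℕ} (h : i ≤ m + 1) (x : C.chain.M i) : C.incl i x ∈ C.preim (i + 1) :=
  (C.range_incl h).le ⟨x, rfl⟩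

variable (C) in
/-- The map from a member of the chain to `\bar V_{1,i}`. -/
def toBarV₁ {i : ℕ} (h : i ≤ m + 1) : C.chain.M i →ₗ[k] C.barV₁ (i + 1) :=
  (S.gComp (i + 1) 1 ∘ₗ C.incl i).codRestrict _ fun x => ⟨(C.incl_mem h x).1, C.incl i x, rfl⟩

variable (C) in
/-- The map from a member of the chain to `\bar V_{n,i}`. -/
def toBarVₙ {i : ℕ} (h : i ≤ m + 1) : C.chain.M i →ₗ[k] C.barVₙ (i + 1) :=
  (S.fComp (i + 1) (m + 2) ∘ₗ C.incl i).codRestrict _ fun x =>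
    ⟨(C.incl_mem h x).2, C.incl i x, rfl⟩

theorem ζₙ_comp_toBarVₙ {i : ℕ} (h : i ≤ m + 1) :
    C.ζₙ (i + 1) ∘ₗ C.toBarVₙ h = -(C.ζ₁ (i + 1) ∘ₗ C.toBarV₁ h) := by
  rw [eq_neg_iff_add_eq_zero]
  ext x
  rw [LinearMap.add_apply, LinearMap.comp_apply, LinearMap.comp_apply, ζ₁, ζₙ,
    LinearMap.comp_apply, LinearMap.comp_apply, ← map_add, Submodule.mkQ_apply,
    LinearMap.zero_apply, Submodule.Quotient.mk_eq_zero]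
  refine ⟨⟨C.incl i x, C.incl_mem h x⟩, Prod.ext ?_ ?_⟩
  · exact (zero_add _).symm
  · exact (add_zero _).symm

/-- The images of the two summands in `BarZ` agree up to sign, so that the image of the sum is that
of `V i` under one composite. -/
theorem FiberPoint.Z_eq (P : C.FiberPoint A) {i : ℕ} (h : i ≤ m + 1) :
    P.Z ⟨i + 1, by omega, by omega⟩ =
      (P.toChain.W i).map ((C.ζ₁ (i + 1) ∘ₗ C.toBarV₁ h).baseChange A) := by
  have e1 : S.gComp (i + 1) 1 ∘ₗ C.incl i = (C.barV₁ (i + 1)).subtype ∘ₗ C.toBarV₁ h := rfl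
  have e2 : S.fComp (i + 1) (m + 2) ∘ₗ C.incl i = (C.barVₙ (i + 1)).subtype ∘ₗ C.toBarVₙ h := rfl
  rw [Z, P.V₁_eq h, P.Vₙ_eq h, e1, e2, LinearMap.baseChange_comp, LinearMap.baseChange_comp,
    Submodule.map_comp, Submodule.map_comp,
    Submodule.comap_map_eq_of_injective (baseChange_injective (Submodule.injective_subtype _)),
    Submodule.comap_map_eq_of_injective (baseChange_injective (Submodule.injective_subtype _)),
    ← Submodule.map_comp, ← Submodule.map_comp, ← LinearMap.baseChange_comp,
    ← LinearMap.baseChange_comp, ζₙ_comp_toBarVₙ, LinearMap.baseChange_neg, Submodule.map_neg,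
    sup_idem]

variable (C) in
/-- The composite to `BarZ` annihilates exactly the sum of the kernels of `f` and `g`. -/
theorem ker_ζ₁_comp_toBarV₁ {i : ℕ} (h : i < m) :
    LinearMap.ker (C.ζ₁ (i + 2) ∘ₗ C.toBarV₁ (i := i + 1) (by omega)) =
      LinearMap.ker (C.chain.f (i + 1)) ⊔ LinearMap.ker (C.chain.g i) := by
  have hf : LinearMap.ker (C.chain.f (i + 1)) =
      (LinearMap.ker (S.fComp (i + 2) (m + 2))).comap (C.incl (i + 1)) := by
    rw [C.ker_chain_f (by omega), S.ker_fComp (by omega) (by omega)]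
  have hg : LinearMap.ker (C.chain.g i) =
      (LinearMap.ker (S.gComp (i + 2) 1)).comap (C.incl (i + 1)) := by
    rw [C.ker_chain_g (by omega), S.ker_gComp (by omega) (by omega)]
  ext x
  rw [LinearMap.mem_ker, LinearMap.comp_apply, ← LinearMap.mem_ker, C.mem_ker_ζ₁]
  constructor
  · rintro ⟨y, hy, h1, h2⟩
    obtain ⟨y, rfl⟩ := (C.range_incl (i := i + 1) (by omega)).ge hy
    refine Submodule.mem_sup.2 ⟨y, hf.ge h2, x - y, hg.ge ?_, by abel⟩
    rw [Submodule.mem_comap, map_sub, LinearMap.mem_ker, map_sub, h1]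
    exact sub_self _
  · intro hx
    obtain ⟨y, hy, z, hz, rfl⟩ := Submodule.mem_sup.1 hx
    have hy := hf.le hy
    have hz := hg.le hz
    refine ⟨C.incl (i + 1) y, C.incl_mem (by omega) y, ?_, hy⟩
    change _ = S.gComp (i + 2) 1 (C.incl (i + 1) (y + z))
    rw [map_add, map_add, show S.gComp (i + 2) 1 (C.incl (i + 1) z) = 0 from hz, add_zero]

/-- The condition that defines a stratum is the condition on the ranks of the corresponding family
in the chain. -/
theorem FiberPoint.inStratum_iff (P : C.FiberPoint A) (δ : Prescription) :
    P.InStratum δ ↔ P.toChain.InStratum (C.ranks δ) := by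
  have key : ∀ i (h : i < m), (IsSubbundle A (P.V₁ ⟨i + 2, by omega, by omega⟩) (δ.V₁ (i + 2)) ∧
      IsSubbundle A (P.Vₙ ⟨i + 2, by omega, by omega⟩) (δ.Vₙ (i + 2)) ∧
      IsSubbundle A (P.Z ⟨i + 2, by omega, by omega⟩) (δ.Z (i + 2))) ↔ _ := fun i h => by
    have := S.finiteDimensional 1 le_rfl (by omega)
    have := S.finiteDimensional (m + 2) (by omega) le_rfl
    have e1 := P.V₁_eq (i := i + 1) (by omega)
    have e2 := P.Vₙ_eq (i := i + 1) (by omega)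
    have e3 := P.Z_eq (i := i + 1) (by omega)
    have hf : LinearMap.ker (S.fComp (i + 1 + 1) (m + 2) ∘ₗ C.incl (i + 1)) =
        LinearMap.ker (C.chain.f (i + 1)) := by
      rw [C.ker_chain_f (by omega), LinearMap.ker_comp, S.ker_fComp (by omega) (by omega)]
    have hg : LinearMap.ker (S.gComp (i + 1 + 1) 1 ∘ₗ C.incl (i + 1)) =
        LinearMap.ker (C.chain.g i) := by
      rw [C.ker_chain_g (by omega), LinearMap.ker_comp, S.ker_gComp (by omega) (by omega)]
    rw [e1, e2, e3, isSubbundle_map_iff, isSubbundle_map_iff, isSubbundle_map_iff, hf, hg,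
      C.ker_ζ₁_comp_toBarV₁ h, Chain.Frame.finrank_ker_add C.chain i h, ← C.ranks_g δ h,
      ← C.ranks_f δ]
  constructor
  · exact fun H i h => (key i h).1 (H ⟨i + 2, by omega, by omega⟩ (by simp) (by simpa using h))
  · rintro H ⟨i, hi⟩ h₁ h₂
    obtain ⟨i, rfl⟩ := Nat.exists_eq_add_of_le' (show 2 ≤ i from h₁)
    have h : i < m := by simpa using h₂
    exact (key i h).2 (H i h)

end LinkedSystem.EndPair

end

/-! ### The scheme that represents the fibre -/

section

namespace LinkedSystem.EndPair

variable {k : Type u} [Field k] {m d r : ℕ} {S : LinkedSystem.{u, v} k (m + 2) d}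

/-- The fibre is represented by the scheme of linked families in the chain. -/
def fiberRepresentation (C : S.EndPair r) : C.FiberRepresentation (C.chain.scheme r) where
  points _ _ _ := ((C.chain.atlas r).pointsEquiv _).trans (C.fiberPointEquiv _).symm
  points_comp _ B _ _ _ _ φ x i :=
    (congrArg (fun Q : C.chain.Point r B => ((C.fiberPointEquiv B).symm Q).V i)
      ((C.chain.atlas r).pointsEquiv_comp φ x)).trans (fiberPointEquiv_symm_map φ _ i)

variable {C : S.EndPair r}

theorem fiberRepresentation_inStratum_iff (δ : Prescription) {A : Type u} [CommRing A]
    [Algebra k A] (x : specOver k A ⟶ C.chain.scheme r) :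
    (∃ y, y ≫ Chain.stratumι r (C.endRanks δ) = x) ↔
      (C.fiberRepresentation.points A x).InStratum δ := by
  rw [FiberPoint.inStratum_iff, Chain.exists_comp_stratumι_iff]
  have := (C.fiberPointEquiv A).apply_symm_apply ((C.chain.atlas r).pointsEquiv A x)
  exact iff_of_eq (congrArg (fun Q : C.chain.Point r A => Q.InStratum (C.ranks δ)) this.symm)

/-- The strata cover the fibre, since every linked family over a field has some ranks. -/
theorem exists_mem_range_stratumι (x : (C.chain.scheme r).left) :
    ∃ δ, x ∈ Set.range (Chain.stratumι r (C.endRanks δ)).left := by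
  obtain ⟨K, _, _, y, hy⟩ := exists_field_point x
  obtain ⟨δ, -, h⟩ := Chain.Point.exists_inStratum
    ((C.chain.atlas r).pointsEquiv K y : C.chain.Point r K)
  let δ' : Prescription := ⟨fun i => δ.g (i - 1), fun i => δ.f (i - 1), fun i => δ.z (i - 1)⟩
  have h' : Chain.Point.InStratum ((C.chain.atlas r).pointsEquiv K y : C.chain.Point r K)
      (C.ranks δ') := fun i hi => by
    rw [C.ranks_g δ' hi, C.ranks_f δ' i]
    exact h i hi
  obtain ⟨z, rfl⟩ := (Chain.exists_comp_stratumι_iff (C.endRanks δ') y).2 h'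
  obtain ⟨t⟩ : Nonempty (Spec (CommRingCat.of K)) := inferInstance
  refine ⟨δ', z.left t, ?_⟩
  rw [← hy t]
  rfl

theorem FiberRepresentation.exists_hom {Y Y' : Over (Spec (CommRingCat.of k))}
    (ρ : C.FiberRepresentation Y) (ρ' : C.FiberRepresentation Y') :
    ∃ h : Y ⟶ Y', ∀ (A : Type u) [CommRing A] [Algebra k A] (x : specOver k A ⟶ Y),
      ρ'.points A (x ≫ h) = ρ.points A x := by
  obtain ⟨h, hh⟩ := exists_hom_of_natural
    (fun B _ _ x => (ρ'.points B).symm (ρ.points B x)) fun B D _ _ _ _ φ x => by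
      apply (ρ'.points D).injective
      rw [Equiv.apply_symm_apply]
      refine FiberPoint.ext fun i => ?_
      rw [ρ'.points_comp, ρ.points_comp, Equiv.apply_symm_apply]
  exact ⟨h, fun A _ _ x => by rw [hh, Equiv.apply_symm_apply]⟩

/-- Two schemes that represent the fibre are isomorphic, hence have the same dimension. -/
theorem FiberRepresentation.topologicalKrullDim_eq {Y Y' : Over (Spec (CommRingCat.of k))}
    (ρ : C.FiberRepresentation Y) (ρ' : C.FiberRepresentation Y') :
    topologicalKrullDim Y.left = topologicalKrullDim Y'.left := by
  obtain ⟨h, hh⟩ := ρ.exists_hom ρ'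
  obtain ⟨h', hh'⟩ := ρ'.exists_hom ρ
  have e : h ≫ h' = 𝟙 Y := over_hom_ext fun B _ _ x => (ρ.points B).injective (by
    rw [← Category.assoc, hh', hh, Category.comp_id])
  have e' : h' ≫ h = 𝟙 Y' := over_hom_ext fun B _ _ x => (ρ'.points B).injective (by
    rw [← Category.assoc, hh, hh', Category.comp_id])
  let I : Y ≅ Y' := ⟨h, h', e, e'⟩
  exact IsHomeomorph.topologicalKrullDim_eq _
    (Scheme.homeoOfIso ((Over.forget _).mapIso I)).isHomeomorph

end LinkedSystem.EndPair

end

end LinkedGr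

end

theorem mainTheorem5 (n r : ℕ) (hn : 2 < n) (hr : 0 < r) :
    (∀ (k : Type w₁) [Field k] (d : ℕ) (_ : r < d) (S : LinkedGr.LinkedSystem.{w₁, w₂} k n d)
      (C : S.EndPair r),
      ∃ (Y : Over (Spec (CommRingCat.of k))) (ρ : C.FiberRepresentation Y)
        (X : LinkedGr.Prescription → Over (Spec (CommRingCat.of k))) (ι : ∀ δ, X δ ⟶ Y),
        (∀ δ, IsImmersion (ι δ).left ∧
          (∀ (A : Type w₁) [CommRing A] [Algebra k A] (x : LinkedGr.specOver k A ⟶ Y),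
            (∃ y : LinkedGr.specOver k A ⟶ X δ, y ≫ ι δ = x) ↔ (ρ.points A x).InStratum δ)) ∧
        (∀ δ δ', δ.DifferBelow n δ' →
          Disjoint (Set.range (ι δ).left) (Set.range (ι δ').left)) ∧
        (⋃ δ, Set.range (ι δ).left) = Set.univ ∧
        (∀ δ, Nonempty (X δ).left ↔ C.Admissible δ) ∧
        (∀ δ, Nonempty (X δ).left →
          ∃ N : ℕ, (N : ℤ) = C.stratumDim δ ∧ SmoothOfRelativeDimension N (X δ).hom)) ∧
    (∀ (k : Type w₁) [Field k] (k' : Type w₃) [Field k'] (d d' : ℕ) (_ : r < d) (_ : r < d')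
      (S : LinkedGr.LinkedSystem.{w₁, w₂} k n d) (S' : LinkedGr.LinkedSystem.{w₃, w₄} k' n d')
      (C : S.EndPair r) (C' : S'.EndPair r), C.SameInvariants C' →
      ∀ (Y : Over (Spec (CommRingCat.of k))) (Y' : Over (Spec (CommRingCat.of k')))
        (_ : C.FiberRepresentation Y) (_ : C'.FiberRepresentation Y'),
        topologicalKrullDim Y.left = topologicalKrullDim Y'.left) := by
  obtain ⟨m, rfl⟩ := Nat.exists_eq_add_of_le' hn.le
  constructor
  · intro k _ d _ S C
    refine ⟨C.chain.scheme r, C.fiberRepresentation,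
      fun δ => LinkedGr.Chain.stratum r (C.endRanks δ),
      fun δ => LinkedGr.Chain.stratumι r (C.endRanks δ), fun δ => ⟨inferInstance,
        fun A _ _ x => LinkedGr.LinkedSystem.EndPair.fiberRepresentation_inStratum_iff δ x⟩,
      fun δ δ' h => ?_, ?_, fun δ => ?_, fun δ h => ?_⟩
    · obtain ⟨i, h₁, h₂, h⟩ := h
      obtain ⟨i, rfl⟩ := Nat.exists_eq_add_of_le' (show 2 ≤ i from h₁)
      have hi : i < m := by omega
      refine LinkedGr.Chain.disjoint_range_stratumι _ _ ⟨i, hi, fun H => ?_⟩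
      rw [C.ranks_g δ hi, C.ranks_g δ' hi, C.ranks_f δ i, C.ranks_f δ' i] at H
      obtain ⟨H₁, H₂, H₃⟩ := H
      exact h.elim (· H₁) fun h => h.elim (· H₂) (· H₃)
    · exact Set.eq_univ_of_forall fun x =>
        Set.mem_iUnion.2 (LinkedGr.LinkedSystem.EndPair.exists_mem_range_stratumι x)
    · rw [← C.admissible_iff, LinkedGr.Chain.nonempty_stratum_iff]
      constructor
      · rintro ⟨K, _, _, P, hP⟩
        exact hP.admissible (C.endRanks δ)
      · intro h
        obtain ⟨P, hP⟩ := h.exists_point (C.endRanks δ)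
        exact ⟨k, inferInstance, inferInstance, P, hP⟩
    · obtain ⟨N, hN, hs⟩ := LinkedGr.Chain.stratum_smooth (C.endRanks δ) h
      exact ⟨N, hN.trans (C.stratumDim_eq δ), hs⟩
  · intro k _ k' _ d d' _ _ S S' C C' h Y Y' ρ ρ'
    rw [ρ.topologicalKrullDim_eq C.fiberRepresentation,
      ρ'.topologicalKrullDim_eq C'.fiberRepresentation]
    exact h.sameDims.topologicalKrullDim_eq r
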